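/- **Conventions.** A distribution $D$ of rank two on a four-manifold is an Engel structure if $[D,D]$ is a distribution of rank three and $[[D,D],[D,D]]$ is the whole tangent bundle; here $[D,D]$ is spanned by the local sections of $D$ and their Lie brackets. Two distributions are isomorphic if a diffeomorphism carries one onto the other. *Lorentz prolongation.* For a Lorentzian three-manifold $(V,g)$ let $NC(TV)$ be the four-manifold of pairs $(x,\ell)$ with $x\in V$ and $\ell\subset T_xV$ a null line, and let $\pi:NC(TV)\to V$ be the projection. The Lorentz prolongation is the plane field $\mathcal D_{(x,\ell)}=(D\pi)^{-1}(\ell)$ on $NC(TV)$. *Suspension.* Let $(N,\xi)$ be a contact three-manifold with $\xi$ oriented and endowed with a Euclidean metric, let $\ell\subset\xi$ be a Legendrian line field, and let $\varphi$ be a diffeomorphism of $N$ preserving $\xi$ and its orientation. Let $R(\rho)$ be the rotation of $\xi$ by the angle $\rho$, and let $\rho:\mathbb R\times N\to\mathbb R$ be a smooth function with $\partial\rho/\partial t>0$ such that the plane field $\widetilde{\mathcal D}_{(t,p)}=\mathbb R\,\partial_t\oplus R(\rho(t,p))\ell_p$ on $\mathbb R\times N$ is invariant under $(t+1,p)\mapsto(t,\varphi(p))$.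 The suspension of $(N,\xi,\ell,\varphi)$ with twisting $\rho$ is the plane field $\mathcal D'$ induced by $\widetilde{\mathcal D}$ on the mapping torus $M_\varphi=\mathbb R\times N/\sim$, where $(t+n,p)\sim(t,\varphi^n(p))$ for $n\in\mathbb Z$. The function $\rho(0,\cdot)$ is called the initial phase of the twisting. *Geodesic flow.* Let $(\Sigma,dh)$ be a smooth Riemannian surface without boundary, and let $S^1(T\Sigma)$ be its unit tangent bundle with projection $\pi_\Sigma$ to $\Sigma$. Denote by $X$ the geodesic vector field, that is, the horizontal lift (for the Levi-Civita connection) of the tautological vectors, by $Z$ the unit vector field along the fibres, and by $Y=[Z,X]$ the horizontal unit field orthogonal to $X$. (If $\Sigma$ is not oriented, $Y$ and $Z$ are defined up to a common sign, and so the line fields $\langle Y\rangle$, $\langle Z\rangle$ and the orientation below are always defined.) The Liouville contact structure $\xi_0=\langle Y,Z\rangle$ is the kernel of the tautological form $\zeta\mapsto dh(v,d\pi_\Sigma(\zeta))$, $\zeta\in T_vS^1(T\Sigma)$; give it the metric and the orientation for which $(Y,Z)$ is a positive orthonormal basis. **Proposition 4.1.** Let $(\Sigma,dh)$ be geodesically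 complete, and let $(V,dg)=(\Sigma,dh)\times(S^1,-d\theta^2)$, where $S^1=\mathbb R/2\pi\mathbb Z$. The Lorentz prolongation $(NC(TV),\mathcal D)$ of $(V,dg)$ is an Engel manifold. It is isomorphic to a suspension of the contact manifold $(S^1(T\Sigma),\xi_0)$ by the time-$2\pi$ map $\varphi=\phi_{2\pi}$ of the geodesic flow, and either of the Legendrian line fields $\langle Z\rangle$ and $\langle Y\rangle$ will do, with an appropriate twisting. Precisely, $\phi_{2\pi}$ is a diffeomorphism that preserves $\xi_0$ and its orientation, and: 1. there is a twisting $\rho$ with initial phase $\rho(0,\cdot)\equiv 0$ for which the suspension of $(S^1(T\Sigma),\xi_0,\langle Z\rangle,\phi_{2\pi})$ is an Engel structure isomorphic to $(NC(TV),\mathcal D)$; 2. there is a twisting $\rho$ with initial phase $\rho(0,\cdot)\equiv\pi/2$ for which the suspension of $(S^1(T\Sigma),\xi_0,\langle Y\rangle,\phi_{2\pi})$ is an Engel structure isomorphic to $(NC(TV),\mathcal D)$. -/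

import Mathlib

open Bundle Manifold Set Filter Topology
open scoped ContDiff

noncomputable section
namespace Engel

section General
variable {E : Type*} [NormedAddCommGroup E] [NormedSpace ℝ E] {H : Type*} [TopologicalSpace H]
  {I : ModelWithCorners ℝ E H} {M : Type*} [TopologicalSpace M] [ChartedSpace H M]

theorem isManifold_of_contMDiffOn
    (h : ∀ e ∈ atlas H M, ∀ e' ∈ atlas H M, ContMDiffOn I I ∞ (e.symm ≫ₕ e') (e.symm ≫ₕ e').source) :
    IsManifold I ∞ M := by
  refine isManifold_of_contDiffOn I ∞ M fun e e' he he' ↦ ?_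
  intro y hy
  have := ((contMDiffOn_iff.1 (h e he e' he')).2 (I.symm y) ((e.symm ≫ₕ e') (I.symm y)))
  refine (this.mono ?_) y hy
  intro z hz
  simp only [mfld_simps] at hz ⊢
  tauto

section Model

variable {E' : Type*} [NormedAddCommGroup E'] [NormedSpace ℝ E'] {H' : Type*} [TopologicalSpace H']
  {I' : ModelWithCorners ℝ E' H'} {F : Type*} [NormedAddCommGroup F] [NormedSpace ℝ F]
  {K : Type*} [TopologicalSpace K] {J : ModelWithCorners ℝ F K}
  {N : Type*} [TopologicalSpace N] [ChartedSpace K N]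

theorem contMDiff_model_fst : ContMDiff (I.prod I') I ∞ (fun y : ModelProd H H' ↦ y.1) := by
  have : ContMDiff (I.prod I') I ∞ (fun y : H × H' ↦ y.1) := contMDiff_fst
  rw [chartedSpaceSelf_prod] at this
  exact this

theorem contMDiff_model_snd : ContMDiff (I.prod I') I' ∞ (fun y : ModelProd H H' ↦ y.2) := by
  have : ContMDiff (I.prod I') I' ∞ (fun y : H × H' ↦ y.2) := contMDiff_snd
  rw [chartedSpaceSelf_prod] at this
  exact this

theorem contMDiffOn_model_prodMk {f : N → H} {g : N → H'} {s : Set N}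
    (hf : ContMDiffOn J I ∞ f s) (hg : ContMDiffOn J I' ∞ g s) :
    ContMDiffOn (M' := ModelProd H H') J (I.prod I') ∞ (fun y ↦ (f y, g y)) s := by
  have := hf.prodMk hg
  rw [chartedSpaceSelf_prod] at this
  exact this
end Model

variable [IsManifold I 1 M]

theorem chart_smul (p : TangentBundle I M) (y : M) (a : ℝ) (v : TangentSpace I y) :
    chartAt (ModelProd H E) p ⟨y, a • v⟩ =
      ((chartAt (ModelProd H E) p ⟨y, v⟩).1, a • (chartAt (ModelProd H E) p ⟨y, v⟩).2) := by
  refine Prod.ext rfl ?_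
  exact ContinuousLinearMap.map_smul ((tangentBundleCore I M).coordChange (achart H y) (achart H p.1) y) a v

theorem chart_symm_smul (p : TangentBundle I M) (x : H) (a : ℝ) (w : E) :
    (chartAt (ModelProd H E) p).symm (x, a • w) =
      ⟨((chartAt (ModelProd H E) p).symm (x, w)).1,
        a • ((chartAt (ModelProd H E) p).symm (x, w)).2⟩ := by
  have : ∀ w : E, (chartAt (ModelProd H E) p).symm (x, w) = ⟨(chartAt H p.1).symm x,
    (tangentBundleCore I M).coordChange (achart H p.1)
      (achart H ((chartAt H p.1).symm x)) ((chartAt H p.1).symm x) w⟩ := fun w ↦ rfl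
  rw [this, this, map_smul]
  rfl

end General


section UnitTangent

/-- The model space `ℝ²` of a surface. -/
abbrev Plane := EuclideanSpace ℝ (Fin 2)

/-- A smooth Riemannian metric on a surface. -/
abbrev SurfaceMetric (S : Type*) [TopologicalSpace S] [ChartedSpace Plane S]
    [IsManifold (𝓡 2) ∞ S] :=
  ContMDiffRiemannianMetric (𝓡 2) ∞ Plane (fun x : S ↦ TangentSpace (𝓡 2) x)

variable {S : Type*} [TopologicalSpace S] [ChartedSpace Plane S] [IsManifold (𝓡 2) ∞ S]

/-- The unit tangent bundle `S¹(TΣ)` of a Riemannian surface: its points are the tangent vectors of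
length one. -/
@[ext]
structure UnitTangent (h : SurfaceMetric S) where
  /-- The underlying tangent vector, together with its base point. -/
  val : TangentBundle (𝓡 2) S
  normSq_eq : h.inner val.1 val.2 val.2 = 1

variable (h : SurfaceMetric S)

/-- The topology of `S¹(TΣ)` as a subspace of `TΣ`. -/
instance : TopologicalSpace (UnitTangent h) := .induced UnitTangent.val inferInstance

theorem UnitTangent.isInducing_val : IsInducing (UnitTangent.val (h := h)) := ⟨rfl⟩

theorem contMDiff_normSq :
    ContMDiff (𝓡 2).tangent 𝓘(ℝ, ℝ) ∞
      (fun p : TangentBundle (𝓡 2) S ↦ h.inner p.1 p.2 p.2) := by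
  let : RiemannianBundle (fun x : S ↦ TangentSpace (𝓡 2) x) := ⟨h.toRiemannianMetric⟩
  have := ContMDiff.inner_bundle (IM := (𝓡 2).tangent) (IB := 𝓡 2) (n := ∞) (F := Plane)
    (E := fun x : S ↦ TangentSpace (𝓡 2) x)
    (b := fun p : TangentBundle (𝓡 2) S ↦ p.1) (v := fun p ↦ p.2) (w := fun p ↦ p.2)
    contMDiff_id contMDiff_id
  exact this

/-- The numerator of the slope of `u` with respect to the frame consisting of `u₀` and of `u₀` rotated
by a right angle. -/
def slopeNum (u₀ u : Plane) : ℝ := u₀ 0 * u 1 - u₀ 1 * u 0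

/-- The denominator of the slope of `u` with respect to the frame consisting of `u₀` and of `u₀`
rotated by a right angle. -/
def slopeDen (u₀ u : Plane) : ℝ := u₀ 0 * u 0 + u₀ 1 * u 1

/-- The vector of slope `s` with respect to the frame of `u₀`. -/
def slopeVec (u₀ : Plane) (s : ℝ) : Plane := u₀ + s • !₂[-u₀ 1, u₀ 0]

theorem slopeDen_self {u : Plane} (hu : u ≠ 0) : 0 < slopeDen u u := by
  have : 0 < ‖u‖ ^ 2 := by positivity
  rw [EuclideanSpace.norm_sq_eq] at this
  simpa [slopeDen, Fin.sum_univ_two, sq] using this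

theorem slopeDen_slopeVec (u : Plane) (s : ℝ) : slopeDen u (slopeVec u s) = slopeDen u u := by
  simp [slopeDen, slopeVec]; ring

theorem slopeNum_slopeVec (u : Plane) (s : ℝ) : slopeNum u (slopeVec u s) = s * slopeDen u u := by
  simp [slopeNum, slopeDen, slopeVec]; ring

theorem slopeVec_slope {u₀ u : Plane} (hu : slopeDen u₀ u ≠ 0) (h₀ : slopeDen u₀ u₀ ≠ 0) :
    (slopeDen u₀ u / slopeDen u₀ u₀) • slopeVec u₀ (slopeNum u₀ u / slopeDen u₀ u) = u := by
  ext i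
  fin_cases i <;> simp [slopeVec] <;> field_simp <;> simp [slopeNum, slopeDen] <;> ring

theorem slopeVec_ne_zero {u : Plane} (hu : u ≠ 0) (s : ℝ) : slopeVec u s ≠ 0 := by
  intro h0
  have := slopeDen_slopeVec u s
  have h1 := slopeDen_self hu
  rw [← this, h0] at h1
  simp [slopeDen] at h1

theorem contDiff_slopeNum (u₀ : Plane) : ContDiff ℝ ∞ (slopeNum u₀) := by
  unfold slopeNum; fun_prop

theorem contDiff_slopeDen (u₀ : Plane) : ContDiff ℝ ∞ (slopeDen u₀) := by
  unfold slopeDen; fun_prop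

theorem contDiff_slopeVec (u₀ : Plane) : ContDiff ℝ ∞ (slopeVec u₀) := by
  unfold slopeVec; fun_prop

/-- The coordinates of a tangent vector in the chart of `TΣ` at `p`. -/
abbrev tChart (p : TangentBundle (𝓡 2) S) :
    OpenPartialHomeomorph (TangentBundle (𝓡 2) S) (ModelProd Plane Plane) :=
  chartAt (ModelProd Plane Plane) p

variable {h} in
theorem UnitTangent.coord_ne_zero (p q : UnitTangent h) (hq : q.1 ∈ (tChart p.1).source) :
    (tChart p.1 q.1).2 ≠ 0 := by
  intro h0
  have h1 : (tChart p.1).symm (tChart p.1 q.1) = q.1 := (tChart p.1).left_inv hq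
  have h2 := chart_symm_smul p.1 (tChart p.1 q.1).1 0 (tChart p.1 q.1).2
  rw [show (0 : ℝ) • (tChart p.1 q.1).2 = (tChart p.1 q.1).2 by simp [h0]] at h2
  have h3 : q.1 = ⟨q.1.1, (0 : ℝ) • q.1.2⟩ := by
    have e : ((tChart p.1 q.1).1, (tChart p.1 q.1).2) = tChart p.1 q.1 := rfl
    rw [e] at h2
    calc q.1 = (tChart p.1).symm (tChart p.1 q.1) := h1.symm
      _ = _ := h2
      _ = _ := by rw [h1]
  have h4 := q.2
  rw [h3] at h4
  simp at h4

/-- The local section of the unit tangent bundle belonging to the coordinate vector `w`. -/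
def unitLift (p : UnitTangent h) (y : ModelProd Plane Plane) : TangentBundle (𝓡 2) S :=
  (tChart p.1).symm (y.1, (√(h.inner _ ((tChart p.1).symm y).2 ((tChart p.1).symm y).2))⁻¹ • y.2)

variable {h}

theorem normSq_symm_pos (p : UnitTangent h) {y : ModelProd Plane Plane}
    (hy : y.1 ∈ (chartAt Plane p.1.1).target) (hy0 : y.2 ≠ 0) :
    0 < h.inner _ ((tChart p.1).symm y).2 ((tChart p.1).symm y).2 := by
  apply h.pos
  intro h0
  have hy' : y ∈ (tChart p.1).target := (TangentBundle.mem_chart_target_iff _ _).2 hy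
  have h1 := (tChart p.1).right_inv hy'
  have h2 := chart_smul p.1 ((tChart p.1).symm y).1 0 ((tChart p.1).symm y).2
  rw [zero_smul, zero_smul] at h2
  have h3 : (⟨((tChart p.1).symm y).1, 0⟩ : TangentBundle (𝓡 2) S) = (tChart p.1).symm y := by
    rw [← h0]
  rw [h3] at h2
  have h4 := h1.symm.trans h2
  exact hy0 (congrArg Prod.snd h4)

theorem normSq_unitLift (p : UnitTangent h) {y : ModelProd Plane Plane}
    (hy : y.1 ∈ (chartAt Plane p.1.1).target) (hy0 : y.2 ≠ 0) :
    h.inner _ (unitLift h p y).2 (unitLift h p y).2 = 1 := by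
  have hpos := normSq_symm_pos p hy hy0
  have := chart_symm_smul p.1 y.1
    (√(h.inner _ ((tChart p.1).symm y).2 ((tChart p.1).symm y).2))⁻¹ y.2
  have e : unitLift h p y = ⟨((tChart p.1).symm y).1,
    (√(h.inner _ ((tChart p.1).symm y).2 ((tChart p.1).symm y).2))⁻¹ •
      ((tChart p.1).symm y).2⟩ := this
  rw [e]
  simp only [map_smul, _root_.smul_apply, smul_eq_mul]
  set r := h.inner _ ((tChart p.1).symm y).2 ((tChart p.1).symm y).2 with hr
  have : √r ≠ 0 := (Real.sqrt_pos.2 hpos).ne'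
  field_simp
  exact (Real.sq_sqrt hpos.le).symm

theorem unitLift_smul (p : UnitTangent h) {x : Plane} {w : Plane} {a : ℝ} (ha : 0 < a)
    (hw : h.inner _ ((tChart p.1).symm (x, a • w)).2 ((tChart p.1).symm (x, a • w)).2 = 1) :
    unitLift h p (x, w) = (tChart p.1).symm (x, a • w) := by
  have e := chart_symm_smul p.1 x a w
  have e' : h.inner _ ((tChart p.1).symm (x, a • w)).2 ((tChart p.1).symm (x, a • w)).2 =
    a ^ 2 * h.inner _ ((tChart p.1).symm (x, w)).2 ((tChart p.1).symm (x, w)).2 := by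
    rw [e]
    simp only [map_smul, _root_.smul_apply, smul_eq_mul]
    ring
  rw [hw] at e'
  set r := h.inner _ ((tChart p.1).symm (x, w)).2 ((tChart p.1).symm (x, w)).2 with hr
  have hra : r = (a⁻¹) ^ 2 := by field_simp; linarith
  have : (√r)⁻¹ = a := by
    rw [hra, Real.sqrt_sq (by positivity), inv_inv]
  simp only [unitLift, ← hr, this]

theorem continuousOn_unitLift (p : UnitTangent h) :
    ContinuousOn (unitLift h p) {y | y.1 ∈ (chartAt Plane p.1.1).target ∧ y.2 ≠ 0} := by
  have h1 : ContinuousOn (tChart p.1).symm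
      {y | y.1 ∈ (chartAt Plane p.1.1).target ∧ y.2 ≠ 0} :=
    (tChart p.1).continuousOn_symm.mono fun y hy ↦
      (TangentBundle.mem_chart_target_iff _ _).2 hy.1
  have h2 := ((contMDiff_normSq h).continuous.comp_continuousOn h1)
  refine (tChart p.1).continuousOn_symm.comp (t := (tChart p.1).target) ?_ ?_
  · have h3 : ContinuousOn (fun y : ModelProd Plane Plane ↦
        (√(h.inner _ ((tChart p.1).symm y).2 ((tChart p.1).symm y).2))⁻¹)
        {y | y.1 ∈ (chartAt Plane p.1.1).target ∧ y.2 ≠ 0} :=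
      ContinuousOn.inv₀ (Real.continuous_sqrt.comp_continuousOn h2) fun y hy ↦
        (Real.sqrt_pos.2 (normSq_symm_pos p hy.1 hy.2)).ne'
    have h4 : ContinuousOn (fun y : ModelProd Plane Plane ↦ y.2)
        {y | y.1 ∈ (chartAt Plane p.1.1).target ∧ y.2 ≠ 0} := continuous_snd.continuousOn
    exact ContinuousOn.prodMk (f := fun y : ModelProd Plane Plane ↦ y.1)
      continuous_fst.continuousOn (h3.smul h4)
  · intro y hy
    exact (TangentBundle.mem_chart_target_iff _ _).2 hy.1

/-- The tangent vector at the point with coordinates `y.1` whose induced coordinates have slope `y.2`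
with respect to `p`. -/
def slopeLift (p : UnitTangent h) (y : ModelProd Plane ℝ) : ModelProd Plane Plane :=
  (y.1, slopeVec (tChart p.1 p.1).2 y.2)

theorem UnitTangent.coord_self_ne_zero (p : UnitTangent h) : (tChart p.1 p.1).2 ≠ 0 :=
  UnitTangent.coord_ne_zero p p (mem_chart_source _ _)

theorem normSq_unitLift_slopeLift (p : UnitTangent h) {y : ModelProd Plane ℝ}
    (hy : y.1 ∈ (chartAt Plane p.1.1).target) :
    h.inner _ (unitLift h p (slopeLift p y)).2 (unitLift h p (slopeLift p y)).2 = 1 :=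
  normSq_unitLift p hy (slopeVec_ne_zero p.coord_self_ne_zero _)

theorem exists_tChart_unitLift (p q : UnitTangent h) {y : ModelProd Plane ℝ}
    (hy : y.1 ∈ (chartAt Plane p.1.1).target) :
    ∃ a : ℝ, 0 < a ∧ tChart q.1 (unitLift h p (slopeLift p y)) =
      ((tChart q.1 ((tChart p.1).symm (slopeLift p y))).1,
        a • (tChart q.1 ((tChart p.1).symm (slopeLift p y))).2) := by
  have hpos := normSq_symm_pos p (y := slopeLift p y) hy
      (slopeVec_ne_zero p.coord_self_ne_zero _)
  refine ⟨_, inv_pos.2 (Real.sqrt_pos.2 hpos), ?_⟩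
  exact (congrArg (tChart q.1) (chart_symm_smul p.1 y.1 _ _)).trans (chart_smul q.1 _ _ _)

theorem tChart_symm_slopeLift (p : UnitTangent h) {y : ModelProd Plane ℝ}
    (hy : y.1 ∈ (chartAt Plane p.1.1).target) :
    tChart p.1 ((tChart p.1).symm (slopeLift p y)) = slopeLift p y :=
  (tChart p.1).right_inv ((TangentBundle.mem_chart_target_iff _ _).2 hy)

theorem slopeDen_smul (u₀ u : Plane) (a : ℝ) : slopeDen u₀ (a • u) = a * slopeDen u₀ u := by
  simp [slopeDen]; ring

theorem slopeNum_smul (u₀ u : Plane) (a : ℝ) : slopeNum u₀ (a • u) = a * slopeNum u₀ u := by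
  simp [slopeNum]; ring

open Classical in
/-- The local parametrisation of `S¹(TΣ)` inverse to `unitChart`. -/
def unitParam (p : UnitTangent h) (y : ModelProd Plane ℝ) : UnitTangent h :=
  if hy : h.inner _ (unitLift h p (slopeLift p y)).2 (unitLift h p (slopeLift p y)).2 = 1
    then ⟨unitLift h p (slopeLift p y), hy⟩ else p

theorem unitParam_val (p : UnitTangent h) {y : ModelProd Plane ℝ}
    (hy : y.1 ∈ (chartAt Plane p.1.1).target) :
    (unitParam p y).1 = unitLift h p (slopeLift p y) := by
  rw [unitParam, dif_pos (normSq_unitLift_slopeLift p hy)]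

/-- The chart of the unit tangent bundle centred at `p`: a unit vector `v` over `x` near `p` has as
coordinates the coordinates of `x` and the slope, in the induced coordinates of `TΣ`, of the ray
spanned by `v` with respect to the ray spanned by `p`. -/
def unitChart (p : UnitTangent h) : OpenPartialHomeomorph (UnitTangent h) (ModelProd Plane ℝ) where
  toFun q := ((tChart p.1 q.1).1, slopeNum (tChart p.1 p.1).2 (tChart p.1 q.1).2 /
    slopeDen (tChart p.1 p.1).2 (tChart p.1 q.1).2)
  invFun := unitParam p
  source := {q | q.1 ∈ (tChart p.1).source ∧
    0 < slopeDen (tChart p.1 p.1).2 (tChart p.1 q.1).2}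
  target := {y | y.1 ∈ (chartAt Plane p.1.1).target}
  map_source' q hq :=
    (TangentBundle.mem_chart_target_iff _ _).1 ((tChart p.1).map_source hq.1)
  map_target' y hy := by
    obtain ⟨a, ha, e⟩ := exists_tChart_unitLift p p hy
    rw [tChart_symm_slopeLift p hy] at e
    have ht : ∀ a : ℝ, (y.1, a • slopeVec (tChart p.1 p.1).2 y.2) ∈ (tChart p.1).target :=
      fun a ↦ (TangentBundle.mem_chart_target_iff _ _).2 hy
    rw [mem_ofPred_eq, unitParam_val p hy]
    refine ⟨(tChart p.1).map_target (ht _), ?_⟩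
    rw [e, slopeDen_smul, slopeLift, slopeDen_slopeVec]
    exact mul_pos ha (slopeDen_self p.coord_self_ne_zero)
  left_inv' q hq := by
    have h0 := slopeDen_self p.coord_self_ne_zero
    have h1 := slopeVec_slope hq.2.ne' h0.ne'
    have h2 : (tChart p.1).symm ((tChart p.1 q.1).1, (tChart p.1 q.1).2) = q.1 :=
      (tChart p.1).left_inv hq.1
    have h3 := q.2
    rw [← h2, ← h1] at h3
    have h4 := unitLift_smul p (div_pos hq.2 h0) h3
    rw [h1, h2] at h4
    refine UnitTangent.ext ((unitParam_val p ?_).trans h4)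
    exact (TangentBundle.mem_chart_target_iff _ _).1 ((tChart p.1).map_source hq.1)
  right_inv' y hy := by
    obtain ⟨a, ha, e⟩ := exists_tChart_unitLift p p hy
    rw [tChart_symm_slopeLift p hy] at e
    rw [unitParam_val p hy, e, slopeDen_smul, slopeNum_smul, slopeLift, slopeDen_slopeVec,
      slopeNum_slopeVec]
    refine Prod.ext rfl ?_
    have h2 := (slopeDen_self p.coord_self_ne_zero).ne'
    have h1 := ha.ne'
    simp only
    field_simp
  open_source := by
    have hc := ((contDiff_slopeDen (tChart p.1 p.1).2).continuous.comp_continuousOn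
      (continuous_snd.comp_continuousOn (tChart p.1).continuousOn))
    have := hc.isOpen_inter_preimage (tChart p.1).open_source (isOpen_Ioi (a := (0 : ℝ)))
    exact this.preimage (UnitTangent.isInducing_val h).continuous
  open_target := (chartAt Plane p.1.1).open_target.preimage continuous_fst
  continuousOn_toFun := by
    have h1 : ContinuousOn (fun q : UnitTangent h ↦ tChart p.1 q.1)
        {q | q.1 ∈ (tChart p.1).source ∧ 0 < slopeDen (tChart p.1 p.1).2 (tChart p.1 q.1).2} :=
      (tChart p.1).continuousOn.comp (UnitTangent.isInducing_val h).continuous.continuousOn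
        fun q hq ↦ hq.1
    have h2 := continuous_snd.comp_continuousOn h1
    exact (continuous_fst.comp_continuousOn h1).prodMk (ContinuousOn.div
      ((contDiff_slopeNum _).continuous.comp_continuousOn h2)
      ((contDiff_slopeDen _).continuous.comp_continuousOn h2) fun q hq ↦ hq.2.ne')
  continuousOn_invFun := by
    rw [(UnitTangent.isInducing_val h).continuousOn_iff]
    have h1 : ContinuousOn (fun y : ModelProd Plane ℝ ↦ unitLift h p (slopeLift p y))
        {y | y.1 ∈ (chartAt Plane p.1.1).target} := by
      refine (continuousOn_unitLift p).comp ?_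
        fun y hy ↦ ⟨hy, slopeVec_ne_zero p.coord_self_ne_zero _⟩
      exact (continuous_fst.prodMk
        ((contDiff_slopeVec _).continuous.comp continuous_snd)).continuousOn
    exact h1.congr fun y hy ↦ unitParam_val p hy

theorem mem_unitChart_source (p : UnitTangent h) : p ∈ (unitChart p).source :=
  ⟨mem_chart_source _ _, slopeDen_self (UnitTangent.coord_ne_zero p p (mem_chart_source _ _))⟩

instance : ChartedSpace (ModelProd Plane ℝ) (UnitTangent h) where
  atlas := range unitChart
  chartAt := unitChart
  mem_chart_source := mem_unitChart_source
  chart_mem_atlas p := mem_range_self p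

/-- The model with corners of the unit tangent bundle, a manifold of dimension three. -/
abbrev unitModel : ModelWithCorners ℝ (Plane × ℝ) (ModelProd Plane ℝ) := (𝓡 2).prod 𝓘(ℝ, ℝ)

instance : IsManifold unitModel ∞ (UnitTangent h) := by
  refine isManifold_of_contMDiffOn ?_
  rintro _ ⟨p, rfl⟩ _ ⟨q, rfl⟩
  have hkey : ∀ y ∈ ((unitChart p).symm ≫ₕ unitChart q).source,
      (tChart p.1).symm (slopeLift p y) ∈ (tChart q.1).source ∧
      0 < slopeDen (tChart q.1 q.1).2 (tChart q.1 ((tChart p.1).symm (slopeLift p y))).2 ∧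
      ((unitChart p).symm ≫ₕ unitChart q) y =
        ((tChart q.1 ((tChart p.1).symm (slopeLift p y))).1,
          slopeNum (tChart q.1 q.1).2 (tChart q.1 ((tChart p.1).symm (slopeLift p y))).2 /
          slopeDen (tChart q.1 q.1).2 (tChart q.1 ((tChart p.1).symm (slopeLift p y))).2) := by
    intro y hy
    have hy1 : y.1 ∈ (chartAt Plane p.1.1).target := hy.1
    have hy2 : (unitParam p y).1 ∈ (tChart q.1).source ∧
      0 < slopeDen (tChart q.1 q.1).2 (tChart q.1 (unitParam p y).1).2 := hy.2
    obtain ⟨a, ha, e⟩ := exists_tChart_unitLift p q hy1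
    rw [unitParam_val p hy1, e, slopeDen_smul] at hy2
    refine ⟨?_, (pos_iff_pos_of_mul_pos hy2.2).1 ha, ?_⟩
    · have := hy2.1
      rw [TangentBundle.mem_chart_source_iff] at this ⊢
      exact this
    · change ((tChart q.1 (unitParam p y).1).1, slopeNum _ (tChart q.1 (unitParam p y).1).2 /
        slopeDen _ (tChart q.1 (unitParam p y).1).2) = _
      rw [unitParam_val p hy1, e, slopeDen_smul, slopeNum_smul, mul_div_mul_left _ _ ha.ne']
  have h1 : ContMDiffOn unitModel ((𝓡 2).prod 𝓘(ℝ, Plane)) ∞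
      (fun y : ModelProd Plane ℝ ↦ tChart q.1 ((tChart p.1).symm (slopeLift p y)))
      ((unitChart p).symm ≫ₕ unitChart q).source := by
    have hl : ContMDiff unitModel ((𝓡 2).prod 𝓘(ℝ, Plane)) ∞ (slopeLift p) :=
      contMDiffOn_univ.1 (contMDiffOn_model_prodMk contMDiff_model_fst.contMDiffOn
        ((contDiff_slopeVec _).contMDiff.comp contMDiff_model_snd).contMDiffOn)
    have hs : ContMDiffOn ((𝓡 2).prod 𝓘(ℝ, Plane)) (𝓡 2).tangent ∞ (tChart p.1).symm
      (tChart p.1).target := contMDiffOn_chart_symm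
    have hc : ContMDiffOn (𝓡 2).tangent ((𝓡 2).prod 𝓘(ℝ, Plane)) ∞ (tChart q.1)
      (tChart q.1).source := contMDiffOn_chart
    have hm : MapsTo (slopeLift p) ((unitChart p).symm ≫ₕ unitChart q).source
        (tChart p.1).target := fun y hy ↦ by
      have hy1 : y.1 ∈ (chartAt Plane p.1.1).target := hy.1
      exact (TangentBundle.mem_chart_target_iff (slopeLift p y) p.1).2 hy1
    have h3 : ContMDiffOn unitModel (𝓡 2).tangent ∞ ((tChart p.1).symm ∘ slopeLift p)
        ((unitChart p).symm ≫ₕ unitChart q).source := hs.comp hl.contMDiffOn hm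
    have hm' : MapsTo ((tChart p.1).symm ∘ slopeLift p) ((unitChart p).symm ≫ₕ unitChart q).source
        (tChart q.1).source := fun y hy ↦ (hkey y hy).1
    exact hc.comp h3 hm'
  have h2 : ContMDiffOn unitModel 𝓘(ℝ, Plane) ∞
      (fun y : ModelProd Plane ℝ ↦ (tChart q.1 ((tChart p.1).symm (slopeLift p y))).2)
      ((unitChart p).symm ≫ₕ unitChart q).source := contMDiff_model_snd.comp_contMDiffOn h1
  have h3 : ContMDiffOn unitModel (𝓡 2) ∞
      (fun y : ModelProd Plane ℝ ↦ (tChart q.1 ((tChart p.1).symm (slopeLift p y))).1)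
      ((unitChart p).symm ≫ₕ unitChart q).source := contMDiff_model_fst.comp_contMDiffOn h1
  have h4 := (contDiff_slopeNum (tChart q.1 q.1).2).contMDiff.comp_contMDiffOn h2
  have h5 := (contDiff_slopeDen (tChart q.1 q.1).2).contMDiff.comp_contMDiffOn h2
  exact (contMDiffOn_model_prodMk h3 (h4.div₀ h5 fun y hy ↦ (hkey y hy).2.1.ne')).congr
    fun y hy ↦ (hkey y hy).2.2

end UnitTangent

section UnitTangentTopology

variable {S : Type*} [TopologicalSpace S] [ChartedSpace Plane S] [IsManifold (𝓡 2) ∞ S]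
  (h : SurfaceMetric S)

instance [T2Space S] : T2Space (UnitTangent h) := by
  refine ⟨fun p q hpq ↦ ?_⟩
  have hv : Continuous (UnitTangent.val (h := h)) := (UnitTangent.isInducing_val h).continuous
  have hproj : Continuous (fun r : UnitTangent h ↦ r.1.1) :=
    (FiberBundle.continuous_proj Plane (fun x : S ↦ TangentSpace (𝓡 2) x)).comp hv
  by_cases hb : p.1.1 = q.1.1
  · have hq : q.1 ∈ (tChart p.1).source := by
      rw [TangentBundle.mem_chart_source_iff, ← hb]; exact mem_chart_source _ _
    have hp : p.1 ∈ (tChart p.1).source := mem_chart_source _ _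
    have hne : tChart p.1 p.1 ≠ tChart p.1 q.1 := fun e ↦
      hpq (UnitTangent.ext ((tChart p.1).injOn hp hq e))
    have : T2Space (ModelProd Plane Plane) := inferInstanceAs (T2Space (Plane × Plane))
    obtain ⟨U, V, hU, hV, hpU, hqV, hUV⟩ := t2_separation hne
    refine ⟨_, _, ((tChart p.1).isOpen_inter_preimage hU).preimage hv,
      ((tChart p.1).isOpen_inter_preimage hV).preimage hv, ⟨hp, hpU⟩, ⟨hq, hqV⟩, ?_⟩
    exact (hUV.preimage _).mono (fun r hr ↦ hr.2) (fun r hr ↦ hr.2) |>.preimage _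
  · obtain ⟨U, V, hU, hV, hpU, hqV, hUV⟩ := t2_separation hb
    exact ⟨_, _, hU.preimage hproj, hV.preimage hproj, hpU, hqV, hUV.preimage _⟩

instance : LocallyCompactSpace (UnitTangent h) :=
  have : LocallyCompactSpace (ModelProd Plane ℝ) := inferInstanceAs (LocallyCompactSpace (Plane × ℝ))
  ChartedSpace.locallyCompactSpace (ModelProd Plane ℝ) (UnitTangent h)

end UnitTangentTopology

section MappingTorus

variable {E : Type*} [NormedAddCommGroup E] [NormedSpace ℝ E] {H : Type*} [TopologicalSpace H]
  {I : ModelWithCorners ℝ E H} {V : Type*} [TopologicalSpace V] [ChartedSpace H V]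

/-- The infinite cyclic covering `ℝ × V` of the mapping torus of the diffeomorphism `φ`. -/
def TorusCover (_φ : V ≃ₘ⟮I, I⟯ V) : Type _ := ℝ × V

variable (φ : V ≃ₘ⟮I, I⟯ V)

instance : TopologicalSpace (TorusCover φ) := inferInstanceAs (TopologicalSpace (ℝ × V))
instance : ChartedSpace (ModelProd ℝ H) (TorusCover φ) :=
  inferInstanceAs (ChartedSpace (ModelProd ℝ H) (ℝ × V))
instance [IsManifold I ∞ V] : IsManifold (𝓘(ℝ, ℝ).prod I) ∞ (TorusCover φ) :=
  inferInstanceAs (IsManifold (𝓘(ℝ, ℝ).prod I) ∞ (ℝ × V))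
instance [T2Space V] : T2Space (TorusCover φ) := inferInstanceAs (T2Space (ℝ × V))
instance [LocallyCompactSpace V] : LocallyCompactSpace (TorusCover φ) :=
  inferInstanceAs (LocallyCompactSpace (ℝ × V))

/-- The deck transformations: `n` sends `(t, v)` to `(t + n, φ⁻ⁿ(v))`, so that `(t + n, v)` and
`(t, φⁿ(v))` lie in the same orbit. -/
instance : AddAction ℤ (TorusCover φ) where
  vadd n p := (p.1 + n, (φ.toEquiv ^ (-n) : Equiv.Perm V) p.2)
  zero_vadd p := by
    change ((p.1 + ((0 : ℤ) : ℝ), (φ.toEquiv ^ (-0 : ℤ) : Equiv.Perm V) p.2) : ℝ × V) = p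
    simp only [Int.cast_zero, add_zero, neg_zero, zpow_zero, Equiv.Perm.coe_one, id_eq]
    rfl
  add_vadd m n p := by
    change ((p.1 + ((m + n : ℤ) : ℝ), (φ.toEquiv ^ (-(m + n)) : Equiv.Perm V) p.2) : ℝ × V) =
      (p.1 + (n : ℝ) + (m : ℝ), (φ.toEquiv ^ (-m) : Equiv.Perm V)
        ((φ.toEquiv ^ (-n) : Equiv.Perm V) p.2))
    rw [neg_add, zpow_add, Equiv.Perm.mul_apply]
    push_cast
    rw [add_assoc, add_comm (m : ℝ)]

theorem torus_vadd_def (n : ℤ) (p : TorusCover φ) :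
    n +ᵥ p = (p.1 + n, (φ.toEquiv ^ (-n) : Equiv.Perm V) p.2) := rfl

theorem contMDiff_zpow (n : ℤ) : ContMDiff I I ∞ (φ.toEquiv ^ n : Equiv.Perm V) := by
  have hnat : ∀ (ψ : V ≃ₘ⟮I, I⟯ V) (n : ℕ), ContMDiff I I ∞ (ψ.toEquiv ^ n : Equiv.Perm V) := by
    intro ψ n
    induction n with
    | zero => exact contMDiff_id
    | succ n ih => rw [pow_succ, Equiv.Perm.coe_mul]; exact ih.comp ψ.contMDiff
  obtain ⟨k, rfl | rfl⟩ := n.eq_nat_or_neg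
  · rw [zpow_natCast]; exact hnat φ k
  · rw [zpow_neg, zpow_natCast, ← inv_pow]; exact hnat φ.symm k

theorem contMDiff_deck (n : ℤ) :
    ContMDiff (𝓘(ℝ, ℝ).prod I) (𝓘(ℝ, ℝ).prod I) ∞ (fun p : TorusCover φ ↦ n +ᵥ p) := by
  have h1 : ContMDiff (𝓘(ℝ, ℝ).prod I) (𝓘(ℝ, ℝ).prod I) ∞
      (fun p : ℝ × V ↦ (p.1 + (n : ℝ), (φ.toEquiv ^ (-n) : Equiv.Perm V) p.2)) :=
    (contMDiff_fst.add contMDiff_const).prodMk ((contMDiff_zpow φ _).comp contMDiff_snd)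
  exact h1

instance : ContinuousConstVAdd ℤ (TorusCover φ) := ⟨fun n ↦ (contMDiff_deck φ n).continuous⟩

instance : IsCancelVAdd ℤ (TorusCover φ) where
  left_cancel' n p q e := by simpa using e
  right_cancel' m n p e := by
    have := congrArg Prod.fst e
    rw [torus_vadd_def, torus_vadd_def] at this
    simpa using this

instance : ProperlyDiscontinuousVAdd ℤ (TorusCover φ) where
  finite_disjoint_inter_image {K L} hK hL := by
    have hf : Continuous (fun p : TorusCover φ ↦ p.1) := continuous_fst (X := ℝ) (Y := V)
    obtain ⟨a, ha⟩ := (hK.image hf).isBounded.exists_norm_le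
    obtain ⟨b, hb⟩ := (hL.image hf).isBounded.exists_norm_le
    refine (Set.finite_Icc (-⌈a + b⌉) ⌈a + b⌉).subset ?_
    rintro n ⟨q, ⟨p, hp, rfl⟩, hq⟩
    have h1 := ha _ (mem_image_of_mem _ hp)
    have h2 := hb _ (mem_image_of_mem _ hq)
    simp only [torus_vadd_def, Real.norm_eq_abs, abs_le] at h1 h2
    have h3 := Int.le_ceil (a + b)
    constructor
    · have : (-⌈a + b⌉ : ℝ) ≤ n := by linarith
      exact_mod_cast this
    · have : (n : ℝ) ≤ ⌈a + b⌉ := by linarith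
      exact_mod_cast this

/-- The mapping torus of `φ`: the quotient of `ℝ × V` in which `(t + n, v)` and `(t, φⁿ(v))` are
identified. Its smooth structure is the one for which the projection from `ℝ × V` is a local
diffeomorphism. -/
abbrev MappingTorus [T2Space V] [LocallyCompactSpace V] : Type _ :=
  AddAction.orbitRel.Quotient ℤ (TorusCover φ)

variable [T2Space V] [LocallyCompactSpace V]

/-- The projection from `ℝ × V` to the mapping torus. -/
def torusProj (p : TorusCover φ) : MappingTorus φ := Quotient.mk _ p

theorem isLocalHomeomorph_torusProj : IsLocalHomeomorph (torusProj φ) :=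
  isAddQuotientCoveringMap_quotientMk_of_properlyDiscontinuousVAdd.isCoveringMap.isLocalHomeomorph

instance : ChartedSpace (ModelProd ℝ H) (MappingTorus φ) := inferInstance

theorem torusProj_vadd (n : ℤ) (p : TorusCover φ) : torusProj φ (n +ᵥ p) = torusProj φ p :=
  Quotient.sound ⟨n, rfl⟩

theorem torusProj_eq_iff {p q : TorusCover φ} :
    torusProj φ p = torusProj φ q ↔ ∃ n : ℤ, n +ᵥ q = p :=
  Quotient.eq.trans (AddAction.orbitRel_apply.trans AddAction.mem_orbit_iff)

instance [IsManifold I ∞ V] : IsManifold (𝓘(ℝ, ℝ).prod I) ∞ (MappingTorus φ) := by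
  have hf := isLocalHomeomorph_torusProj φ
  have hsymm : ∀ (a : TorusCover φ) (x : TorusCover φ), (hf.localInverseAt a).symm x =
      torusProj φ x := fun a x ↦ congrFun (hf.localInverseAt_symm a) x
  refine isManifold_of_contMDiffOn ?_
  have hatlas : ∀ e ∈ atlas (ModelProd ℝ H) (MappingTorus φ), ∃ a : TorusCover φ,
      e = (hf.localInverseAt a).trans (chartAt (ModelProd ℝ H) a) := by
    rintro _ ⟨q, rfl⟩
    exact ⟨_, rfl⟩
  intro e he e' he'
  obtain ⟨a, rfl⟩ := hatlas e he
  obtain ⟨b, rfl⟩ := hatlas e' he'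
  intro y hy
  set ca := chartAt (ModelProd ℝ H) a with hca
  set cb := chartAt (ModelProd ℝ H) b with hcb
  have hya : y ∈ ca.target := hy.1.1
  have hyb : torusProj φ (ca.symm y) ∈ (hf.localInverseAt b).source := by
    rw [← hsymm a]; exact hy.2.1
  have hyc : hf.localInverseAt b (torusProj φ (ca.symm y)) ∈ cb.source := by
    rw [← hsymm a]; exact hy.2.2
  obtain ⟨n, hn⟩ := (torusProj_eq_iff φ).1 (hf.apply_localInverseAt_of_mem hyb)
  have hc : ContMDiffAt (𝓘(ℝ, ℝ).prod I) (𝓘(ℝ, ℝ).prod I) ∞ ca.symm y :=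
    contMDiffOn_chart_symm.contMDiffAt (ca.open_target.mem_nhds hya)
  have hd := (contMDiff_deck φ n).contMDiffAt (x := ca.symm y)
  have hdc := hd.comp y hc
  have hcb' : ContMDiffAt (𝓘(ℝ, ℝ).prod I) (𝓘(ℝ, ℝ).prod I) ∞ cb (n +ᵥ ca.symm y) := by
    rw [hn]
    exact contMDiffOn_chart.contMDiffAt (cb.open_source.mem_nhds hyc)
  have htot := hcb'.comp y hdc
  refine (htot.congr_of_eventuallyEq ?_).contMDiffWithinAt
  have hmem : n +ᵥ ca.symm y ∈ (hf.localInverseAt b).target := by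
    rw [hn]; exact (hf.localInverseAt b).map_source hyb
  filter_upwards [hdc.continuousAt.preimage_mem_nhds
    ((hf.localInverseAt b).open_target.mem_nhds hmem)] with z hz
  have hz' : n +ᵥ ca.symm z ∈ (hf.localInverseAt b).target := hz
  have h1 := (hf.localInverseAt b).right_inv hz'
  rw [hsymm b, torusProj_vadd, ← hsymm a] at h1
  change cb (hf.localInverseAt b ((hf.localInverseAt a).symm (ca.symm z))) = _
  rw [h1]
  rfl

end MappingTorus

section Lorentz

variable {E : Type*} [NormedAddCommGroup E] [NormedSpace ℝ E] {H : Type*} [TopologicalSpace H]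
  (I : ModelWithCorners ℝ E H) (V : Type*) [TopologicalSpace V] [ChartedSpace H V]
  [IsManifold I ∞ V]

/-- A smooth Lorentzian metric: a smooth field of symmetric bilinear forms each of which is negative
on some vector and positive definite on the orthogonal complement of that vector. -/
structure LorentzMetric where
  /-- The bilinear form on the tangent space at `x`. -/
  inner (x : V) : TangentSpace I x →L[ℝ] TangentSpace I x →L[ℝ] ℝ
  symm (x : V) (u w : TangentSpace I x) : inner x u w = inner x w u
  signature (x : V) : ∃ w : TangentSpace I x, inner x w w < 0 ∧
    ∀ u : TangentSpace I x, inner x w u = 0 → u ≠ 0 → 0 < inner x u u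
  contMDiffAt (x₀ : V) (A B : ∀ x : V, TangentSpace I x)
    (hA : ContMDiffAt I I.tangent ∞ (fun x ↦ (⟨x, A x⟩ : TangentBundle I V)) x₀)
    (hB : ContMDiffAt I I.tangent ∞ (fun x ↦ (⟨x, B x⟩ : TangentBundle I V)) x₀) :
    ContMDiffAt I 𝓘(ℝ, ℝ) ∞ (fun x ↦ inner x (A x) (B x)) x₀

variable {I V} (g : LorentzMetric I V)

/-- A nonzero null vector of a Lorentzian manifold. -/
structure NullVector where
  /-- The underlying tangent vector, together with its base point. -/
  val : TangentBundle I V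
  ne_zero : val.2 ≠ 0
  null : g.inner val.1 val.2 val.2 = 0

/-- The null circle bundle `NC(TV)`: its points are the pairs `(v, ℓ)` of a point `v` of the
Lorentzian manifold `V` and a null line `ℓ` in the tangent space at `v`. -/
structure NullLine where
  /-- The base point. -/
  point : V
  /-- The null line. -/
  line : Submodule ℝ (TangentSpace I point)
  finrank_line : Module.finrank ℝ line = 1
  null (w : TangentSpace I point) (hw : w ∈ line) : g.inner point w w = 0

variable {g}

/-- The null line spanned by a nonzero null vector. -/
def NullVector.toLine (w : NullVector g) : NullLine g where
  point := w.val.1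
  line := Submodule.span ℝ {w.val.2}
  finrank_line := finrank_span_singleton w.ne_zero
  null v hv := by
    obtain ⟨a, rfl⟩ := Submodule.mem_span_singleton.1 hv
    simp [w.null]

theorem NullVector.toLine_surjective :
    Function.Surjective (NullVector.toLine : NullVector g → NullLine g) := by
  rintro ⟨x, ℓ, hℓ, hnull⟩
  obtain ⟨v, hv0, hv⟩ := finrank_eq_one_iff'.1 hℓ
  have hspan : Submodule.span ℝ {(v : TangentSpace I x)} = ℓ := by
    apply le_antisymm
    · rw [Submodule.span_singleton_le_iff_mem]; exact v.2
    · intro w hw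
      obtain ⟨a, ha⟩ := hv ⟨w, hw⟩
      exact Submodule.mem_span_singleton.2 ⟨a, congrArg Subtype.val ha⟩
  refine ⟨⟨⟨x, v⟩, fun h ↦ hv0 (Subtype.ext h), hnull _ v.2⟩, ?_⟩
  simp only [NullVector.toLine, hspan]

theorem NullVector.exists_smul_of_toLine_eq {w w' : NullVector g} (h : w.toLine = w'.toLine) :
    ∃ a : ℝ, a ≠ 0 ∧ w'.val = ⟨w.val.1, a • w.val.2⟩ := by
  obtain ⟨⟨x, v⟩, hv0, hv⟩ := w
  obtain ⟨⟨x', v'⟩, hv0', hv'⟩ := w'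
  have hx : x = x' := congrArg NullLine.point h
  subst hx
  have hl : Submodule.span ℝ {v} = Submodule.span ℝ {v'} := by
    simpa [NullVector.toLine] using h
  have : v' ∈ Submodule.span ℝ {v} := hl ▸ Submodule.mem_span_singleton_self v'
  obtain ⟨a, rfl⟩ := Submodule.mem_span_singleton.1 this
  refine ⟨a, ?_, rfl⟩
  rintro rfl
  simp at hv0'

theorem NullVector.toLine_eq_of_smul {w w' : NullVector g} {c : ℝ} (hc : c ≠ 0)
    (h : w'.val = ⟨w.val.1, c • w.val.2⟩) : w'.toLine = w.toLine := by
  obtain ⟨⟨x, v⟩, hv0, hv⟩ := w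
  obtain ⟨⟨x', v'⟩, hv0', hv'⟩ := w'
  simp only at h
  obtain ⟨rfl, h2⟩ := TotalSpace.mk.inj h
  have h2 := eq_of_heq h2
  subst h2
  have := Submodule.span_singleton_smul_eq (R := ℝ) (Ne.isUnit hc) v
  simp only [toLine, this]

/-- The topology on the nonzero null vectors as a subspace of `TV`. -/
instance : TopologicalSpace (NullVector g) := .induced NullVector.val inferInstance

/-- The topology on `NC(TV)` as a quotient of the nonzero null vectors. -/
instance : TopologicalSpace (NullLine g) := .coinduced NullVector.toLine inferInstance

theorem NullVector.isInducing_val : IsInducing (NullVector.val (g := g)) := ⟨rfl⟩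

theorem NullVector.isQuotientMap_toLine :
    IsQuotientMap (NullVector.toLine : NullVector g → NullLine g) :=
  ⟨⟨rfl⟩, NullVector.toLine_surjective⟩

/-- The coordinates, induced by the chart at `x₀`, of tangent vectors at `y`. -/
def coordAt (x₀ y : V) : TangentSpace I y →L[ℝ] E :=
  (tangentBundleCore I V).coordChange (achart H y) (achart H x₀) y

/-- The tangent vectors at `y` with given coordinates in the chart at `x₀`. -/
def frameAt (x₀ y : V) : E →L[ℝ] TangentSpace I y :=
  (tangentBundleCore I V).coordChange (achart H x₀) (achart H y) y

theorem frameAt_coordAt {x₀ y : V} (hy : y ∈ (chartAt H x₀).source) (v : TangentSpace I y) :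
    frameAt x₀ y (coordAt x₀ y v) = v := by
  have h1 := (tangentBundleCore I V).coordChange_comp (achart H y) (achart H x₀) (achart H y) y
    ⟨⟨mem_chart_source _ _, hy⟩, mem_chart_source _ _⟩ v
  exact h1.trans ((tangentBundleCore I V).coordChange_self _ _ (mem_chart_source _ _) v)

theorem coordAt_frameAt {x₀ y : V} (hy : y ∈ (chartAt H x₀).source) (u : E) :
    coordAt x₀ y (frameAt (I := I) x₀ y u) = u := by
  have h1 := (tangentBundleCore I V).coordChange_comp (achart H x₀) (achart H y) (achart H x₀) y
    ⟨⟨hy, mem_chart_source _ _⟩, hy⟩ u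
  exact h1.trans ((tangentBundleCore I V).coordChange_self _ _ hy u)

theorem contMDiffOn_coordAt (x₀ : V) :
    ContMDiffOn I.tangent 𝓘(ℝ, E) ∞ (fun q : TangentBundle I V ↦ coordAt x₀ q.1 q.2)
      {q | q.1 ∈ (chartAt H x₀).source} := by
  have h := contMDiffOn_chart (I := I.tangent) (n := ∞) (x := (⟨x₀, 0⟩ : TangentBundle I V))
  exact (contMDiff_model_snd.comp_contMDiffOn h).mono fun q hq ↦
    (TangentBundle.mem_chart_source_iff _ _).2 hq

theorem contMDiffOn_frameAt (x₀ : V) :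
    ContMDiffOn (I.prod 𝓘(ℝ, E)) I.tangent ∞
      (fun y : ModelProd H E ↦ (⟨(chartAt H x₀).symm y.1, frameAt x₀ _ y.2⟩ : TangentBundle I V))
      {y | y.1 ∈ (chartAt H x₀).target} := by
  have h := contMDiffOn_chart_symm (I := I.tangent) (n := ∞)
    (x := (⟨x₀, 0⟩ : TangentBundle I V))
  exact h.mono fun q hq ↦ (TangentBundle.mem_chart_target_iff _ _).2 hq

variable (g) in
/-- The coefficients of the metric in the chart at `x₀`. -/
def coef (x₀ : V) (u w : E) (y : V) : ℝ := g.inner y (frameAt x₀ y u) (frameAt x₀ y w)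

theorem contMDiffOn_coef (x₀ : V) (u w : E) :
    ContMDiffOn I 𝓘(ℝ, ℝ) ∞ (coef g x₀ u w) (chartAt H x₀).source := by
  have hsec : ∀ u : E, ContMDiffOn I I.tangent ∞
      (fun y ↦ (⟨y, frameAt x₀ y u⟩ : TangentBundle I V)) (chartAt H x₀).source := by
    intro u
    have h1 : ContMDiffOn (M' := ModelProd H E) I (I.prod 𝓘(ℝ, E)) ∞
        (fun y : V ↦ (chartAt H x₀ y, u)) (chartAt H x₀).source :=
      contMDiffOn_model_prodMk contMDiffOn_chart contMDiffOn_const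
    have h2 := (contMDiffOn_frameAt (I := I) x₀).comp h1
      (fun y hy ↦ (chartAt H x₀).map_source hy)
    refine h2.congr fun y hy ↦ ?_
    have := (chartAt H x₀).left_inv hy
    exact (congrArg (fun z ↦ (⟨z, frameAt x₀ z u⟩ : TangentBundle I V)) this).symm
  intro y hy
  have hn := (chartAt H x₀).open_source.mem_nhds hy
  exact (g.contMDiffAt y _ _ ((hsec u).contMDiffAt hn)
    ((hsec w).contMDiffAt hn)).contMDiffWithinAt

theorem coef_symm (x₀ : V) (u w : E) (y : V) : coef g x₀ u w y = coef g x₀ w u y := g.symm _ _ _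

theorem coef_add_left (x₀ : V) (u u' w : E) (y : V) :
    coef g x₀ (u + u') w y = coef g x₀ u w y + coef g x₀ u' w y := by
  simp [coef]

theorem coef_smul_left (x₀ : V) (a : ℝ) (u w : E) (y : V) :
    coef g x₀ (a • u) w y = a * coef g x₀ u w y := by
  simp [coef]

theorem coef_add_right (x₀ : V) (u w w' : E) (y : V) :
    coef g x₀ u (w + w') y = coef g x₀ u w y + coef g x₀ u w' y := by
  simp [coef]

theorem coef_smul_right (x₀ : V) (a : ℝ) (u w : E) (y : V) :
    coef g x₀ u (a • w) y = a * coef g x₀ u w y := by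
  simp [coef]

/-- A frame of the model space adapted to the null vector `w`: it consists of the coordinates of `w`
and of two more vectors `a` and `b`, of which `b` is not orthogonal to `w`. The functionals `α`, `β`
and `γ` form the dual frame. -/
structure NullFrame (w : NullVector g) where
  (a b : E)
  (α β γ : E →L[ℝ] ℝ)
  decomp (u : E) : u = α u • coordAt w.val.1 w.val.1 w.val.2 + β u • a + γ u • b
  α_w : α (coordAt w.val.1 w.val.1 w.val.2) = 1
  β_w : β (coordAt w.val.1 w.val.1 w.val.2) = 0
  α_a : α a = 0
  β_a : β a = 1
  α_b : α b = 0
  β_b : β b = 0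
  coef_pos : 0 < coef g w.val.1 (coordAt w.val.1 w.val.1 w.val.2) b w.val.1

theorem exists_nullFrame (hE : Module.finrank ℝ E = 3) (w : NullVector g) :
    Nonempty (NullFrame w) := by
  have : FiniteDimensional ℝ E := Module.finite_of_finrank_pos (by omega)
  set x := w.val.1
  set u := coordAt x x w.val.2 with hu
  have hux : frameAt x x u = w.val.2 := frameAt_coordAt (mem_chart_source _ _) _
  obtain ⟨τ, hτ, hτ'⟩ := g.signature x
  have hne : g.inner x w.val.2 τ ≠ 0 := by
    intro h0
    rw [g.symm] at h0
    exact (hτ' _ h0 w.ne_zero).ne' w.null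
  obtain ⟨b, hb⟩ : ∃ b : E, 0 < coef g x u b x := by
    have hc : coef g x u (coordAt x x τ) x = g.inner x w.val.2 τ := by
      rw [coef, hux, frameAt_coordAt (mem_chart_source _ _)]
    rcases lt_or_gt_of_ne hne with h | h
    · refine ⟨(-1 : ℝ) • coordAt x x τ, ?_⟩
      rw [coef_smul_right, hc]; linarith
    · exact ⟨coordAt x x τ, hc ▸ h⟩
  have huu : coef g x u u x = 0 := by rw [coef, hux]; exact w.null
  have hu0 : u ≠ 0 := by
    intro h0
    rw [h0] at hux
    exact w.ne_zero (by rw [← hux, map_zero])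
  have hli : LinearIndependent ℝ ![u, b] := by
    rw [LinearIndependent.pair_iff' hu0]
    intro c hc
    rw [← hc, coef_smul_right, huu, mul_zero] at hb
    exact lt_irrefl _ hb
  obtain ⟨a, ha⟩ := exists_linearIndependent_cons_of_lt_finrank hli (by rw [hE]; norm_num)
  let B := basisOfLinearIndependentOfCardEqFinrank ha (by simp [hE])
  have hB : ⇑B = Fin.cons a ![u, b] := coe_basisOfLinearIndependentOfCardEqFinrank ha (by simp [hE])
  have h0 : B 0 = a := by rw [hB]; rfl
  have h1 : B 1 = u := by rw [hB]; rfl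
  have h2 : B 2 = b := by rw [hB]; rfl
  refine ⟨⟨a, b, LinearMap.toContinuousLinearMap (B.coord 1),
    LinearMap.toContinuousLinearMap (B.coord 0),
    LinearMap.toContinuousLinearMap (B.coord 2), fun v ↦ ?_, ?_, ?_, ?_, ?_, ?_, ?_, hb⟩⟩
  · have := B.sum_repr v
    rw [Fin.sum_univ_three, h0, h1, h2] at this
    simp only [LinearMap.coe_toContinuousLinearMap', Module.Basis.coord_apply]
    rw [add_comm (B.repr v 1 • _)]
    exact this.symm
  all_goals simp only [LinearMap.coe_toContinuousLinearMap', Module.Basis.coord_apply]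
  all_goals first
    | rw [← hu, ← h1] | rw [← h0] | rw [← h2]
  all_goals simp

namespace NullFrame

variable {w : NullVector g} (F : NullFrame w)

/-- The affine combination `w + s a` of the first two vectors of the frame. -/
def dir (s : ℝ) : E := coordAt w.val.1 w.val.1 w.val.2 + s • F.a

/-- The discriminant of the quadratic equation for `r` which says that `w + s a + r b` is null. -/
def disc (s : ℝ) (y : V) : ℝ :=
  coef g w.val.1 (F.dir s) F.b y ^ 2 -
    coef g w.val.1 F.b F.b y * coef g w.val.1 (F.dir s) (F.dir s) y

/-- The root `r` near zero of the quadratic equation which says that `w + s a + r b` is null. -/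
def root (s : ℝ) (y : V) : ℝ :=
  -coef g w.val.1 (F.dir s) (F.dir s) y /
    (coef g w.val.1 (F.dir s) F.b y + √(F.disc s y))

/-- The coordinates of a null vector at `y` in the affine plane `w + s a + r b`. -/
def vec (s : ℝ) (y : V) : E := F.dir s + F.root s y • F.b

/-- The tangent vectors that span the lines in the domain of the chart belonging to the frame. -/
def dom : Set (TangentBundle I V) :=
  {q | q.1 ∈ (chartAt H w.val.1).source ∧
    0 < F.α (coordAt w.val.1 q.1 q.2) * coef g w.val.1 (coordAt w.val.1 q.1 q.2) F.b q.1 ∧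
    0 < coef g w.val.1 (F.dir (F.β (coordAt w.val.1 q.1 q.2) / F.α (coordAt w.val.1 q.1 q.2)))
      F.b q.1}

/-- The coordinates of the line spanned by a tangent vector: those of the base point, and the slope
`β / α` of the vector with respect to the frame. -/
def coord (q : TangentBundle I V) : ModelProd H ℝ :=
  (chartAt H w.val.1 q.1, F.β (coordAt w.val.1 q.1 q.2) / F.α (coordAt w.val.1 q.1 q.2))

theorem coord_smul (y : V) (v : TangentSpace I y) {c : ℝ} (hc : c ≠ 0) :
    F.coord ⟨y, c • v⟩ = F.coord ⟨y, v⟩ := by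
  refine Prod.ext rfl ?_
  simp only [coord, map_smul, smul_eq_mul]
  exact mul_div_mul_left _ _ hc

theorem smul_mem_dom (y : V) (v : TangentSpace I y) {c : ℝ} (hc : c ≠ 0) :
    (⟨y, c • v⟩ : TangentBundle I V) ∈ F.dom ↔ ⟨y, v⟩ ∈ F.dom := by
  have h1 : ∀ p q : ℝ, 0 < c * p * (c * q) ↔ 0 < p * q := fun p q ↦ by
    rw [show c * p * (c * q) = c ^ 2 * (p * q) by ring]
    exact mul_pos_iff_of_pos_left (by positivity)
  simp only [dom, mem_ofPred_eq, map_smul, smul_eq_mul, coef_smul_left, h1,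
    mul_div_mul_left _ _ hc]

theorem contMDiffOn_coord {s : Set (TangentBundle I V)} (hs : s ⊆ F.dom) :
    ContMDiffOn I.tangent (I.prod 𝓘(ℝ, ℝ)) ∞ F.coord s := by
  have hc := (contMDiffOn_coordAt (I := I) w.val.1).mono (hs.trans fun q hq ↦ hq.1)
  have h1 : ContMDiffOn I.tangent I ∞ (fun q : TangentBundle I V ↦ chartAt H w.val.1 q.1) s :=
    (contMDiffOn_chart (I := I) (n := ∞) (x := w.val.1)).comp
      (contMDiff_proj (fun x : V ↦ TangentSpace I x)).contMDiffOn fun q hq ↦ (hs hq).1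
  have hα := F.α.contDiff.contMDiff.comp_contMDiffOn hc
  have hβ := F.β.contDiff.contMDiff.comp_contMDiffOn hc
  exact contMDiffOn_model_prodMk h1 (hβ.div₀ hα fun q hq h0 ↦ by
    have := (hs hq).2.1
    rw [show F.α (coordAt w.val.1 q.1 q.2) = 0 from h0, zero_mul] at this
    exact lt_irrefl _ this)

theorem coef_dir (s : ℝ) (v : E) (y : V) :
    coef g w.val.1 (F.dir s) v y = coef g w.val.1 (coordAt w.val.1 w.val.1 w.val.2) v y +
      s * coef g w.val.1 F.a v y := by
  rw [dir, coef_add_left, coef_smul_left]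

theorem coef_decomp (u v : E) (y : V) :
    coef g w.val.1 u v y = F.α u * coef g w.val.1 (coordAt w.val.1 w.val.1 w.val.2) v y +
      F.β u * coef g w.val.1 F.a v y + F.γ u * coef g w.val.1 F.b v y := by
  conv_lhs => rw [F.decomp u]
  simp only [coef_add_left, coef_smul_left]

theorem isOpen_dom : IsOpen F.dom := by
  have hp : Continuous (fun q : TangentBundle I V ↦ q.1) :=
    FiberBundle.continuous_proj E (fun x : V ↦ TangentSpace I x)
  set O : Set (TangentBundle I V) := {q | q.1 ∈ (chartAt H w.val.1).source} with hO
  have ho : IsOpen O := (chartAt H w.val.1).open_source.preimage hp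
  have hc : ContinuousOn (fun q : TangentBundle I V ↦ coordAt w.val.1 q.1 q.2) O :=
    (contMDiffOn_coordAt (I := I) w.val.1).continuousOn
  have hα : ContinuousOn (fun q : TangentBundle I V ↦ F.α (coordAt w.val.1 q.1 q.2)) O :=
    F.α.continuous.comp_continuousOn hc
  have hβ : ContinuousOn (fun q : TangentBundle I V ↦ F.β (coordAt w.val.1 q.1 q.2)) O :=
    F.β.continuous.comp_continuousOn hc
  have hγ : ContinuousOn (fun q : TangentBundle I V ↦ F.γ (coordAt w.val.1 q.1 q.2)) O :=
    F.γ.continuous.comp_continuousOn hc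
  have hcoef : ∀ u v : E, ContinuousOn (fun q : TangentBundle I V ↦ coef g w.val.1 u v q.1) O :=
    fun u v ↦ (contMDiffOn_coef (g := g) w.val.1 u v).continuousOn.comp hp.continuousOn
      fun q hq ↦ hq
  have h1 : ContinuousOn (fun q : TangentBundle I V ↦ F.α (coordAt w.val.1 q.1 q.2) *
      coef g w.val.1 (coordAt w.val.1 q.1 q.2) F.b q.1) O := by
    have : ∀ q : TangentBundle I V, coef g w.val.1 (coordAt w.val.1 q.1 q.2) F.b q.1 = _ :=
      fun q ↦ F.coef_decomp _ _ _
    simp only [this]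
    exact hα.mul (((hα.mul (hcoef _ _)).add (hβ.mul (hcoef _ _))).add (hγ.mul (hcoef _ _)))
  have ho1 := h1.isOpen_inter_preimage ho (isOpen_Ioi (a := (0 : ℝ)))
  have h2 : ContinuousOn (fun q : TangentBundle I V ↦ coef g w.val.1
      (F.dir (F.β (coordAt w.val.1 q.1 q.2) / F.α (coordAt w.val.1 q.1 q.2))) F.b q.1)
      (O ∩ (fun q : TangentBundle I V ↦ F.α (coordAt w.val.1 q.1 q.2) *
        coef g w.val.1 (coordAt w.val.1 q.1 q.2) F.b q.1) ⁻¹' Ioi 0) := by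
    simp only [coef_dir]
    refine ((hcoef _ _).mono inter_subset_left).add (ContinuousOn.mul ?_
      ((hcoef _ _).mono inter_subset_left))
    refine (hβ.mono inter_subset_left).div (hα.mono inter_subset_left) fun q hq h0 ↦ ?_
    have := hq.2
    rw [mem_preimage, h0, zero_mul] at this
    exact lt_irrefl (0 : ℝ) this
  have ho2 := h2.isOpen_inter_preimage ho1 (isOpen_Ioi (a := (0 : ℝ)))
  convert ho2 using 1
  ext q
  simp only [dom, mem_ofPred_eq, mem_inter_iff, mem_preimage, mem_Ioi, hO, and_assoc]

/-- The range of the chart belonging to the frame. -/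
def target : Set (ModelProd H ℝ) :=
  {y | y.1 ∈ (chartAt H w.val.1).target ∧
    0 < coef g w.val.1 (F.dir y.2) F.b ((chartAt H w.val.1).symm y.1) ∧
    0 < F.disc y.2 ((chartAt H w.val.1).symm y.1)}

/-- The null vector that spans the line with coordinates `y`. -/
def lift (y : ModelProd H ℝ) : TangentBundle I V :=
  ⟨(chartAt H w.val.1).symm y.1, frameAt w.val.1 _ (F.vec y.2 ((chartAt H w.val.1).symm y.1))⟩

theorem contMDiffOn_coef_symm (u v : E) :
    ContMDiffOn (I.prod 𝓘(ℝ, ℝ)) 𝓘(ℝ, ℝ) ∞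
      (fun y : ModelProd H ℝ ↦ coef g w.val.1 u v ((chartAt H w.val.1).symm y.1))
      {y | y.1 ∈ (chartAt H w.val.1).target} := by
  have h1 : ContMDiffOn (I.prod 𝓘(ℝ, ℝ)) I ∞
      (fun y : ModelProd H ℝ ↦ (chartAt H w.val.1).symm y.1)
      {y | y.1 ∈ (chartAt H w.val.1).target} :=
    (contMDiffOn_chart_symm (I := I) (n := ∞) (x := w.val.1)).comp
      contMDiff_model_fst.contMDiffOn fun y hy ↦ hy
  exact (contMDiffOn_coef w.val.1 u v).comp h1 fun y hy ↦ (chartAt H w.val.1).map_target hy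

theorem contMDiffOn_coef_dir (v : E) :
    ContMDiffOn (I.prod 𝓘(ℝ, ℝ)) 𝓘(ℝ, ℝ) ∞
      (fun y : ModelProd H ℝ ↦ coef g w.val.1 (F.dir y.2) v ((chartAt H w.val.1).symm y.1))
      {y | y.1 ∈ (chartAt H w.val.1).target} := by
  simp only [coef_dir]
  exact (contMDiffOn_coef_symm _ _).add
    (contMDiff_model_snd.contMDiffOn.mul (contMDiffOn_coef_symm _ _))

theorem contMDiffOn_coef_dir_dir :
    ContMDiffOn (I.prod 𝓘(ℝ, ℝ)) 𝓘(ℝ, ℝ) ∞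
      (fun y : ModelProd H ℝ ↦
        coef g w.val.1 (F.dir y.2) (F.dir y.2) ((chartAt H w.val.1).symm y.1))
      {y | y.1 ∈ (chartAt H w.val.1).target} := by
  have : ∀ (s : ℝ) (y : V), coef g w.val.1 (F.dir s) (F.dir s) y =
      coef g w.val.1 (F.dir s) (coordAt w.val.1 w.val.1 w.val.2) y +
        s * coef g w.val.1 (F.dir s) F.a y := fun s y ↦ by
    rw [coef_symm, coef_dir, coef_symm, coef_symm _ F.a]
  simp only [this]
  exact (F.contMDiffOn_coef_dir _).add
    (contMDiff_model_snd.contMDiffOn.mul (F.contMDiffOn_coef_dir _))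

theorem contMDiffOn_disc :
    ContMDiffOn (I.prod 𝓘(ℝ, ℝ)) 𝓘(ℝ, ℝ) ∞
      (fun y : ModelProd H ℝ ↦ F.disc y.2 ((chartAt H w.val.1).symm y.1))
      {y | y.1 ∈ (chartAt H w.val.1).target} :=
  ((F.contMDiffOn_coef_dir _).pow 2).sub
    ((contMDiffOn_coef_symm _ _).mul F.contMDiffOn_coef_dir_dir)

theorem isOpen_target : IsOpen F.target := by
  have ho : IsOpen {y : ModelProd H ℝ | y.1 ∈ (chartAt H w.val.1).target} :=
    (chartAt H w.val.1).open_target.preimage continuous_fst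
  have h1 := (F.contMDiffOn_coef_dir F.b).continuousOn.isOpen_inter_preimage ho
    (isOpen_Ioi (a := (0 : ℝ)))
  have h2 := F.contMDiffOn_disc.continuousOn.isOpen_inter_preimage ho (isOpen_Ioi (a := (0 : ℝ)))
  convert h1.inter h2 using 1
  ext y
  simp only [target, mem_ofPred_eq, mem_inter_iff, mem_preimage, mem_Ioi]
  tauto

theorem contMDiffOn_lift :
    ContMDiffOn (I.prod 𝓘(ℝ, ℝ)) I.tangent ∞ F.lift F.target := by
  have hsub : F.target ⊆ {y : ModelProd H ℝ | y.1 ∈ (chartAt H w.val.1).target} :=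
    fun y hy ↦ hy.1
  have hdisc : ContMDiffOn (I.prod 𝓘(ℝ, ℝ)) 𝓘(ℝ, ℝ) ∞
      (fun y : ModelProd H ℝ ↦ √(F.disc y.2 ((chartAt H w.val.1).symm y.1))) F.target := by
    intro y hy
    have h1 : ContMDiffAt 𝓘(ℝ, ℝ) 𝓘(ℝ, ℝ) ∞ Real.sqrt
        (F.disc y.2 ((chartAt H w.val.1).symm y.1)) :=
      (Real.contDiffAt_sqrt hy.2.2.ne').contMDiffAt
    exact h1.comp_contMDiffWithinAt y ((F.contMDiffOn_disc.mono hsub) y hy)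
  have hroot : ContMDiffOn (I.prod 𝓘(ℝ, ℝ)) 𝓘(ℝ, ℝ) ∞
      (fun y : ModelProd H ℝ ↦ F.root y.2 ((chartAt H w.val.1).symm y.1)) F.target :=
    ((F.contMDiffOn_coef_dir_dir.mono hsub).neg).div₀
      (((F.contMDiffOn_coef_dir F.b).mono hsub).add hdisc) fun y hy ↦
        (add_pos_of_pos_of_nonneg hy.2.1 (Real.sqrt_nonneg _)).ne'
  have hvec : ContMDiffOn (I.prod 𝓘(ℝ, ℝ)) 𝓘(ℝ, E) ∞
      (fun y : ModelProd H ℝ ↦ F.vec y.2 ((chartAt H w.val.1).symm y.1)) F.target :=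
    (contMDiffOn_const.add (contMDiff_model_snd.contMDiffOn.smul contMDiffOn_const)).add
      (hroot.smul contMDiffOn_const)
  have h1 : ContMDiffOn (M' := ModelProd H E) (I.prod 𝓘(ℝ, ℝ)) (I.prod 𝓘(ℝ, E)) ∞
      (fun y : ModelProd H ℝ ↦ (y.1, F.vec y.2 ((chartAt H w.val.1).symm y.1))) F.target :=
    contMDiffOn_model_prodMk contMDiff_model_fst.contMDiffOn hvec
  exact (contMDiffOn_frameAt (I := I) w.val.1).comp h1 hsub

theorem coef_vec (s r : ℝ) (y : V) :
    coef g w.val.1 (F.dir s + r • F.b) (F.dir s + r • F.b) y =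
      coef g w.val.1 F.b F.b y * r ^ 2 + 2 * coef g w.val.1 (F.dir s) F.b y * r +
        coef g w.val.1 (F.dir s) (F.dir s) y := by
  simp only [coef_add_left, coef_add_right, coef_smul_left, coef_smul_right]
  rw [coef_symm w.val.1 F.b (F.dir s)]
  ring

theorem root_spec {s : ℝ} {y : V} (h1 : 0 < coef g w.val.1 (F.dir s) F.b y)
    (h2 : 0 < F.disc s y) :
    coef g w.val.1 (F.vec s y) (F.vec s y) y = 0 ∧
      coef g w.val.1 (F.vec s y) F.b y = √(F.disc s y) := by
  have hD := Real.sq_sqrt h2.le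
  have hD0 := Real.sqrt_pos.2 h2
  rw [vec, coef_vec, coef_add_left, coef_smul_left, root]
  set D := √(F.disc s y)
  rw [disc] at hD
  set A := coef g w.val.1 F.b F.b y
  set B := coef g w.val.1 (F.dir s) F.b y
  set C := coef g w.val.1 (F.dir s) (F.dir s) y
  have hBD : B + D ≠ 0 := by positivity
  constructor
  · field_simp
    linear_combination C * hD
  · field_simp
    linear_combination -hD

theorem root_unique {s r : ℝ} {y : V} (h1 : 0 < coef g w.val.1 (F.dir s) F.b y)
    (h2 : coef g w.val.1 (F.dir s + r • F.b) (F.dir s + r • F.b) y = 0)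
    (h3 : 0 < coef g w.val.1 (F.dir s + r • F.b) F.b y) :
    0 < F.disc s y ∧ F.root s y = r := by
  rw [coef_vec] at h2
  rw [coef_add_left, coef_smul_left] at h3
  rw [root, disc]
  set A := coef g w.val.1 F.b F.b y
  set B := coef g w.val.1 (F.dir s) F.b y
  set C := coef g w.val.1 (F.dir s) (F.dir s) y
  have hd : B ^ 2 - A * C = (B + r * A) ^ 2 := by linear_combination -A * h2
  rw [hd, Real.sqrt_sq h3.le]
  refine ⟨by positivity, ?_⟩
  have : B + (B + r * A) ≠ 0 := by positivity
  field_simp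
  linear_combination -h2

theorem α_vec (s : ℝ) (y : V) : F.α (F.vec s y) = 1 := by
  simp [vec, dir, F.α_w, F.α_a, F.α_b]

theorem β_vec (s : ℝ) (y : V) : F.β (F.vec s y) = s := by
  simp [vec, dir, F.β_w, F.β_a, F.β_b]

theorem coordAt_lift {y : ModelProd H ℝ} (hy : y ∈ F.target) :
    coordAt w.val.1 (F.lift y).1 (F.lift y).2 =
      F.vec y.2 ((chartAt H w.val.1).symm y.1) :=
  coordAt_frameAt ((chartAt H w.val.1).map_target hy.1) _

/-- The null vector over a point of the range of the chart. -/
def liftNull {y : ModelProd H ℝ} (hy : y ∈ F.target) : NullVector g where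
  val := F.lift y
  ne_zero h0 := by
    have h1 := F.coordAt_lift hy
    rw [h0, map_zero] at h1
    have h2 := F.α_vec y.2 ((chartAt H w.val.1).symm y.1)
    rw [← h1, map_zero] at h2
    exact zero_ne_one h2
  null := (F.root_spec hy.2.1 hy.2.2).1

theorem lift_mem_dom {y : ModelProd H ℝ} (hy : y ∈ F.target) : F.lift y ∈ F.dom := by
  refine ⟨(chartAt H w.val.1).map_target hy.1, ?_, ?_⟩
  · rw [F.coordAt_lift hy, F.α_vec, one_mul]
    have := (F.root_spec hy.2.1 hy.2.2).2
    change 0 < coef g w.val.1 (F.vec y.2 _) F.b ((chartAt H w.val.1).symm y.1)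
    rw [this]
    exact Real.sqrt_pos.2 hy.2.2
  · rw [F.coordAt_lift hy, F.α_vec, F.β_vec, div_one]
    exact hy.2.1

theorem coord_lift {y : ModelProd H ℝ} (hy : y ∈ F.target) : F.coord (F.lift y) = y := by
  refine Prod.ext ((chartAt H w.val.1).right_inv hy.1) ?_
  change F.β (coordAt _ _ (F.lift y).2) / F.α (coordAt _ _ (F.lift y).2) = _
  rw [F.coordAt_lift hy, F.α_vec, F.β_vec, div_one]

theorem lift_coord {v : NullVector g} (hv : v.val ∈ F.dom) :
    F.coord v.val ∈ F.target ∧ ∃ c : ℝ, c ≠ 0 ∧ F.lift (F.coord v.val) = ⟨v.val.1, c • v.val.2⟩ := by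
  obtain ⟨⟨y, v⟩, hv0, hnull⟩ := v
  obtain ⟨hy, hpos, hpos'⟩ := hv
  simp only at hy hpos hpos' hnull
  have hsymm : (chartAt H w.val.1).symm (chartAt H w.val.1 y) = y := (chartAt H w.val.1).left_inv hy
  set u := coordAt w.val.1 y v with hu
  have hα : F.α u ≠ 0 := by
    intro h0; rw [h0, zero_mul] at hpos; exact lt_irrefl _ hpos
  have huv : frameAt w.val.1 y u = v := frameAt_coordAt hy v
  have hdec : (F.α u)⁻¹ • u = F.dir (F.β u / F.α u) + ((F.α u)⁻¹ * F.γ u) • F.b := by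
    have h0 := congrArg (fun z ↦ (F.α u)⁻¹ • z) (F.decomp u)
    refine h0.trans ?_
    rw [dir, smul_add, smul_add, smul_smul, smul_smul, smul_smul, inv_mul_cancel₀ hα, one_smul,
      div_eq_inv_mul]
  have h2 : coef g w.val.1 ((F.α u)⁻¹ • u) ((F.α u)⁻¹ • u) y = 0 := by
    rw [coef_smul_left, coef_smul_right, coef, huv, hnull, mul_zero, mul_zero]
  have h3 : 0 < coef g w.val.1 ((F.α u)⁻¹ • u) F.b y := by
    rw [coef_smul_left]
    have : (F.α u)⁻¹ * coef g w.val.1 u F.b y =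
      ((F.α u)⁻¹) ^ 2 * (F.α u * coef g w.val.1 u F.b y) := by field_simp
    rw [this]
    exact mul_pos (by positivity) hpos
  rw [hdec] at h2 h3
  obtain ⟨h4, h5⟩ := F.root_unique hpos' h2 h3
  refine ⟨⟨(chartAt H w.val.1).map_source hy, ?_, ?_⟩, (F.α u)⁻¹, inv_ne_zero hα, ?_⟩
  · change 0 < coef g w.val.1 _ F.b ((chartAt H w.val.1).symm (chartAt H w.val.1 y))
    rw [hsymm]; exact hpos'
  · change 0 < F.disc _ ((chartAt H w.val.1).symm (chartAt H w.val.1 y))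
    rw [hsymm]; exact h4
  · have e : F.lift (F.coord ⟨y, v⟩) = (⟨y, frameAt w.val.1 y (F.vec (F.β u / F.α u) y)⟩ :
        TangentBundle I V) :=
      congrArg (fun z ↦ (⟨z, frameAt w.val.1 z (F.vec (F.β u / F.α u) z)⟩ : TangentBundle I V))
        hsymm
    rw [e, vec, h5, ← hdec, map_smul, huv]

end NullFrame

end Lorentz

section NullLineManifold

variable {E : Type*} [NormedAddCommGroup E] [NormedSpace ℝ E] {H : Type*} [TopologicalSpace H]
  {I : ModelWithCorners ℝ E H} {V : Type*} [TopologicalSpace V] [ChartedSpace H V]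
  [IsManifold I ∞ V] {g : LorentzMetric I V}

namespace NullLine

/-- A null vector spanning a given null line. -/
def rep (m : NullLine g) : NullVector g := (NullVector.toLine_surjective m).choose

theorem toLine_rep (m : NullLine g) : m.rep.toLine = m :=
  (NullVector.toLine_surjective m).choose_spec

variable {w : NullVector g} (F : NullFrame w)

theorem coord_rep (v : NullVector g) : F.coord v.toLine.rep.val = F.coord v.val := by
  obtain ⟨a, ha, e⟩ := NullVector.exists_smul_of_toLine_eq (toLine_rep v.toLine).symm
  rw [e]
  exact F.coord_smul _ _ ha

theorem rep_mem_dom (v : NullVector g) : v.toLine.rep.val ∈ F.dom ↔ v.val ∈ F.dom := by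
  obtain ⟨a, ha, e⟩ := NullVector.exists_smul_of_toLine_eq (toLine_rep v.toLine).symm
  rw [e]
  exact F.smul_mem_dom _ _ ha

theorem isOpen_frameDomain : IsOpen {m : NullLine g | m.rep.val ∈ F.dom} := by
  rw [← NullVector.isQuotientMap_toLine.isOpen_preimage]
  convert F.isOpen_dom.preimage (NullVector.isInducing_val (g := g)).continuous using 1
  ext v
  exact rep_mem_dom F v

open Classical in
/-- The local parametrisation of `NC(TV)` inverse to the chart belonging to a frame. -/
def param (y : ModelProd H ℝ) : NullLine g :=
  if hy : y ∈ F.target then (F.liftNull hy).toLine else w.toLine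

theorem param_of_mem {y : ModelProd H ℝ} (hy : y ∈ F.target) :
    param F y = (F.liftNull hy).toLine := dif_pos hy

/-- The chart of `NC(TV)` belonging to the frame `F`: the coordinates of a null line are those of its
base point and the slope of the line with respect to the frame. -/
def frameChart : OpenPartialHomeomorph (NullLine g) (ModelProd H ℝ) where
  toFun m := F.coord m.rep.val
  invFun := param F
  source := {m | m.rep.val ∈ F.dom}
  target := F.target
  map_source' m hm := (F.lift_coord hm).1
  map_target' y hy := by
    rw [mem_ofPred_eq, param_of_mem F hy, rep_mem_dom]
    exact F.lift_mem_dom hy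
  left_inv' m hm := by
    obtain ⟨h1, c, hc, e⟩ := F.lift_coord hm
    rw [param_of_mem F h1]
    conv_rhs => rw [← toLine_rep m]
    exact NullVector.toLine_eq_of_smul hc e
  right_inv' y hy := by
    rw [param_of_mem F hy, coord_rep]
    exact F.coord_lift hy
  open_source := isOpen_frameDomain F
  open_target := F.isOpen_target
  continuousOn_toFun := by
    rw [NullVector.isQuotientMap_toLine.continuousOn_isOpen_iff (isOpen_frameDomain F)]
    have h1 : ContinuousOn (fun v : NullVector g ↦ F.coord v.val)
        (NullVector.toLine ⁻¹' {m : NullLine g | m.rep.val ∈ F.dom}) :=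
      (F.contMDiffOn_coord subset_rfl).continuousOn.comp
        (NullVector.isInducing_val (g := g)).continuous.continuousOn
        fun v hv ↦ (rep_mem_dom F v).1 hv
    exact h1.congr fun v _ ↦ coord_rep F v
  continuousOn_invFun := by
    rw [continuousOn_iff_continuous_domRestrict]
    have h1 : Continuous (fun y : F.target ↦ F.liftNull y.2) := by
      rw [(NullVector.isInducing_val (g := g)).continuous_iff]
      exact continuousOn_iff_continuous_domRestrict.1 F.contMDiffOn_lift.continuousOn
    have h2 := NullVector.isQuotientMap_toLine.continuous.comp h1
    convert h2 using 1
    funext y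
    exact param_of_mem F y.2

theorem mem_frameChart_source : w.toLine ∈ (frameChart F).source := by
  change w.toLine.rep.val ∈ F.dom
  rw [rep_mem_dom]
  refine ⟨mem_chart_source _ _, ?_, ?_⟩
  · rw [F.α_w, one_mul]; exact F.coef_pos
  · rw [F.α_w, F.β_w, zero_div, NullFrame.dir, zero_smul, add_zero]; exact F.coef_pos

variable [hE : Fact (Module.finrank ℝ E = 3)]

/-- A frame adapted to a null line. -/
def frame (m : NullLine g) : NullFrame m.rep := (exists_nullFrame hE.out m.rep).some

/-- The smooth structure of `NC(TV)`: a circle bundle over the three-manifold `V`. -/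
instance : ChartedSpace (ModelProd H ℝ) (NullLine g) where
  atlas := range fun m : NullLine g ↦ frameChart m.frame
  chartAt m := frameChart m.frame
  mem_chart_source m := by
    have := mem_frameChart_source m.frame
    rwa [toLine_rep] at this
  chart_mem_atlas m := ⟨m, rfl⟩

instance : IsManifold (I.prod 𝓘(ℝ, ℝ)) ∞ (NullLine g) := by
  refine isManifold_of_contMDiffOn ?_
  rintro _ ⟨p, rfl⟩ _ ⟨q, rfl⟩
  simp only
  have hkey : ∀ y ∈ ((frameChart p.frame).symm ≫ₕ frameChart q.frame).source,
      y ∈ p.frame.target ∧ p.frame.lift y ∈ q.frame.dom ∧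
      ((frameChart p.frame).symm ≫ₕ frameChart q.frame) y = q.frame.coord (p.frame.lift y) := by
    intro y hy
    have hy1 : y ∈ p.frame.target := hy.1
    have hy2 : (param p.frame y).rep.val ∈ q.frame.dom := hy.2
    refine ⟨hy1, ?_, ?_⟩
    · rw [param_of_mem _ hy1, rep_mem_dom] at hy2; exact hy2
    · change q.frame.coord (param p.frame y).rep.val = _
      rw [param_of_mem _ hy1, coord_rep]
      rfl
  have h1 := p.frame.contMDiffOn_lift.mono fun y hy ↦ (hkey y hy).1
  have h2 := (q.frame.contMDiffOn_coord subset_rfl).comp h1 fun y hy ↦ (hkey y hy).2.1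
  exact h2.congr fun y hy ↦ (hkey y hy).2.2

end NullLine

/-- The Lorentz prolongation: the field of two-planes on `NC(TV)` whose value at `(v, ℓ)` is the
preimage of `ℓ` under the derivative of the projection to `V`. -/
def lorentzProlongation [Fact (Module.finrank ℝ E = 3)] (g : LorentzMetric I V) :
    Set (TangentBundle (I.prod 𝓘(ℝ, ℝ)) (NullLine g)) :=
  {ζ | mfderiv (I.prod 𝓘(ℝ, ℝ)) I (NullLine.point (g := g)) ζ.1 ζ.2 ∈ ζ.1.line}

end NullLineManifold

section ProductMetric

variable {S : Type*} [TopologicalSpace S] [ChartedSpace Plane S] [IsManifold (𝓡 2) ∞ S]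

/-- The derivative of the inclusion of the unit circle into the complex plane. -/
def circleDeriv (z : Circle) : TangentSpace (𝓡 1) z →L[ℝ] ℂ :=
  mfderiv (𝓡 1) 𝓘(ℝ, ℂ) (fun z : Circle ↦ (z : ℂ)) z

/-- The form `dθ` on the unit circle `{e^{iθ}}`: on the circle `dz = i z dθ`, so that `dθ` is the
imaginary part of `z̄ dz`. -/
def dTheta (z : Circle) : TangentSpace (𝓡 1) z →L[ℝ] ℝ :=
  Complex.imCLM.comp ((ContinuousLinearMap.mul ℝ ℂ (starRingEnd ℂ (z : ℂ))).comp (circleDeriv z))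

theorem contMDiff_coe_circle : ContMDiff (𝓡 1) 𝓘(ℝ, ℂ) ∞ (fun z : Circle ↦ (z : ℂ)) :=
  haveI : Fact (Module.finrank ℝ ℂ = 1 + 1) := finrank_real_complex_fact'
  contMDiff_coe_sphere (n := 1)

theorem circleDeriv_injective (z : Circle) : Function.Injective (circleDeriv z) :=
  haveI : Fact (Module.finrank ℝ ℂ = 1 + 1) := finrank_real_complex_fact'
  injective_mvfderiv_subtypeVal_sphere (n := 1) z

theorem inner_circleDeriv (z : Circle) (u : TangentSpace (𝓡 1) z) :
    inner ℝ (z : ℂ) (circleDeriv z u) = 0 := by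
  have : Fact (Module.finrank ℝ ℂ = 1 + 1) := finrank_real_complex_fact'
  have h1 := range_mvfderiv_subtypeVal (n := 1) (E := ℂ) z
  have h2 : circleDeriv z u ∈ (Submodule.span ℝ {(z : ℂ)})ᗮ := by
    rw [← h1]; exact ⟨u, rfl⟩
  exact (Submodule.mem_orthogonal_singleton_iff_inner_right).1 h2

theorem dTheta_injective (z : Circle) : Function.Injective (dTheta z) := by
  rw [injective_iff_map_eq_zero]
  intro u hu
  have h1 := inner_circleDeriv z u
  rw [Complex.inner, mul_comm] at h1
  have h2 : starRingEnd ℂ (z : ℂ) * circleDeriv z u = 0 := Complex.ext h1 hu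
  have h3 : starRingEnd ℂ (z : ℂ) ≠ 0 := by simp
  exact circleDeriv_injective z ((mul_eq_zero.1 h2).resolve_left h3 |>.trans (map_zero _).symm)

instance : Fact (Module.finrank ℝ (Plane × EuclideanSpace ℝ (Fin 1)) = 3) := ⟨by simp⟩

/-- The model of the product of a surface and the circle. -/
abbrev productModel : ModelWithCorners ℝ (Plane × EuclideanSpace ℝ (Fin 1))
    (ModelProd Plane (EuclideanSpace ℝ (Fin 1))) := (𝓡 2).prod (𝓡 1)

/-- The form `dθ` on the product of a surface and the circle. -/
def productTheta (x : S × Circle) : TangentSpace productModel x →L[ℝ] ℝ :=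
  (dTheta x.2).comp (mfderiv productModel (𝓡 1) Prod.snd x)

/-- The derivative of the projection to the surface. -/
def productFst (x : S × Circle) : TangentSpace productModel x →L[ℝ] TangentSpace (𝓡 2) x.1 :=
  mfderiv productModel (𝓡 2) Prod.fst x

set_option linter.unusedSectionVars false in
theorem productFst_apply (x : S × Circle) (u : TangentSpace productModel x) :
    productFst x u = (u : Plane × EuclideanSpace ℝ (Fin 1)).1 := by
  rw [productFst, mfderiv_fst]; rfl

set_option linter.unusedSectionVars false in
theorem productTheta_apply (x : S × Circle) (u : TangentSpace productModel x) :
    productTheta x u = dTheta x.2 (u : Plane × EuclideanSpace ℝ (Fin 1)).2 := by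
  rw [productTheta, mfderiv_snd]; rfl

theorem contMDiff_productTheta : ContMDiff productModel.tangent 𝓘(ℝ, ℝ) ∞
    (fun q : TangentBundle productModel (S × Circle) ↦ productTheta q.1 q.2) := by
  have h1 : ContMDiff productModel 𝓘(ℝ, ℂ) ∞ (fun x : S × Circle ↦ (x.2 : ℂ)) :=
    contMDiff_coe_circle.comp contMDiff_snd
  have h2 : ContMDiff productModel.tangent 𝓘(ℝ, ℂ) ∞
      (fun q : TangentBundle productModel (S × Circle) ↦
        (tangentMap productModel 𝓘(ℝ, ℂ) (fun x : S × Circle ↦ (x.2 : ℂ)) q).2) := by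
    have := (h1.contMDiff_tangentMap (m := ∞) le_rfl)
    exact (contMDiff_snd_tangentBundle_modelSpace ℂ 𝓘(ℝ, ℂ)).comp this
  have h3 : ContMDiff productModel.tangent 𝓘(ℝ, ℂ) ∞
      (fun q : TangentBundle productModel (S × Circle) ↦ starRingEnd ℂ (q.1.2 : ℂ)) :=
    Complex.conjCLE.contDiff.contMDiff.comp (h1.comp (contMDiff_proj _))
  have h4 := (Complex.imCLM.contDiff.comp (contDiff_mul (𝕜 := ℝ) (𝔸 := ℂ))).contMDiff.comp
    (h3.prodMk_space h2)
  convert! h4 using 1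
  funext q
  have : mfderiv productModel 𝓘(ℝ, ℂ) (fun x : S × Circle ↦ (x.2 : ℂ)) q.1 =
      (circleDeriv q.1.2).comp (mfderiv productModel (𝓡 1) Prod.snd q.1) :=
    mfderiv_comp q.1 (contMDiff_coe_circle.mdifferentiable (by simp) _) mdifferentiableAt_snd
  change _ = (ContinuousLinearMap.mul ℝ ℂ (starRingEnd ℂ (q.1.2 : ℂ))
    ((mfderiv productModel 𝓘(ℝ, ℂ) (fun x : S × Circle ↦ (x.2 : ℂ)) q.1) q.2)).im
  rw [this]
  rfl

/-- The Lorentzian product `(Σ, dh) × (S¹, -dθ²)` of a Riemannian surface and of the unit circle with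
the negative of its standard metric. -/
def productMetric (h : SurfaceMetric S) : LorentzMetric productModel (S × Circle) where
  inner x := ((ContinuousLinearMap.precomp ℝ (productFst x)).comp (h.inner x.1)).comp (productFst x) -
      (productTheta x).smulRight (productTheta x)
  symm x u w := by
    change h.inner x.1 (productFst x u) (productFst x w) - productTheta x u * productTheta x w =
      h.inner x.1 (productFst x w) (productFst x u) - productTheta x w * productTheta x u
    rw [h.symm, mul_comm]
  signature x := by
    change ∃ w : TangentSpace productModel x,
      h.inner x.1 (productFst x w) (productFst x w) - productTheta x w * productTheta x w < 0 ∧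
      ∀ u, h.inner x.1 (productFst x w) (productFst x u) - productTheta x w * productTheta x u = 0 →
        u ≠ 0 → 0 < h.inner x.1 (productFst x u) (productFst x u) -
          productTheta x u * productTheta x u
    obtain ⟨W, hW1, hW2⟩ : ∃ W : TangentSpace productModel x,
        productFst x W = 0 ∧ productTheta x W ≠ 0 := by
      obtain ⟨e, he⟩ : ∃ e : EuclideanSpace ℝ (Fin 1), e ≠ 0 := exists_ne 0
      let W : TangentSpace productModel x := ((0, e) : Plane × EuclideanSpace ℝ (Fin 1))
      refine ⟨W, productFst_apply x W, fun h0 ↦ he ?_⟩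
      rw [productTheta_apply] at h0
      exact dTheta_injective x.2 (h0.trans (map_zero (dTheta x.2)).symm)
    refine ⟨W, ?_, fun u hu hu0 ↦ ?_⟩
    · have := mul_self_pos.2 hW2
      rw [hW1, map_zero]
      linarith
    · rw [hW1, map_zero] at hu
      have hu' : productTheta x W * productTheta x u = 0 := by
        have h0 : (0 : TangentSpace (𝓡 2) x.1 →L[ℝ] ℝ) (productFst x u) = 0 := rfl
        linarith
      have h1 := (mul_eq_zero.1 hu').resolve_left hW2
      rw [h1, mul_zero, sub_zero]
      refine h.pos _ _ fun h0 ↦ hu0 ?_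
      rw [productFst_apply] at h0
      rw [productTheta_apply] at h1
      exact Prod.ext h0 (dTheta_injective x.2 (h1.trans (map_zero (dTheta x.2)).symm))
  contMDiffAt x₀ A B hA hB := by
    change ContMDiffAt productModel 𝓘(ℝ, ℝ) ∞ (fun x ↦
      h.inner x.1 (productFst x (A x)) (productFst x (B x)) -
        productTheta x (A x) * productTheta x (B x)) x₀
    have hf := (contMDiff_fst (I := 𝓡 2) (J := 𝓡 1) (M := S) (N := Circle)
      (n := ∞)).contMDiff_tangentMap (m := ∞) le_rfl
    have hA1 := hf.contMDiffAt.comp x₀ hA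
    have hB1 := hf.contMDiffAt.comp x₀ hB
    have hA2 := contMDiff_productTheta.contMDiffAt.comp x₀ hA
    have hB2 := contMDiff_productTheta.contMDiffAt.comp x₀ hB
    let : RiemannianBundle (fun x : S ↦ TangentSpace (𝓡 2) x) := ⟨h.toRiemannianMetric⟩
    have hAB := ContMDiffAt.inner_bundle (IM := productModel) (IB := 𝓡 2) (n := ∞) (F := Plane)
      (E := fun x : S ↦ TangentSpace (𝓡 2) x)
      (b := fun x : S × Circle ↦ x.1) (v := fun x ↦ productFst x (A x))
      (w := fun x ↦ productFst x (B x)) hA1 hB1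
    exact ContMDiffAt.sub hAB (ContMDiffAt.mul hA2 hB2)

theorem productMetric_apply (h : SurfaceMetric S) (x : S × Circle)
    (u w : TangentSpace productModel x) :
    (productMetric h).inner x u w = h.inner x.1 (productFst x u) (productFst x w) -
      productTheta x u * productTheta x w := rfl

end ProductMetric

section Distributions

variable {E : Type*} [NormedAddCommGroup E] [NormedSpace ℝ E] {H : Type*} [TopologicalSpace H]
  {I : ModelWithCorners ℝ E H} {M : Type*} [TopologicalSpace M] [ChartedSpace H M]
  [IsManifold I ∞ M]

/-- The vector field `A` is smooth near `x₀`. -/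
def SmoothNear (A : ∀ x : M, TangentSpace I x) (x₀ : M) : Prop :=
  ∀ᶠ x in 𝓝 x₀, ContMDiffAt I I.tangent ∞ (fun x ↦ (⟨x, A x⟩ : TangentBundle I M)) x

/-- The vector field `A` is, near `x₀`, a smooth section of `D`. A field of subspaces of the tangent
spaces is given as the set `D` of all tangent vectors that lie in one of these subspaces. -/
def IsSectionNear (D : Set (TangentBundle I M)) (A : ∀ x : M, TangentSpace I x) (x₀ : M) : Prop :=
  SmoothNear A x₀ ∧ ∀ᶠ x in 𝓝 x₀, (⟨x, A x⟩ : TangentBundle I M) ∈ D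

/-- `D` is a smooth distribution of rank `k`: near each point it is spanned by `k` smooth vector
fields that are linearly independent at each point. -/
def IsSmoothDistribution (D : Set (TangentBundle I M)) (k : ℕ) : Prop :=
  ∀ x₀ : M, ∃ A : Fin k → ∀ x : M, TangentSpace I x, (∀ i, SmoothNear (A i) x₀) ∧
    ∀ᶠ x in 𝓝 x₀, LinearIndependent ℝ (fun i ↦ A i x) ∧
      ∀ v : TangentSpace I x, (⟨x, v⟩ : TangentBundle I M) ∈ D ↔
        v ∈ Submodule.span ℝ (range fun i ↦ A i x)

/-- The derived distribution `[D, D]`: it is spanned, at each point, by the values of the smooth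
local sections of `D` and of their Lie brackets. -/
def derived (D : Set (TangentBundle I M)) : Set (TangentBundle I M) :=
  {ζ | ζ.2 ∈ Submodule.span ℝ
    ({v : TangentSpace I ζ.1 | ∃ A, IsSectionNear D A ζ.1 ∧ v = A ζ.1} ∪
      {v : TangentSpace I ζ.1 | ∃ A B, IsSectionNear D A ζ.1 ∧ IsSectionNear D B ζ.1 ∧
        v = VectorField.mlieBracket I A B ζ.1})}

/-- A contact structure on a three-manifold: a smooth distribution `ξ` of rank two such that
`[ξ, ξ]` is the whole tangent bundle. -/
def IsContact (ξ : Set (TangentBundle I M)) : Prop :=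
  Module.finrank ℝ E = 3 ∧ IsSmoothDistribution ξ 2 ∧ derived ξ = univ

/-- An Engel structure on a four-manifold: a smooth distribution `D` of rank two such that
`[D, D]` is a smooth distribution of rank three and `[[D, D], [D, D]]` is the whole tangent
bundle. -/
def IsEngel (D : Set (TangentBundle I M)) : Prop :=
  Module.finrank ℝ E = 4 ∧ IsSmoothDistribution D 2 ∧ IsSmoothDistribution (derived D) 3 ∧
    derived (derived D) = univ

variable {E' : Type*} [NormedAddCommGroup E'] [NormedSpace ℝ E'] {H' : Type*} [TopologicalSpace H']
  {I' : ModelWithCorners ℝ E' H'} {M' : Type*} [TopologicalSpace M'] [ChartedSpace H' M']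
  [IsManifold I' ∞ M']

/-- Two distributions are isomorphic if some diffeomorphism carries the one onto the other. -/
def IsIsomorphic (D : Set (TangentBundle I M)) (D' : Set (TangentBundle I' M')) : Prop :=
  ∃ Φ : M ≃ₘ⟮I, I'⟯ M', tangentMap I I' Φ '' D = D'

end Distributions

section Suspension

variable {E : Type*} [NormedAddCommGroup E] [NormedSpace ℝ E] {H : Type*} [TopologicalSpace H]
  (I : ModelWithCorners ℝ E H) (V : Type*) [TopologicalSpace V] [ChartedSpace H V]
  [IsManifold I ∞ V]

/-- The data of the suspension construction. -/
structure Suspension where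
  /-- The contact structure `ξ`. -/
  plane : Set (TangentBundle I V)
  isContact : IsContact plane
  /-- The rotation of `ξ` by a right angle. It stands for a Euclidean metric on `ξ`, up to a
  conformal factor, and for an orientation of `ξ`; its values outside `ξ` play no role. -/
  rot (p : V) : TangentSpace I p →L[ℝ] TangentSpace I p
  rot_mem (p : V) (η : TangentSpace I p) (hη : (⟨p, η⟩ : TangentBundle I V) ∈ plane) :
    (⟨p, rot p η⟩ : TangentBundle I V) ∈ plane
  rot_rot (p : V) (η : TangentSpace I p) (hη : (⟨p, η⟩ : TangentBundle I V) ∈ plane) :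
    rot p (rot p η) = -η
  smooth_rot (A : ∀ p : V, TangentSpace I p) (p : V) (hA : IsSectionNear plane A p) :
    SmoothNear (fun p ↦ rot p (A p)) p
  /-- The Legendrian line field `ℓ`. -/
  line : Set (TangentBundle I V)
  smooth_line : IsSmoothDistribution line 1
  line_subset : line ⊆ plane
  /-- The contact diffeomorphism `φ`. -/
  map : V ≃ₘ⟮I, I⟯ V
  map_plane (ζ : TangentBundle I V) : tangentMap I I map ζ ∈ plane ↔ ζ ∈ plane
  /-- `φ` preserves the orientation of `ξ`, that is, the positive bases of the form `(η, Jη)`, where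
  `J` is the rotation by a right angle. -/
  map_orientation (p : V) (η : TangentSpace I p) (hη : (⟨p, η⟩ : TangentBundle I V) ∈ plane)
    (hη0 : η ≠ 0) : ∃ a b : ℝ, 0 < b ∧ mfderiv I I map p (rot p η) =
      a • mfderiv I I map p η + b • rot (map p) (mfderiv I I map p η)
  /-- The twisting function. -/
  twist : ℝ × V → ℝ
  smooth_twist : ContMDiff (𝓘(ℝ, ℝ).prod I) 𝓘(ℝ, ℝ) ∞ twist
  deriv_twist_pos (t : ℝ) (p : V) : 0 < deriv (fun s ↦ twist (s, p)) t
  /-- The field of the lines `R(ρ(t, p)) ℓ_p`, where `R(ρ)` is the rotation of `ξ` by the angle `ρ`,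
  is compatible with the identification of `(t + 1, p)` and `(t, φ(p))`. -/
  deck_invariant (t : ℝ) (p : V) (η : TangentSpace I p) :
    (∃ η₀ : TangentSpace I p, (⟨p, η₀⟩ : TangentBundle I V) ∈ line ∧
        η = Real.cos (twist (t + 1, p)) • η₀ + Real.sin (twist (t + 1, p)) • rot p η₀) ↔
      ∃ η₁ : TangentSpace I (map p), (⟨map p, η₁⟩ : TangentBundle I V) ∈ line ∧
        mfderiv I I map p η =
          Real.cos (twist (t, map p)) • η₁ + Real.sin (twist (t, map p)) • rot (map p) η₁

variable {I V} (s : Suspension I V)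

/-- The plane field on `ℝ × V` spanned at `(t, p)` by `∂/∂t` and the line `R(ρ(t, p)) ℓ_p`. -/
def Suspension.coverDistribution :
    Set (TangentBundle (𝓘(ℝ, ℝ).prod I) (TorusCover s.map)) :=
  {ζ | ∃ η : TangentSpace I ζ.1.2, (⟨ζ.1.2, η⟩ : TangentBundle I V) ∈ s.line ∧
    mfderiv (𝓘(ℝ, ℝ).prod I) I (fun q : ℝ × V ↦ q.2) ζ.1 ζ.2 =
      Real.cos (s.twist ζ.1) • η + Real.sin (s.twist ζ.1) • s.rot ζ.1.2 η}

/-- The plane field on the mapping torus of `φ` given by the suspension construction. -/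
def Suspension.distribution [T2Space V] [LocallyCompactSpace V] :
    Set (TangentBundle (𝓘(ℝ, ℝ).prod I) (MappingTorus s.map)) :=
  tangentMap (𝓘(ℝ, ℝ).prod I) (𝓘(ℝ, ℝ).prod I) (torusProj s.map) '' s.coverDistribution

end Suspension

section GeodesicFlow

variable {S : Type*} [TopologicalSpace S] [ChartedSpace Plane S] [IsManifold (𝓡 2) ∞ S]
  (h : SurfaceMetric S)

/-- The coefficients `h(u, w)` of the metric for the coordinate fields with the constant coordinates
`u` and `w` in the chart at `x`, as a function of the coordinates `y`. -/
def metricCoeff (x : S) (u w : Plane) (y : Plane) : ℝ :=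
  h.inner ((chartAt Plane x).symm y) (frameAt x ((chartAt Plane x).symm y) u)
    (frameAt x ((chartAt Plane x).symm y) w)

/-- The Christoffel symbols of the first kind `h(∇_a u, w)` of the Levi-Civita connection at `x`, for
the coordinate fields with the constant coordinates `a`, `u` and `w` in the chart at `x`. -/
def christoffel (x : S) (a u w : Plane) : ℝ :=
  (fderiv ℝ (metricCoeff h x u w) (chartAt Plane x x) a +
    fderiv ℝ (metricCoeff h x a w) (chartAt Plane x x) u -
    fderiv ℝ (metricCoeff h x a u) (chartAt Plane x x) w) / 2

variable {h}

/-- The base point of a unit tangent vector. -/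
def UnitTangent.base (p : UnitTangent h) : S := p.val.1

/-- The unit tangent vector `v`, as a tangent vector at its base point. -/
def UnitTangent.vec (p : UnitTangent h) : TangentSpace (𝓡 2) p.base := p.val.2

/-- The derivative of the projection `S¹(TΣ) → Σ`. -/
def dBase (p : UnitTangent h) : TangentSpace unitModel p →L[ℝ] TangentSpace (𝓡 2) p.base :=
  mfderiv unitModel (𝓡 2) UnitTangent.base p

/-- The derivative of the inclusion `S¹(TΣ) → TΣ`. In the chart of `TΣ` at the base point of `p`,
its value is the pair of the derivatives of the base point and of the vector. -/
def dVal (p : UnitTangent h) : TangentSpace unitModel p →L[ℝ] Plane × Plane :=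
  mfderiv unitModel (𝓡 2).tangent UnitTangent.val p

/-- The covariant derivative of the unit tangent vector in the direction `ζ`, paired by the metric with
`w`. If `v(t)` is a curve of unit tangent vectors with velocity `ζ`, this is `h(∇v/dt, w)` for the
Levi-Civita connection. -/
def covariant (p : UnitTangent h) (ζ : TangentSpace unitModel p) (w : TangentSpace (𝓡 2) p.base) : ℝ :=
  h.inner p.base (dVal p ζ).2 w + christoffel h p.base (dVal p ζ).1 p.vec w

variable (h)

/-- The Liouville contact structure `ξ₀` on `S¹(TΣ)`, which is the kernel of the tautological form
`ζ ↦ h(v, dπ(ζ))`. It is spanned by the vertical field `Z` and the horizontal field `Y` orthogonal to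
the geodesic field `X`. -/
def liouville : Set (TangentBundle unitModel (UnitTangent h)) :=
  {ζ | h.inner ζ.1.base ζ.1.vec (dBase ζ.1 ζ.2) = 0}

/-- The line field spanned by the vertical field `Z`, tangent to the fibres of `S¹(TΣ)`. -/
def verticalLine : Set (TangentBundle unitModel (UnitTangent h)) :=
  {ζ | dBase ζ.1 ζ.2 = 0}

/-- The line field spanned by `Y`: the horizontal vectors whose projection to `Σ` is orthogonal to the
tautological vector. -/
def horizontalLine : Set (TangentBundle unitModel (UnitTangent h)) :=
  {ζ | (∀ w, covariant ζ.1 ζ.2 w = 0) ∧ h.inner ζ.1.base ζ.1.vec (dBase ζ.1 ζ.2) = 0}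

variable {h}

/-- The curve `c` in `S¹(TΣ)` is an orbit of the geodesic flow: at each time its velocity is the
horizontal lift of the tautological vector. -/
def IsGeodesicOrbit (c : ℝ → UnitTangent h) : Prop :=
  ∀ t : ℝ, ∃ ζ : TangentSpace unitModel (c t),
    HasMFDerivAt 𝓘(ℝ, ℝ) unitModel c t (ContinuousLinearMap.toSpanSingleton ℝ ζ) ∧
      dBase (c t) ζ = (c t).vec ∧ ∀ w, covariant (c t) ζ w = 0

variable (h)

/-- The surface is geodesically complete: the geodesics are defined for all times. -/
def IsGeodesicallyComplete : Prop :=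
  ∀ p : UnitTangent h, ∃ c : ℝ → UnitTangent h, IsGeodesicOrbit c ∧ c 0 = p

variable {h}

/-- `φ` is the time `T` map of the geodesic flow. -/
def IsTimeMap (T : ℝ) (φ : UnitTangent h → UnitTangent h) : Prop :=
  ∀ p : UnitTangent h, ∃ c : ℝ → UnitTangent h, IsGeodesicOrbit c ∧ c 0 = p ∧ c T = φ p

/-- `J` is the rotation of `ξ₀` by a right angle for the metric and the orientation for which `(Y, Z)` is
a positive orthonormal basis. It sends `Y` to `Z` and `Z` to `-Y`. In terms of the base component
`dπ(ζ)` and the covariant derivative `∇v(ζ)` of vectors `ζ` in `ξ₀` this says that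
`dπ(Jζ) = -∇v(ζ)` and `∇v(Jζ) = dπ(ζ)`. -/
def IsStandardRotation (J : ∀ p : UnitTangent h, TangentSpace unitModel p →L[ℝ]
    TangentSpace unitModel p) : Prop :=
  ∀ (p : UnitTangent h) (ζ : TangentSpace unitModel p),
    (⟨p, ζ⟩ : TangentBundle unitModel (UnitTangent h)) ∈ liouville h →
      ∀ w : TangentSpace (𝓡 2) p.base,
        h.inner p.base (dBase p (J p ζ)) w = -covariant p ζ w ∧
          covariant p (J p ζ) w = h.inner p.base (dBase p ζ) w

end GeodesicFlow

end Engel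
end

open Engel

open Bundle Manifold Set Filter Topology
open scoped ContDiff

/-! A null line of `(Σ, h) × (S¹, -dθ²)` contains exactly one vector with `dθ = 1`, namely `v +
∂/∂θ` with `v` a unit vector of `Σ`. So `nullLine : (θ, v) ↦ ℝ(v + ∂/∂θ)` is a surjective local
diffeomorphism from `ℝ × S¹(TΣ)` to `NC(TV)` whose fibres are the classes of `θ` modulo `2π`. It
pulls the Lorentz prolongation back to `rollingPlane`, the vectors `(τ, ζ)` with `dπ(ζ) = τ v`
(`mem_rollingPlane_iff`).

Engel condition. In coordinates `(t, x, s)`, where `v(x, s)` runs through the unit vectors at `x`,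
this plane field is spanned by `∂/∂t + v` and `∂/∂s`. Bracketing with `∂/∂s` produces `∂v/∂s` and
then `∂²v/∂s²`. Differentiating `h(v, v) = 1` in `s` shows that `v` and `∂v/∂s` are independent, and
so are `∂v/∂s` and `∂²v/∂s²`; thus the ranks are 2, 3 and 4 (`engelAt_modelPlane`,
`engelAt_rollingPlane`). The property is local and passes through local diffeomorphisms because
pullback commutes with Lie brackets (`mem_derived_iff`).

Suspension. Let `φ_t` be the geodesic flow. The change of variables `untwist : (t, p) ↦ (2πt,
φ_{2πt}(p))` turns the rolling plane field into `ℝ∂/∂t ⊕ (dφ_{2πt})⁻¹⟨Z⟩`, because the geodesic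
field `X` projects to `v` and so absorbs the time component
(`mfderiv_untwist_mem_rollingPlane_iff`). These lines lie in `ξ₀`, because the tautological form `α`
satisfies `α(X) = 1` and `i_X dα = 0` and is therefore invariant (`form_dTime`); for the same reason
`dα` is invariant (`symplectic_dTime`), which gives the orientation.

It remains to see that the lines rotate with positive speed. Let `y` and `z` be the normal
components of the Jacobi fields of `Y` and `Z`. Invariance of `dα` says that their Wronskian `y z' -
z y'` is 1 (`jacobi_wronskian`). The line `(dφ_t)⁻¹⟨Z⟩` is spanned by `-z Y + y Z`, that is, by `Z`
turned by the polar angle of `(y, z)`, whose derivative is `1 / (y² + z²) > 0`. The angle is defined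
as the integral of this function (`phase`, `dBase_dTime_eq_zero_iff`). With respect to `Y` the same
lines have the angle increased by `π / 2`.

Finally, `torusLine = nullLine ∘ untwist` and the projection to the mapping torus of `φ_{2π}` are
surjective local diffeomorphisms with the same fibres (`torusProj_eq_iff_torusLine_eq`), so their
targets are diffeomorphic, compatibly with the plane fields. The Engel condition for the suspension
is then inherited from the prolongation.

Two analytic points carry weight. The flow of a complete field is smooth: locally this is the
inverse function theorem for the integral equation on a space of continuous curves, and the group
law extends it to all times (`contMDiff_flow`). The unit normal to a unit vector is chosen
pointwise, with no continuity of its sign; hence smoothness and derivatives are established only for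
expressions in which that sign cancels, such as products of two Jacobi components. -/

theorem two_le_infty : (2 : WithTop ℕ∞) ≤ ∞ := WithTop.coe_le_coe.2 (le_top : (2 : ℕ∞) ≤ ⊤)

/-! ### Local diffeomorphisms and transport of distributions. -/

section LocalDiffeo

set_option linter.unusedSectionVars false

variable {E : Type*} [NormedAddCommGroup E] [NormedSpace ℝ E] {H : Type*} [TopologicalSpace H]
  {I : ModelWithCorners ℝ E H} {M : Type*} [TopologicalSpace M] [ChartedSpace H M]
  {E' : Type*} [NormedAddCommGroup E'] [NormedSpace ℝ E'] {H' : Type*} [TopologicalSpace H']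
  {I' : ModelWithCorners ℝ E' H'} {M' : Type*} [TopologicalSpace M'] [ChartedSpace H' M']

theorem IsLocalDiffeomorphAt.of_open {f : M → M'} {g : M' → M} {U : Set M} {W : Set M'}
    (hU : IsOpen U) (hW : IsOpen W) (hfU : MapsTo f U W) (hgW : MapsTo g W U)
    (hgf : ∀ x ∈ U, g (f x) = x) (hfg : ∀ y ∈ W, f (g y) = y)
    (hf : ContMDiffOn I I' ∞ f U) (hg : ContMDiffOn I' I ∞ g W) {x : M} (hx : x ∈ U) :
    IsLocalDiffeomorphAt I I' ∞ f x :=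
  ⟨{ toFun := f, invFun := g, source := U, target := W, map_source' := hfU, map_target' := hgW,
     left_inv' := hgf, right_inv' := hfg, open_source := hU, open_target := hW,
     contMDiffOn_toFun := hf, contMDiffOn_invFun := hg }, hx, fun _ _ ↦ rfl⟩

theorem IsLocalDiffeomorphAt.eventually {f : M → M'} {x : M}
    (hf : IsLocalDiffeomorphAt I I' ∞ f x) : ∀ᶠ x' in 𝓝 x, IsLocalDiffeomorphAt I I' ∞ f x' := by
  obtain ⟨Φ, hx, h⟩ := hf
  filter_upwards [Φ.open_source.mem_nhds hx] with x' hx'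
  exact ⟨Φ, hx', h⟩

/-- A germ of a smooth map with a germ of a smooth inverse is a local diffeomorphism. -/
theorem IsLocalDiffeomorphAt.of_eventually {f : M → M'} {g : M' → M} {x : M}
    (hf : ∀ᶠ x' in 𝓝 x, ContMDiffAt I I' ∞ f x') (hg : ∀ᶠ y in 𝓝 (f x), ContMDiffAt I' I ∞ g y)
    (hgf : ∀ᶠ x' in 𝓝 x, g (f x') = x') (hfg : ∀ᶠ y in 𝓝 (f x), f (g y) = y) :
    IsLocalDiffeomorphAt I I' ∞ f x := by
  obtain ⟨U, hU, hUo, hxU⟩ := eventually_nhds_iff.1 (hf.and hgf)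
  obtain ⟨W, hW, hWo, hxW⟩ := eventually_nhds_iff.1 (hg.and hfg)
  have hcf : ContinuousOn f U := fun z hz ↦ (hU z hz).1.continuousAt.continuousWithinAt
  have hcg : ContinuousOn g W := fun z hz ↦ (hW z hz).1.continuousAt.continuousWithinAt
  refine IsLocalDiffeomorphAt.of_open (g := g) (hcf.isOpen_inter_preimage hUo hWo)
    (hcg.isOpen_inter_preimage hWo hUo) ?_ ?_ (fun z hz ↦ (hU z hz.1).2)
    (fun z hz ↦ (hW z hz.1).2) (fun z hz ↦ (hU z hz.1).1.contMDiffWithinAt)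
    (fun z hz ↦ (hW z hz.1).1.contMDiffWithinAt) ⟨hxU, hxW⟩
  · intro z hz
    exact ⟨hz.2, by rw [mem_preimage, (hU z hz.1).2]; exact hz.1⟩
  · intro z hz
    exact ⟨hz.2, by rw [mem_preimage, (hW z hz.1).2]; exact hz.1⟩

theorem IsLocalDiffeomorphAt.eventually_contMDiffAt {f : M → M'} {x : M}
    (hf : IsLocalDiffeomorphAt I I' ∞ f x) : ∀ᶠ x' in 𝓝 x, ContMDiffAt I I' ∞ f x' :=
  hf.eventually.mono fun _ h ↦ h.contMDiffAt

theorem IsLocalDiffeomorphAt.congr {f f' : M → M'} {x : M}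
    (hf : IsLocalDiffeomorphAt I I' ∞ f x) (h : f' =ᶠ[𝓝 x] f) :
    IsLocalDiffeomorphAt I I' ∞ f' x := by
  have hx : f' x = f x := h.self_of_nhds
  refine .of_eventually (g := hf.localInverse) ?_ ?_ ?_ ?_
  · filter_upwards [h.eventuallyEq_nhds, hf.eventually_contMDiffAt] with z hz hz'
    exact hz'.congr_of_eventuallyEq hz
  · rw [hx]
    exact hf.localInverse_isLocalDiffeomorphAt.eventually_contMDiffAt
  · filter_upwards [h, hf.localInverse_eventuallyEq_left] with z hz hz'
    rw [hz]; exact hz'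
  · rw [hx]
    -- The maps `f` and `f'` agree only near `x`, so the inverse germ must be known to take values
    -- there.
    have h1 : Tendsto hf.localInverse (𝓝 (f x)) (𝓝 x) := by
      have := hf.localInverse_contMDiffAt.continuousAt.tendsto
      rwa [hf.localInverse_left_inv hf.localInverse_mem_target] at this
    filter_upwards [h1.eventually h, hf.localInverse_eventuallyEq_right] with z hz hz'
    rw [hz]; exact hz'

theorem IsLocalDiffeomorphAt.isInvertible_mfderiv {f : M → M'} {x : M}
    (hf : IsLocalDiffeomorphAt I I' ∞ f x) : (mfderiv I I' f x).IsInvertible :=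
  ⟨hf.mfderivToContinuousLinearEquiv (by simp), rfl⟩

theorem IsLocalDiffeomorphAt.inverse_apply {f : M → M'} {x : M}
    (hf : IsLocalDiffeomorphAt I I' ∞ f x) (v : TangentSpace I x) :
    (mfderiv I I' f x).inverse (mfderiv I I' f x v) = v := by
  obtain ⟨e, he⟩ := hf.isInvertible_mfderiv
  rw [← he, ContinuousLinearMap.inverse_equiv]
  exact e.symm_apply_apply v

theorem IsLocalDiffeomorphAt.apply_inverse {f : M → M'} {x : M}
    (hf : IsLocalDiffeomorphAt I I' ∞ f x) (v : TangentSpace I' (f x)) :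
    mfderiv I I' f x ((mfderiv I I' f x).inverse v) = v := by
  obtain ⟨e, he⟩ := hf.isInvertible_mfderiv
  rw [← he, ContinuousLinearMap.inverse_equiv]
  exact e.apply_symm_apply v

theorem IsLocalDiffeomorphAt.localInverse_apply {f : M → M'} {x : M}
    (hf : IsLocalDiffeomorphAt I I' ∞ f x) : hf.localInverse (f x) = x :=
  hf.localInverse_left_inv hf.localInverse_mem_target

theorem IsLocalDiffeomorphAt.tendsto_localInverse {f : M → M'} {x : M}
    (hf : IsLocalDiffeomorphAt I I' ∞ f x) : Tendsto hf.localInverse (𝓝 (f x)) (𝓝 x) := by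
  have := hf.localInverse_contMDiffAt.continuousAt.tendsto
  rwa [hf.localInverse_apply] at this

/-- Near `x`, the field of tangent subspaces `D` is the pullback of `D'` by `f`. -/
def PullbackNear (f : M → M') (D : Set (TangentBundle I M)) (D' : Set (TangentBundle I' M'))
    (x : M) : Prop :=
  ∀ᶠ x' in 𝓝 x, ∀ v : TangentSpace I x', (⟨x', v⟩ : TangentBundle I M) ∈ D ↔
    (⟨f x', mfderiv I I' f x' v⟩ : TangentBundle I' M') ∈ D'

theorem PullbackNear.eventually {f : M → M'} {D : Set (TangentBundle I M)}
    {D' : Set (TangentBundle I' M')} {x : M} (h : PullbackNear f D D' x) :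
    ∀ᶠ x' in 𝓝 x, PullbackNear f D D' x' := eventually_eventually_nhds.2 h

/-- The chain rule for `f ∘ hf.localInverse = id` near `f x`. It makes the pullback relation
reversible, so that transport results have to be proved in one direction only. -/
theorem PullbackNear.localInverse {f : M → M'} {D : Set (TangentBundle I M)}
    {D' : Set (TangentBundle I' M')} {x : M} (h : PullbackNear f D D' x)
    (hf : IsLocalDiffeomorphAt I I' ∞ f x) : PullbackNear hf.localInverse D' D (f x) := by
  filter_upwards [hf.tendsto_localInverse.eventually h, hf.tendsto_localInverse.eventually hf.eventually,
    hf.localInverse_eventuallyEq_right.eventuallyEq_nhds,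
    hf.localInverse_isLocalDiffeomorphAt.eventually] with y h1 h2 h3 h4 v
  rw [h1]
  have e1 : f (hf.localInverse y) = y := h3.self_of_nhds
  have e2 : tangentMap I I' f (tangentMap I' I hf.localInverse ⟨y, v⟩) = ⟨y, v⟩ := by
    have hc := tangentMap_comp_at (I := I') (I' := I) (I'' := I') (⟨y, v⟩ : TangentBundle I' M')
      (g := f) (f := hf.localInverse)
      (h2.mdifferentiableAt (by simp)) (h4.mdifferentiableAt (by simp))
    rw [← hc]
    have hd : tangentMap I' I' (f ∘ hf.localInverse) ⟨y, v⟩ = tangentMap I' I' id ⟨y, v⟩ := by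
      simp only [tangentMap, h3.mfderiv_eq]
      exact congrArg (fun z ↦ (⟨z, _⟩ : TangentBundle I' M')) e1
    rw [hd, tangentMap_id]; rfl
  change (⟨y, v⟩ : TangentBundle I' M') ∈ D' ↔
    tangentMap I I' f (tangentMap I' I hf.localInverse ⟨y, v⟩) ∈ D'
  rw [e2]

variable [IsManifold I ∞ M] [IsManifold I' ∞ M'] [CompleteSpace E] [CompleteSpace E']

theorem SmoothNear.mpullback {f : M → M'} {x : M} (hf : IsLocalDiffeomorphAt I I' ∞ f x)
    {A : ∀ y : M', TangentSpace I' y} (hA : SmoothNear A (f x)) :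
    SmoothNear (VectorField.mpullback I I' f A) x := by
  have : IsManifold I 1 M := IsManifold.of_le (n := ∞) (by simp)
  have : IsManifold I' 1 M' := IsManifold.of_le (n := ∞) (by simp)
  filter_upwards [hf.contMDiffAt.continuousAt.eventually hA, hf.eventually] with x' h1 h2
  exact h1.mpullback_vectorField_preimage h2.contMDiffAt h2.isInvertible_mfderiv (by simp)

theorem IsSectionNear.mpullback {f : M → M'} {x : M} (hf : IsLocalDiffeomorphAt I I' ∞ f x)
    {D : Set (TangentBundle I M)} {D' : Set (TangentBundle I' M')} (h : PullbackNear f D D' x)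
    {A : ∀ y : M', TangentSpace I' y} (hA : IsSectionNear D' A (f x)) :
    IsSectionNear D (VectorField.mpullback I I' f A) x := by
  refine ⟨SmoothNear.mpullback hf hA.1, ?_⟩
  filter_upwards [hf.contMDiffAt.continuousAt.eventually hA.2, hf.eventually, h] with x' h1 h2 h3
  rw [h3, VectorField.mpullback_apply, h2.apply_inverse]
  exact h1

theorem mem_derived {D : Set (TangentBundle I M)} {x : M} {v : TangentSpace I x} :
    (⟨x, v⟩ : TangentBundle I M) ∈ derived D ↔ v ∈ Submodule.span ℝ
    ({v : TangentSpace I x | ∃ A, IsSectionNear D A x ∧ v = A x} ∪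
      {v : TangentSpace I x | ∃ A B, IsSectionNear D A x ∧ IsSectionNear D B x ∧
        v = VectorField.mlieBracket I A B x}) := Iff.rfl

/-- Pullback of vector fields commutes with the Lie bracket and takes sections of `D'` to sections
of `D`, so it takes the generators of the one span to generators of the other. -/
theorem inverse_mem_derived {f : M → M'} {x : M} (hf : IsLocalDiffeomorphAt I I' ∞ f x)
    {D : Set (TangentBundle I M)} {D' : Set (TangentBundle I' M')} (h : PullbackNear f D D' x)
    {w : TangentSpace I' (f x)} (hw : (⟨f x, w⟩ : TangentBundle I' M') ∈ derived D') :
    (⟨x, (mfderiv I I' f x).inverse w⟩ : TangentBundle I M) ∈ derived D := by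
  have : IsManifold I (minSmoothness ℝ 2) M :=
    IsManifold.of_le (n := ∞) (by simpa using two_le_infty)
  have : IsManifold I' (minSmoothness ℝ 2) M' :=
    IsManifold.of_le (n := ∞) (by simpa using two_le_infty)
  refine Submodule.span_induction (p := fun w _ ↦
    (⟨x, (mfderiv I I' f x).inverse w⟩ : TangentBundle I M) ∈ derived D) ?_ ?_ ?_ ?_ hw
  · rintro w (⟨A, hA, rfl⟩ | ⟨A, B, hA, hB, rfl⟩)
    · exact mem_derived.2 (Submodule.subset_span (Or.inl ⟨_, IsSectionNear.mpullback hf h hA, rfl⟩))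
    · refine mem_derived.2 (Submodule.subset_span (Or.inr ⟨_, _, IsSectionNear.mpullback hf h hA,
        IsSectionNear.mpullback hf h hB, ?_⟩))
      exact VectorField.mpullback_mlieBracket (hA.1.self_of_nhds.mdifferentiableAt (by simp))
        (hB.1.self_of_nhds.mdifferentiableAt (by simp)) hf.contMDiffAt
        (by simpa using two_le_infty)
  · rw [map_zero, mem_derived]; exact Submodule.zero_mem _
  · intro u v _ _ hu hv
    rw [map_add, mem_derived]; exact Submodule.add_mem _ (mem_derived.1 hu) (mem_derived.1 hv)
  · intro a u _ hu
    rw [map_smul, mem_derived]; exact Submodule.smul_mem _ a (mem_derived.1 hu)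

theorem mem_derived_of_tangentMap {f : M → M'} {ζ : TangentBundle I M}
    (hf : IsLocalDiffeomorphAt I I' ∞ f ζ.1) {D : Set (TangentBundle I M)}
    {D' : Set (TangentBundle I' M')} (h : PullbackNear f D D' ζ.1)
    (hw : tangentMap I I' f ζ ∈ derived D') : ζ ∈ derived D := by
  have := inverse_mem_derived (w := mfderiv I I' f ζ.1 ζ.2) hf h hw
  rwa [hf.inverse_apply] at this

/-- One implication applies `inverse_mem_derived` to `f`, the other to its local inverse. -/
theorem mem_derived_iff {f : M → M'} {x : M} (hf : IsLocalDiffeomorphAt I I' ∞ f x)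
    {D : Set (TangentBundle I M)} {D' : Set (TangentBundle I' M')} (h : PullbackNear f D D' x)
    (v : TangentSpace I x) : (⟨x, v⟩ : TangentBundle I M) ∈ derived D ↔
      (⟨f x, mfderiv I I' f x v⟩ : TangentBundle I' M') ∈ derived D' := by
  refine ⟨fun hv ↦ ?_, fun hv ↦ mem_derived_of_tangentMap (ζ := ⟨x, v⟩) hf h hv⟩
  have hg := hf.localInverse_isLocalDiffeomorphAt
  refine mem_derived_of_tangentMap (ζ := tangentMap I I' f ⟨x, v⟩) hg (h.localInverse hf) ?_
  have e : tangentMap I' I hf.localInverse (tangentMap I I' f ⟨x, v⟩) = ⟨x, v⟩ := by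
    have hc := tangentMap_comp_at (I := I) (I' := I') (I'' := I) (⟨x, v⟩ : TangentBundle I M)
      (g := hf.localInverse) (f := f)
      (hg.mdifferentiableAt (by simp)) (hf.mdifferentiableAt (by simp))
    have e1 := hf.localInverse_eventuallyEq_left
    rw [← hc]
    have hd : tangentMap I I (hf.localInverse ∘ f) ⟨x, v⟩ = tangentMap I I id ⟨x, v⟩ := by
      simp only [tangentMap, e1.mfderiv_eq]
      exact congrArg (fun z ↦ (⟨z, _⟩ : TangentBundle I M)) e1.self_of_nhds
    rw [hd, tangentMap_id]; rfl
  rw [e]; exact hv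

/-- The hypotheses persist at nearby points. Since the conclusion has the same form as the
hypothesis, the result can be iterated, as needed for `derived (derived D)`. -/
theorem PullbackNear.derived {f : M → M'} {x : M} (hf : IsLocalDiffeomorphAt I I' ∞ f x)
    {D : Set (TangentBundle I M)} {D' : Set (TangentBundle I' M')} (h : PullbackNear f D D' x) :
    PullbackNear f (derived D) (derived D') x := by
  filter_upwards [hf.eventually, h.eventually] with x' h1 h2 v
  exact mem_derived_iff h1 h2 v

/-- Near `x₀`, `D` is a smooth distribution of rank `k`. -/
def SmoothDistributionAt (D : Set (TangentBundle I M)) (k : ℕ) (x₀ : M) : Prop :=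
  ∃ A : Fin k → ∀ x : M, TangentSpace I x, (∀ i, SmoothNear (A i) x₀) ∧
    ∀ᶠ x in 𝓝 x₀, LinearIndependent ℝ (fun i ↦ A i x) ∧
      ∀ v : TangentSpace I x, (⟨x, v⟩ : TangentBundle I M) ∈ D ↔
        v ∈ Submodule.span ℝ (range fun i ↦ A i x)

/-- The pullback of a local frame is a local frame, since the derivative of `f` is an isomorphism at
all nearby points. -/
theorem SmoothDistributionAt.of_pullback {f : M → M'} {x : M}
    (hf : IsLocalDiffeomorphAt I I' ∞ f x)
    {D : Set (TangentBundle I M)} {D' : Set (TangentBundle I' M')} (h : PullbackNear f D D' x)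
    {k : ℕ} (hD : SmoothDistributionAt D' k (f x)) : SmoothDistributionAt D k x := by
  obtain ⟨A, hA, hA'⟩ := hD
  refine ⟨fun i ↦ VectorField.mpullback I I' f (A i), fun i ↦ SmoothNear.mpullback hf (hA i), ?_⟩
  filter_upwards [hf.contMDiffAt.continuousAt.eventually hA', hf.eventually, h] with x' h1 h2 h3
  obtain ⟨e, he⟩ := h2.isInvertible_mfderiv
  have hv : ∀ i, VectorField.mpullback I I' f (A i) x' = e.symm (A i (f x')) := by
    intro i
    rw [VectorField.mpullback_apply, ← he, ContinuousLinearMap.inverse_equiv]; rfl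
  simp only [hv]
  refine ⟨h1.1.map' (e.symm : TangentSpace I' (f x') →ₗ[ℝ] TangentSpace I x')
    (LinearMap.ker_eq_bot.2 e.symm.injective), fun v ↦ ?_⟩
  rw [h3, h1.2, ← he]
  have : (range fun i ↦ e.symm (A i (f x'))) =
      (e.symm : TangentSpace I' (f x') →ₗ[ℝ] TangentSpace I x') '' range fun i ↦ A i (f x') := by
    rw [← range_comp]; rfl
  rw [this, Submodule.span_image, Submodule.mem_map]
  constructor
  · intro hv
    exact ⟨_, hv, e.symm_apply_apply v⟩
  · rintro ⟨w, hw, rfl⟩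
    have : (e : TangentSpace I x' →L[ℝ] TangentSpace I' (f x')) (e.symm w) = w := e.apply_symm_apply w
    exact this.symm ▸ hw

/-- The conditions on an Engel structure at a point. -/
def EngelAt (D : Set (TangentBundle I M)) (x : M) : Prop :=
  SmoothDistributionAt D 2 x ∧ SmoothDistributionAt (derived D) 3 x ∧
    ∀ v : TangentSpace I x, (⟨x, v⟩ : TangentBundle I M) ∈ derived (derived D)

/-- The conditions on a contact structure at a point. -/
def ContactAt (D : Set (TangentBundle I M)) (x : M) : Prop :=
  SmoothDistributionAt D 2 x ∧ ∀ v : TangentSpace I x, (⟨x, v⟩ : TangentBundle I M) ∈ derived D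

theorem EngelAt.of_pullback {f : M → M'} {x : M} (hf : IsLocalDiffeomorphAt I I' ∞ f x)
    {D : Set (TangentBundle I M)} {D' : Set (TangentBundle I' M')} (h : PullbackNear f D D' x)
    (hD : EngelAt D' (f x)) : EngelAt D x :=
  ⟨hD.1.of_pullback hf h, hD.2.1.of_pullback hf (h.derived hf), fun v ↦
    (mem_derived_iff hf (h.derived hf) v).2 (hD.2.2 _)⟩

theorem ContactAt.of_pullback {f : M → M'} {x : M} (hf : IsLocalDiffeomorphAt I I' ∞ f x)
    {D : Set (TangentBundle I M)} {D' : Set (TangentBundle I' M')} (h : PullbackNear f D D' x)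
    (hD : ContactAt D' (f x)) : ContactAt D x :=
  ⟨hD.1.of_pullback hf h, fun v ↦ (mem_derived_iff hf h v).2 (hD.2 _)⟩

/-- The Engel condition passes to the target of a local diffeomorphism. -/
theorem EngelAt.map {f : M → M'} {x : M} (hf : IsLocalDiffeomorphAt I I' ∞ f x)
    {D : Set (TangentBundle I M)} {D' : Set (TangentBundle I' M')} (h : PullbackNear f D D' x)
    (hD : EngelAt D x) : EngelAt D' (f x) :=
  EngelAt.of_pullback hf.localInverse_isLocalDiffeomorphAt (h.localInverse hf)
    (by rw [hf.localInverse_apply]; exact hD)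

theorem isEngel_of_engelAt (hE : Module.finrank ℝ E = 4) {D : Set (TangentBundle I M)}
    (h : ∀ x, EngelAt D x) : IsEngel D :=
  ⟨hE, fun x ↦ (h x).1, fun x ↦ (h x).2.1, eq_univ_of_forall fun ζ ↦ (h ζ.1).2.2 ζ.2⟩

theorem isContact_of_contactAt (hE : Module.finrank ℝ E = 3) {D : Set (TangentBundle I M)}
    (h : ∀ x, ContactAt D x) : IsContact D :=
  ⟨hE, fun x ↦ (h x).1, eq_univ_of_forall fun ζ ↦ (h ζ.1).2 ζ.2⟩

end LocalDiffeo

/-! ### Fields of subspaces in a vector space. -/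

section VectorSpace

variable {F : Type*} [NormedAddCommGroup F] [NormedSpace ℝ F]

theorem smoothNear_vectorSpace_iff {A : F → F} {x : F} :
    SmoothNear (I := 𝓘(ℝ, F)) (M := F) A x ↔ ∀ᶠ y in 𝓝 x, ContDiffAt ℝ ∞ A y :=
  eventually_congr (.of_forall fun _ ↦ contMDiffAt_vectorSpace_iff_contDiffAt)

theorem mlieBracket_vectorSpace (A B : F → F) (x : F) :
    VectorField.mlieBracket 𝓘(ℝ, F) A B x = (fderiv ℝ B x (A x) - fderiv ℝ A x (B x) : F) := by
  have := congrFun (VectorField.mlieBracketWithin_eq_lieBracketWithin (𝕜 := ℝ) (V := A) (W := B)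
    (s := univ)) x
  rw [VectorField.lieBracketWithin_univ] at this
  exact (congrFun VectorField.mlieBracketWithin_univ.symm x).trans this

/-- The field of tangent subspaces of a vector space given by a family of subspaces. -/
def subspaceField (P : F → Submodule ℝ F) : Set (TangentBundle 𝓘(ℝ, F) F) :=
  {ζ | (show F from ζ.2) ∈ P ζ.1}

/-- Near `x`, `A` is a smooth section of the field of subspaces `P`. -/
def FieldSection (P : F → Submodule ℝ F) (A : F → F) (x : F) : Prop :=
  (∀ᶠ y in 𝓝 x, ContDiffAt ℝ ∞ A y) ∧ ∀ᶠ y in 𝓝 x, A y ∈ P y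

theorem fieldSection_iff {P : F → Submodule ℝ F} {A : F → F} {x : F} :
    IsSectionNear (I := 𝓘(ℝ, F)) (M := F) (subspaceField P) A x ↔ FieldSection P A x :=
  and_congr smoothNear_vectorSpace_iff Iff.rfl

/-- The derived field of a field of subspaces. -/
def derivedField (P : F → Submodule ℝ F) (x : F) : Submodule ℝ F :=
  Submodule.span ℝ ({u | ∃ A, FieldSection P A x ∧ u = A x} ∪
    {u | ∃ A B, FieldSection P A x ∧ FieldSection P B x ∧
      u = fderiv ℝ B x (A x) - fderiv ℝ A x (B x)})

/-- On a vector space the bracket of vector fields is given by Fréchet derivatives. This turns the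
derived distribution into a field of linear subspaces that can be computed by hand, and twice in a
row. -/
theorem derived_subspaceField [CompleteSpace F] (P : F → Submodule ℝ F) :
    derived (subspaceField P) = subspaceField (derivedField P) := by
  ext ⟨x, u⟩
  have h1 : {v : TangentSpace 𝓘(ℝ, F) x | ∃ A, IsSectionNear (subspaceField P) A x ∧ v = A x} =
      {u : F | ∃ A, FieldSection P A x ∧ u = A x} :=
    Set.ext fun w ↦ exists_congr fun A ↦ and_congr fieldSection_iff Iff.rfl
  have h2 : {v : TangentSpace 𝓘(ℝ, F) x | ∃ A B, IsSectionNear (subspaceField P) A x ∧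
      IsSectionNear (subspaceField P) B x ∧ v = VectorField.mlieBracket 𝓘(ℝ, F) A B x} =
      {u : F | ∃ A B, FieldSection P A x ∧ FieldSection P B x ∧
        u = fderiv ℝ B x (A x) - fderiv ℝ A x (B x)} :=
    Set.ext fun w ↦ exists_congr fun A ↦ exists_congr fun B ↦ and_congr fieldSection_iff
      (and_congr fieldSection_iff (by rw [mlieBracket_vectorSpace A B x]; rfl))
  refine mem_derived.trans ?_
  rw [h1, h2]
  rfl

theorem smoothDistributionAt_subspaceField {P : F → Submodule ℝ F} {k : ℕ} {x : F}
    (A : Fin k → F → F) (hA : ∀ i, ∀ᶠ y in 𝓝 x, ContDiffAt ℝ ∞ (A i) y)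
    (h : ∀ᶠ y in 𝓝 x, LinearIndependent ℝ (fun i ↦ A i y) ∧
      P y = Submodule.span ℝ (range fun i ↦ A i y)) :
    SmoothDistributionAt (I := 𝓘(ℝ, F)) (M := F) (subspaceField P) k x := by
  refine ⟨A, fun i ↦ smoothNear_vectorSpace_iff.2 (hA i), ?_⟩
  filter_upwards [h] with y hy
  exact ⟨hy.1, fun v ↦ Iff.of_eq (congrArg (fun Q : Submodule ℝ F ↦ (show F from v) ∈ Q) hy.2)⟩

theorem FieldSection.mem {P : F → Submodule ℝ F} {A : F → F} {x : F} (hA : FieldSection P A x) :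
    A x ∈ derivedField P x := Submodule.subset_span (Or.inl ⟨A, hA, rfl⟩)

theorem FieldSection.bracket_mem {P : F → Submodule ℝ F} {A B : F → F} {x : F}
    (hA : FieldSection P A x) (hB : FieldSection P B x) {L L' : F →L[ℝ] F}
    (hL : HasFDerivAt A L x) (hL' : HasFDerivAt B L' x) :
    L' (A x) - L (B x) ∈ derivedField P x :=
  Submodule.subset_span (Or.inr ⟨A, B, hA, hB, by rw [hL.fderiv, hL'.fderiv]⟩)

/-- The derivatives enter as arbitrary `L` and `L'`, so that in applications they can be constrained
by uniqueness of derivatives instead of being computed. -/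
theorem derivedField_le {P : F → Submodule ℝ F} {x : F} {Q : Submodule ℝ F}
    (h1 : ∀ A, FieldSection P A x → A x ∈ Q)
    (h2 : ∀ A B, FieldSection P A x → FieldSection P B x → ∀ L L' : F →L[ℝ] F, HasFDerivAt A L x →
      HasFDerivAt B L' x → L' (A x) - L (B x) ∈ Q) : derivedField P x ≤ Q := by
  refine Submodule.span_le.2 ?_
  rintro u (⟨A, hA, rfl⟩ | ⟨A, B, hA, hB, rfl⟩)
  · exact h1 A hA
  · exact h2 A B hA hB _ _ (hA.1.self_of_nhds.differentiableAt (by simp)).hasFDerivAt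
      (hB.1.self_of_nhds.differentiableAt (by simp)).hasFDerivAt

/-- Only germs of sections enter the definition. This permits the second derivation of a field whose
first derived field is known only near the point. -/
theorem derivedField_congr {P Q : F → Submodule ℝ F} {x : F} (h : P =ᶠ[𝓝 x] Q) :
    derivedField P x = derivedField Q x := by
  have : ∀ A, FieldSection P A x ↔ FieldSection Q A x := fun A ↦
    and_congr Iff.rfl (eventually_congr (h.mono fun y hy ↦ by rw [hy]))
  simp only [derivedField, this]

end VectorSpace

/-! ### The local models of the Engel and contact structures. -/

section Models

theorem exists_plane_coords {a b : Plane} (h : LinearIndependent ℝ ![a, b]) (w : Plane) :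
    ∃ c d : ℝ, w = c • a + d • b := by
  have h1 := h.span_eq_top_of_card_eq_finrank (by simp)
  have h2 : w ∈ Submodule.span ℝ (range ![a, b]) := h1 ▸ Submodule.mem_top
  rw [Matrix.range_cons, Matrix.range_cons, Matrix.range_empty, union_empty, singleton_union,
    Submodule.mem_span_pair] at h2
  obtain ⟨c, d, h⟩ := h2
  exact ⟨c, d, h.symm⟩

/-- The derivative of a function of the plane and of a real parameter in the direction of the
parameter. -/
noncomputable def paramDeriv {W : Type*} [NormedAddCommGroup W] [NormedSpace ℝ W] (v : W × ℝ → W)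
    (z : W × ℝ) : W := fderiv ℝ v z (0, 1)

theorem eventually_contDiffAt_paramDeriv {v : Plane × ℝ → Plane} {z : Plane × ℝ}
    (hv : ∀ᶠ y in 𝓝 z, ContDiffAt ℝ ∞ v y) : ∀ᶠ y in 𝓝 z, ContDiffAt ℝ ∞ (paramDeriv v) y := by
  filter_upwards [hv] with y hy
  exact (hy.fderiv_right (m := ∞) (by simp)).clm_apply contDiffAt_const

/-- The plane field spanned by `∂/∂t + v(x, s)` and `∂/∂s` on the space of the triples `(t, x, s)`. -/
def modelPlane (v : Plane × ℝ → Plane) (y : ℝ × Plane × ℝ) : Submodule ℝ (ℝ × Plane × ℝ) where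
  carrier := {u | u.2.1 = u.1 • v y.2}
  add_mem' {a b} ha hb := by
    simp only [mem_ofPred_eq, Prod.snd_add, Prod.fst_add] at *
    rw [ha, hb]; module
  zero_mem' := by simp
  smul_mem' c u hu := by
    simp only [mem_ofPred_eq, Prod.smul_snd, Prod.smul_fst] at *
    rw [hu]; module

/-- The hyperplane field spanned by `∂/∂t + v(x, s)`, `∂v/∂s` and `∂/∂s`. -/
def modelSpace (v : Plane × ℝ → Plane) (y : ℝ × Plane × ℝ) : Submodule ℝ (ℝ × Plane × ℝ) where
  carrier := {u | ∃ c : ℝ, u.2.1 = u.1 • v y.2 + c • paramDeriv v y.2}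
  add_mem' := by
    rintro a b ⟨c, hc⟩ ⟨d, hd⟩
    refine ⟨c + d, ?_⟩
    rw [Prod.snd_add, Prod.fst_add, hc, hd, Prod.fst_add]; module
  zero_mem' := ⟨0, by simp⟩
  smul_mem' := by
    rintro a u ⟨c, hc⟩
    refine ⟨a * c, ?_⟩
    rw [Prod.smul_snd, Prod.smul_fst, hc, Prod.smul_fst]; module

/-- The plane field spanned by `∂v/∂s` and `∂/∂s` on the space of the pairs `(x, s)`. -/
def modelContact (v : Plane × ℝ → Plane) (y : Plane × ℝ) : Submodule ℝ (Plane × ℝ) where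
  carrier := {u | ∃ c : ℝ, u.1 = c • paramDeriv v y}
  add_mem' := by
    rintro a b ⟨c, hc⟩ ⟨d, hd⟩
    exact ⟨c + d, by rw [Prod.fst_add, hc, hd]; module⟩
  zero_mem' := ⟨0, by simp⟩
  smul_mem' := by
    rintro a u ⟨c, hc⟩
    exact ⟨a * c, by rw [Prod.smul_fst, hc]; module⟩

variable {v : Plane × ℝ → Plane}

theorem mem_modelPlane {y u : ℝ × Plane × ℝ} : u ∈ modelPlane v y ↔ u.2.1 = u.1 • v y.2 := Iff.rfl

theorem mem_modelSpace {y u : ℝ × Plane × ℝ} :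
    u ∈ modelSpace v y ↔ ∃ c : ℝ, u.2.1 = u.1 • v y.2 + c • paramDeriv v y.2 := Iff.rfl

theorem mem_modelContact {y u : Plane × ℝ} :
    u ∈ modelContact v y ↔ ∃ c : ℝ, u.1 = c • paramDeriv v y := Iff.rfl

theorem eventually_contDiffAt_lift (c : ℝ) {x : ℝ × Plane × ℝ}
    (hv : ∀ᶠ y in 𝓝 x.2, ContDiffAt ℝ ∞ v y) :
    ∀ᶠ y in 𝓝 x, ContDiffAt ℝ ∞ (fun y : ℝ × Plane × ℝ ↦ ((c, (v y.2, 0)) : ℝ × Plane × ℝ)) y := by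
  filter_upwards [continuous_snd.continuousAt.eventually hv] with y hy
  exact contDiffAt_const.prodMk ((hy.comp y contDiffAt_snd).prodMk contDiffAt_const)

/-- The value on `(0, (0, 1))` is all that the bracket with the constant field `∂/∂s` requires. -/
theorem hasFDerivAt_lift (c : ℝ) {x : ℝ × Plane × ℝ} (hv : ContDiffAt ℝ ∞ v x.2) :
    ∃ L : ℝ × Plane × ℝ →L[ℝ] ℝ × Plane × ℝ,
      HasFDerivAt (fun y : ℝ × Plane × ℝ ↦ ((c, (v y.2, 0)) : ℝ × Plane × ℝ)) L x ∧
      L (0, (0, 1)) = (0, (paramDeriv v x.2, 0)) := by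
  have h1 : HasFDerivAt v (fderiv ℝ v x.2) x.2 := (hv.differentiableAt (by simp)).hasFDerivAt
  have h2 := h1.comp x (hasFDerivAt_snd (𝕜 := ℝ) (E := ℝ) (F := Plane × ℝ))
  exact ⟨_, (hasFDerivAt_const c x).prodMk (h2.prodMk (hasFDerivAt_const (0 : ℝ) x)), rfl⟩

/-- For the upper bound, the relation `A.2.1 = A.1 • v` that holds along a section is
differentiated; this determines the middle component of a bracket of two sections. For the lower
bound, `∂/∂t + v`, `∂/∂s` and their bracket `∂v/∂s` suffice. -/
theorem derivedField_modelPlane {x : ℝ × Plane × ℝ} (hv : ∀ᶠ y in 𝓝 x.2, ContDiffAt ℝ ∞ v y) :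
    derivedField (modelPlane v) x = modelSpace v x := by
  have hv0 : HasFDerivAt v (fderiv ℝ v x.2) x.2 :=
    (hv.self_of_nhds.differentiableAt (by simp)).hasFDerivAt
  apply le_antisymm
  · refine derivedField_le (fun A hA ↦ ?_) fun A B hA hB L L' hL hL' ↦ ?_
    · rw [mem_modelSpace]
      exact ⟨0, by rw [zero_smul, add_zero]; exact hA.2.self_of_nhds⟩
    · have hder : ∀ (C : ℝ × Plane × ℝ → ℝ × Plane × ℝ)
          (L : ℝ × Plane × ℝ →L[ℝ] ℝ × Plane × ℝ), FieldSection (modelPlane v) C x → HasFDerivAt C L x →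
            (C x).2.1 = (C x).1 • v x.2 ∧
              ∀ u : ℝ × Plane × ℝ, (L u).2.1 = (C x).1 • fderiv ℝ v x.2 u.2 + (L u).1 • v x.2 := by
        intro C L hC h2
        refine ⟨hC.2.self_of_nhds, fun u ↦ ?_⟩
        have h3 : HasFDerivAt (fun y ↦ (C y).2.1) _ x := h2.snd.fst
        have h4 : HasFDerivAt (fun y ↦ (C y).1 • v y.2) _ x :=
          h2.fst.smul (hv0.comp x (hasFDerivAt_snd (𝕜 := ℝ) (E := ℝ) (F := Plane × ℝ)))
        have h5 : (fun y ↦ (C y).2.1) =ᶠ[𝓝 x] (fun y ↦ (C y).1 • v y.2) := hC.2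
        have h6 := DFunLike.congr_fun (h3.unique (h4.congr_of_eventuallyEq h5)) u
        simpa using h6
      obtain ⟨hL1, hL2⟩ := hder A L hA hL
      obtain ⟨hL1', hL2'⟩ := hder B L' hB hL'
      have hsplit : ∀ C : ℝ × Plane × ℝ, C.2.1 = C.1 • v x.2 → fderiv ℝ v x.2 C.2 =
          C.1 • fderiv ℝ v x.2 (v x.2, 0) + C.2.2 • paramDeriv v x.2 := by
        intro C hC
        rw [paramDeriv, ← map_smul, ← map_smul, ← map_add]
        congr 1
        ext1 <;> simp [hC]
      rw [mem_modelSpace]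
      -- In the antisymmetrised expression the terms with `fderiv ℝ v x.2 (v x.2, 0)` cancel; this
      -- is the remaining coefficient of `∂v/∂s`.
      refine ⟨(B x).1 * (A x).2.2 - (A x).1 * (B x).2.2, ?_⟩
      rw [Prod.snd_sub, Prod.fst_sub, Prod.fst_sub, hL2, hL2', hsplit _ hL1, hsplit _ hL1']
      module
  · intro u hu
    obtain ⟨c, hc⟩ := mem_modelSpace.1 hu
    have hA : FieldSection (modelPlane v) (fun y ↦ (1, (v y.2, 0))) x :=
      ⟨eventually_contDiffAt_lift 1 hv, .of_forall fun y ↦ (one_smul ℝ (v y.2)).symm⟩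
    have hB : FieldSection (modelPlane v) (fun y ↦ (0, (0, 1))) x :=
      ⟨.of_forall fun _ ↦ contDiffAt_const, .of_forall fun y ↦ (zero_smul ℝ (v y.2)).symm⟩
    obtain ⟨L, hL, hL1⟩ := hasFDerivAt_lift 1 hv.self_of_nhds
    -- The bracket of `∂/∂s` and `∂/∂t + v` is `∂v/∂s`.
    have hC := hB.bracket_mem hA (hasFDerivAt_const _ x) hL
    rw [hL1, zero_apply, sub_zero] at hC
    have hu : u = u.1 • (1, (v x.2, 0)) + u.2.2 • (0, (0, 1)) +
        c • (0, (paramDeriv v x.2, 0)) := by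
      ext1
      · simp
      ext1
      · simp [hc]
      · simp
    rw [hu]
    exact Submodule.add_mem _ (Submodule.add_mem _ (Submodule.smul_mem _ _ hA.mem)
      (Submodule.smul_mem _ _ hB.mem)) (Submodule.smul_mem _ _ hC)

/-- The first bracket with `∂/∂s` adds `∂v/∂s` and the second adds `∂²v/∂s²`. Independence of `v`
and `∂v/∂s` is needed on a neighbourhood, because the derived distribution must have constant rank;
independence of `∂v/∂s` and `∂²v/∂s²` is needed at the point only. -/
theorem engelAt_modelPlane {x : ℝ × Plane × ℝ} (hv : ∀ᶠ y in 𝓝 x.2, ContDiffAt ℝ ∞ v y)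
    (h1 : ∀ᶠ y in 𝓝 x.2, LinearIndependent ℝ ![v y, paramDeriv v y])
    (h2 : LinearIndependent ℝ ![paramDeriv v x.2, paramDeriv (paramDeriv v) x.2]) :
    EngelAt (subspaceField (modelPlane v)) x := by
  have hc : Tendsto (fun y : ℝ × Plane × ℝ ↦ y.2) (𝓝 x) (𝓝 x.2) := continuous_snd.continuousAt
  have hvs := eventually_contDiffAt_paramDeriv hv
  have hder : derivedField (modelPlane v) =ᶠ[𝓝 x] modelSpace v := by
    filter_upwards [hc.eventually (eventually_eventually_nhds.2 hv)] with y hy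
    exact derivedField_modelPlane hy
  have hA := eventually_contDiffAt_lift 1 hv
  have hC := eventually_contDiffAt_lift 0 hvs
  have hB : ∀ᶠ y in 𝓝 x, ContDiffAt ℝ ∞ (fun _ : ℝ × Plane × ℝ ↦ ((0, (0, 1)) : ℝ × Plane × ℝ)) y :=
    .of_forall fun _ ↦ contDiffAt_const
  refine ⟨?_, ?_, ?_⟩
  · refine smoothDistributionAt_subspaceField ![fun y ↦ (1, (v y.2, 0)), fun y ↦ (0, (0, 1))]
      (Fin.forall_fin_two.2 ⟨hA, hB⟩) (.of_forall fun y ↦ ⟨?_, ?_⟩)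
    · rw [Fintype.linearIndependent_iff]
      intro g hg
      rw [Fin.sum_univ_two] at hg
      simp only [Matrix.cons_val_zero, Matrix.cons_val_one, Prod.smul_mk, Prod.mk_add_mk,
        Prod.mk_eq_zero, smul_eq_mul, mul_one, mul_zero, add_zero, zero_add] at hg
      exact Fin.forall_fin_two.2 ⟨hg.1, hg.2.2⟩
    · have hr : (range fun i ↦ (![fun y ↦ (1, (v y.2, 0)),
          fun y ↦ (0, (0, 1))] : Fin 2 → ℝ × Plane × ℝ → ℝ × Plane × ℝ) i y) =
          {(1, (v y.2, 0)), (0, (0, 1))} := by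
        ext w; simp only [mem_range, Fin.exists_fin_two, eq_comm]; rfl
      rw [hr]
      ext u
      rw [mem_modelPlane, Submodule.mem_span_pair]
      constructor
      · intro hu
        refine ⟨u.1, u.2.2, ?_⟩
        ext1
        · simp
        ext1
        · simp [hu]
        · simp
      · rintro ⟨a, b, rfl⟩
        simp
  · rw [derived_subspaceField]
    refine smoothDistributionAt_subspaceField ![fun y ↦ (1, (v y.2, 0)), fun y ↦ (0, (0, 1)),
      fun y ↦ (0, (paramDeriv v y.2, 0))] ?_ ?_
    · intro i
      fin_cases i
      exacts [hA, hB, hC]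
    · filter_upwards [hder, hc.eventually h1] with y hy hy1
      refine ⟨?_, ?_⟩
      · rw [Fintype.linearIndependent_iff]
        intro g hg
        rw [Fin.sum_univ_three] at hg
        simp only [Matrix.cons_val_zero, Matrix.cons_val_one, Matrix.cons_val, Prod.smul_mk,
          Prod.mk_add_mk, Prod.mk_eq_zero, smul_eq_mul, mul_one, mul_zero, add_zero, zero_add,
          smul_zero] at hg
        obtain ⟨g0, e3, g1⟩ := hg
        rw [g0, zero_smul, zero_add] at e3
        have g2 := (smul_eq_zero.1 e3).resolve_right (hy1.ne_zero 1)
        intro i; fin_cases i <;> assumption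
      · have hr : (range fun i ↦ (![fun y ↦ (1, (v y.2, 0)), fun y ↦ (0, (0, 1)),
            fun y ↦ (0, (paramDeriv v y.2, 0))] : Fin 3 → ℝ × Plane × ℝ → ℝ × Plane × ℝ) i y) =
            {(1, (v y.2, 0)), (0, (0, 1)), (0, (paramDeriv v y.2, 0))} := by
          ext w
          constructor
          · rintro ⟨i, rfl⟩
            fin_cases i <;> simp
          · rintro (rfl | rfl | rfl)
            exacts [⟨0, rfl⟩, ⟨1, rfl⟩, ⟨2, rfl⟩]
        rw [hy, hr]
        ext u
        rw [mem_modelSpace, Submodule.mem_span_triple]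
        constructor
        · rintro ⟨c, hu⟩
          refine ⟨u.1, u.2.2, c, ?_⟩
          ext1
          · simp
          ext1
          · simp [hu]
          · simp
        · rintro ⟨a, b, c, rfl⟩
          exact ⟨c, by simp⟩
  · rw [derived_subspaceField, derived_subspaceField]
    intro u
    change (show ℝ × Plane × ℝ from u) ∈ derivedField (derivedField (modelPlane v)) x
    rw [derivedField_congr hder]
    generalize (show ℝ × Plane × ℝ from u) = u
    -- After subtraction of the right multiple of `∂/∂t + v`, the remaining planar part is a
    -- combination of `∂v/∂s` and `∂²v/∂s²`.
    obtain ⟨c, d, hcd⟩ := exists_plane_coords h2 (u.2.1 - u.1 • v x.2)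
    have sA : FieldSection (modelSpace v) (fun y ↦ (1, (v y.2, 0))) x :=
      ⟨hA, .of_forall fun y ↦ mem_modelSpace.2 ⟨0, by simp⟩⟩
    have sB : FieldSection (modelSpace v) (fun y ↦ (0, (0, 1))) x :=
      ⟨hB, .of_forall fun y ↦ mem_modelSpace.2 ⟨0, by simp⟩⟩
    have sC : FieldSection (modelSpace v) (fun y ↦ (0, (paramDeriv v y.2, 0))) x :=
      ⟨hC, .of_forall fun y ↦ mem_modelSpace.2 ⟨1, by simp⟩⟩
    obtain ⟨L, hL, hL1⟩ := hasFDerivAt_lift 0 hvs.self_of_nhds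
    have sD := sB.bracket_mem sC (hasFDerivAt_const _ x) hL
    rw [hL1, zero_apply, sub_zero] at sD
    have hu : u = u.1 • (1, (v x.2, 0)) + u.2.2 • (0, (0, 1)) +
        c • (0, (paramDeriv v x.2, 0)) + d • (0, (paramDeriv (paramDeriv v) x.2, 0)) := by
      refine Prod.ext ?_ (Prod.ext ?_ ?_)
      · simp
      · rw [sub_eq_iff_eq_add] at hcd
        refine hcd.trans ?_
        simp only [Prod.smul_mk, Prod.mk_add_mk]
        module
      · simp
    rw [hu]
    exact Submodule.add_mem _ (Submodule.add_mem _ (Submodule.add_mem _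
      (Submodule.smul_mem _ _ sA.mem) (Submodule.smul_mem _ _ sB.mem))
      (Submodule.smul_mem _ _ sC.mem)) (Submodule.smul_mem _ _ sD)

/-- The bracket of `∂/∂s` and `∂v/∂s` is `∂²v/∂s²`, which together with `∂v/∂s` spans the plane of
the `x` directions. -/
theorem contactAt_modelContact {x : Plane × ℝ} (hv : ∀ᶠ y in 𝓝 x, ContDiffAt ℝ ∞ v y)
    (h1 : ∀ᶠ y in 𝓝 x, paramDeriv v y ≠ 0)
    (h2 : LinearIndependent ℝ ![paramDeriv v x, paramDeriv (paramDeriv v) x]) :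
    ContactAt (subspaceField (modelContact v)) x := by
  have hvs := eventually_contDiffAt_paramDeriv hv
  have hC : ∀ᶠ y in 𝓝 x, ContDiffAt ℝ ∞ (fun y ↦ ((paramDeriv v y, 0) : Plane × ℝ)) y := by
    filter_upwards [hvs] with y hy
    exact hy.prodMk contDiffAt_const
  have hB : ∀ᶠ y in 𝓝 x, ContDiffAt ℝ ∞ (fun _ ↦ ((0, 1) : Plane × ℝ)) y :=
    .of_forall fun _ ↦ contDiffAt_const
  constructor
  · refine smoothDistributionAt_subspaceField ![fun y ↦ (paramDeriv v y, 0), fun y ↦ (0, 1)]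
      (Fin.forall_fin_two.2 ⟨hC, hB⟩) (h1.mono fun y hy ↦ ⟨?_, ?_⟩)
    · rw [Fintype.linearIndependent_iff]
      intro g hg
      rw [Fin.sum_univ_two] at hg
      simp only [Matrix.cons_val_zero, Matrix.cons_val_one, Prod.smul_mk, Prod.mk_add_mk,
        Prod.mk_eq_zero, smul_eq_mul, mul_one, mul_zero, add_zero, zero_add, smul_zero] at hg
      exact Fin.forall_fin_two.2 ⟨(smul_eq_zero.1 hg.1).resolve_right hy, hg.2⟩
    · have hr : (range fun i ↦ (![fun y ↦ (paramDeriv v y, 0),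
          fun y ↦ (0, 1)] : Fin 2 → Plane × ℝ → Plane × ℝ) i y) =
          {(paramDeriv v y, 0), (0, 1)} := by
        ext w; simp only [mem_range, Fin.exists_fin_two, eq_comm]; rfl
      rw [hr]
      ext u
      rw [mem_modelContact, Submodule.mem_span_pair]
      constructor
      · rintro ⟨c, hu⟩
        refine ⟨c, u.2, ?_⟩
        ext1
        · simp [hu]
        · simp
      · rintro ⟨a, b, rfl⟩
        exact ⟨a, by simp⟩
  · rw [derived_subspaceField]
    intro u
    change (show Plane × ℝ from u) ∈ derivedField (modelContact v) x
    generalize (show Plane × ℝ from u) = u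
    obtain ⟨c, d, hcd⟩ := exists_plane_coords h2 u.1
    have sB : FieldSection (modelContact v) (fun y ↦ (0, 1)) x :=
      ⟨hB, .of_forall fun y ↦ mem_modelContact.2 ⟨0, by simp⟩⟩
    have sC : FieldSection (modelContact v) (fun y ↦ (paramDeriv v y, 0)) x :=
      ⟨hC, .of_forall fun y ↦ mem_modelContact.2 ⟨1, by simp⟩⟩
    have h3 : HasFDerivAt (paramDeriv v) (fderiv ℝ (paramDeriv v) x) x :=
      (hvs.self_of_nhds.differentiableAt (by simp)).hasFDerivAt
    have sD := sB.bracket_mem sC (hasFDerivAt_const _ x) (h3.prodMk (hasFDerivAt_const (0 : ℝ) x))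
    rw [zero_apply, sub_zero] at sD
    change (paramDeriv (paramDeriv v) x, (0 : ℝ)) ∈ _ at sD
    have hu : u = u.2 • (0, 1) + c • (paramDeriv v x, 0) + d • (paramDeriv (paramDeriv v) x, 0) := by
      refine Prod.ext ?_ ?_
      · refine hcd.trans ?_
        simp
      · simp
    rw [hu]
    exact Submodule.add_mem _ (Submodule.add_mem _ (Submodule.smul_mem _ _ sB.mem)
      (Submodule.smul_mem _ _ sC.mem)) (Submodule.smul_mem _ _ sD)

end Models

/-! ### Composition operators on spaces of continuous functions. -/

section CompositionOperator

universe u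
variable {K : Type*} [TopologicalSpace K] [CompactSpace K]
  {E F G : Type*} [NormedAddCommGroup E] [NormedSpace ℝ E] [NormedAddCommGroup F]
  [NormedSpace ℝ F] [NormedAddCommGroup G] [NormedSpace ℝ G]

/-- A bilinear map, applied pointwise to continuous functions. -/
noncomputable def pointwiseAux (B : G →L[ℝ] E →L[ℝ] F) (A : C(K, G)) (γ : C(K, E)) : C(K, F) :=
  ⟨fun k ↦ B (A k) (γ k), (B.continuous.comp A.continuous).clm_apply γ.continuous⟩

theorem norm_pointwiseAux_le (B : G →L[ℝ] E →L[ℝ] F) (A : C(K, G)) (γ : C(K, E)) :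
    ‖pointwiseAux B A γ‖ ≤ ‖B‖ * ‖A‖ * ‖γ‖ := by
  rw [ContinuousMap.norm_le _ (by positivity)]
  intro k
  refine (B.le_opNorm₂ _ _).trans ?_
  gcongr
  · exact A.norm_coe_le_norm k
  · exact γ.norm_coe_le_norm k

/-- The pointwise application of a bilinear map as a continuous bilinear map. -/
noncomputable def pointwise (B : G →L[ℝ] E →L[ℝ] F) : C(K, G) →L[ℝ] C(K, E) →L[ℝ] C(K, F) :=
  (LinearMap.mk₂ ℝ (pointwiseAux (K := K) B)
      (fun _ _ _ ↦ ContinuousMap.ext fun _ ↦ by simp [pointwiseAux])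
      (fun _ _ _ ↦ ContinuousMap.ext fun _ ↦ by simp [pointwiseAux])
      (fun _ _ _ ↦ ContinuousMap.ext fun _ ↦ by simp [pointwiseAux])
      (fun _ _ _ ↦ ContinuousMap.ext fun _ ↦ by simp [pointwiseAux])).mkContinuous₂ ‖B‖
    (norm_pointwiseAux_le B)

/-- The derivative of `f` is continuous, hence uniformly so at the compact range of `γ`. One radius
therefore serves for all `k` in the mean value inequality, and the remainder is small in the
supremum norm. -/
theorem hasFDerivAt_comp_left (B : G →L[ℝ] E →L[ℝ] F) {f : C(E, F)} {f' : C(E, G)}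
    (hf : ∀ x, HasFDerivAt f (B (f' x)) x) (γ : C(K, E)) :
    HasFDerivAt (fun δ : C(K, E) ↦ f.comp δ) (pointwise B (f'.comp γ)) γ := by
  rw [hasFDerivAt_iff_isLittleO, Asymptotics.isLittleO_iff]
  intro c hc
  have hK : IsCompact (range γ) := isCompact_range γ.continuous
  have hu := hK.uniformContinuousAt_of_continuousAt (fun x ↦ B (f' x))
    (fun x _ ↦ (B.continuous.comp f'.continuous).continuousAt) (Metric.dist_mem_uniformity hc)
  obtain ⟨ε, hε, h⟩ := Metric.mem_uniformity_dist.1 hu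
  filter_upwards [Metric.ball_mem_nhds γ hε] with δ hδ
  rw [ContinuousMap.norm_le _ (by positivity)]
  intro k
  have hk : dist (δ k) (γ k) < ε := lt_of_le_of_lt (ContinuousMap.dist_apply_le_dist k) hδ
  have hb : ∀ x ∈ Metric.ball (γ k) ε, ‖B (f' x) - B (f' (γ k))‖ ≤ c := by
    intro x hx
    have := h (a := γ k) (b := x) (by rw [dist_comm]; exact hx) (mem_range_self k)
    rw [← dist_eq_norm, dist_comm]
    exact le_of_lt this
  have := Convex.norm_image_sub_le_of_norm_hasFDerivWithin_le' (f := f) (f' := fun x ↦ B (f' x))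
    (φ := B (f' (γ k))) (s := Metric.ball (γ k) ε) (x := γ k) (y := δ k)
    (fun x _ ↦ (hf x).hasFDerivWithinAt) hb (convex_ball _ _) (Metric.mem_ball_self hε) hk
  refine this.trans ?_
  gcongr
  exact (δ - γ).norm_coe_le_norm k

/-- Induction on `n`: the derivative of the composition operator of `f` is a continuous linear
operator applied to the composition operator of `fderiv ℝ f`. The target space is quantified inside
the induction because it changes from `F` to `E →L[ℝ] F`; the common universe keeps the latter
within range. -/
theorem contDiff_nat_comp_left {E : Type u} [NormedAddCommGroup E] [NormedSpace ℝ E] (n : ℕ) :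
    ∀ {F : Type u} [NormedAddCommGroup F] [NormedSpace ℝ F] (f : C(E, F)),
      ContDiff ℝ ∞ f → ContDiff ℝ n (fun δ : C(K, E) ↦ f.comp δ) := by
  induction n with
  | zero =>
    intro F _ _ f hf
    exact contDiff_zero.2 (ContinuousMap.continuous_postcomp f)
  | succ n ih =>
    intro F _ _ f hf
    have hf' := (contDiff_infty_iff_fderiv.1 hf)
    let f' : C(E, E →L[ℝ] F) := ⟨fderiv ℝ f, hf'.2.continuous⟩
    have hd := hasFDerivAt_comp_left (K := K) (.id ℝ (E →L[ℝ] F)) (f := f) (f' := f')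
      (fun x ↦ (hf'.1 x).hasFDerivAt)
    push_cast
    rw [contDiff_succ_iff_fderiv]
    refine ⟨fun γ ↦ (hd γ).differentiableAt, by simp, ?_⟩
    rw [show fderiv ℝ (fun δ : C(K, E) ↦ f.comp δ) = fun γ ↦ pointwise (.id ℝ (E →L[ℝ] F)) (f'.comp γ) from
      funext fun γ ↦ (hd γ).fderiv]
    exact (pointwise (.id ℝ (E →L[ℝ] F))).contDiff.comp (ih f' hf'.2)

/-- The composition operator of a smooth map on spaces of continuous functions is smooth. -/
theorem contDiff_comp_left {E F : Type u} [NormedAddCommGroup E] [NormedSpace ℝ E]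
    [NormedAddCommGroup F] [NormedSpace ℝ F] (f : C(E, F)) (hf : ContDiff ℝ ∞ f) :
    ContDiff ℝ ∞ (fun δ : C(K, E) ↦ f.comp δ) :=
  contDiff_infty.2 fun n ↦ contDiff_nat_comp_left n f hf

end CompositionOperator

/-! ### The Volterra integral operator. -/

section Volterra

variable {E : Type*} [NormedAddCommGroup E] [NormedSpace ℝ E] [CompleteSpace E]

/-- The compact time interval on which the curves are defined. -/
abbrev TimeInterval : Type := Icc (-2 : ℝ) 2

theorem neg_two_le_two : (-2 : ℝ) ≤ 2 := by norm_num

/-- The primitive, vanishing at time zero, of a continuous function. -/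
noncomputable def primitive (γ : C(TimeInterval, E)) (s : ℝ) : E :=
  ∫ u in (0 : ℝ)..s, γ (projIcc (-2) 2 neg_two_le_two u)

/-- The projection to the interval extends `γ` continuously to the line, so the fundamental theorem
of calculus applies at every real time. -/
theorem hasDerivAt_primitive (γ : C(TimeInterval, E)) (s : ℝ) :
    HasDerivAt (primitive γ) (γ (projIcc (-2) 2 neg_two_le_two s)) s := by
  have hc : Continuous fun u ↦ γ (projIcc (-2) 2 neg_two_le_two u) :=
    γ.continuous.comp continuous_projIcc
  exact intervalIntegral.integral_hasDerivAt_right (hc.intervalIntegrable _ _)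
    (hc.stronglyMeasurableAtFilter _ _) hc.continuousAt

/-- The Volterra operator. -/
noncomputable def volterra : C(TimeInterval, E) →L[ℝ] C(TimeInterval, E) :=
  LinearMap.mkContinuous
    { toFun := fun γ ↦ ⟨fun s ↦ primitive γ s,
        (continuous_iff_continuousAt.2 fun s ↦ (hasDerivAt_primitive γ s).continuousAt).comp
          continuous_subtype_val⟩
      map_add' := fun γ δ ↦ by
        ext s
        have hc : ∀ γ : C(TimeInterval, E), Continuous fun u ↦ γ (projIcc (-2) 2 neg_two_le_two u) :=
          fun γ ↦ γ.continuous.comp continuous_projIcc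
        exact intervalIntegral.integral_add ((hc γ).intervalIntegrable _ _)
          ((hc δ).intervalIntegrable _ _)
      map_smul' := fun a γ ↦ by
        ext s
        exact intervalIntegral.integral_smul _ _ } 2 (by
    intro γ
    rw [ContinuousMap.norm_le _ (by positivity)]
    intro s
    have := intervalIntegral.norm_integral_le_of_norm_le_const (a := (0 : ℝ)) (b := s) (C := ‖γ‖)
      (f := fun u ↦ γ (projIcc (-2) 2 neg_two_le_two u)) fun u _ ↦ γ.norm_coe_le_norm _
    refine this.trans ?_
    rw [sub_zero, mul_comm]
    gcongr
    exact abs_le.2 s.2)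

end Volterra

/-! ### Local flows by the inverse function theorem. -/

section LocalFlow

universe u
variable {E : Type u} [NormedAddCommGroup E] [NormedSpace ℝ E] [CompleteSpace E]

/-- The map whose zeros, in the last component, are the solutions of the integral equation. -/
noncomputable def picardMap (f : C(E, E)) (q : ℝ × E × C(TimeInterval, E)) :
    ℝ × E × C(TimeInterval, E) :=
  (q.1, q.2.1, q.2.2 - ContinuousLinearMap.const ℝ TimeInterval q.2.1 -
    q.1 • volterra (f.comp q.2.2))

theorem contDiff_picardMap {f : C(E, E)} (hf : ContDiff ℝ ∞ f) : ContDiff ℝ ∞ (picardMap f) := by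
  have h1 : ContDiff ℝ ∞ (fun q : ℝ × E × C(TimeInterval, E) ↦ volterra (f.comp q.2.2)) :=
    volterra.contDiff.comp ((contDiff_comp_left f hf).comp (contDiff_snd.comp contDiff_snd))
  have h2 : ContDiff ℝ ∞ (fun q : ℝ × E × C(TimeInterval, E) ↦
      ContinuousLinearMap.const ℝ TimeInterval q.2.1) :=
    (ContinuousLinearMap.const ℝ TimeInterval : E →L[ℝ] C(TimeInterval, E)).contDiff.comp
      (contDiff_fst.comp contDiff_snd)
  exact contDiff_fst.prodMk ((contDiff_fst.comp contDiff_snd).prodMk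
    (((contDiff_snd.comp contDiff_snd).sub h2).sub (contDiff_fst.smul h1)))

/-- The linear automorphism `(ε, x, γ) ↦ (ε, x, γ - x - ε δ)`. -/
noncomputable def shearEquiv (δ : C(TimeInterval, E)) :
    (ℝ × E × C(TimeInterval, E)) ≃L[ℝ] (ℝ × E × C(TimeInterval, E)) :=
  .equivOfInverse
    ((ContinuousLinearMap.fst ℝ _ _).prod (((ContinuousLinearMap.fst ℝ _ _).comp
      (ContinuousLinearMap.snd ℝ _ _)).prod (((ContinuousLinearMap.snd ℝ _ _).comp
      (ContinuousLinearMap.snd ℝ _ _)) - (ContinuousLinearMap.const ℝ TimeInterval).comp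
        ((ContinuousLinearMap.fst ℝ _ _).comp (ContinuousLinearMap.snd ℝ _ _)) -
        (ContinuousLinearMap.fst ℝ _ _).smulRight δ)))
    ((ContinuousLinearMap.fst ℝ _ _).prod (((ContinuousLinearMap.fst ℝ _ _).comp
      (ContinuousLinearMap.snd ℝ _ _)).prod (((ContinuousLinearMap.snd ℝ _ _).comp
      (ContinuousLinearMap.snd ℝ _ _)) + (ContinuousLinearMap.const ℝ TimeInterval).comp
        ((ContinuousLinearMap.fst ℝ _ _).comp (ContinuousLinearMap.snd ℝ _ _)) +
        (ContinuousLinearMap.fst ℝ _ _).smulRight δ)))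
    (fun q ↦ Prod.ext rfl (Prod.ext rfl (by simp; abel)))
    (fun q ↦ Prod.ext rfl (Prod.ext rfl (by simp; abel)))

/-- At `ε = 0` the product `ε • volterra (f ∘ γ)` contributes only through its `ε` derivative. The
derivative of the whole map is therefore a shear, which is invertible without any smallness
assumption on `f`; this is what the scaling parameter is for. -/
theorem hasFDerivAt_picardMap {f : C(E, E)} (hf : ContDiff ℝ ∞ f) (x₀ : E) :
    HasFDerivAt (picardMap f)
      (shearEquiv (volterra (f.comp (ContinuousLinearMap.const ℝ TimeInterval x₀))) :
        (ℝ × E × C(TimeInterval, E)) →L[ℝ] (ℝ × E × C(TimeInterval, E)))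
      (0, x₀, ContinuousLinearMap.const ℝ TimeInterval x₀) := by
  set q₀ : ℝ × E × C(TimeInterval, E) := (0, x₀, ContinuousLinearMap.const ℝ TimeInterval x₀)
  have h1 : DifferentiableAt ℝ
      (fun q : ℝ × E × C(TimeInterval, E) ↦ volterra (f.comp q.2.2)) q₀ :=
    ((volterra (E := E)).contDiff.comp ((contDiff_comp_left f hf).comp
      (contDiff_snd.comp contDiff_snd)) : ContDiff ℝ ∞ _).differentiable (by simp) q₀
  have h2 := (hasFDerivAt_fst (𝕜 := ℝ) (p := q₀)).smul h1.hasFDerivAt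
  have h3 := (((ContinuousLinearMap.snd ℝ _ _).comp (ContinuousLinearMap.snd ℝ _ _)) -
    (ContinuousLinearMap.const ℝ TimeInterval).comp
        ((ContinuousLinearMap.fst ℝ E _).comp
          (ContinuousLinearMap.snd ℝ ℝ (E × C(TimeInterval, E))))).hasFDerivAt (x := q₀)
  have h4 := (hasFDerivAt_fst (𝕜 := ℝ) (p := q₀)).prodMk
    (((hasFDerivAt_fst (𝕜 := ℝ)).comp q₀ (hasFDerivAt_snd (𝕜 := ℝ) (p := q₀))).prodMk
      (h3.sub h2))
  refine h4.congr_fderiv ?_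
  ext q <;> simp [shearEquiv, q₀]

/-- Solutions of the integral equation depend smoothly on the parameters. -/
theorem exists_smooth_solution {f : C(E, E)} (hf : ContDiff ℝ ∞ f) (x₀ : E) :
    ∃ Γ : ℝ × E → C(TimeInterval, E), ContDiffAt ℝ ∞ Γ (0, x₀) ∧
      Γ (0, x₀) = ContinuousLinearMap.const ℝ TimeInterval x₀ ∧
      ∀ᶠ q in 𝓝 (0, x₀), Γ q = ContinuousLinearMap.const ℝ TimeInterval q.2 +
        q.1 • volterra (f.comp (Γ q)) := by
  set q₀ : ℝ × E × C(TimeInterval, E) := (0, x₀, ContinuousLinearMap.const ℝ TimeInterval x₀)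
    with hq₀
  have h1 := (contDiff_picardMap hf).contDiffAt (x := q₀)
  have h2 := hasFDerivAt_picardMap hf x₀
  have hn : (∞ : WithTop ℕ∞) ≠ 0 := by simp
  set e := h1.toOpenPartialHomeomorph (picardMap f) h2 hn with he
  have hp : picardMap f q₀ = (0, x₀, 0) := by simp [picardMap, hq₀]
  have h3 : ContDiffAt ℝ ∞ e.symm (0, x₀, 0) := hp ▸ h1.to_localInverse h2 hn
  have h4 : e.symm (0, x₀, 0) = q₀ := hp ▸ h1.localInverse_apply_image h2 hn
  have h5 : (0, x₀, 0) ∈ e.target := hp ▸ h1.image_mem_toOpenPartialHomeomorph_target h2 hn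
  -- The first two components of `picardMap` are the parameters themselves, so its local inverse at
  -- `(ε, x, 0)` has the solution for the parameters `(ε, x)` as last component.
  let ι : ℝ × E → ℝ × E × C(TimeInterval, E) := fun q ↦ (q.1, q.2, 0)
  have hι : ContDiff ℝ ∞ ι := contDiff_fst.prodMk (contDiff_snd.prodMk contDiff_const)
  refine ⟨fun q ↦ (e.symm (ι q)).2.2, ?_, by change (e.symm (0, x₀, 0)).2.2 = _; rw [h4], ?_⟩
  · exact contDiff_snd.contDiffAt.comp _ (contDiff_snd.contDiffAt.comp _
      (ContDiffAt.comp (0, x₀) (g := e.symm) h3 hι.contDiffAt))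
  · filter_upwards [hι.continuous.continuousAt.preimage_mem_nhds (e.open_target.mem_nhds h5)]
      with q hq
    have h6 : picardMap f (e.symm (ι q)) = ι q := e.right_inv hq
    have h7 : (e.symm (ι q)).1 = q.1 := congrArg Prod.fst h6
    have h8 : (e.symm (ι q)).2.1 = q.2 := congrArg (fun z ↦ z.2.1) h6
    have h9 : (picardMap f (e.symm (ι q))).2.2 = 0 := congrArg (fun z ↦ z.2.2) h6
    rw [picardMap, h7, h8] at h9
    rw [sub_sub, sub_eq_zero] at h9
    exact h9

/-- A smooth local flow, rescaled so that its curves are defined beyond time one. -/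
theorem exists_smooth_localFlow {f : E → E} (hf : ContDiff ℝ ∞ f) (x₀ : E) {U : Set E}
    (hU : U ∈ 𝓝 x₀) :
    ∃ ψ : ℝ × E → E, ContDiffAt ℝ ∞ ψ (0, x₀) ∧ ψ (0, x₀) = x₀ ∧ ∀ᶠ q in 𝓝 (0, x₀),
      ∃ c : ℝ → E, c 0 = q.2 ∧ c 1 = ψ q ∧ ∀ s ∈ Ioo (-2 : ℝ) 2, c s ∈ U ∧
        HasDerivAt c (q.1 • f (c s)) s := by
  obtain ⟨Γ, hΓ, hΓ₀, hΓe⟩ := exists_smooth_solution (f := ⟨f, hf.continuous⟩) hf x₀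
  let F : C(E, E) := ⟨f, hf.continuous⟩
  let one : TimeInterval := ⟨1, by norm_num, by norm_num⟩
  have hev : ContDiff ℝ ∞ (fun γ : C(TimeInterval, E) ↦ γ one) :=
    (ContinuousMap.evalCLM ℝ one : C(TimeInterval, E) →L[ℝ] E).contDiff
  refine ⟨fun q ↦ Γ q one, hev.contDiffAt.comp _ hΓ, by beta_reduce; rw [hΓ₀]; rfl, ?_⟩
  obtain ⟨δ, hδ, hball⟩ := Metric.mem_nhds_iff.1 hU
  -- Continuity of `Γ` in the supremum norm keeps the whole curve in the ball, at all times at once.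
  have hcont := hΓ.continuousAt.preimage_mem_nhds (Metric.ball_mem_nhds _ hδ)
  filter_upwards [hΓe, hcont] with q hq hq'
  have hq1 : ∀ s : TimeInterval, Γ q s = q.2 + q.1 • primitive (F.comp (Γ q)) s := fun s ↦
    congrArg (fun γ : C(TimeInterval, E) ↦ γ s) hq
  refine ⟨fun s ↦ q.2 + q.1 • primitive (F.comp (Γ q)) s, by simp [primitive], (hq1 one).symm,
    fun s hs ↦ ?_⟩
  have hs' : s ∈ Icc (-2 : ℝ) 2 := Ioo_subset_Icc_self hs
  have e1 := hq1 ⟨s, hs'⟩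
  beta_reduce
  rw [← e1]
  constructor
  · apply hball
    have h2 : dist (Γ q ⟨s, hs'⟩) (Γ (0, x₀) ⟨s, hs'⟩) < δ :=
      lt_of_le_of_lt (ContinuousMap.dist_apply_le_dist _) hq'
    rw [hΓ₀] at h2
    exact h2
  · have h3 := ((hasDerivAt_primitive (F.comp (Γ q)) s).const_smul q.1).const_add q.2
    rw [projIcc_of_mem _ hs'] at h3
    exact h3

end LocalFlow

/-! ### Charts as local diffeomorphisms. -/

section Boundaryless

variable {E : Type*} [NormedAddCommGroup E] [NormedSpace ℝ E] {H : Type*} [TopologicalSpace H]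
  {I : ModelWithCorners ℝ E H} {M : Type*} [TopologicalSpace M] [ChartedSpace H M]
  [IsManifold I ∞ M] [I.Boundaryless]

theorem isLocalDiffeomorphAt_extChartAt_symm (x₀ : M) {y : E} (hy : y ∈ (extChartAt I x₀).target) :
    IsLocalDiffeomorphAt 𝓘(ℝ, E) I ∞ (extChartAt I x₀).symm y :=
  .of_open (g := extChartAt I x₀) (U := (extChartAt I x₀).target) (W := (extChartAt I x₀).source)
    (isOpen_extChartAt_target x₀) (isOpen_extChartAt_source x₀)
    (fun _ h ↦ (extChartAt I x₀).map_target h) (fun _ h ↦ (extChartAt I x₀).map_source h)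
    (fun _ h ↦ (extChartAt I x₀).right_inv h) (fun _ h ↦ (extChartAt I x₀).left_inv h)
    (contMDiffOn_extChartAt_symm x₀)
    (by rw [extChartAt_source]; exact contMDiffOn_extChartAt) hy

end Boundaryless

/-! ### Smoothness of the flow of a complete vector field. -/

section Flow

set_option linter.unusedSectionVars false

universe u
variable {E : Type u} [NormedAddCommGroup E] [NormedSpace ℝ E] [FiniteDimensional ℝ E]

/-- A locally defined smooth map agrees near a point with a globally defined one. -/
theorem exists_contDiff_eventuallyEq {F : Type*} [NormedAddCommGroup F] [NormedSpace ℝ F]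
    {f₀ : E → F} {x₀ : E} (h : ∀ᶠ y in 𝓝 x₀, ContDiffAt ℝ ∞ f₀ y) :
    ∃ f : E → F, ContDiff ℝ ∞ f ∧ f =ᶠ[𝓝 x₀] f₀ := by
  obtain ⟨δ, hδ, hball⟩ := Metric.mem_nhds_iff.1 h
  -- The outer radius `δ / 2` leaves a margin: near each point outside the ball of radius `δ` the
  -- bump vanishes identically, so `f₀` need not be smooth there.
  let χ : ContDiffBump x₀ := ⟨δ / 4, δ / 2, by positivity, by linarith⟩
  refine ⟨fun y ↦ χ y • f₀ y, contDiff_iff_contDiffAt.2 fun y ↦ ?_, ?_⟩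
  · by_cases hy : y ∈ Metric.ball x₀ δ
    · exact χ.contDiffAt.smul (hball hy)
    · have hev : (fun y ↦ χ y • f₀ y) =ᶠ[𝓝 y] fun _ ↦ 0 := by
        have ho : IsOpen {z : E | δ / 2 < dist z x₀} :=
          isOpen_lt continuous_const (continuous_id.dist continuous_const)
        have hy' : y ∈ {z : E | δ / 2 < dist z x₀} := by
          rw [Metric.mem_ball, not_lt] at hy
          exact lt_of_lt_of_le (by linarith) hy
        filter_upwards [ho.mem_nhds hy'] with z hz
        rw [χ.zero_of_le_dist (le_of_lt hz), zero_smul]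
      exact contDiffAt_const.congr_of_eventuallyEq hev
  · filter_upwards [χ.eventuallyEq_one] with y hy
    rw [hy, Pi.one_apply, one_smul]

variable {H : Type*} [TopologicalSpace H]
  {I : ModelWithCorners ℝ E H} {M : Type*} [TopologicalSpace M] [ChartedSpace H M]
  [IsManifold I ∞ M] [I.Boundaryless] [T2Space M]
  {v : ∀ x : M, TangentSpace I x} {φ : ℝ × M → M}

/-- As functions of `s` both sides are integral curves, and they agree at `s = 0`. -/
theorem flow_add (hv : ContMDiff I I.tangent ∞ (fun x ↦ (⟨x, v x⟩ : TangentBundle I M)))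
    (hφ : ∀ p, IsMIntegralCurve (fun t ↦ φ (t, p)) v) (h₀ : ∀ p, φ (0, p) = p) (s t : ℝ) (p : M) :
    φ (s + t, p) = φ (s, φ (t, p)) := by
  have : IsManifold I 1 M := IsManifold.of_le (n := ∞) (by simp)
  have h1 := (hφ p).comp_add t
  have h2 := hφ (φ (t, p))
  have := isMIntegralCurve_Ioo_eq_of_contMDiff_boundaryless (t₀ := 0) (hv.of_le (by simp)) h1 h2
    (by simp [h₀])
  exact congrFun this s

/-- In a chart, with the field cut off to a global one, the time one value `ψ (ε, x)` of the
solution of `c' = ε f(c)` depends smoothly on `ε` and `x`. By rescaling of time it is the flow for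
the time `ε`, and uniqueness of integral curves identifies it with `φ`. -/
theorem contMDiffAt_flow_zero
    (hv : ContMDiff I I.tangent ∞ (fun x ↦ (⟨x, v x⟩ : TangentBundle I M)))
    (hφ : ∀ p, IsMIntegralCurve (fun t ↦ φ (t, p)) v) (h₀ : ∀ p, φ (0, p) = p) (p₀ : M) :
    ContMDiffAt (𝓘(ℝ, ℝ).prod I) I ∞ φ (0, p₀) := by
  have : IsManifold I 1 M := IsManifold.of_le (n := ∞) (by simp)
  set e := extChartAt I p₀ with he
  have hx : e p₀ ∈ e.target := mem_extChartAt_target p₀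
  have hld := isLocalDiffeomorphAt_extChartAt_symm (I := I) p₀ hx
  let f₀ : E → E := VectorField.mpullback 𝓘(ℝ, E) I e.symm v
  have hf₀ : ∀ᶠ y in 𝓝 (e p₀), ContDiffAt ℝ ∞ f₀ y :=
    smoothNear_vectorSpace_iff.1 (SmoothNear.mpullback hld (.of_forall fun x ↦ hv x))
  obtain ⟨f, hf, hff⟩ := exists_contDiff_eventuallyEq hf₀
  have hU : {y | y ∈ e.target ∧ f y = f₀ y} ∈ 𝓝 (e p₀) :=
    inter_mem ((isOpen_extChartAt_target p₀).mem_nhds hx) hff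
  obtain ⟨ψ, hψ, hψ₀, hψc⟩ := exists_smooth_localFlow hf (e p₀) hU
  have hι : ContMDiffAt (𝓘(ℝ, ℝ).prod I) 𝓘(ℝ, ℝ × E) ∞ (fun q : ℝ × M ↦ (q.1, e q.2)) (0, p₀) :=
    contMDiffAt_fst.prodMk_space ((contMDiffAt_extChartAt (I := I) (x := p₀)).comp _ contMDiffAt_snd)
  have h1 : ContMDiffAt (𝓘(ℝ, ℝ).prod I) I ∞ (fun q : ℝ × M ↦ e.symm (ψ (q.1, e q.2))) (0, p₀) := by
    have h2 : ContMDiffAt (𝓘(ℝ, ℝ).prod I) 𝓘(ℝ, E) ∞ (fun q : ℝ × M ↦ ψ (q.1, e q.2)) (0, p₀) :=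
      hψ.contMDiffAt.comp (f := fun q : ℝ × M ↦ (q.1, e q.2)) (0, p₀) hι
    have h3 : ContMDiffAt 𝓘(ℝ, E) I ∞ e.symm (ψ ((0 : ℝ), e p₀)) := by
      rw [hψ₀]; exact hld.contMDiffAt
    exact ContMDiffAt.comp (g := e.symm) (f := fun q : ℝ × M ↦ ψ (q.1, e q.2)) (0, p₀) h3 h2
  refine h1.congr_of_eventuallyEq ?_
  have hsrc : ∀ᶠ q : ℝ × M in 𝓝 (0, p₀), q.2 ∈ e.source :=
    continuous_snd.continuousAt.preimage_mem_nhds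
      ((isOpen_extChartAt_source p₀).mem_nhds (mem_extChartAt_source p₀))
  filter_upwards [hι.continuousAt.eventually hψc, hsrc] with q ⟨c, hc0, hc1, hc⟩ hq
  have h3 : IsMIntegralCurveOn (e.symm ∘ c) (q.1 • v) (Ioo (-2) 2) := by
    intro s hs
    obtain ⟨⟨hs1, hs2⟩, hs3⟩ := hc s hs
    have hl := isLocalDiffeomorphAt_extChartAt_symm (I := I) p₀ hs1
    have h4 : HasMFDerivAt 𝓘(ℝ, ℝ) 𝓘(ℝ, E) c s
      (ContinuousLinearMap.smulRight (1 : ℝ →L[ℝ] ℝ) (q.1 • f (c s))) :=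
      hs3.hasFDerivAt.hasMFDerivAt
    have h5 := (hl.contMDiffAt.mdifferentiableAt (by simp)).hasMFDerivAt.comp s h4
    refine (h5.congr_mfderiv ?_).hasMFDerivWithinAt
    ext
    have h6 : mfderiv 𝓘(ℝ, E) I e.symm (c s) (f₀ (c s)) = v (e.symm (c s)) := hl.apply_inverse _
    change mfderiv 𝓘(ℝ, E) I e.symm (c s) ((1 : ℝ) • (q.1 • f (c s))) =
      (1 : ℝ) • (q.1 • v (e.symm (c s)))
    rw [hs2, one_smul, one_smul, ← h6]
    exact ContinuousLinearMap.map_smul _ _ _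
  -- The curve `s ↦ φ (s * q.1, q.2)` is an integral curve of the same rescaled field.
  have h4 := ((hφ q.2).comp_mul q.1).isMIntegralCurveOn (Ioo (-2) 2)
  have hv' : ContMDiff I I.tangent 1 (fun x ↦ (⟨x, (q.1 • v) x⟩ : TangentBundle I M)) :=
    (ContMDiff.const_smul_section (a := q.1) hv).of_le (by simp)
  have h5 := isMIntegralCurveOn_Ioo_eqOn_of_contMDiff_boundaryless (t₀ := 0)
    (by norm_num) hv' h4 h3
    (by
      simp only [Function.comp_apply, zero_mul, h₀, hc0]
      exact (e.left_inv hq).symm)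
  -- The value of interest is at time one, an interior point of the interval of uniqueness.
  have h6 := h5 (x := 1) (by norm_num)
  simp only [Function.comp_apply, one_mul, hc1] at h6
  exact h6

/-- The flow of a complete smooth vector field is smooth. -/
theorem contMDiff_flow
    (hv : ContMDiff I I.tangent ∞ (fun x ↦ (⟨x, v x⟩ : TangentBundle I M)))
    (hφ : ∀ p, IsMIntegralCurve (fun t ↦ φ (t, p)) v) (h₀ : ∀ p, φ (0, p) = p) :
    ContMDiff (𝓘(ℝ, ℝ).prod I) I ∞ φ := by
  -- For finite `n`, smoothness of order `n` at a point is an open condition, which fails for order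
  -- `∞`. The connectedness argument below relies on this openness.
  refine contMDiff_infty.2 fun n ↦ ?_
  have : IsManifold I n M := IsManifold.of_le (n := ∞) (by exact_mod_cast le_top)
  have hn : (n : WithTop ℕ∞) ≠ ∞ := by exact_mod_cast WithTop.coe_ne_top
  have hloc : ∀ p₀, ∀ᶠ q in 𝓝 ((0 : ℝ), p₀), ContMDiffAt (𝓘(ℝ, ℝ).prod I) I n φ q := fun p₀ ↦
    (contMDiffAt_iff_contMDiffAt_nhds hn).1
      ((contMDiffAt_flow_zero hv hφ h₀ p₀).of_le (by exact_mod_cast le_top))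
  rintro ⟨t₁, p₀⟩
  -- For fixed `p₀`, the set of the times at which the flow is smooth is open, closed and contains
  -- zero.
  have hcl : IsClopen {t : ℝ | ContMDiffAt (𝓘(ℝ, ℝ).prod I) I n φ (t, p₀)} := by
    constructor
    · refine isClosed_of_closure_subset fun t ht ↦ ?_
      have h1 := hloc (φ (t, p₀))
      have hc : Continuous fun s ↦ (t - s, φ (s, p₀)) :=
        (continuous_const.sub continuous_id).prodMk (hφ p₀).continuous
      have h2 : ∀ᶠ s in 𝓝 t, ContMDiffAt (𝓘(ℝ, ℝ).prod I) I n φ (t - s, φ (s, p₀)) :=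
        hc.continuousAt.eventually (by beta_reduce; rw [sub_self]; exact h1)
      -- A good time `s` so close to `t` that the remaining time `t - s` is covered by smoothness
      -- near time zero at `φ (t, p₀)`. The group law `φ_t = φ_{t-s} ∘ φ_s` then gives smoothness at
      -- `t`.
      obtain ⟨s, hs1, hs2⟩ := mem_closure_iff_nhds.1 ht _ h2
      have h3 : ContMDiffAt (𝓘(ℝ, ℝ).prod I) (𝓘(ℝ, ℝ).prod I) n
          (fun q : ℝ × M ↦ (q.1 - s, φ (s, q.2))) (t, p₀) := by
        refine (contMDiffAt_fst.sub contMDiffAt_const).prodMk ?_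
        exact ContMDiffAt.comp (g := φ) (f := fun q : ℝ × M ↦ (s, q.2)) (t, p₀) hs2
          (contMDiffAt_const.prodMk contMDiffAt_snd)
      have h4 := ContMDiffAt.comp (g := φ) (f := fun q : ℝ × M ↦ (q.1 - s, φ (s, q.2))) (t, p₀) hs1 h3
      refine h4.congr_of_eventuallyEq (.of_forall fun q ↦ ?_)
      rw [Function.comp_apply, ← flow_add hv hφ h₀, sub_add_cancel]
    · refine isOpen_iff_mem_nhds.2 fun t ht ↦ ?_
      have := (contMDiffAt_iff_contMDiffAt_nhds hn).1 ht
      exact (Continuous.prodMk_left p₀).continuousAt.eventually this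
  have := hcl.eq_univ ⟨0, (hloc p₀).self_of_nhds⟩
  exact eq_univ_iff_forall.1 this t₁

end Flow

set_option maxSynthPendingDepth 3

/-! ### Unit vectors and the Levi-Civita connection in coordinates. -/

section LocalUnitBundle

variable {W : Type*} [NormedAddCommGroup W] [NormedSpace ℝ W]

/-- The Christoffel symbols of the first kind of a metric on an open set of the plane. -/
noncomputable def localChristoffel (G : W → W →L[ℝ] W →L[ℝ] ℝ) (x a u w : W) : ℝ :=
  (fderiv ℝ G x a u w + fderiv ℝ G x u a w - fderiv ℝ G x w a u) / 2

/-- The covariant derivative of the vector field `v` in the direction `ζ`, paired with `w`. -/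
noncomputable def localCov (G : W → W →L[ℝ] W →L[ℝ] ℝ) (v : W × ℝ → W)
    (z ζ : W × ℝ) (w : W) : ℝ :=
  G z.1 (fderiv ℝ v z ζ) w + localChristoffel G z.1 ζ.1 (v z) w

/-- The horizontal lift of `u` to the parameter space of unit vectors. -/
noncomputable def horLift (G : W → W →L[ℝ] W →L[ℝ] ℝ) (v : W × ℝ → W)
    (z : W × ℝ) (u : W) : W × ℝ :=
  (u, -(localCov G v z (u, 0) (paramDeriv v z) / G z.1 (paramDeriv v z) (paramDeriv v z)))

/-- Near `z₀`, the map `v` parametrises the unit tangent vectors of the metric `G`. -/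
structure LocalUnitBundle (G : W → W →L[ℝ] W →L[ℝ] ℝ) (v : W × ℝ → W)
    (z₀ : W × ℝ) : Prop where
  finrank_eq : Module.finrank ℝ W = 2
  symm : ∀ x u w, G x u w = G x w u
  pos : ∀ᶠ z in 𝓝 z₀, ∀ u, u ≠ 0 → 0 < G z.1 u u
  smooth_metric : ∀ᶠ z in 𝓝 z₀, ContDiffAt ℝ ∞ G z.1
  smooth : ∀ᶠ z in 𝓝 z₀, ContDiffAt ℝ ∞ v z
  unit : ∀ᶠ z in 𝓝 z₀, G z.1 (v z) (v z) = 1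
  param_ne_zero : ∀ᶠ z in 𝓝 z₀, paramDeriv v z ≠ 0

namespace LocalUnitBundle

variable {G : W → W →L[ℝ] W →L[ℝ] ℝ} {v : W × ℝ → W} {z : W × ℝ}

theorem eventually (h : LocalUnitBundle G v z) : ∀ᶠ z' in 𝓝 z, LocalUnitBundle G v z' := by
  filter_upwards [h.pos.eventually_nhds, h.smooth_metric.eventually_nhds, h.smooth.eventually_nhds,
    h.unit.eventually_nhds, h.param_ne_zero.eventually_nhds] with z' h1 h2 h3 h4 h5
  exact ⟨h.finrank_eq, h.symm, h1, h2, h3, h4, h5⟩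

theorem hasFDerivAt_pairing (h : LocalUnitBundle G v z) {A B : W × ℝ → W}
    (hA : DifferentiableAt ℝ A z) (hB : DifferentiableAt ℝ B z) (ζ : W × ℝ) :
    DifferentiableAt ℝ (fun z ↦ G z.1 (A z) (B z)) z ∧
    fderiv ℝ (fun z ↦ G z.1 (A z) (B z)) z ζ = fderiv ℝ G z.1 ζ.1 (A z) (B z) +
      G z.1 (fderiv ℝ A z ζ) (B z) + G z.1 (A z) (fderiv ℝ B z ζ) := by
  have hG : DifferentiableAt ℝ G z.1 := h.smooth_metric.self_of_nhds.differentiableAt (by simp)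
  have h1 : HasFDerivAt (fun z : W × ℝ ↦ G z.1)
      ((fderiv ℝ G z.1).comp (ContinuousLinearMap.fst ℝ W ℝ)) z :=
    hG.hasFDerivAt.comp z hasFDerivAt_fst
  have h2 := (h1.clm_apply hA.hasFDerivAt).clm_apply hB.hasFDerivAt
  refine ⟨h2.differentiableAt, ?_⟩
  rw [h2.fderiv]
  simp
  ring

theorem differentiableAt (h : LocalUnitBundle G v z) : DifferentiableAt ℝ v z :=
  h.smooth.self_of_nhds.differentiableAt (by simp)

theorem fderiv_symm (h : LocalUnitBundle G v z) (a u w : W) :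
    fderiv ℝ G z.1 a u w = fderiv ℝ G z.1 a w u := by
  have hG : DifferentiableAt ℝ G z.1 := h.smooth_metric.self_of_nhds.differentiableAt (by simp)
  have h1 : ∀ u w, fderiv ℝ G z.1 a u w = fderiv ℝ (fun x ↦ G x u w) z.1 a := fun u w ↦ by
    have := ((hG.hasFDerivAt.clm_apply (hasFDerivAt_const u _)).clm_apply (hasFDerivAt_const w _))
    rw [this.fderiv]; simp
  rw [h1, h1]
  simp only [h.symm _ u w]

/-- This is compatibility of the connection with the metric: differentiation is in the direction
`u`, and the symmetry of the symbols in the first two arguments has been used to exchange the roles.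
-/
theorem christoffel_add (h : LocalUnitBundle G v z) (a u w : W) :
    localChristoffel G z.1 a u w + localChristoffel G z.1 w u a = fderiv ℝ G z.1 u a w := by
  rw [localChristoffel, localChristoffel, h.fderiv_symm w u a, h.fderiv_symm u w a,
    h.fderiv_symm a w u]
  ring

/-- The antisymmetric counterpart, which expresses vanishing torsion. It is the part of the
connection that enters the exterior derivative of the tautological form. -/
theorem christoffel_sub (h : LocalUnitBundle G v z) (a u w : W) :
    localChristoffel G z.1 a u w - localChristoffel G z.1 w u a =
      fderiv ℝ G z.1 a u w - fderiv ℝ G z.1 w u a := by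
  rw [localChristoffel, localChristoffel, h.fderiv_symm w u a, h.fderiv_symm u w a,
    h.fderiv_symm a w u]
  ring

theorem christoffel_add_left (a b u w : W) : localChristoffel G z.1 (a + b) u w =
    localChristoffel G z.1 a u w + localChristoffel G z.1 b u w := by
  simp [localChristoffel]; ring

theorem christoffel_smul_left (c : ℝ) (a u w : W) : localChristoffel G z.1 (c • a) u w =
    c * localChristoffel G z.1 a u w := by
  simp [localChristoffel]; ring

theorem christoffel_add_right (a u w w' : W) : localChristoffel G z.1 a u (w + w') =
    localChristoffel G z.1 a u w + localChristoffel G z.1 a u w' := by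
  simp [localChristoffel]; ring

theorem christoffel_smul_right (c : ℝ) (a u w : W) : localChristoffel G z.1 a u (c • w) =
    c * localChristoffel G z.1 a u w := by
  simp [localChristoffel]; ring

theorem cov_add (ζ ζ' : W × ℝ) (w : W) :
    localCov G v z (ζ + ζ') w = localCov G v z ζ w + localCov G v z ζ' w := by
  simp only [localCov, map_add, Prod.fst_add, christoffel_add_left, add_apply]; ring

theorem cov_smul (c : ℝ) (ζ : W × ℝ) (w : W) :
    localCov G v z (c • ζ) w = c * localCov G v z ζ w := by
  simp only [localCov, map_smul, Prod.smul_fst, christoffel_smul_left,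
    smul_apply, smul_eq_mul]; ring

theorem cov_add_right (ζ : W × ℝ) (w w' : W) :
    localCov G v z ζ (w + w') = localCov G v z ζ w + localCov G v z ζ w' := by
  simp only [localCov, map_add, christoffel_add_right]; ring

theorem cov_smul_right (c : ℝ) (ζ : W × ℝ) (w : W) :
    localCov G v z ζ (c • w) = c * localCov G v z ζ w := by
  simp only [localCov, map_smul, christoffel_smul_right, smul_eq_mul]; ring

theorem fderiv_unit (h : LocalUnitBundle G v z) (ζ : W × ℝ) :
    fderiv ℝ G z.1 ζ.1 (v z) (v z) + 2 * G z.1 (fderiv ℝ v z ζ) (v z) = 0 := by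
  have h1 := (h.hasFDerivAt_pairing h.differentiableAt h.differentiableAt ζ).2
  have h2 : (fun z ↦ G z.1 (v z) (v z)) =ᶠ[𝓝 z] fun _ ↦ 1 := h.unit
  rw [h2.fderiv_eq, h.symm _ (v z)] at h1
  simp at h1
  linarith

/-- The derivative of `G (v, v) = 1`: the covariant derivative of a unit vector is orthogonal to it.
-/
theorem cov_vec (h : LocalUnitBundle G v z) (ζ : W × ℝ) : localCov G v z ζ (v z) = 0 := by
  have h1 := h.fderiv_unit ζ
  rw [localCov, localChristoffel, h.fderiv_symm (v z) (ζ.1)]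
  linarith

theorem cov_vertical (c : ℝ) (w : W) :
    localCov G v z (0, c) w = c * G z.1 (paramDeriv v z) w := by
  have : fderiv ℝ v z (0, c) = c • paramDeriv v z := by
    rw [paramDeriv, ← map_smul]; simp
  rw [localCov, this]
  simp [localChristoffel]

theorem inner_param (h : LocalUnitBundle G v z) : G z.1 (paramDeriv v z) (v z) = 0 := by
  have h1 := h.cov_vec (0, 1)
  rwa [cov_vertical, one_mul] at h1

theorem param_pos (h : LocalUnitBundle G v z) :
    0 < G z.1 (paramDeriv v z) (paramDeriv v z) :=
  h.pos.self_of_nhds _ h.param_ne_zero.self_of_nhds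

theorem linearIndependent (h : LocalUnitBundle G v z) :
    LinearIndependent ℝ ![v z, paramDeriv v z] := by
  rw [LinearIndependent.pair_iff]
  intro s t hst
  have h1 := congrArg (G z.1 (v z)) hst
  have h2 := congrArg (G z.1 (paramDeriv v z)) hst
  simp only [map_add, map_smul, smul_eq_mul, map_zero, h.unit.self_of_nhds, h.inner_param,
    h.symm _ (v z) (paramDeriv v z), mul_zero, mul_one, add_zero, zero_add] at h1 h2
  exact ⟨h1, (mul_eq_zero.1 h2).resolve_right h.param_pos.ne'⟩

theorem contDiffAt_paramDeriv (h : LocalUnitBundle G v z) : ContDiffAt ℝ ∞ (paramDeriv v) z :=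
  (h.smooth.self_of_nhds.fderiv_right (m := ∞) (by simp)).clm_apply contDiffAt_const

/-- The derivative of the relation `G (∂v/∂s, v) = 0` in the direction of `s`, along which the
metric does not change. The nonzero right-hand side, the curvature of the unit circle, is what makes
the second bracket of the Engel structure leave the derived distribution. -/
theorem inner_param_param (h : LocalUnitBundle G v z) :
    G z.1 (paramDeriv (paramDeriv v) z) (v z) =
      -G z.1 (paramDeriv v z) (paramDeriv v z) := by
  have h1 := (h.hasFDerivAt_pairing (h.contDiffAt_paramDeriv.differentiableAt (by simp))
    h.differentiableAt (0, 1)).2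
  have h2 : (fun z ↦ G z.1 (paramDeriv v z) (v z)) =ᶠ[𝓝 z] fun _ ↦ 0 :=
    h.eventually.mono fun z' h' ↦ h'.inner_param
  rw [h2.fderiv_eq] at h1
  simp only [fderiv_fun_const, Pi.zero_apply, map_zero, zero_apply, zero_add] at h1
  change 0 = G z.1 (paramDeriv (paramDeriv v) z) (v z) +
    G z.1 (paramDeriv v z) (paramDeriv v z) at h1
  linarith

theorem linearIndependent_param (h : LocalUnitBundle G v z) :
    LinearIndependent ℝ ![paramDeriv v z, paramDeriv (paramDeriv v) z] := by
  rw [LinearIndependent.pair_iff]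
  intro s t hst
  have h1 := congrArg (fun u ↦ G z.1 u (v z)) hst
  simp only [map_add, map_smul, add_apply, smul_apply,
    smul_eq_mul, map_zero, zero_apply, h.inner_param, h.inner_param_param,
    mul_zero, zero_add] at h1
  have ht : t = 0 := by
    refine (mul_eq_zero.1 h1).resolve_right ?_
    have := h.param_pos
    linarith
  refine ⟨?_, ht⟩
  rw [ht, zero_smul, add_zero] at hst
  exact (smul_eq_zero.1 hst).resolve_right h.param_ne_zero.self_of_nhds

theorem decomp (h : LocalUnitBundle G v z) (u : W) :
    u = G z.1 (v z) u • v z +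
      (G z.1 (paramDeriv v z) u / G z.1 (paramDeriv v z) (paramDeriv v z)) • paramDeriv v z := by
  obtain ⟨a, b, rfl⟩ : ∃ a b : ℝ, u = a • v z + b • paramDeriv v z := by
    have hsp := h.linearIndependent.span_eq_top_of_card_eq_finrank (by simp [h.finrank_eq])
    have : u ∈ Submodule.span ℝ (range ![v z, paramDeriv v z]) := hsp ▸ Submodule.mem_top
    rw [Matrix.range_cons, Matrix.range_cons, Matrix.range_empty, union_empty,
      singleton_union, Submodule.mem_span_pair] at this
    obtain ⟨a, b, hab⟩ := this
    exact ⟨a, b, hab.symm⟩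
  have hp := h.param_pos.ne'
  simp only [map_add, map_smul, smul_eq_mul, h.unit.self_of_nhds, h.inner_param,
    h.symm _ (v z) (paramDeriv v z), mul_zero, mul_one, add_zero, zero_add]
  rw [mul_div_cancel_right₀ _ hp]

theorem orthogonal_iff (h : LocalUnitBundle G v z) (u : W) :
    G z.1 (v z) u = 0 ↔ ∃ c : ℝ, u = c • paramDeriv v z := by
  constructor
  · intro h0
    have := h.decomp u
    rw [h0, zero_smul, zero_add] at this
    exact ⟨_, this⟩
  · rintro ⟨c, rfl⟩
    rw [map_smul, h.symm, h.inner_param, smul_zero]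

theorem horLift_fst (u : W) : (horLift G v z u).1 = u := rfl

/-- The covariant derivative is orthogonal to `v` by `cov_vec`, so in dimension two a single pairing
determines it. -/
theorem cov_eq (h : LocalUnitBundle G v z) (ζ : W × ℝ) (w : W) :
    localCov G v z ζ w = (G z.1 (paramDeriv v z) w / G z.1 (paramDeriv v z) (paramDeriv v z)) *
      localCov G v z ζ (paramDeriv v z) := by
  conv_lhs => rw [h.decomp w]
  rw [cov_add_right, cov_smul_right, cov_smul_right, h.cov_vec]
  ring

/-- The vertical component of `horLift` is chosen to cancel the pairing with `∂v/∂s`, and `cov_eq`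
reduces all other pairings to this one. -/
theorem cov_horLift (h : LocalUnitBundle G v z) (u w : W) :
    localCov G v z (horLift G v z u) w = 0 := by
  rw [h.cov_eq]
  have : horLift G v z u = (u, 0) + (0, (horLift G v z u).2) := by ext <;> simp [horLift]
  rw [this, cov_add, cov_vertical, horLift]
  have := h.param_pos.ne'
  field_simp
  simp

theorem eq_zero_of_cov (h : LocalUnitBundle G v z) {ζ : W × ℝ} (h1 : ζ.1 = 0)
    (h2 : localCov G v z ζ (paramDeriv v z) = 0) : ζ = 0 := by
  have e : ζ = (0, ζ.2) := Prod.ext h1 rfl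
  rw [e, cov_vertical] at h2
  rw [e, (mul_eq_zero.1 h2).resolve_right h.param_pos.ne']
  rfl

theorem contDiffAt_fderiv_metric (h : LocalUnitBundle G v z) :
    ContDiffAt ℝ ∞ (fun z : W × ℝ ↦ fderiv ℝ G z.1) z :=
  (h.smooth_metric.self_of_nhds.fderiv_right (m := ∞) (by simp)).comp z contDiffAt_fst

theorem contDiffAt_metric (h : LocalUnitBundle G v z) {A B : W × ℝ → W}
    (hA : ContDiffAt ℝ ∞ A z) (hB : ContDiffAt ℝ ∞ B z) :
    ContDiffAt ℝ ∞ (fun z ↦ G z.1 (A z) (B z)) z :=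
  ((h.smooth_metric.self_of_nhds.comp z contDiffAt_fst).clm_apply hA).clm_apply hB

theorem contDiffAt_cov (h : LocalUnitBundle G v z) {A : W × ℝ → W × ℝ}
    {B : W × ℝ → W} (hA : ContDiffAt ℝ ∞ A z) (hB : ContDiffAt ℝ ∞ B z) :
    ContDiffAt ℝ ∞ (fun z ↦ localCov G v z (A z) (B z)) z := by
  have h1 := h.contDiffAt_fderiv_metric
  have hv := h.smooth.self_of_nhds
  have hv' : ContDiffAt ℝ ∞ (fun z ↦ fderiv ℝ v z (A z)) z :=
    (hv.fderiv_right (m := ∞) (by simp)).clm_apply hA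
  have hA1 : ContDiffAt ℝ ∞ (fun z ↦ (A z).1) z := contDiffAt_fst.comp z hA
  exact (h.contDiffAt_metric hv' hB).add (((((h1.clm_apply hA1).clm_apply hv).clm_apply hB).add
    (((h1.clm_apply hv).clm_apply hA1).clm_apply hB)).sub
    (((h1.clm_apply hB).clm_apply hA1).clm_apply hv) |>.div_const 2)

theorem contDiffAt_horLift (h : LocalUnitBundle G v z) {A : W × ℝ → W}
    (hA : ContDiffAt ℝ ∞ A z) : ContDiffAt ℝ ∞ (fun z ↦ horLift G v z (A z)) z :=
  hA.prodMk (((h.contDiffAt_cov (hA.prodMk contDiffAt_const) h.contDiffAt_paramDeriv).div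
    (h.contDiffAt_metric h.contDiffAt_paramDeriv h.contDiffAt_paramDeriv) h.param_pos.ne').neg)

/-- The exterior derivative of the tautological form. -/
theorem fderiv_form (h : LocalUnitBundle G v z) (ζ ζ' : W × ℝ) :
    fderiv ℝ (fun z ↦ G z.1 (v z) ζ'.1) z ζ - fderiv ℝ (fun z ↦ G z.1 (v z) ζ.1) z ζ' =
      localCov G v z ζ ζ'.1 - localCov G v z ζ' ζ.1 := by
  rw [(h.hasFDerivAt_pairing h.differentiableAt (differentiableAt_const _) ζ).2,
    (h.hasFDerivAt_pairing h.differentiableAt (differentiableAt_const _) ζ').2, localCov, localCov]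
  have := h.christoffel_sub ζ.1 (v z) ζ'.1
  simp only [fderiv_fun_const, Pi.zero_apply, zero_apply, map_zero, add_zero]
  linarith

/-- The covariant derivatives determine the derivative of inner products along geodesics. -/
theorem fderiv_inner (h : LocalUnitBundle G v z) (ζ ζ' : W × ℝ) :
    fderiv ℝ G z.1 (v z) ζ.1 ζ'.1 + G z.1 (fderiv ℝ v z ζ) ζ'.1 + G z.1 ζ.1 (fderiv ℝ v z ζ') =
      localCov G v z ζ ζ'.1 + localCov G v z ζ' ζ.1 := by
  rw [localCov, localCov, h.symm _ ζ.1]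
  have := h.christoffel_add ζ.1 (v z) ζ'.1
  linarith

end LocalUnitBundle

/-- The transformation law of the Christoffel symbols. -/
theorem localChristoffel_transform {G G' : W → W →L[ℝ] W →L[ℝ] ℝ} {T : W → W}
    {x : W} (hT : ContDiffAt ℝ 2 T x) (hG' : DifferentiableAt ℝ G' (T x))
    (hsymm : ∀ x u w, G' x u w = G' x w u)
    (hG : ∀ᶠ y in 𝓝 x, ∀ u w, G y u w = G' (T y) (fderiv ℝ T y u) (fderiv ℝ T y w))
    (hGd : DifferentiableAt ℝ G x) (a u w : W) :
    localChristoffel G x a u w = localChristoffel G' (T x) (fderiv ℝ T x a) (fderiv ℝ T x u)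
      (fderiv ℝ T x w) + G' (T x) (fderiv ℝ (fderiv ℝ T) x a u) (fderiv ℝ T x w) := by
  have hTd : DifferentiableAt ℝ T x := hT.differentiableAt (by simp)
  have hT2 : DifferentiableAt ℝ (fderiv ℝ T) x :=
    (hT.fderiv_right (m := 1) (by norm_num)).differentiableAt (by simp)
  have hD : ∀ a u w, fderiv ℝ G x a u w = fderiv ℝ G' (T x) (fderiv ℝ T x a) (fderiv ℝ T x u)
      (fderiv ℝ T x w) + G' (T x) (fderiv ℝ (fderiv ℝ T) x a u) (fderiv ℝ T x w) +
      G' (T x) (fderiv ℝ T x u) (fderiv ℝ (fderiv ℝ T) x a w) := by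
    intro a u w
    have h1 := ((hGd.hasFDerivAt.clm_apply (hasFDerivAt_const u _)).clm_apply
      (hasFDerivAt_const w _))
    have h2 := ((hG'.hasFDerivAt.comp x hTd.hasFDerivAt).clm_apply
      (hT2.hasFDerivAt.clm_apply (hasFDerivAt_const u _))).clm_apply
      (hT2.hasFDerivAt.clm_apply (hasFDerivAt_const w _))
    have h3 := h1.unique (h2.congr_of_eventuallyEq (hG.mono fun y hy ↦ hy u w))
    have h4 := congrArg (fun L : W →L[ℝ] ℝ ↦ L a) h3
    simp at h4
    linarith
  -- By symmetry of the second derivative of `T`, four of the six terms that contain it cancel in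
  -- the alternating sum; the other two are equal.
  have hs : ∀ a u, fderiv ℝ (fderiv ℝ T) x a u = fderiv ℝ (fderiv ℝ T) x u a := fun a u ↦
    (hT.isSymmSndFDerivAt (by simp)).eq a u
  rw [localChristoffel, localChristoffel, hD, hD, hD, hs u a, hs w a, hs w u,
    hsymm _ (fderiv ℝ (fderiv ℝ T) x a w), hsymm _ (fderiv ℝ T x a) (fderiv ℝ (fderiv ℝ T) x u w)]
  ring

end LocalUnitBundle

/-! ### The unit tangent bundle in charts. -/

section ChartInterface

variable {S : Type*} [TopologicalSpace S] [ChartedSpace Plane S] [IsManifold (𝓡 2) ∞ S]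
  (h : SurfaceMetric S)

/-- The metric in the chart at `x₀`. -/
noncomputable def chartMetric (x₀ : S) (y : Plane) : Plane →L[ℝ] Plane →L[ℝ] ℝ :=
  ((ContinuousLinearMap.precomp ℝ (frameAt (I := 𝓡 2) x₀ ((chartAt Plane x₀).symm y))).comp
    (h.inner ((chartAt Plane x₀).symm y))).comp
      (frameAt (I := 𝓡 2) x₀ ((chartAt Plane x₀).symm y))

theorem chartMetric_symm (x₀ : S) (y u w : Plane) :
    chartMetric h x₀ y u w = chartMetric h x₀ y w u := h.symm _ _ _

/-- The coordinate change between two charts of the surface. -/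
noncomputable def transition (x₀ x₁ : S) (y : Plane) : Plane :=
  chartAt Plane x₁ ((chartAt Plane x₀).symm y)

theorem contDiffAt_transition (x₀ x₁ : S) {y : Plane} (hy : y ∈ (chartAt Plane x₀).target)
    (hy' : (chartAt Plane x₀).symm y ∈ (chartAt Plane x₁).source) :
    ContDiffAt ℝ ∞ (transition x₀ x₁) y := by
  have h1 : ContMDiffAt (𝓡 2) (𝓡 2) ∞ (chartAt Plane x₀).symm y :=
    contMDiffOn_chart_symm.contMDiffAt ((chartAt Plane x₀).open_target.mem_nhds hy)
  have h2 : ContMDiffAt (𝓡 2) (𝓡 2) ∞ (chartAt Plane x₁) ((chartAt Plane x₀).symm y) :=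
    contMDiffOn_chart.contMDiffAt ((chartAt Plane x₁).open_source.mem_nhds hy')
  exact (h2.comp y h1).contDiffAt

theorem coordAt_frameAt_eq (x₀ x₁ : S) {y : Plane} (hy : y ∈ (chartAt Plane x₀).target)
    (hy' : (chartAt Plane x₀).symm y ∈ (chartAt Plane x₁).source) (u : Plane) :
    coordAt x₁ ((chartAt Plane x₀).symm y)
      (frameAt (I := 𝓡 2) x₀ ((chartAt Plane x₀).symm y) u) =
      fderiv ℝ (transition x₀ x₁) y u := by
  have h1 := (tangentBundleCore (𝓡 2) S).coordChange_comp (achart Plane x₀)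
    (achart Plane ((chartAt Plane x₀).symm y)) (achart Plane x₁) ((chartAt Plane x₀).symm y)
    ⟨⟨(chartAt Plane x₀).map_target hy, mem_chart_source _ _⟩, hy'⟩ u
  refine h1.trans ?_
  rw [tangentBundleCore_coordChange_achart]
  have e : extChartAt (𝓡 2) x₀ ((chartAt Plane x₀).symm y) = y := (chartAt Plane x₀).right_inv hy
  rw [e]
  have : range (𝓡 2) = univ := (𝓡 2).range_eq_univ
  rw [this, fderivWithin_univ]
  rfl

theorem inner_eq_chartMetric (x₀ : S) {x : S} (hx : x ∈ (chartAt Plane x₀).source)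
    (u w : TangentSpace (𝓡 2) x) :
    h.inner x u w = chartMetric h x₀ (chartAt Plane x₀ x) (coordAt x₀ x u) (coordAt x₀ x w) := by
  have e : (chartAt Plane x₀).symm (chartAt Plane x₀ x) = x := (chartAt Plane x₀).left_inv hx
  -- The frame depends on the base point through its type, so the base point is replaced by a
  -- variable before it is substituted.
  have key : ∀ x', x' = x → h.inner x' (frameAt (I := 𝓡 2) x₀ x' (coordAt x₀ x u))
      (frameAt (I := 𝓡 2) x₀ x' (coordAt x₀ x w)) = h.inner x u w := by
    rintro _ rfl
    rw [frameAt_coordAt hx, frameAt_coordAt hx]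
  exact (key _ e).symm

theorem chartMetric_transition (x₀ x₁ : S) {y : Plane} (hy : y ∈ (chartAt Plane x₀).target)
    (hy' : (chartAt Plane x₀).symm y ∈ (chartAt Plane x₁).source) (u w : Plane) :
    chartMetric h x₀ y u w = chartMetric h x₁ (transition x₀ x₁ y)
      (fderiv ℝ (transition x₀ x₁) y u) (fderiv ℝ (transition x₀ x₁) y w) := by
  rw [← coordAt_frameAt_eq x₀ x₁ hy hy', ← coordAt_frameAt_eq x₀ x₁ hy hy']
  exact inner_eq_chartMetric h x₁ hy' _ _

theorem contDiffAt_chartMetric (x₀ : S) {y : Plane} (hy : y ∈ (chartAt Plane x₀).target) :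
    ContDiffAt ℝ ∞ (chartMetric h x₀) y := by
  have ho := (chartAt Plane x₀).open_target
  have hc : ∀ u w : Plane, ContDiffOn ℝ ∞ (fun y ↦ chartMetric h x₀ y u w)
      (chartAt Plane x₀).target := by
    intro u w
    have hsec : ∀ u : Plane, ContMDiffOn (𝓡 2) (𝓡 2).tangent ∞ (fun y : Plane ↦
        (⟨(chartAt Plane x₀).symm y, frameAt x₀ ((chartAt Plane x₀).symm y) u⟩ :
          TangentBundle (𝓡 2) S)) (chartAt Plane x₀).target := by
      intro u
      have h1 : ContMDiffOn (M' := ModelProd Plane Plane) (𝓡 2) ((𝓡 2).prod 𝓘(ℝ, Plane)) ∞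
          (fun y : Plane ↦ (y, u)) (chartAt Plane x₀).target :=
        contMDiffOn_model_prodMk contMDiffOn_id contMDiffOn_const
      exact (contMDiffOn_frameAt (I := 𝓡 2) x₀).comp h1 fun y hy ↦ hy
    let : RiemannianBundle (fun x : S ↦ TangentSpace (𝓡 2) x) := ⟨h.toRiemannianMetric⟩
    have := ContMDiffOn.inner_bundle (IM := 𝓡 2) (IB := 𝓡 2) (n := ∞) (F := Plane)
      (E := fun x : S ↦ TangentSpace (𝓡 2) x)
      (b := fun y : Plane ↦ (chartAt Plane x₀).symm y) (v := fun y ↦ frameAt x₀ _ u)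
      (w := fun y ↦ frameAt x₀ _ w) (hsec u) (hsec w)
    exact this.contDiffOn
  -- In finite dimension, smoothness of a family of bilinear forms can be tested on fixed vectors.
  exact (contDiffOn_clm_apply.2 fun u ↦ contDiffOn_clm_apply.2 fun w ↦ hc u w).contDiffAt
    (ho.mem_nhds hy)

theorem chartMetric_pos (x₀ : S) {y : Plane} (hy : y ∈ (chartAt Plane x₀).target) {u : Plane}
    (hu : u ≠ 0) : 0 < chartMetric h x₀ y u u := by
  refine h.pos _ _ fun h0 ↦ hu ?_
  have := coordAt_frameAt (I := 𝓡 2) ((chartAt Plane x₀).map_target hy) u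
  rw [← this]
  exact (congrArg _ h0).trans (map_zero _)

variable {h}

/-- The slope parametrisation of the directions near `p`. -/
noncomputable def chartSlope (p : UnitTangent h) (z : Plane × ℝ) : Plane :=
  slopeVec (tChart p.1 p.1).2 z.2

/-- The coordinates of the unit vectors near `p`. -/
noncomputable def chartVec (p : UnitTangent h) (z : Plane × ℝ) : Plane :=
  (√(chartMetric h p.base z.1 (chartSlope p z) (chartSlope p z)))⁻¹ • chartSlope p z

theorem chartSlope_ne_zero (p : UnitTangent h) (z : Plane × ℝ) : chartSlope p z ≠ 0 :=
  slopeVec_ne_zero p.coord_self_ne_zero _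

theorem contDiff_chartSlope (p : UnitTangent h) : ContDiff ℝ ∞ (chartSlope p) :=
  (contDiff_slopeVec _).comp contDiff_snd

theorem contDiffAt_chartVec (p : UnitTangent h) {z : Plane × ℝ}
    (hz : z.1 ∈ (chartAt Plane p.base).target) : ContDiffAt ℝ ∞ (chartVec p) z := by
  have hG : ContDiffAt ℝ ∞ (fun z : Plane × ℝ ↦ chartMetric h p.base z.1) z :=
    (contDiffAt_chartMetric h p.base hz).comp z contDiffAt_fst
  have hs := (contDiff_chartSlope p).contDiffAt (x := z)
  have hpos := chartMetric_pos h p.base hz (chartSlope_ne_zero p z)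
  exact ((((hG.clm_apply hs).clm_apply hs).sqrt hpos.ne').inv (Real.sqrt_pos.2 hpos).ne').smul hs

theorem eventually_fst_mem_target (p : UnitTangent h) {z : Plane × ℝ}
    (hz : z.1 ∈ (chartAt Plane p.base).target) :
    ∀ᶠ z' in 𝓝 z, z'.1 ∈ (chartAt Plane p.base).target :=
  continuous_fst.continuousAt.eventually ((chartAt Plane p.base).open_target.mem_nhds hz)

/-- The chart of the unit tangent bundle at `p` in the form of a local unit bundle. -/
theorem localUnitBundle (p : UnitTangent h) {z : Plane × ℝ}
    (hz : z.1 ∈ (chartAt Plane p.base).target) :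
    LocalUnitBundle (chartMetric h p.base) (chartVec p) z := by
  have hev := eventually_fst_mem_target p hz
  refine ⟨by simp, chartMetric_symm h _, hev.mono fun z' hz' u hu ↦ chartMetric_pos h _ hz' hu,
    hev.mono fun z' hz' ↦ contDiffAt_chartMetric h _ hz',
    hev.mono fun z' hz' ↦ contDiffAt_chartVec p hz', hev.mono fun z' hz' ↦ ?_,
    hev.mono fun z' hz' ↦ ?_⟩
  · have hpos := chartMetric_pos h p.base hz' (chartSlope_ne_zero p z')
    simp only [chartVec, map_smul, smul_apply, smul_eq_mul]
    have h1 := Real.sq_sqrt hpos.le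
    have h2 := (Real.sqrt_pos.2 hpos).ne'
    field_simp
    exact h1.symm
  · have hpos := chartMetric_pos h p.base hz' (chartSlope_ne_zero p z')
    set r : Plane × ℝ → ℝ := fun z ↦
      (√(chartMetric h p.base z.1 (chartSlope p z) (chartSlope p z)))⁻¹ with hr
    have hr0 : r z' ≠ 0 := inv_ne_zero (Real.sqrt_pos.2 hpos).ne'
    have hs := (contDiff_chartSlope p).contDiffAt (x := z')
    have hG : ContDiffAt ℝ ∞ (fun z : Plane × ℝ ↦ chartMetric h p.base z.1) z' :=
      (contDiffAt_chartMetric h p.base hz').comp z' contDiffAt_fst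
    have hrd : DifferentiableAt ℝ r z' :=
      ((((hG.clm_apply hs).clm_apply hs).sqrt hpos.ne').inv
        (Real.sqrt_pos.2 hpos).ne').differentiableAt (by simp)
    have hsd : HasFDerivAt (chartSlope p) ((ContinuousLinearMap.snd ℝ Plane ℝ).smulRight
        (!₂[-(tChart p.1 p.1).2 1, (tChart p.1 p.1).2 0] : Plane)) z' := by
      have := (hasFDerivAt_snd (𝕜 := ℝ) (p := z')).smul_const
        (!₂[-(tChart p.1 p.1).2 1, (tChart p.1 p.1).2 0] : Plane)
      exact this.const_add _
    have hd : paramDeriv (chartVec p) z' = r z' • (!₂[-(tChart p.1 p.1).2 1, (tChart p.1 p.1).2 0] : Plane)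
        + fderiv ℝ r z' (0, 1) • chartSlope p z' := by
      have := (hrd.hasFDerivAt.smul hsd).fderiv
      change fderiv ℝ (fun z ↦ r z • chartSlope p z) z' (0, 1) = _
      erw [this]
      simp
    intro h0
    rw [hd] at h0
    have hu0 := slopeDen_self p.coord_self_ne_zero
    -- With `u₀` the coordinates of `p`, pairing with `u₀` removes the multiple of the rotated
    -- vector and shows that the derivative of `r` vanishes. Pairing with the rotated vector then
    -- forces `r z' = 0`.
    have h1 := congrArg (slopeDen (tChart p.1 p.1).2) h0
    have h2 := congrArg (slopeNum (tChart p.1 p.1).2) h0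
    simp only [slopeDen, slopeNum, chartSlope, slopeVec] at h1 h2 hu0
    simp at h1 h2
    have h3 : fderiv ℝ r z' (0, 1) = 0 := by
      by_contra hne
      have : fderiv ℝ r z' (0, 1) * ((tChart p.1 p.1).2 0 * (tChart p.1 p.1).2 0 +
        (tChart p.1 p.1).2 1 * (tChart p.1 p.1).2 1) = 0 := by linarith
      exact (mul_ne_zero hne hu0.ne') this
    rw [h3] at h2
    have : r z' * ((tChart p.1 p.1).2 0 * (tChart p.1 p.1).2 0 +
        (tChart p.1 p.1).2 1 * (tChart p.1 p.1).2 1) = 0 := by linarith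
    exact (mul_ne_zero hr0 hu0.ne') this

/-- The local parametrisation of the unit tangent bundle near `p`. -/
noncomputable def param (p : UnitTangent h) : Plane × ℝ → UnitTangent h :=
  (extChartAt unitModel p).symm

theorem mem_extChartAt_target_iff (p : UnitTangent h) {z : Plane × ℝ} :
    z ∈ (extChartAt unitModel p).target ↔ z.1 ∈ (chartAt Plane p.base).target := by
  rw [extChartAt_target]
  have : range unitModel = univ := unitModel.range_eq_univ
  rw [this, inter_univ]
  rfl

theorem val_param (p : UnitTangent h) {z : Plane × ℝ}
    (hz : z.1 ∈ (chartAt Plane p.base).target) :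
    (param p z).val = (tChart p.1).symm (z.1, chartVec p z) :=
  unitParam_val p hz

theorem base_param (p : UnitTangent h) {z : Plane × ℝ}
    (hz : z.1 ∈ (chartAt Plane p.base).target) :
    (param p z).base = (chartAt Plane p.base).symm z.1 :=
  congrArg (fun q : TangentBundle (𝓡 2) S ↦ q.1) (val_param p hz)

theorem base_param_mem (p : UnitTangent h) {z : Plane × ℝ}
    (hz : z.1 ∈ (chartAt Plane p.base).target) :
    (param p z).base ∈ (chartAt Plane p.base).source := by
  rw [base_param p hz]; exact (chartAt Plane p.base).map_target hz

theorem mem_tChart_target (p : UnitTangent h) {z : Plane × ℝ}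
    (hz : z.1 ∈ (chartAt Plane p.base).target) (u : Plane) :
    ((z.1, u) : ModelProd Plane Plane) ∈ (tChart p.1).target :=
  (TangentBundle.mem_chart_target_iff ((z.1, u) : ModelProd Plane Plane) p.1).2 hz

theorem coordAt_vec_param (p : UnitTangent h) {z : Plane × ℝ}
    (hz : z.1 ∈ (chartAt Plane p.base).target) :
    coordAt p.base (param p z).base (param p z).vec = chartVec p z := by
  change (tChart p.1 (param p z).val).2 = _
  rw [val_param p hz, (tChart p.1).right_inv (mem_tChart_target p hz _)]

theorem isLocalDiffeomorphAt_param (p : UnitTangent h) {z : Plane × ℝ}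
    (hz : z.1 ∈ (chartAt Plane p.base).target) :
    IsLocalDiffeomorphAt 𝓘(ℝ, Plane × ℝ) unitModel ∞ (param p) z :=
  isLocalDiffeomorphAt_extChartAt_symm p ((mem_extChartAt_target_iff p).2 hz)

theorem inner_param (p : UnitTangent h) {z : Plane × ℝ}
    (hz : z.1 ∈ (chartAt Plane p.base).target) (u w : TangentSpace (𝓡 2) (param p z).base) :
    h.inner (param p z).base u w =
      chartMetric h p.base z.1 (coordAt p.base _ u) (coordAt p.base _ w) := by
  rw [inner_eq_chartMetric h p.base (base_param_mem p hz)]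
  have : chartAt Plane p.base (param p z).base = z.1 := by
    rw [base_param p hz, (chartAt Plane p.base).right_inv hz]
  rw [this]

variable (h)

/-- The charts of `S¹(TΣ)` record slopes, so smoothness of the inclusion in `TΣ` is not automatic.
It comes from the smooth normalising factor in `chartVec`. -/
theorem contMDiff_val : ContMDiff unitModel (𝓡 2).tangent ∞ (UnitTangent.val (h := h)) := by
  intro p
  have h1 : ContMDiffAt unitModel 𝓘(ℝ, Plane × ℝ) ∞ (extChartAt unitModel p) p :=
    contMDiffAt_extChartAt
  set z₀ := extChartAt unitModel p p with hz₀
  have hz : z₀.1 ∈ (chartAt Plane p.base).target :=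
    (mem_extChartAt_target_iff p).1 (mem_extChartAt_target p)
  have h2 : ContMDiffAt 𝓘(ℝ, Plane × ℝ) (𝓡 2).tangent ∞
      (fun z : Plane × ℝ ↦ (tChart p.1).symm (z.1, chartVec p z)) z₀ := by
    have ho : IsOpen {z : Plane × ℝ | z.1 ∈ (chartAt Plane p.base).target} :=
      (chartAt Plane p.base).open_target.preimage continuous_fst
    have hm : ContMDiffOn (M' := ModelProd Plane Plane) 𝓘(ℝ, Plane × ℝ)
        ((𝓡 2).prod 𝓘(ℝ, Plane)) ∞ (fun z : Plane × ℝ ↦ (z.1, chartVec p z))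
        {z | z.1 ∈ (chartAt Plane p.base).target} :=
      contMDiffOn_model_prodMk contDiff_fst.contMDiff.contMDiffOn
        fun z hz ↦ (contDiffAt_chartVec p hz).contMDiffAt.contMDiffWithinAt
    have hs : ContMDiffOn ((𝓡 2).prod 𝓘(ℝ, Plane)) (𝓡 2).tangent ∞ (tChart p.1).symm
        (tChart p.1).target := contMDiffOn_chart_symm
    exact (hs.comp hm fun z hz ↦ mem_tChart_target p hz _).contMDiffAt (ho.mem_nhds hz)
  refine (h2.comp p h1).congr_of_eventuallyEq ?_
  have hsrc : ∀ᶠ q in 𝓝 p, q ∈ (extChartAt unitModel p).source :=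
    extChartAt_source_mem_nhds p
  filter_upwards [hsrc] with q hq
  have h3 : (extChartAt unitModel p q).1 ∈ (chartAt Plane p.base).target :=
    (mem_extChartAt_target_iff p).1 ((extChartAt unitModel p).map_source hq)
  have h4 := val_param p h3
  rw [param, (extChartAt unitModel p).left_inv hq] at h4
  exact h4

theorem contMDiff_base : ContMDiff unitModel (𝓡 2) ∞ (UnitTangent.base (h := h)) :=
  (contMDiff_proj (fun x : S ↦ TangentSpace (𝓡 2) x)).comp (contMDiff_val h)

end ChartInterface

theorem mfderiv_eq_fderiv_extChartAt {F : Type*} [NormedAddCommGroup F] [NormedSpace ℝ F]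
    {E : Type*} [NormedAddCommGroup E] [NormedSpace ℝ E] {H : Type*} [TopologicalSpace H]
    {I : ModelWithCorners ℝ E H} {M : Type*} [TopologicalSpace M] [ChartedSpace H M]
    {f : F → M} {z : F} (hf : MDifferentiableAt 𝓘(ℝ, F) I f z) :
    mfderiv 𝓘(ℝ, F) I f z = fderiv ℝ (fun z' ↦ extChartAt I (f z) (f z')) z := by
  rw [hf.mfderiv, ModelWithCorners.range_eq_univ, fderivWithin_univ]
  rfl

/-! ### The covariant derivative in charts. -/

section ChartInterface

variable {S : Type*} [TopologicalSpace S] [ChartedSpace Plane S] [IsManifold (𝓡 2) ∞ S]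
  {h : SurfaceMetric S}

theorem coordAt_eq_mfderiv (x₀ : S) {x : S} (hx : x ∈ (chartAt Plane x₀).source) :
    coordAt (I := 𝓡 2) x₀ x = mfderiv (𝓡 2) (𝓡 2) (chartAt Plane x₀) x :=
  (mfderiv_chartAt_eq_tangentCoordChange hx).symm

theorem coordAt_dBase_param (p : UnitTangent h) {z : Plane × ℝ}
    (hz : z.1 ∈ (chartAt Plane p.base).target) (ζ : Plane × ℝ) :
    coordAt p.base (param p z).base
      (dBase (param p z) (mfderiv 𝓘(ℝ, Plane × ℝ) unitModel (param p) z ζ)) = ζ.1 := by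
  have hx := base_param_mem p hz
  have h1 : MDifferentiableAt 𝓘(ℝ, Plane × ℝ) unitModel (param p) z :=
    (isLocalDiffeomorphAt_param p hz).contMDiffAt.mdifferentiableAt (by simp)
  have h2 : MDifferentiableAt unitModel (𝓡 2) UnitTangent.base (param p z) :=
    (contMDiff_base h).contMDiffAt.mdifferentiableAt (by simp)
  have h3 : MDifferentiableAt (𝓡 2) (𝓡 2) (chartAt Plane p.base) (param p z).base :=
    (contMDiffOn_chart.contMDiffAt ((chartAt Plane p.base).open_source.mem_nhds hx)).mdifferentiableAt
      (n := ∞) (by simp)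
  rw [coordAt_eq_mfderiv _ hx, dBase]
  have h4 := (h3.hasMFDerivAt.comp z (h2.hasMFDerivAt.comp z h1.hasMFDerivAt)).mfderiv
  have h5 : (chartAt Plane p.base) ∘ UnitTangent.base ∘ param p =ᶠ[𝓝 z] Prod.fst := by
    filter_upwards [eventually_fst_mem_target p hz] with z' hz'
    rw [Function.comp_apply, Function.comp_apply, base_param p hz',
      (chartAt Plane p.base).right_inv hz']
  have h6 : mfderiv 𝓘(ℝ, Plane × ℝ) (𝓡 2) (Prod.fst : Plane × ℝ → Plane) z =
      ContinuousLinearMap.fst ℝ Plane ℝ := by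
    have := mfderiv_eq_fderiv (𝕜 := ℝ) (f := (Prod.fst : Plane × ℝ → Plane)) (x := z)
    exact this.trans fderiv_fst
  have h7 := h5.mfderiv_eq (I := 𝓘(ℝ, Plane × ℝ)) (I' := 𝓡 2)
  exact congrArg (fun L : Plane × ℝ →L[ℝ] Plane ↦ L ζ) (h4.symm.trans (h7.trans h6))

/-- The derivative `dVal` refers to the chart of `TΣ` at the moving base point, whereas `param p`
uses the one at `p`. The chain rule for the change of charts of `TΣ` accounts for the second
derivative of the transition map. -/
theorem dVal_param (p : UnitTangent h) {z : Plane × ℝ}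
    (hz : z.1 ∈ (chartAt Plane p.base).target) (ζ : Plane × ℝ) :
    dVal (param p z) (mfderiv 𝓘(ℝ, Plane × ℝ) unitModel (param p) z ζ) =
      (fderiv ℝ (transition p.base (param p z).base) z.1 ζ.1,
        fderiv ℝ (fderiv ℝ (transition p.base (param p z).base)) z.1 ζ.1 (chartVec p z) +
        fderiv ℝ (transition p.base (param p z).base) z.1 (fderiv ℝ (chartVec p) z ζ)) := by
  set y := (param p z).base with hy
  have hx : y ∈ (chartAt Plane p.base).source := base_param_mem p hz
  have h1 : MDifferentiableAt 𝓘(ℝ, Plane × ℝ) unitModel (param p) z :=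
    (isLocalDiffeomorphAt_param p hz).contMDiffAt.mdifferentiableAt (by simp)
  have h2 : MDifferentiableAt unitModel (𝓡 2).tangent (UnitTangent.val (h := h)) (param p z) :=
    (contMDiff_val h).contMDiffAt.mdifferentiableAt (by simp)
  have h3 := (h2.hasMFDerivAt.comp z h1.hasMFDerivAt)
  have h4 := mfderiv_eq_fderiv_extChartAt h3.mdifferentiableAt
  rw [h3.mfderiv] at h4
  have hyz : (chartAt Plane p.base).symm z.1 ∈ (chartAt Plane y).source := by
    rw [hy, ← base_param p hz]; exact mem_chart_source _ _
  have hev : ∀ᶠ z' : Plane × ℝ in 𝓝 z, (chartAt Plane p.base).symm z'.1 ∈ (chartAt Plane y).source := by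
    have hc : ContinuousAt (fun z' : Plane × ℝ ↦ (chartAt Plane p.base).symm z'.1) z :=
      ((chartAt Plane p.base).continuousAt_symm hz).comp continuousAt_fst
    exact hc.eventually ((chartAt Plane y).open_source.mem_nhds hyz)
  have h5 : (fun z' ↦ extChartAt (𝓡 2).tangent ((UnitTangent.val (h := h) ∘ param p) z)
      ((UnitTangent.val ∘ param p) z')) =ᶠ[𝓝 z] fun z' : Plane × ℝ ↦ (transition p.base y z'.1,
        fderiv ℝ (transition p.base y) z'.1 (chartVec p z')) := by
    filter_upwards [hev, eventually_fst_mem_target p hz] with z' hz' hz''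
    rw [Function.comp_apply, Function.comp_apply, val_param p hz'']
    exact Prod.ext rfl (coordAt_frameAt_eq p.base y hz'' hz' (chartVec p z'))
  rw [h5.fderiv_eq] at h4
  have hT := contDiffAt_transition p.base y hz hyz
  have hTd : HasFDerivAt (fun z' : Plane × ℝ ↦ transition p.base y z'.1) _ z :=
    (hT.differentiableAt (by simp)).hasFDerivAt.comp z hasFDerivAt_fst
  have hT2 : HasFDerivAt (fun z' : Plane × ℝ ↦ fderiv ℝ (transition p.base y) z'.1) _ z :=
    ((hT.fderiv_right (m := ∞) (by simp)).differentiableAt (by simp)).hasFDerivAt.comp z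
      hasFDerivAt_fst
  have hv : HasFDerivAt (chartVec p) _ z :=
    ((contDiffAt_chartVec p hz).differentiableAt (by simp)).hasFDerivAt
  rw [(hTd.prodMk (hT2.clm_apply hv)).fderiv] at h4
  have h6 := congrArg (fun L : Plane × ℝ →L[ℝ] Plane × Plane ↦ L ζ) h4
  refine h6.trans ?_
  refine Prod.ext rfl ?_
  exact add_comm _ _

theorem coordAt_self (x : S) (u : TangentSpace (𝓡 2) x) : coordAt x x u = u :=
  (tangentBundleCore (𝓡 2) S).coordChange_self _ _ (mem_chart_source _ _) u

theorem chartMetric_self (x : S) (u w : Plane) :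
    chartMetric h x (chartAt Plane x x) u w =
      h.inner x (u : TangentSpace (𝓡 2) x) (w : TangentSpace (𝓡 2) x) := by
  have := inner_eq_chartMetric h x (mem_chart_source _ x) (u : TangentSpace (𝓡 2) x)
    (w : TangentSpace (𝓡 2) x)
  exact (congrArg₂ (fun a b : Plane ↦ chartMetric h x (chartAt Plane x x) a b)
    (coordAt_self x u).symm (coordAt_self x w).symm).trans this.symm

theorem christoffel_eq (x : S) (a u w : Plane) :
    christoffel h x a u w = localChristoffel (chartMetric h x) (chartAt Plane x x) a u w := by
  have hG : DifferentiableAt ℝ (chartMetric h x) (chartAt Plane x x) :=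
    (contDiffAt_chartMetric h x (mem_chart_target _ x)).differentiableAt (by simp)
  have key : ∀ a u w, fderiv ℝ (metricCoeff h x u w) (chartAt Plane x x) a =
      fderiv ℝ (chartMetric h x) (chartAt Plane x x) a u w := by
    intro a u w
    have h1 := ((hG.hasFDerivAt.clm_apply (hasFDerivAt_const u _)).clm_apply
      (hasFDerivAt_const w _))
    have h2 : (fun y ↦ chartMetric h x y u w) = metricCoeff h x u w := rfl
    rw [h2] at h1
    rw [h1.fderiv]
    simp
  rw [christoffel, localChristoffel, key, key, key]

/-- The covariant derivative in the chart at `p`. -/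
theorem covariant_param (p : UnitTangent h) {z : Plane × ℝ}
    (hz : z.1 ∈ (chartAt Plane p.base).target) (ζ : Plane × ℝ)
    (w : TangentSpace (𝓡 2) (param p z).base) :
    covariant (param p z) (mfderiv 𝓘(ℝ, Plane × ℝ) unitModel (param p) z ζ) w =
      localCov (chartMetric h p.base) (chartVec p) z ζ (coordAt p.base _ w) := by
  have e0 : covariant (param p z) (mfderiv 𝓘(ℝ, Plane × ℝ) unitModel (param p) z ζ) w =
      chartMetric h (param p z).base (chartAt Plane (param p z).base (param p z).base)
        (dVal (param p z) (mfderiv 𝓘(ℝ, Plane × ℝ) unitModel (param p) z ζ)).2 w +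
      localChristoffel (chartMetric h (param p z).base)
        (chartAt Plane (param p z).base (param p z).base)
        (dVal (param p z) (mfderiv 𝓘(ℝ, Plane × ℝ) unitModel (param p) z ζ)).1
        (param p z).vec w :=
    congrArg₂ (· + ·) (chartMetric_self _ _ _).symm (christoffel_eq _ _ _ _)
  rw [e0, dVal_param p hz]
  clear e0
  have hx : (param p z).base ∈ (chartAt Plane p.base).source := base_param_mem p hz
  have hyz : (chartAt Plane p.base).symm z.1 ∈ (chartAt Plane (param p z).base).source := by
    rw [← base_param p hz]; exact mem_chart_source _ _
  have hT := contDiffAt_transition p.base (param p z).base hz hyz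
  have hTz : transition p.base (param p z).base z.1 = chartAt Plane (param p z).base (param p z).base := by
    rw [transition, ← base_param p hz]
  have hchange : ∀ u : TangentSpace (𝓡 2) (param p z).base,
      fderiv ℝ (transition p.base (param p z).base) z.1 (coordAt p.base (param p z).base u) = u := by
    intro u
    have h1 := coordAt_frameAt_eq p.base (param p z).base hz hyz (coordAt p.base (param p z).base u)
    rw [← h1]
    have key : ∀ x', x' = (param p z).base →
        coordAt (param p z).base x' (frameAt (I := 𝓡 2) p.base x' (coordAt p.base (param p z).base u)) =
        u := by
      rintro _ rfl
      rw [frameAt_coordAt hx]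
      exact coordAt_self _ _
    exact key _ (base_param p hz).symm
  have hvec : fderiv ℝ (transition p.base (param p z).base) z.1 (chartVec p z) = (param p z).vec := by
    rw [← coordAt_vec_param p hz]; exact hchange _
  -- The inhomogeneous term of this law is exactly the second derivative of the transition map which
  -- appears in `dVal_param`.
  have hlaw := localChristoffel_transform (G := chartMetric h p.base) (G' := chartMetric h (param p z).base)
    (T := transition p.base (param p z).base) (x := z.1) (hT.of_le (by simpa using two_le_infty))
    (by rw [hTz]; exact (contDiffAt_chartMetric h (param p z).base
      (mem_chart_target _ (param p z).base)).differentiableAt (by simp))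
    (chartMetric_symm h (param p z).base) (by
      have hc : ContinuousAt (chartAt Plane p.base).symm z.1 :=
        (chartAt Plane p.base).continuousAt_symm hz
      filter_upwards [hc.eventually ((chartAt Plane (param p z).base).open_source.mem_nhds hyz),
        (chartAt Plane p.base).open_target.mem_nhds hz] with x' h1 h2 u w
      exact chartMetric_transition h p.base (param p z).base h2 h1 u w)
    ((contDiffAt_chartMetric h p.base hz).differentiableAt (by simp))
    ζ.1 (chartVec p z) (coordAt p.base (param p z).base w)
  have h1 : fderiv ℝ (transition p.base (param p z).base) z.1 (chartVec p z) =
    (id (param p z).vec : Plane) := hvec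
  have h2 := hchange w
  rw [localCov, hlaw, hTz]
  erw [h2, chartMetric_transition h p.base (param p z).base hz hyz]
  rw [hTz]
  erw [h2, h1, map_add]
  refine (congrArg (· + _) (add_apply _ _ _)).trans ?_
  simp only [id]
  ring

end ChartInterface

/-! ### The frame `X`, `Y`, `Z` and the rotation of the Liouville planes. -/

section UnitTangentStructure

variable {S : Type*} [TopologicalSpace S] [ChartedSpace Plane S] [IsManifold (𝓡 2) ∞ S]
  {h : SurfaceMetric S}

/-- The derivative of the local parametrisation. -/
noncomputable def dParam (p : UnitTangent h) (z : Plane × ℝ) :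
    Plane × ℝ →L[ℝ] TangentSpace unitModel (param p z) :=
  mfderiv 𝓘(ℝ, Plane × ℝ) unitModel (param p) z

theorem exists_param (q : UnitTangent h) :
    ∃ p : UnitTangent h, ∃ z : Plane × ℝ, z.1 ∈ (chartAt Plane p.base).target ∧ param p z = q :=
  ⟨q, extChartAt unitModel q q, (mem_extChartAt_target_iff q).1 (mem_extChartAt_target q),
    extChartAt_to_inv q⟩

theorem exists_dParam (p : UnitTangent h) {z : Plane × ℝ}
    (hz : z.1 ∈ (chartAt Plane p.base).target) (ζ : TangentSpace unitModel (param p z)) :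
    ∃ ζ' : Plane × ℝ, dParam p z ζ' = ζ :=
  ⟨_, (isLocalDiffeomorphAt_param p hz).apply_inverse ζ⟩

theorem dParam_injective (p : UnitTangent h) {z : Plane × ℝ}
    (hz : z.1 ∈ (chartAt Plane p.base).target) : Function.Injective (dParam p z) :=
  Function.LeftInverse.injective fun ζ ↦ (isLocalDiffeomorphAt_param p hz).inverse_apply ζ

theorem coordAt_injective (x₀ : S) {x : S} (hx : x ∈ (chartAt Plane x₀).source) :
    Function.Injective (coordAt (I := 𝓡 2) x₀ x) :=
  Function.LeftInverse.injective fun u ↦ frameAt_coordAt hx u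

theorem coordAt_surjective (x₀ : S) {x : S} (hx : x ∈ (chartAt Plane x₀).source) :
    Function.Surjective (coordAt (I := 𝓡 2) x₀ x) := fun u ↦ ⟨_, coordAt_frameAt hx u⟩

theorem covariant_dParam (p : UnitTangent h) {z : Plane × ℝ}
    (hz : z.1 ∈ (chartAt Plane p.base).target) (ζ : Plane × ℝ)
    (w : TangentSpace (𝓡 2) (param p z).base) :
    covariant (param p z) (dParam p z ζ) w =
      localCov (chartMetric h p.base) (chartVec p) z ζ (coordAt p.base _ w) :=
  covariant_param p hz ζ w

theorem dBase_dParam (p : UnitTangent h) {z : Plane × ℝ}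
    (hz : z.1 ∈ (chartAt Plane p.base).target) (ζ : Plane × ℝ) :
    coordAt p.base (param p z).base (dBase (param p z) (dParam p z ζ)) = ζ.1 :=
  coordAt_dBase_param p hz ζ

theorem inner_dBase_dParam (p : UnitTangent h) {z : Plane × ℝ}
    (hz : z.1 ∈ (chartAt Plane p.base).target) (ζ : Plane × ℝ)
    (w : TangentSpace (𝓡 2) (param p z).base) :
    h.inner (param p z).base (dBase (param p z) (dParam p z ζ)) w =
      chartMetric h p.base z.1 ζ.1 (coordAt p.base _ w) :=
  (inner_param p hz _ w).trans
    (congrArg (fun u : Plane ↦ chartMetric h p.base z.1 u (coordAt p.base _ w))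
      (dBase_dParam p hz ζ))

theorem inner_vec_dBase_dParam (p : UnitTangent h) {z : Plane × ℝ}
    (hz : z.1 ∈ (chartAt Plane p.base).target) (ζ : Plane × ℝ) :
    h.inner (param p z).base (param p z).vec (dBase (param p z) (dParam p z ζ)) =
      chartMetric h p.base z.1 (chartVec p z) ζ.1 :=
  (inner_param p hz _ _).trans
    (congrArg₂ (fun u u' : Plane ↦ chartMetric h p.base z.1 u u')
      (coordAt_vec_param p hz) (dBase_dParam p hz ζ))

theorem covariant_add (q : UnitTangent h) (ζ ζ' : TangentSpace unitModel q)
    (w : TangentSpace (𝓡 2) q.base) :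
    covariant q (ζ + ζ') w = covariant q ζ w + covariant q ζ' w := by
  obtain ⟨p, z, hz, rfl⟩ := exists_param q
  obtain ⟨ζ, rfl⟩ := exists_dParam p hz ζ
  obtain ⟨ζ', rfl⟩ := exists_dParam p hz ζ'
  rw [← map_add, covariant_dParam p hz, covariant_dParam p hz, covariant_dParam p hz,
    LocalUnitBundle.cov_add]

theorem covariant_smul (q : UnitTangent h) (c : ℝ) (ζ : TangentSpace unitModel q)
    (w : TangentSpace (𝓡 2) q.base) : covariant q (c • ζ) w = c * covariant q ζ w := by
  obtain ⟨p, z, hz, rfl⟩ := exists_param q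
  obtain ⟨ζ, rfl⟩ := exists_dParam p hz ζ
  rw [← map_smul, covariant_dParam p hz, covariant_dParam p hz, LocalUnitBundle.cov_smul]

theorem covariant_add_right (q : UnitTangent h) (ζ : TangentSpace unitModel q)
    (w w' : TangentSpace (𝓡 2) q.base) :
    covariant q ζ (w + w') = covariant q ζ w + covariant q ζ w' := by
  obtain ⟨p, z, hz, rfl⟩ := exists_param q
  obtain ⟨ζ, rfl⟩ := exists_dParam p hz ζ
  rw [covariant_dParam p hz, covariant_dParam p hz, covariant_dParam p hz, map_add,
    LocalUnitBundle.cov_add_right]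

theorem covariant_smul_right (q : UnitTangent h) (c : ℝ) (ζ : TangentSpace unitModel q)
    (w : TangentSpace (𝓡 2) q.base) : covariant q ζ (c • w) = c * covariant q ζ w := by
  obtain ⟨p, z, hz, rfl⟩ := exists_param q
  obtain ⟨ζ, rfl⟩ := exists_dParam p hz ζ
  rw [covariant_dParam p hz, covariant_dParam p hz, map_smul, LocalUnitBundle.cov_smul_right]

theorem covariant_vec (q : UnitTangent h) (ζ : TangentSpace unitModel q) :
    covariant q ζ q.vec = 0 := by
  obtain ⟨p, z, hz, rfl⟩ := exists_param q
  obtain ⟨ζ, rfl⟩ := exists_dParam p hz ζ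
  rw [covariant_dParam p hz, coordAt_vec_param p hz]
  exact (localUnitBundle p hz).cov_vec _

/-- There is a unit vector orthogonal to a given one. -/
theorem exists_normal (q : UnitTangent h) : ∃ n : TangentSpace (𝓡 2) q.base,
    h.inner q.base q.vec n = 0 ∧ h.inner q.base n n = 1 ∧
    ∀ u, u = h.inner q.base q.vec u • q.vec + h.inner q.base n u • n := by
  obtain ⟨p, z, hz, rfl⟩ := exists_param q
  have hU := localUnitBundle p hz
  have hx := base_param_mem p hz
  set g := chartMetric h p.base z.1 (paramDeriv (chartVec p) z) (paramDeriv (chartVec p) z) with hg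
  have hg0 : 0 < g := hU.param_pos
  have hs : √g ^ 2 = g := Real.sq_sqrt hg0.le
  have hs0 : √g ≠ 0 := (Real.sqrt_pos.2 hg0).ne'
  obtain ⟨n, hn⟩ := coordAt_surjective p.base hx ((√g)⁻¹ • paramDeriv (chartVec p) z)
  have hvn : ∀ u : TangentSpace (𝓡 2) (param p z).base, h.inner (param p z).base n u =
      (√g)⁻¹ * chartMetric h p.base z.1 (paramDeriv (chartVec p) z) (coordAt p.base _ u) := by
    intro u
    rw [inner_param p hz, hn, map_smul, smul_apply, smul_eq_mul]
  refine ⟨n, ?_, ?_, fun u ↦ ?_⟩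
  · rw [h.symm, hvn, coordAt_vec_param p hz, hU.inner_param, mul_zero]
  · rw [hvn, hn, map_smul, smul_eq_mul, ← hg]
    field_simp
    exact hs.symm
  · apply coordAt_injective p.base hx
    rw [map_add, map_smul, map_smul, hn, coordAt_vec_param p hz, inner_param p hz,
      coordAt_vec_param p hz, hvn, smul_smul]
    refine (hU.decomp _).trans ?_
    congr 2
    rw [← hg]
    field_simp
    rw [hs]
  
/-- A unit vector orthogonal to a given one. -/
noncomputable def normal (q : UnitTangent h) : TangentSpace (𝓡 2) q.base := (exists_normal q).choose

theorem inner_normal (q : UnitTangent h) : h.inner q.base (normal q) (normal q) = 1 :=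
  (exists_normal q).choose_spec.2.1

theorem normal_decomp (q : UnitTangent h) (u : TangentSpace (𝓡 2) q.base) :
    u = h.inner q.base q.vec u • q.vec + h.inner q.base (normal q) u • normal q :=
  (exists_normal q).choose_spec.2.2 u

/-- Unit vectors have covariant derivative orthogonal to themselves, so only the pairing with the
normal remains. A change of sign of the normal leaves the right-hand side unchanged. -/
theorem covariant_eq (q : UnitTangent h) (ζ : TangentSpace unitModel q)
    (w : TangentSpace (𝓡 2) q.base) :
    covariant q ζ w = h.inner q.base (normal q) w * covariant q ζ (normal q) := by
  conv_lhs => rw [normal_decomp q w]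
  rw [covariant_add_right, covariant_smul_right, covariant_smul_right, covariant_vec]
  ring

theorem eq_zero_of_dBase_covariant (q : UnitTangent h) {ζ : TangentSpace unitModel q}
    (h1 : dBase q ζ = 0) (h2 : ∀ w, covariant q ζ w = 0) : ζ = 0 := by
  obtain ⟨p, z, hz, rfl⟩ := exists_param q
  obtain ⟨ζ, rfl⟩ := exists_dParam p hz ζ
  obtain ⟨n, hn⟩ := coordAt_surjective p.base (base_param_mem p hz) (paramDeriv (chartVec p) z)
  have h3 := h2 n
  rw [covariant_dParam p hz, hn] at h3
  have h4 : ζ.1 = 0 := by rw [← dBase_dParam p hz ζ, h1, map_zero]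
  rw [(localUnitBundle p hz).eq_zero_of_cov h4 h3, map_zero]

instance (q : UnitTangent h) : FiniteDimensional ℝ (TangentSpace unitModel q) :=
  inferInstanceAs (FiniteDimensional ℝ (Plane × ℝ))

instance (q : UnitTangent h) : T2Space (TangentSpace unitModel q) :=
  inferInstanceAs (T2Space (Plane × ℝ))

theorem finrank_tangentSpace (q : UnitTangent h) :
    Module.finrank ℝ (TangentSpace unitModel q) = 3 := by
  have : Module.finrank ℝ (Plane × ℝ) = 3 := by simp
  exact this

/-- The covariant derivative in the direction of the normal, as a linear form. -/
noncomputable def covariantForm (q : UnitTangent h) : TangentSpace unitModel q →L[ℝ] ℝ :=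
  LinearMap.toContinuousLinearMap
    { toFun := fun ζ ↦ covariant q ζ (normal q)
      map_add' := fun ζ ζ' ↦ covariant_add q ζ ζ' _
      map_smul' := fun c ζ ↦ covariant_smul q c ζ _ }

/-- The coframe dual to the frame `X`, `Y`, `Z`, up to the common sign of `Y` and `Z`. -/
noncomputable def coframe (q : UnitTangent h) : TangentSpace unitModel q →L[ℝ] ℝ × ℝ × ℝ :=
  ((h.inner q.base q.vec).comp (dBase q)).prod
    (((h.inner q.base (normal q)).comp (dBase q)).prod (covariantForm q))

theorem coframe_apply (q : UnitTangent h) (ζ : TangentSpace unitModel q) :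
    coframe q ζ = (h.inner q.base q.vec (dBase q ζ), h.inner q.base (normal q) (dBase q ζ),
      covariant q ζ (normal q)) := rfl

theorem coframe_injective (q : UnitTangent h) : Function.Injective (coframe q) := by
  rw [injective_iff_map_eq_zero]
  intro ζ h0
  rw [coframe_apply] at h0
  simp only [Prod.mk_eq_zero] at h0
  refine eq_zero_of_dBase_covariant q ?_ fun w ↦ ?_
  · rw [normal_decomp q (dBase q ζ), h0.1, h0.2.1, zero_smul, zero_smul, add_zero]
  · rw [covariant_eq, h0.2.2, mul_zero]

/-- The coframe as an isomorphism. -/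
noncomputable def coframeEquiv (q : UnitTangent h) : TangentSpace unitModel q ≃L[ℝ] ℝ × ℝ × ℝ :=
  (LinearMap.linearEquivOfInjective (coframe q).toLinearMap (coframe_injective q)
    (by rw [finrank_tangentSpace]; simp)).toContinuousLinearEquiv

/-- The tangent vector with given coframe coordinates. -/
noncomputable def ofCoframe (q : UnitTangent h) (a b c : ℝ) : TangentSpace unitModel q :=
  (coframeEquiv q).symm (a, b, c)

theorem coframe_ofCoframe (q : UnitTangent h) (a b c : ℝ) :
    coframe q (ofCoframe q a b c) = (a, b, c) := (coframeEquiv q).apply_symm_apply _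

theorem inner_vec_ofCoframe (q : UnitTangent h) (a b c : ℝ) :
    h.inner q.base q.vec (dBase q (ofCoframe q a b c)) = a :=
  congrArg Prod.fst (coframe_ofCoframe q a b c)

theorem inner_normal_ofCoframe (q : UnitTangent h) (a b c : ℝ) :
    h.inner q.base (normal q) (dBase q (ofCoframe q a b c)) = b :=
  congrArg (fun t ↦ t.2.1) (coframe_ofCoframe q a b c)

theorem covariant_ofCoframe (q : UnitTangent h) (a b c : ℝ) :
    covariant q (ofCoframe q a b c) (normal q) = c :=
  congrArg (fun t ↦ t.2.2) (coframe_ofCoframe q a b c)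

theorem dBase_ofCoframe (q : UnitTangent h) (a b c : ℝ) :
    dBase q (ofCoframe q a b c) = a • q.vec + b • normal q := by
  conv_lhs => rw [normal_decomp q (dBase q (ofCoframe q a b c))]
  rw [inner_vec_ofCoframe, inner_normal_ofCoframe]

/-- The geodesic vector field. -/
noncomputable def geodesicField (q : UnitTangent h) : TangentSpace unitModel q := ofCoframe q 1 0 0

theorem dBase_geodesicField (q : UnitTangent h) : dBase q (geodesicField q) = q.vec := by
  rw [geodesicField, dBase_ofCoframe, one_smul, zero_smul, add_zero]

theorem covariant_geodesicField (q : UnitTangent h) (w : TangentSpace (𝓡 2) q.base) :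
    covariant q (geodesicField q) w = 0 := by
  rw [covariant_eq, geodesicField, covariant_ofCoframe, mul_zero]

/-- The coframe is injective. Intrinsic fields are identified with their coordinate expressions by
comparison of these two invariants. -/
theorem eq_of_dBase_covariant (q : UnitTangent h) {ζ ζ' : TangentSpace unitModel q}
    (h1 : dBase q ζ = dBase q ζ') (h2 : ∀ w, covariant q ζ w = covariant q ζ' w) : ζ = ζ' := by
  refine coframe_injective q ?_
  rw [coframe_apply, coframe_apply, h1, h2]

/-- The rotation of the Liouville planes by a right angle. -/
noncomputable def quarterTurn (q : UnitTangent h) :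
    TangentSpace unitModel q →L[ℝ] TangentSpace unitModel q :=
  ((coframeEquiv q).symm : ℝ × ℝ × ℝ →L[ℝ] TangentSpace unitModel q).comp
    ((((0 : ℝ × ℝ × ℝ →L[ℝ] ℝ)).prod ((-((ContinuousLinearMap.snd ℝ ℝ ℝ).comp
      (ContinuousLinearMap.snd ℝ ℝ (ℝ × ℝ)))).prod ((ContinuousLinearMap.fst ℝ ℝ ℝ).comp
      (ContinuousLinearMap.snd ℝ ℝ (ℝ × ℝ))))).comp (coframe q))

theorem quarterTurn_apply (q : UnitTangent h) (ζ : TangentSpace unitModel q) :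
    quarterTurn q ζ = ofCoframe q 0 (-covariant q ζ (normal q))
      (h.inner q.base (normal q) (dBase q ζ)) := rfl

theorem inner_dBase_quarterTurn (q : UnitTangent h) (ζ : TangentSpace unitModel q)
    (w : TangentSpace (𝓡 2) q.base) :
    h.inner q.base (dBase q (quarterTurn q ζ)) w = -covariant q ζ w := by
  rw [quarterTurn_apply, dBase_ofCoframe, zero_smul, zero_add, map_smul, covariant_eq q ζ w,
    smul_apply, smul_eq_mul]
  ring

theorem covariant_quarterTurn (q : UnitTangent h) (ζ : TangentSpace unitModel q)
    (w : TangentSpace (𝓡 2) q.base) :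
    covariant q (quarterTurn q ζ) w =
      h.inner q.base (normal q) (dBase q ζ) * h.inner q.base (normal q) w := by
  rw [covariant_eq, quarterTurn_apply, covariant_ofCoframe, mul_comm]

theorem mem_liouville (q : UnitTangent h) (ζ : TangentSpace unitModel q) :
    (⟨q, ζ⟩ : TangentBundle unitModel (UnitTangent h)) ∈ liouville h ↔
      h.inner q.base q.vec (dBase q ζ) = 0 := Iff.rfl

theorem dBase_of_mem_liouville {q : UnitTangent h} {ζ : TangentSpace unitModel q}
    (hζ : (⟨q, ζ⟩ : TangentBundle unitModel (UnitTangent h)) ∈ liouville h) :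
    dBase q ζ = h.inner q.base (normal q) (dBase q ζ) • normal q := by
  conv_lhs => rw [normal_decomp q (dBase q ζ), (mem_liouville q ζ).1 hζ, zero_smul, zero_add]

/-- On `ξ₀` the base component is a multiple of the normal, so the two normal factors in
`covariant_quarterTurn` combine to the inner product. Outside `ξ₀` a component along the
tautological vector would be lost. -/
theorem isStandardRotation : IsStandardRotation (quarterTurn (h := h)) := by
  refine fun q ζ hζ w ↦ ⟨inner_dBase_quarterTurn q ζ w, ?_⟩
  rw [covariant_quarterTurn, dBase_of_mem_liouville hζ]
  simp only [map_smul, smul_apply, smul_eq_mul, inner_normal, mul_one]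

theorem quarterTurn_mem (q : UnitTangent h) (ζ : TangentSpace unitModel q) :
    (⟨q, quarterTurn q ζ⟩ : TangentBundle unitModel (UnitTangent h)) ∈ liouville h := by
  rw [mem_liouville, quarterTurn_apply, inner_vec_ofCoframe]

theorem quarterTurn_quarterTurn {q : UnitTangent h} {ζ : TangentSpace unitModel q}
    (hζ : (⟨q, ζ⟩ : TangentBundle unitModel (UnitTangent h)) ∈ liouville h) :
    quarterTurn q (quarterTurn q ζ) = -ζ := by
  refine coframe_injective q ?_
  rw [map_neg, quarterTurn_apply, coframe_ofCoframe, coframe_apply, (mem_liouville q ζ).1 hζ,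
    covariant_quarterTurn, inner_normal, quarterTurn_apply, inner_normal_ofCoframe]
  simp

end UnitTangentStructure

theorem contMDiffAt_tangentMap {E : Type*} [NormedAddCommGroup E]
    [NormedSpace ℝ E] {H : Type*} [TopologicalSpace H] {I : ModelWithCorners ℝ E H} {M : Type*}
    [TopologicalSpace M] [ChartedSpace H M] {E' : Type*} [NormedAddCommGroup E'] [NormedSpace ℝ E']
    {H' : Type*} [TopologicalSpace H'] {I' : ModelWithCorners ℝ E' H'} {M' : Type*}
    [TopologicalSpace M'] [ChartedSpace H' M'] [IsManifold I 1 M] [IsManifold I' 1 M']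
    {f : M → M'} {ζ : TangentBundle I M} (hf : ∀ᶠ x in 𝓝 ζ.1, ContMDiffAt I I' ∞ f x) :
    ContMDiffAt I.tangent I'.tangent ∞ (tangentMap I I' f) ζ := by
  obtain ⟨U, hU, hUo, hxU⟩ := eventually_nhds_iff.1 hf
  have h1 : ContMDiffOn I I' ∞ f U := fun x hx ↦ (hU x hx).contMDiffWithinAt
  have h2 := h1.contMDiffOn_tangentMapWithin (m := ∞) (by simp) hUo.uniqueMDiffOn
  have ho : IsOpen (Bundle.TotalSpace.proj ⁻¹' U : Set (TangentBundle I M)) :=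
    hUo.preimage (FiberBundle.continuous_proj E (TangentSpace I))
  refine (h2.contMDiffAt (ho.mem_nhds hxU)).congr_of_eventuallyEq ?_
  filter_upwards [ho.mem_nhds hxU] with ζ' hζ'
  exact (tangentMapWithin_eq_tangentMap (hUo.uniqueMDiffOn _ hζ')
    ((hU _ hζ').mdifferentiableAt (by simp))).symm

/-! ### Smooth fields and the contact condition on the unit tangent bundle. -/

section UnitTangentSmooth

variable {S : Type*} [TopologicalSpace S] [ChartedSpace Plane S] [IsManifold (𝓡 2) ∞ S]
  {h : SurfaceMetric S}

theorem contMDiffAt_of_param {A : ∀ q : UnitTangent h, TangentSpace unitModel q}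
    (p : UnitTangent h) {z₀ : Plane × ℝ} (hz : z₀.1 ∈ (chartAt Plane p.base).target)
    {B : Plane × ℝ → Plane × ℝ} (hB : ContDiffAt ℝ ∞ B z₀)
    (hA : ∀ᶠ z in 𝓝 z₀, A (param p z) = dParam p z (B z)) :
    ContMDiffAt unitModel unitModel.tangent ∞
      (fun q ↦ (⟨q, A q⟩ : TangentBundle unitModel (UnitTangent h))) (param p z₀) := by
  have : IsManifold unitModel 1 (UnitTangent h) := IsManifold.of_le (n := ∞) (by simp)
  have hf := isLocalDiffeomorphAt_param p hz
  have h1 : ContMDiffAt 𝓘(ℝ, Plane × ℝ) 𝓘(ℝ, Plane × ℝ).tangent ∞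
      (fun z ↦ (⟨z, B z⟩ : TangentBundle 𝓘(ℝ, Plane × ℝ) (Plane × ℝ))) z₀ :=
    contMDiffAt_vectorSpace_iff_contDiffAt.2 hB
  have h2 : ContMDiffAt 𝓘(ℝ, Plane × ℝ) unitModel.tangent ∞
      (fun z ↦ tangentMap 𝓘(ℝ, Plane × ℝ) unitModel (param p) ⟨z, B z⟩) z₀ :=
    (contMDiffAt_tangentMap (ζ := ⟨z₀, B z₀⟩) hf.eventually_contMDiffAt).comp z₀ h1
  have h3 := hf.localInverse_contMDiffAt
  have h4 : hf.localInverse (param p z₀) = z₀ := hf.localInverse_apply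
  have h5 := ContMDiffAt.comp (param p z₀) (by rw [h4]; exact h2) h3
  refine h5.congr_of_eventuallyEq ?_
  filter_upwards [hf.tendsto_localInverse.eventually hA, hf.localInverse_eventuallyEq_right]
    with y h6 h7
  have h8 : param p (hf.localInverse y) = y := h7
  refine (congrArg (fun q ↦ (⟨q, A q⟩ : TangentBundle unitModel (UnitTangent h))) h8.symm).trans ?_
  exact congrArg (fun ζ ↦ (⟨param p (hf.localInverse y), ζ⟩ :
    TangentBundle unitModel (UnitTangent h))) h6

theorem smoothNear_of_param {A : ∀ q : UnitTangent h, TangentSpace unitModel q}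
    (p : UnitTangent h) {z₀ : Plane × ℝ} (hz : z₀.1 ∈ (chartAt Plane p.base).target)
    {B : Plane × ℝ → Plane × ℝ} (hB : ∀ᶠ z in 𝓝 z₀, ContDiffAt ℝ ∞ B z)
    (hA : ∀ᶠ z in 𝓝 z₀, A (param p z) = dParam p z (B z)) : SmoothNear A (param p z₀) := by
  have hf := isLocalDiffeomorphAt_param p hz
  have h1 : ∀ᶠ z in 𝓝 z₀, ContMDiffAt unitModel unitModel.tangent ∞
      (fun q ↦ (⟨q, A q⟩ : TangentBundle unitModel (UnitTangent h))) (param p z) := by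
    filter_upwards [hB, hA.eventually_nhds, eventually_fst_mem_target p hz] with z h1 h2 h3
    exact contMDiffAt_of_param p h3 h1 h2
  filter_upwards [hf.tendsto_localInverse.eventually h1, hf.localInverse_eventuallyEq_right]
    with y h2 h3
  have h3 : param p (hf.localInverse y) = y := h3
  rwa [h3] at h2

/-- The coordinates of a smooth vector field. -/
theorem exists_coord {A : ∀ q : UnitTangent h, TangentSpace unitModel q}
    (p : UnitTangent h) {z₀ : Plane × ℝ} (hz : z₀.1 ∈ (chartAt Plane p.base).target)
    (hA : SmoothNear A (param p z₀)) : ∃ B : Plane × ℝ → Plane × ℝ,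
      (∀ᶠ z in 𝓝 z₀, ContDiffAt ℝ ∞ B z) ∧ ∀ᶠ z in 𝓝 z₀, A (param p z) = dParam p z (B z) := by
  have hf := isLocalDiffeomorphAt_param p hz
  refine ⟨VectorField.mpullback 𝓘(ℝ, Plane × ℝ) unitModel (param p) A,
    smoothNear_vectorSpace_iff.1 (SmoothNear.mpullback hf hA), ?_⟩
  filter_upwards [eventually_fst_mem_target p hz] with z hz
  rw [VectorField.mpullback_apply]
  exact ((isLocalDiffeomorphAt_param p hz).apply_inverse _).symm

theorem geodesicField_param (p : UnitTangent h) {z : Plane × ℝ}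
    (hz : z.1 ∈ (chartAt Plane p.base).target) : geodesicField (param p z) =
      dParam p z (horLift (chartMetric h p.base) (chartVec p) z (chartVec p z)) := by
  refine eq_of_dBase_covariant _ ?_ fun w ↦ ?_
  · apply coordAt_injective p.base (base_param_mem p hz)
    rw [dBase_dParam p hz, dBase_geodesicField, coordAt_vec_param p hz]
    rfl
  · rw [covariant_geodesicField, covariant_dParam p hz, (localUnitBundle p hz).cov_horLift]

/-- The definition passes through the pointwise choice of `normal`; the horizontal lift in a chart
involves no choice and is visibly smooth. -/
theorem contMDiff_geodesicField : ContMDiff unitModel unitModel.tangent ∞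
    (fun q ↦ (⟨q, geodesicField q⟩ : TangentBundle unitModel (UnitTangent h))) := by
  intro q
  obtain ⟨p, z, hz, rfl⟩ := exists_param q
  have hU := localUnitBundle p hz
  exact contMDiffAt_of_param p hz (hU.contDiffAt_horLift hU.smooth.self_of_nhds)
    ((eventually_fst_mem_target p hz).mono fun z' hz' ↦ geodesicField_param p hz')

/-- The coordinate expression of the quarter turn. -/
noncomputable def localTurn (G : Plane → Plane →L[ℝ] Plane →L[ℝ] ℝ) (v : Plane × ℝ → Plane)
    (z ζ : Plane × ℝ) : Plane × ℝ :=
  -(localCov G v z ζ (paramDeriv v z) / G z.1 (paramDeriv v z) (paramDeriv v z)) •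
    horLift G v z (paramDeriv v z) +
  (0, G z.1 ζ.1 (paramDeriv v z) / G z.1 (paramDeriv v z) (paramDeriv v z))

/-- Both vectors have the base component and the covariant derivative prescribed by
`IsStandardRotation`. The coordinate expression is free of the choice of `normal`, which is what
smoothness requires. -/
theorem quarterTurn_dParam (p : UnitTangent h) {z : Plane × ℝ}
    (hz : z.1 ∈ (chartAt Plane p.base).target) (ζ : Plane × ℝ)
    (hζ : (⟨param p z, dParam p z ζ⟩ : TangentBundle unitModel (UnitTangent h)) ∈ liouville h) :
    quarterTurn (param p z) (dParam p z ζ) =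
      dParam p z (localTurn (chartMetric h p.base) (chartVec p) z ζ) := by
  have hU := localUnitBundle p hz
  have hx := base_param_mem p hz
  have hp := hU.param_pos.ne'
  have key := isStandardRotation (h := h) (param p z) (dParam p z ζ) hζ
  refine eq_of_dBase_covariant _ ?_ fun w ↦ ?_
  · have e : ∀ u u' : TangentSpace (𝓡 2) (param p z).base,
        (∀ w, h.inner (param p z).base u w = h.inner (param p z).base u' w) → u = u' := by
      intro u u' huu
      rw [normal_decomp _ u, normal_decomp _ u', h.symm _ _ u, h.symm _ _ u, h.symm _ _ u',
        h.symm _ _ u', huu, huu]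
    refine e _ _ fun w ↦ ?_
    rw [(key w).1, inner_dBase_dParam p hz, covariant_dParam p hz, hU.cov_eq, localTurn]
    simp only [Prod.fst_add, Prod.smul_fst, horLift, map_smul, add_zero,
      smul_apply, smul_eq_mul]
    field_simp
  · rw [(key w).2, inner_dBase_dParam p hz, covariant_dParam p hz, localTurn,
      LocalUnitBundle.cov_add, LocalUnitBundle.cov_smul, hU.cov_horLift,
      LocalUnitBundle.cov_vertical]
    have h1 : chartMetric h p.base z.1 (chartVec p z) ζ.1 = 0 := by
      rw [← inner_vec_dBase_dParam p hz]; exact hζ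
    obtain ⟨c, hc⟩ := (hU.orthogonal_iff _).1 h1
    rw [hc]
    simp only [map_smul, smul_apply, smul_eq_mul]
    field_simp
    ring

theorem smoothNear_quarterTurn (A : ∀ q : UnitTangent h, TangentSpace unitModel q)
    (q : UnitTangent h) (hA : IsSectionNear (liouville h) A q) :
    SmoothNear (fun q ↦ quarterTurn q (A q)) q := by
  obtain ⟨p, z, hz, rfl⟩ := exists_param q
  have hf := isLocalDiffeomorphAt_param p hz
  obtain ⟨B, hB, hAB⟩ := exists_coord p hz hA.1
  refine smoothNear_of_param p hz
    (B := fun z ↦ localTurn (chartMetric h p.base) (chartVec p) z (B z)) ?_ ?_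
  · filter_upwards [hB, (localUnitBundle p hz).eventually] with z' hB' hU
    have hs := hU.contDiffAt_paramDeriv
    have h2 := hU.contDiffAt_metric hs hs
    exact (((hU.contDiffAt_cov hB' hs).div h2 hU.param_pos.ne').neg.smul
      (hU.contDiffAt_horLift hs)).add (contDiffAt_const.prodMk
        ((hU.contDiffAt_metric (contDiffAt_fst.comp z' hB') hs).div h2 hU.param_pos.ne'))
  · filter_upwards [hAB, hf.contMDiffAt.continuousAt.eventually hA.2,
      eventually_fst_mem_target p hz] with z' h1 h2 h3
    rw [h1] at h2
    exact (congrArg _ h1).trans (quarterTurn_dParam p h3 _ h2)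

theorem pullbackNear_param {P : Plane × ℝ → Submodule ℝ (Plane × ℝ)}
    {D : Set (TangentBundle unitModel (UnitTangent h))} (p : UnitTangent h) {z : Plane × ℝ}
    (hz : z.1 ∈ (chartAt Plane p.base).target)
    (hD : ∀ z : Plane × ℝ, z.1 ∈ (chartAt Plane p.base).target → ∀ ζ : Plane × ℝ,
      ζ ∈ P z ↔ (⟨param p z, dParam p z ζ⟩ : TangentBundle unitModel (UnitTangent h)) ∈ D) :
    PullbackNear (I := 𝓘(ℝ, Plane × ℝ)) (I' := unitModel) (param p) (subspaceField P) D z :=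
  (eventually_fst_mem_target p hz).mono fun z' hz' ↦ hD z' hz'

theorem SmoothDistributionAt.map {E : Type*} [NormedAddCommGroup E]
    [NormedSpace ℝ E] {H : Type*} [TopologicalSpace H] {I : ModelWithCorners ℝ E H} {M : Type*}
    [TopologicalSpace M] [ChartedSpace H M] {E' : Type*} [NormedAddCommGroup E'] [NormedSpace ℝ E']
    {H' : Type*} [TopologicalSpace H'] {I' : ModelWithCorners ℝ E' H'} {M' : Type*}
    [TopologicalSpace M'] [ChartedSpace H' M'] [IsManifold I ∞ M] [IsManifold I' ∞ M']
    [CompleteSpace E] [CompleteSpace E'] {f : M → M'} {x : M}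
    (hf : IsLocalDiffeomorphAt I I' ∞ f x)
    {D : Set (TangentBundle I M)} {D' : Set (TangentBundle I' M')} (h : PullbackNear f D D' x)
    {k : ℕ} (hD : SmoothDistributionAt D k x) : SmoothDistributionAt D' k (f x) :=
  SmoothDistributionAt.of_pullback hf.localInverse_isLocalDiffeomorphAt (h.localInverse hf)
    (by rw [hf.localInverse_apply]; exact hD)

theorem ContactAt.map {E : Type*} [NormedAddCommGroup E]
    [NormedSpace ℝ E] {H : Type*} [TopologicalSpace H] {I : ModelWithCorners ℝ E H} {M : Type*}
    [TopologicalSpace M] [ChartedSpace H M] {E' : Type*} [NormedAddCommGroup E'] [NormedSpace ℝ E']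
    {H' : Type*} [TopologicalSpace H'] {I' : ModelWithCorners ℝ E' H'} {M' : Type*}
    [TopologicalSpace M'] [ChartedSpace H' M'] [IsManifold I ∞ M] [IsManifold I' ∞ M']
    [CompleteSpace E] [CompleteSpace E'] {f : M → M'} {x : M}
    (hf : IsLocalDiffeomorphAt I I' ∞ f x)
    {D : Set (TangentBundle I M)} {D' : Set (TangentBundle I' M')} (h : PullbackNear f D D' x)
    (hD : ContactAt D x) : ContactAt D' (f x) :=
  ContactAt.of_pullback hf.localInverse_isLocalDiffeomorphAt (h.localInverse hf)
    (by rw [hf.localInverse_apply]; exact hD)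

variable (h)

/-- In a chart the kernel of the tautological form is spanned by `∂v/∂s` and `∂/∂s`, because the
vectors orthogonal to `v` are the multiples of `∂v/∂s`. -/
theorem isContact_liouville : IsContact (liouville h) := by
  refine isContact_of_contactAt (by simp) fun q ↦ ?_
  obtain ⟨p, z, hz, rfl⟩ := exists_param q
  have hU := localUnitBundle p hz
  refine (contactAt_modelContact hU.smooth hU.param_ne_zero hU.linearIndependent_param).map
    (isLocalDiffeomorphAt_param p hz) (pullbackNear_param p hz fun z hz ζ ↦ ?_)
  rw [mem_modelContact, ← (localUnitBundle p hz).orthogonal_iff, mem_liouville,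
    inner_vec_dBase_dParam p hz]

theorem isSmoothDistribution_of_param {D : Set (TangentBundle unitModel (UnitTangent h))}
    (A : UnitTangent h → Plane × ℝ → Plane × ℝ)
    (hA : ∀ p : UnitTangent h, ∀ z : Plane × ℝ, z.1 ∈ (chartAt Plane p.base).target →
      ContDiffAt ℝ ∞ (A p) z ∧ A p z ≠ 0 ∧ ∀ ζ : Plane × ℝ,
        (⟨param p z, dParam p z ζ⟩ : TangentBundle unitModel (UnitTangent h)) ∈ D ↔
          ∃ c : ℝ, c • A p z = ζ) : IsSmoothDistribution D 1 := by
  intro q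
  obtain ⟨p, z, hz, rfl⟩ := exists_param q
  have hev := eventually_fst_mem_target p hz
  refine (smoothDistributionAt_subspaceField (P := fun z ↦ Submodule.span ℝ {A p z})
    (fun _ ↦ A p) (fun _ ↦ hev.mono fun z hz ↦ (hA p z hz).1) (hev.mono fun z hz ↦ ⟨?_, ?_⟩)).map
    (isLocalDiffeomorphAt_param p hz) (pullbackNear_param p hz fun z hz ζ ↦ ?_)
  · exact LinearIndependent.of_subsingleton 0 (hA p z hz).2.1
  · rw [range_const]
  · rw [Submodule.mem_span_singleton, (hA p z hz).2.2]

theorem isSmoothDistribution_verticalLine : IsSmoothDistribution (verticalLine h) 1 := by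
  refine isSmoothDistribution_of_param h (fun _ _ ↦ (0, 1)) fun p z hz ↦
    ⟨contDiffAt_const, by simp, fun ζ ↦ ?_⟩
  have h1 : (⟨param p z, dParam p z ζ⟩ : TangentBundle unitModel (UnitTangent h)) ∈ verticalLine h ↔
      ζ.1 = 0 := by
    rw [← dBase_dParam p hz ζ]
    exact ⟨fun h0 ↦ (congrArg _ h0).trans (map_zero _), fun h0 ↦
      coordAt_injective p.base (base_param_mem p hz) (h0.trans (map_zero _).symm)⟩
  rw [h1]
  constructor
  · intro h0
    exact ⟨ζ.2, Prod.ext (by simp [h0]) (by simp)⟩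
  · rintro ⟨c, rfl⟩
    simp

/-- In a chart the horizontal lift of `∂v/∂s` spans the line: a vector with the same base component
as a multiple of it and vanishing covariant derivative must be that multiple. -/
theorem isSmoothDistribution_horizontalLine : IsSmoothDistribution (horizontalLine h) 1 := by
  refine isSmoothDistribution_of_param h
    (fun p z ↦ horLift (chartMetric h p.base) (chartVec p) z (paramDeriv (chartVec p) z))
    fun p z hz ↦ ?_
  have hU := localUnitBundle p hz
  refine ⟨hU.contDiffAt_horLift hU.contDiffAt_paramDeriv, fun h0 ↦
    hU.param_ne_zero.self_of_nhds (congrArg Prod.fst h0), fun ζ ↦ ?_⟩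
  have h1 : (⟨param p z, dParam p z ζ⟩ : TangentBundle unitModel (UnitTangent h)) ∈
      horizontalLine h ↔ (∀ w, localCov (chartMetric h p.base) (chartVec p) z ζ w = 0) ∧
        chartMetric h p.base z.1 (chartVec p z) ζ.1 = 0 := by
    refine and_congr ⟨fun h0 w ↦ ?_, fun h0 w ↦ (covariant_dParam p hz ζ w).trans (h0 _)⟩ ?_
    · obtain ⟨w, rfl⟩ := coordAt_surjective p.base (base_param_mem p hz) w
      exact (covariant_dParam p hz ζ w).symm.trans (h0 w)
    · rw [← inner_vec_dBase_dParam p hz]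
  rw [h1, hU.orthogonal_iff]
  constructor
  · rintro ⟨h2, c, hc⟩
    refine ⟨c, ?_⟩
    rw [← sub_eq_zero]
    refine hU.eq_zero_of_cov ?_ ?_
    · simp [hc, horLift]
    · rw [sub_eq_add_neg, ← neg_one_smul ℝ ζ, LocalUnitBundle.cov_add, LocalUnitBundle.cov_smul,
        LocalUnitBundle.cov_smul, h2, hU.cov_horLift]
      simp
  · rintro ⟨c, rfl⟩
    refine ⟨fun w ↦ ?_, c, rfl⟩
    rw [LocalUnitBundle.cov_smul, hU.cov_horLift, mul_zero]

theorem verticalLine_subset : verticalLine h ⊆ liouville h := fun ζ hζ ↦ by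
  have : dBase ζ.1 ζ.2 = 0 := hζ
  refine (mem_liouville ζ.1 ζ.2).2 ?_
  rw [this, map_zero]

theorem horizontalLine_subset : horizontalLine h ⊆ liouville h := fun _ hζ ↦ hζ.2

end UnitTangentSmooth

/-- The linearisation of a flow satisfies the linearised equation. -/
theorem hasDerivAt_linearised {A B : Type*} [NormedAddCommGroup A] [NormedSpace ℝ A]
    [NormedAddCommGroup B] [NormedSpace ℝ B] {F : ℝ × A → B} {t₀ : ℝ} {y₀ : A} {X : B → B}
    (hF : ContDiffAt ℝ 2 F (t₀, y₀)) (hX : DifferentiableAt ℝ X (F (t₀, y₀)))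
    (h : ∀ᶠ q in 𝓝 (t₀, y₀), fderiv ℝ F q (1, 0) = X (F q)) (η : A) :
    HasDerivAt (fun t ↦ fderiv ℝ F (t, y₀) (0, η))
      (fderiv ℝ X (F (t₀, y₀)) (fderiv ℝ F (t₀, y₀) (0, η))) t₀ := by
  have hF1 : DifferentiableAt ℝ F (t₀, y₀) := hF.differentiableAt (by simp)
  have hF2 : DifferentiableAt ℝ (fderiv ℝ F) (t₀, y₀) :=
    (hF.fderiv_right (m := 1) (by norm_num)).differentiableAt (by simp)
  have h1 : HasFDerivAt (fun q ↦ fderiv ℝ F q (1, 0))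
      ((fderiv ℝ X (F (t₀, y₀))).comp (fderiv ℝ F (t₀, y₀))) (t₀, y₀) :=
    (hX.hasFDerivAt.comp _ hF1.hasFDerivAt).congr_of_eventuallyEq h
  have hv : ∀ v : ℝ × A, HasFDerivAt (fun q ↦ fderiv ℝ F q v)
      ((ContinuousLinearMap.apply ℝ B v).comp (fderiv ℝ (fderiv ℝ F) (t₀, y₀))) (t₀, y₀) :=
    fun v ↦ (ContinuousLinearMap.apply ℝ B v).hasFDerivAt.comp _ hF2.hasFDerivAt
  have h3 : fderiv ℝ X (F (t₀, y₀)) (fderiv ℝ F (t₀, y₀) (0, η)) =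
      fderiv ℝ (fderiv ℝ F) (t₀, y₀) (0, η) (1, 0) :=
    congrArg (fun L : ℝ × A →L[ℝ] B ↦ L (0, η)) (h1.unique (hv (1, 0)))
  -- Symmetry of the second derivative exchanges differentiation in time with differentiation in the
  -- initial value.
  have h4 : fderiv ℝ (fderiv ℝ F) (t₀, y₀) (1, 0) (0, η) =
      fderiv ℝ (fderiv ℝ F) (t₀, y₀) (0, η) (1, 0) := (hF.isSymmSndFDerivAt (by simp)).eq _ _
  have h5 : HasDerivAt (fun t : ℝ ↦ (t, y₀)) ((1 : ℝ), (0 : A)) t₀ :=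
    (hasDerivAt_id t₀).prodMk (hasDerivAt_const t₀ y₀)
  rw [h3, ← h4]
  exact (hv (0, η)).comp_hasDerivAt t₀ h5

/-! ### The geodesic flow and its linearisation. -/

section Flow

variable {S : Type*} [TopologicalSpace S] [ChartedSpace Plane S]
  [IsManifold (𝓡 2) ∞ S] {h : SurfaceMetric S}

theorem isGeodesicOrbit_iff {c : ℝ → UnitTangent h} :
    IsGeodesicOrbit c ↔ IsMIntegralCurve c (geodesicField (h := h)) := by
  have key : ∀ (q : UnitTangent h) (ζ : TangentSpace unitModel q),
      ContinuousLinearMap.toSpanSingleton ℝ ζ = (1 : ℝ →L[ℝ] ℝ).smulRight ζ := fun q ζ ↦ by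
    ext; simp
  constructor
  · intro hc t
    obtain ⟨ζ, h1, h2, h3⟩ := hc t
    have : ζ = geodesicField (c t) := eq_of_dBase_covariant _ (h2.trans (dBase_geodesicField _).symm)
      fun w ↦ (h3 w).trans (covariant_geodesicField _ w).symm
    rw [this, key] at h1
    exact h1
  · intro hc t
    refine ⟨geodesicField (c t), ?_, dBase_geodesicField _, covariant_geodesicField _⟩
    rw [key]
    exact hc t

/-- The coordinate expression of the geodesic field. -/
noncomputable def localGeodesicField (P : UnitTangent h) (z : Plane × ℝ) : Plane × ℝ :=
  horLift (chartMetric h P.base) (chartVec P) z (chartVec P z)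

theorem contDiffAt_localGeodesicField (P : UnitTangent h) {z : Plane × ℝ}
    (hz : z.1 ∈ (chartAt Plane P.base).target) : ContDiffAt ℝ ∞ (localGeodesicField P) z :=
  (localUnitBundle P hz).contDiffAt_horLift (localUnitBundle P hz).smooth.self_of_nhds

theorem tangentBundle_mk_eq {q q' : UnitTangent h} (hq : q = q') {ζ : TangentSpace unitModel q}
    {ζ' : TangentSpace unitModel q'} (hζ : (id ζ : Plane × ℝ) = ζ') :
    (⟨q, ζ⟩ : TangentBundle unitModel (UnitTangent h)) = ⟨q', ζ'⟩ := by
  subst hq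
  exact congrArg _ hζ

/-- The geodesic flow. -/
noncomputable def geodesicFlow (hh : IsGeodesicallyComplete h) (q : ℝ × UnitTangent h) :
    UnitTangent h := (hh q.2).choose q.1

variable (hh : IsGeodesicallyComplete h)

theorem isGeodesicOrbit_geodesicFlow (p : UnitTangent h) :
    IsGeodesicOrbit (fun t ↦ geodesicFlow hh (t, p)) := (hh p).choose_spec.1

theorem isMIntegralCurve_geodesicFlow (p : UnitTangent h) :
    IsMIntegralCurve (fun t ↦ geodesicFlow hh (t, p)) (geodesicField (h := h)) :=
  isGeodesicOrbit_iff.1 (isGeodesicOrbit_geodesicFlow hh p)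

theorem geodesicFlow_zero (p : UnitTangent h) : geodesicFlow hh (0, p) = p :=
  (hh p).choose_spec.2

variable [T2Space S]

theorem geodesicFlow_add (s t : ℝ) (p : UnitTangent h) :
    geodesicFlow hh (s + t, p) = geodesicFlow hh (s, geodesicFlow hh (t, p)) :=
  flow_add contMDiff_geodesicField (isMIntegralCurve_geodesicFlow hh) (geodesicFlow_zero hh) s t p

theorem contMDiff_geodesicFlow :
    ContMDiff (𝓘(ℝ, ℝ).prod unitModel) unitModel ∞ (geodesicFlow hh) :=
  contMDiff_flow contMDiff_geodesicField (isMIntegralCurve_geodesicFlow hh) (geodesicFlow_zero hh)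

/-- The time `T` map of the geodesic flow. -/
noncomputable def timeMap (T : ℝ) : UnitTangent h ≃ₘ⟮unitModel, unitModel⟯ UnitTangent h where
  toFun p := geodesicFlow hh (T, p)
  invFun p := geodesicFlow hh (-T, p)
  left_inv p := by beta_reduce; rw [← geodesicFlow_add, neg_add_cancel, geodesicFlow_zero]
  right_inv p := by beta_reduce; rw [← geodesicFlow_add, add_neg_cancel, geodesicFlow_zero]
  contMDiff_toFun := (contMDiff_geodesicFlow hh).comp (contMDiff_const.prodMk contMDiff_id)
  contMDiff_invFun := (contMDiff_geodesicFlow hh).comp (contMDiff_const.prodMk contMDiff_id)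

theorem isTimeMap_timeMap (T : ℝ) : IsTimeMap T (timeMap hh T) := fun p ↦
  ⟨_, isGeodesicOrbit_geodesicFlow hh p, geodesicFlow_zero hh p, rfl⟩

/-- The derivative of the time `T` map. -/
noncomputable def dTime (T : ℝ) (p : UnitTangent h) :
    TangentSpace unitModel p →L[ℝ] TangentSpace unitModel (timeMap hh T p) :=
  mfderiv unitModel unitModel (timeMap hh T) p

/-- The geodesic flow and its derivative in a chart. -/
theorem exists_local_variation (p : UnitTangent h) (t₀ : ℝ) :
    ∃ (P : UnitTangent h) (z : ℝ → Plane × ℝ) (V : ℝ → TangentSpace unitModel p → Plane × ℝ),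
      (z t₀).1 ∈ (chartAt Plane P.base).target ∧
      HasDerivAt z (localGeodesicField P (z t₀)) t₀ ∧
      (∀ η, HasDerivAt (fun t ↦ V t η)
        (fderiv ℝ (localGeodesicField P) (z t₀) (V t₀ η)) t₀) ∧
      ∀ᶠ t in 𝓝 t₀, (z t).1 ∈ (chartAt Plane P.base).target ∧ ∀ η,
        (⟨timeMap hh t p, dTime hh t p η⟩ : TangentBundle unitModel (UnitTangent h)) =
          ⟨param P (z t), dParam P (z t) (V t η)⟩ := by
  obtain ⟨p', y₀, hy₀, rfl⟩ := exists_param p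
  choose c hcη using exists_dParam p' hy₀
  set P := timeMap hh t₀ (param p' y₀) with hP
  set g := extChartAt unitModel P with hg
  have hpar := isLocalDiffeomorphAt_param p' hy₀
  set Φ : ℝ × (Plane × ℝ) → UnitTangent h := fun q ↦ geodesicFlow hh (q.1, param p' q.2) with hΦ
  have hΦs : ∀ q : ℝ × (Plane × ℝ), q.2.1 ∈ (chartAt Plane p'.base).target →
      ContMDiffAt 𝓘(ℝ, ℝ × (Plane × ℝ)) unitModel ∞ Φ q := by
    intro q hq
    have h1 : ContMDiffAt 𝓘(ℝ, ℝ × (Plane × ℝ)) 𝓘(ℝ, ℝ) ∞ (fun q : ℝ × (Plane × ℝ) ↦ q.1) q :=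
      contDiffAt_fst.contMDiffAt
    have h2 : ContMDiffAt 𝓘(ℝ, ℝ × (Plane × ℝ)) 𝓘(ℝ, Plane × ℝ) ∞
        (fun q : ℝ × (Plane × ℝ) ↦ q.2) q := contDiffAt_snd.contMDiffAt
    exact (contMDiff_geodesicFlow hh).contMDiffAt.comp q (h1.prodMk
      (ContMDiffAt.comp q (g := param p') (isLocalDiffeomorphAt_param p' hq).contMDiffAt h2))
  -- Initial points vary in a fixed chart around `p`, and end points are read in the chart at the
  -- end point for the time `t₀`. The Jacobi field `V` is the partial derivative of this map in the
  -- direction of the coordinates of `η`.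
  set F : ℝ × (Plane × ℝ) → Plane × ℝ := fun q ↦ g (Φ q) with hF
  have hev : ∀ᶠ q in 𝓝 (t₀, y₀), q.2.1 ∈ (chartAt Plane p'.base).target ∧ Φ q ∈ g.source :=
    (continuousAt_snd.eventually (eventually_fst_mem_target p' hy₀)).and
      ((hΦs (t₀, y₀) hy₀).continuousAt.eventually (extChartAt_source_mem_nhds P))
  have hmem : ∀ q, Φ q ∈ g.source → (F q).1 ∈ (chartAt Plane P.base).target := fun q hq ↦
    (mem_extChartAt_target_iff P).1 (g.map_source hq)
  have hinv : ∀ q, Φ q ∈ g.source → param P (F q) = Φ q := fun q hq ↦ g.left_inv hq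
  have hFs : ∀ᶠ q in 𝓝 (t₀, y₀), ContDiffAt ℝ ∞ F q := by
    filter_upwards [hev] with q hq
    have hq2 := hq.2
    rw [hg, extChartAt_source] at hq2
    exact (ContMDiffAt.comp q (g := g) (contMDiffAt_extChartAt' hq2) (hΦs q hq.1)).contDiffAt
  -- Both sides have the same image under the injective derivative of the parametrisation at the end
  -- point: the velocity of the geodesic.
  have hode : ∀ᶠ q in 𝓝 (t₀, y₀), fderiv ℝ F q (1, 0) = localGeodesicField P (F q) := by
    filter_upwards [hev, hev.eventually_nhds, hFs] with q hq hq' hFq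
    have hd : HasDerivAt (fun t : ℝ ↦ F (t, q.2)) (fderiv ℝ F q (1, 0)) q.1 := by
      have h5 : HasDerivAt (fun t : ℝ ↦ (t, q.2)) ((1 : ℝ), (0 : Plane × ℝ)) q.1 :=
        (hasDerivAt_id _).prodMk (hasDerivAt_const _ _)
      exact (hFq.differentiableAt (by simp)).hasFDerivAt.comp_hasDerivAt q.1 h5
    have h1 := (((isLocalDiffeomorphAt_param P (hmem q hq.2)).contMDiffAt.mdifferentiableAt
      (by simp)).hasMFDerivAt.comp (f := fun t : ℝ ↦ F (t, q.2)) q.1 hd.hasFDerivAt.hasMFDerivAt)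
    have h2 : (fun t ↦ geodesicFlow hh (t, param p' q.2)) =ᶠ[𝓝 q.1]
        param P ∘ fun t : ℝ ↦ F (t, q.2) := by
      have hc : ContinuousAt (fun t : ℝ ↦ (t, q.2)) q.1 := by fun_prop
      filter_upwards [hc.eventually hq'] with t ht
      exact (hinv (t, q.2) ht.2).symm
    have h3 := hasMFDerivAt_unique (h1.congr_of_eventuallyEq h2)
      (isMIntegralCurve_geodesicFlow hh (param p' q.2) q.1)
    have h4 := congrArg (fun L : ℝ →L[ℝ] Plane × ℝ ↦ L 1) h3
    have h5 : (id (dParam P (F q) (fderiv ℝ F q (1, 0))) : Plane × ℝ) = geodesicField (Φ q) := by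
      refine Eq.trans ?_ (h4.trans (one_smul ℝ _))
      exact congrArg (dParam P (F q)) (one_smul ℝ _).symm
    have h6 : (id (geodesicField (param P (F q))) : Plane × ℝ) = geodesicField (Φ q) :=
      congrArg (fun q ↦ (id (geodesicField q) : Plane × ℝ)) (hinv q hq.2)
    apply dParam_injective P (hmem q hq.2)
    exact (h5.trans h6.symm).trans (geodesicField_param P (hmem q hq.2))
  have hev0 := hev.self_of_nhds
  refine ⟨P, fun t ↦ F (t, y₀), fun t η ↦ fderiv ℝ F (t, y₀) (0, c η), hmem _ hev0.2, ?_, fun η ↦ ?_,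
    ?_⟩
  · rw [← hode.self_of_nhds]
    have h5 : HasDerivAt (fun t : ℝ ↦ (t, y₀)) ((1 : ℝ), (0 : Plane × ℝ)) t₀ :=
      (hasDerivAt_id _).prodMk (hasDerivAt_const _ _)
    exact (hFs.self_of_nhds.differentiableAt (by simp)).hasFDerivAt.comp_hasDerivAt t₀ h5
  · exact hasDerivAt_linearised (hFs.self_of_nhds.of_le (by simpa using two_le_infty))
      ((contDiffAt_localGeodesicField P (hmem _ hev0.2)).differentiableAt (by simp)) hode (c η)
  · have hc : ContinuousAt (fun t : ℝ ↦ (t, y₀)) t₀ := by fun_prop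
    filter_upwards [hc.eventually hev.eventually_nhds, hc.eventually hFs] with t ht hFt
    have ht0 := ht.self_of_nhds
    refine ⟨hmem _ ht0.2, fun η ↦ tangentBundle_mk_eq (hinv _ ht0.2).symm ?_⟩
    have hd : HasFDerivAt (fun y : Plane × ℝ ↦ F (t, y))
        ((fderiv ℝ F (t, y₀)).comp (ContinuousLinearMap.inr ℝ ℝ (Plane × ℝ))) y₀ :=
      (hFt.differentiableAt (by simp)).hasFDerivAt.comp y₀ (hasFDerivAt_prodMk_right t y₀)
    have h1 := (((isLocalDiffeomorphAt_param P (hmem _ ht0.2)).contMDiffAt.mdifferentiableAt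
      (by simp)).hasMFDerivAt.comp (f := fun y : Plane × ℝ ↦ F (t, y)) y₀ hd.hasMFDerivAt)
    have h2 : (timeMap hh t ∘ param p') =ᶠ[𝓝 y₀] param P ∘ fun y : Plane × ℝ ↦ F (t, y) := by
      have hc' : ContinuousAt (fun y : Plane × ℝ ↦ (t, y)) y₀ := by fun_prop
      filter_upwards [hc'.eventually ht] with y hy
      exact (hinv (t, y) hy.2).symm
    have h3 := (((timeMap hh t).contMDiff.mdifferentiable (by simp)
      (param p' y₀)).hasMFDerivAt.comp y₀ ((isLocalDiffeomorphAt_param p' hy₀).contMDiffAt.mdifferentiableAt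
      (by simp)).hasMFDerivAt)
    have h4 := hasMFDerivAt_unique (h1.congr_of_eventuallyEq h2) h3
    have h5 := congrArg (fun L : Plane × ℝ →L[ℝ] Plane × ℝ ↦ L (c η)) h4
    refine Eq.trans ?_ h5.symm
    exact congrArg (dTime hh t (param p' y₀)) (hcη η).symm

end Flow

/-! ### Forms invariant along a flow. -/

section Cartan

variable {E : Type*} [NormedAddCommGroup E] [NormedSpace ℝ E] {β : E → E →L[ℝ] ℝ} {X : E → E}
  {z : ℝ → E} {V W : ℝ → E} {t₀ : ℝ}

/-- A form `β` with `β(X) = 1` and `i_X dβ = 0` is invariant under the flow of `X`. -/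
theorem hasDerivAt_form (hβ : DifferentiableAt ℝ β (z t₀)) (hX : DifferentiableAt ℝ X (z t₀))
    (h1 : ∀ᶠ x in 𝓝 (z t₀), β x (X x) = 1)
    (h2 : ∀ U, fderiv ℝ β (z t₀) (X (z t₀)) U = fderiv ℝ β (z t₀) U (X (z t₀)))
    (hz : HasDerivAt z (X (z t₀)) t₀) (hV : HasDerivAt V (fderiv ℝ X (z t₀) (V t₀)) t₀) :
    HasDerivAt (fun t ↦ β (z t) (V t)) 0 t₀ := by
  have h3 := (hβ.hasFDerivAt.comp_hasDerivAt t₀ hz).clm_apply hV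
  refine h3.congr_deriv ?_
  -- Differentiating `β(X) = 1` in the direction `V` expresses `β(DX V)` as minus the derivative of
  -- `β` along `V`, evaluated on `X`. Because of `i_X dβ = 0` this cancels the derivative of `β`
  -- along the flow.
  have h4 : HasFDerivAt (fun x ↦ β x (X x)) (0 : E →L[ℝ] ℝ) (z t₀) :=
    (hasFDerivAt_const (1 : ℝ) _).congr_of_eventuallyEq h1
  have h5 := congrArg (fun L : E →L[ℝ] ℝ ↦ L (V t₀))
    (h4.unique (hβ.hasFDerivAt.clm_apply hX.hasFDerivAt))
  simp only [zero_apply, add_apply, ContinuousLinearMap.comp_apply,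
    ContinuousLinearMap.flip_apply] at h5
  rw [h2, h5]
  simp only [Function.comp_apply]
  ring

/-- If `i_X dβ = 0` then `dβ` is invariant under the flow of `X`. -/
theorem hasDerivAt_exterior (hβ : ContDiffAt ℝ ∞ β (z t₀)) (hX : DifferentiableAt ℝ X (z t₀))
    (h2 : ∀ᶠ x in 𝓝 (z t₀), ∀ U, fderiv ℝ β x (X x) U = fderiv ℝ β x U (X x))
    (hz : HasDerivAt z (X (z t₀)) t₀) (hV : HasDerivAt V (fderiv ℝ X (z t₀) (V t₀)) t₀)
    (hW : HasDerivAt W (fderiv ℝ X (z t₀) (W t₀)) t₀) :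
    HasDerivAt (fun t ↦ fderiv ℝ β (z t) (V t) (W t) - fderiv ℝ β (z t) (W t) (V t)) 0 t₀ := by
  have hβ2 : DifferentiableAt ℝ (fderiv ℝ β) (z t₀) :=
    (hβ.fderiv_right (m := ∞) (by simp)).differentiableAt (by simp)
  have hs : ∀ A B, fderiv ℝ (fderiv ℝ β) (z t₀) A B = fderiv ℝ (fderiv ℝ β) (z t₀) B A := fun A B ↦
    ((hβ.of_le (by simpa using two_le_infty)).isSymmSndFDerivAt (by simp)).eq A B
  have hd : ∀ {A B : ℝ → E}, HasDerivAt A (fderiv ℝ X (z t₀) (A t₀)) t₀ →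
      HasDerivAt B (fderiv ℝ X (z t₀) (B t₀)) t₀ →
      HasDerivAt (fun t ↦ fderiv ℝ β (z t) (A t) (B t))
        (fderiv ℝ (fderiv ℝ β) (z t₀) (X (z t₀)) (A t₀) (B t₀) +
          fderiv ℝ β (z t₀) (fderiv ℝ X (z t₀) (A t₀)) (B t₀) +
          fderiv ℝ β (z t₀) (A t₀) (fderiv ℝ X (z t₀) (B t₀))) t₀ := fun hA hB ↦
    (((hβ2.hasFDerivAt.comp_hasDerivAt t₀ hz).clm_apply hA).clm_apply hB)
  -- This is the derivative of `i_X dβ = 0` in the direction `A`. Antisymmetrised, and with the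
  -- second derivative of `β` symmetric, it is Cartan's formula with `d(dβ) = 0`.
  have hc : ∀ A B, fderiv ℝ (fderiv ℝ β) (z t₀) A (X (z t₀)) B +
      fderiv ℝ β (z t₀) (fderiv ℝ X (z t₀) A) B =
      fderiv ℝ (fderiv ℝ β) (z t₀) A B (X (z t₀)) + fderiv ℝ β (z t₀) B (fderiv ℝ X (z t₀) A) := by
    intro A B
    have e1 := (hβ2.hasFDerivAt.clm_apply hX.hasFDerivAt).clm_apply (hasFDerivAt_const B (z t₀))
    have e2 := (hβ2.hasFDerivAt.clm_apply (hasFDerivAt_const B (z t₀))).clm_apply hX.hasFDerivAt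
    have e3 := congrArg (fun L : E →L[ℝ] ℝ ↦ L A)
      (e1.unique (e2.congr_of_eventuallyEq (h2.mono fun x hx ↦ hx B)))
    simp only [zero_apply, add_apply, ContinuousLinearMap.comp_apply,
      ContinuousLinearMap.flip_apply, map_zero] at e3
    linarith
  refine ((hd hV hW).sub (hd hW hV)).congr_deriv ?_
  have h3 := hc (V t₀) (W t₀)
  have h4 := hc (W t₀) (V t₀)
  rw [hs (X (z t₀)) (V t₀), hs (X (z t₀)) (W t₀)]
  rw [hs (W t₀) (V t₀)] at h4
  linarith

end Cartan

/-! ### The tautological form in a chart. -/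

namespace LocalUnitBundle

variable {W : Type*} [NormedAddCommGroup W] [NormedSpace ℝ W] {G : W → W →L[ℝ] W →L[ℝ] ℝ}
  {v : W × ℝ → W} {z : W × ℝ}

/-- The tautological form in a chart. -/
noncomputable def form (G : W → W →L[ℝ] W →L[ℝ] ℝ) (v : W × ℝ → W) (z : W × ℝ) : W × ℝ →L[ℝ] ℝ :=
  (G z.1 (v z)).comp (ContinuousLinearMap.fst ℝ W ℝ)

theorem contDiffAt_form (h : LocalUnitBundle G v z) : ContDiffAt ℝ ∞ (form G v) z :=
  ((h.smooth_metric.self_of_nhds.comp z contDiffAt_fst).clm_apply h.smooth.self_of_nhds).clm_comp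
    contDiffAt_const

theorem exterior_form (h : LocalUnitBundle G v z) (ζ ζ' : W × ℝ) :
    fderiv ℝ (form G v) z ζ ζ' - fderiv ℝ (form G v) z ζ' ζ =
      localCov G v z ζ ζ'.1 - localCov G v z ζ' ζ.1 := by
  have key : ∀ ζ ζ' : W × ℝ, fderiv ℝ (form G v) z ζ ζ' =
      fderiv ℝ (fun z ↦ G z.1 (v z) ζ'.1) z ζ := by
    intro ζ ζ'
    have h1 := (h.contDiffAt_form.differentiableAt (by simp)).hasFDerivAt
    have h2 : HasFDerivAt (fun z ↦ G z.1 (v z) ζ'.1)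
        ((ContinuousLinearMap.apply ℝ ℝ ζ').comp (fderiv ℝ (form G v) z)) z :=
      (ContinuousLinearMap.apply ℝ ℝ ζ').hasFDerivAt.comp z h1
    rw [h2.fderiv]
    rfl
  rw [key, key, h.fderiv_form]

theorem form_horLift (h : LocalUnitBundle G v z) : form G v z (horLift G v z (v z)) = 1 :=
  h.unit.self_of_nhds

/-- The condition `i_X dα = 0`: the geodesic field has vanishing covariant derivative, and its base
component is `v`, to which every covariant derivative is orthogonal. -/
theorem exterior_form_horLift (h : LocalUnitBundle G v z) (ζ : W × ℝ) :
    fderiv ℝ (form G v) z (horLift G v z (v z)) ζ =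
      fderiv ℝ (form G v) z ζ (horLift G v z (v z)) := by
  rw [← sub_eq_zero, h.exterior_form, h.cov_horLift, horLift_fst, h.cov_vec, sub_zero]

/-- The derivative of inner products along geodesics. -/
theorem hasDerivAt_inner {z : ℝ → W × ℝ} {A B : ℝ → W × ℝ} {t₀ : ℝ}
    (h : LocalUnitBundle G v (z t₀))
    (hz : HasDerivAt z (horLift G v (z t₀) (v (z t₀))) t₀)
    (hA : HasDerivAt A (fderiv ℝ (fun z ↦ horLift G v z (v z)) (z t₀) (A t₀)) t₀)
    (hB : HasDerivAt B (fderiv ℝ (fun z ↦ horLift G v z (v z)) (z t₀) (B t₀)) t₀) :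
    HasDerivAt (fun t ↦ G (z t).1 (A t).1 (B t).1)
      (localCov G v (z t₀) (A t₀) (B t₀).1 + localCov G v (z t₀) (B t₀) (A t₀).1) t₀ := by
  have hX : DifferentiableAt ℝ (fun z ↦ horLift G v z (v z)) (z t₀) :=
    (h.contDiffAt_horLift h.smooth.self_of_nhds).differentiableAt (by simp)
  -- The base component of the geodesic field is `v`, so that of the linearised field is the
  -- derivative of `v`.
  have hX1 : ∀ ζ, (fderiv ℝ (fun z ↦ horLift G v z (v z)) (z t₀) ζ).1 = fderiv ℝ v (z t₀) ζ := by
    intro ζ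
    have h1 : HasFDerivAt v ((ContinuousLinearMap.fst ℝ W ℝ).comp
        (fderiv ℝ (fun z ↦ horLift G v z (v z)) (z t₀))) (z t₀) :=
      (ContinuousLinearMap.fst ℝ W ℝ).hasFDerivAt.comp (z t₀) hX.hasFDerivAt
    rw [h1.fderiv]
    rfl
  have hG : DifferentiableAt ℝ G (z t₀).1 := h.smooth_metric.self_of_nhds.differentiableAt (by simp)
  have hf : ∀ (C : ℝ → W × ℝ) (c : W × ℝ), HasDerivAt C c t₀ →
      HasDerivAt (fun t ↦ (C t).1) c.1 t₀ := fun C c hC ↦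
    (ContinuousLinearMap.fst ℝ W ℝ).hasFDerivAt.comp_hasDerivAt t₀ hC
  have hA1 := hf A _ hA
  have hB1 := hf B _ hB
  rw [hX1] at hA1 hB1
  have hGz : HasDerivAt (fun t ↦ G (z t).1) (fderiv ℝ G (z t₀).1 (v (z t₀))) t₀ :=
    hG.hasFDerivAt.comp_hasDerivAt t₀ (hf z _ hz)
  have h1 := (hGz.clm_apply hA1).clm_apply hB1
  rw [← h.fderiv_inner]
  exact h1

end LocalUnitBundle

/-! ### Invariance of the contact structure under the geodesic flow. -/

section Invariance

variable {S : Type*} [TopologicalSpace S] [ChartedSpace Plane S]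
  [IsManifold (𝓡 2) ∞ S] {h : SurfaceMetric S}

/-- The covariant derivative paired with the base component. -/
noncomputable def covariantBase (q : UnitTangent h) (ζ ζ' : TangentSpace unitModel q) : ℝ :=
  covariant q ζ (dBase q ζ')

/-- The exterior derivative of the tautological form. -/
noncomputable def symplectic (q : UnitTangent h) (ζ ζ' : TangentSpace unitModel q) : ℝ :=
  covariantBase q ζ ζ' - covariantBase q ζ' ζ

/-- The inner product of the base components. -/
noncomputable def baseInner (q : UnitTangent h) (ζ ζ' : TangentSpace unitModel q) : ℝ :=
  h.inner q.base (dBase q ζ) (dBase q ζ')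

/-- Functions of two tangent vectors at a common point are transported along equalities in the
tangent bundle, where a change of base point causes no mismatch of types. -/
theorem tangentBundle_pairing {q q' : UnitTangent h}
    (F : ∀ q : UnitTangent h, TangentSpace unitModel q → TangentSpace unitModel q → ℝ)
    {ζ η : TangentSpace unitModel q} {ζ' η' : TangentSpace unitModel q'}
    (hζ : (⟨q, ζ⟩ : TangentBundle unitModel (UnitTangent h)) = ⟨q', ζ'⟩)
    (hη : (⟨q, η⟩ : TangentBundle unitModel (UnitTangent h)) = ⟨q', η'⟩) :
    F q ζ η = F q' ζ' η' := by
  obtain rfl : q = q' := congrArg TotalSpace.proj hζ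
  rw [TotalSpace.mk_inj] at hζ hη
  rw [hζ, hη]

theorem covariantBase_dParam (p : UnitTangent h) {z : Plane × ℝ}
    (hz : z.1 ∈ (chartAt Plane p.base).target) (ζ ζ' : Plane × ℝ) :
    covariantBase (param p z) (dParam p z ζ) (dParam p z ζ') =
      localCov (chartMetric h p.base) (chartVec p) z ζ ζ'.1 :=
  (covariant_dParam p hz ζ _).trans (congrArg _ (dBase_dParam p hz ζ'))

theorem baseInner_dParam (p : UnitTangent h) {z : Plane × ℝ}
    (hz : z.1 ∈ (chartAt Plane p.base).target) (ζ ζ' : Plane × ℝ) :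
    baseInner (param p z) (dParam p z ζ) (dParam p z ζ') =
      chartMetric h p.base z.1 ζ.1 ζ'.1 :=
  (inner_dBase_dParam p hz ζ _).trans (congrArg _ (dBase_dParam p hz ζ'))

theorem ofCoframe_mem_liouville (q : UnitTangent h) (b c : ℝ) :
    (⟨q, ofCoframe q 0 b c⟩ : TangentBundle unitModel (UnitTangent h)) ∈ liouville h := by
  rw [mem_liouville, inner_vec_ofCoframe]

theorem symplectic_eq {q : UnitTangent h} {ζ ζ' : TangentSpace unitModel q}
    (hζ : (⟨q, ζ⟩ : TangentBundle unitModel (UnitTangent h)) ∈ liouville h)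
    (hζ' : (⟨q, ζ'⟩ : TangentBundle unitModel (UnitTangent h)) ∈ liouville h) :
    symplectic q ζ ζ' = covariant q ζ (normal q) * h.inner q.base (normal q) (dBase q ζ') -
      covariant q ζ' (normal q) * h.inner q.base (normal q) (dBase q ζ) := by
  rw [symplectic, covariantBase, covariantBase, dBase_of_mem_liouville hζ,
    dBase_of_mem_liouville hζ', covariant_smul_right, covariant_smul_right]
  simp only [map_smul, smul_eq_mul, inner_normal, mul_one]
  ring

/-- A vector of a Liouville plane in terms of its normal and its vertical component. -/
theorem eq_ofCoframe {q : UnitTangent h} {ζ : TangentSpace unitModel q}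
    (hζ : (⟨q, ζ⟩ : TangentBundle unitModel (UnitTangent h)) ∈ liouville h) :
    ζ = ofCoframe q 0 (h.inner q.base (normal q) (dBase q ζ)) (covariant q ζ (normal q)) := by
  refine coframe_injective q ?_
  rw [coframe_ofCoframe, coframe_apply, (mem_liouville q ζ).1 hζ]

variable [T2Space S] (hh : IsGeodesicallyComplete h)

theorem dTime_zero (p : UnitTangent h) (η : TangentSpace unitModel p) :
    (⟨timeMap hh 0 p, dTime hh 0 p η⟩ : TangentBundle unitModel (UnitTangent h)) = ⟨p, η⟩ := by
  have h1 : (timeMap hh 0 : UnitTangent h → UnitTangent h) = id := funext (geodesicFlow_zero hh)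
  change tangentMap unitModel unitModel (timeMap hh 0) ⟨p, η⟩ = _
  rw [h1, tangentMap_id]
  rfl

theorem dTime_add (s t : ℝ) (p : UnitTangent h) (η : TangentSpace unitModel p) :
    (⟨timeMap hh (s + t) p, dTime hh (s + t) p η⟩ : TangentBundle unitModel (UnitTangent h)) =
      ⟨timeMap hh s (timeMap hh t p), dTime hh s _ (dTime hh t p η)⟩ := by
  have h1 : (timeMap hh (s + t) : UnitTangent h → UnitTangent h) = timeMap hh s ∘ timeMap hh t :=
    funext (geodesicFlow_add hh s t)
  change tangentMap unitModel unitModel (timeMap hh (s + t)) ⟨p, η⟩ =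
    tangentMap unitModel unitModel (timeMap hh s) (tangentMap unitModel unitModel (timeMap hh t) ⟨p, η⟩)
  rw [h1, tangentMap_comp_at _ ((timeMap hh s).contMDiff.mdifferentiable (by simp) _)
    ((timeMap hh t).contMDiff.mdifferentiable (by simp) _)]

/-- The geodesic flow preserves the tautological form. -/
theorem form_dTime (t : ℝ) (p : UnitTangent h) (η : TangentSpace unitModel p) :
    h.inner (timeMap hh t p).base (timeMap hh t p).vec (dBase _ (dTime hh t p η)) =
      h.inner p.base p.vec (dBase p η) := by
  set F : ∀ q : UnitTangent h, TangentSpace unitModel q → TangentSpace unitModel q → ℝ :=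
    fun q ζ _ ↦ h.inner q.base q.vec (dBase q ζ) with hF
  have key : ∀ t₀, HasDerivAt (fun t ↦ F (timeMap hh t p) (dTime hh t p η) (dTime hh t p η)) 0 t₀ := by
    intro t₀
    obtain ⟨P, z, V, hz₀, hz, hV, hev⟩ := exists_local_variation hh p t₀
    have hU := localUnitBundle P hz₀
    have h1 : HasDerivAt (fun t ↦ LocalUnitBundle.form (chartMetric h P.base) (chartVec P)
        (z t) (V t η)) 0 t₀ :=
      hasDerivAt_form (X := localGeodesicField P) (hU.contDiffAt_form.differentiableAt (by simp))
        ((contDiffAt_localGeodesicField P hz₀).differentiableAt (by simp))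
        (hU.eventually.mono fun x hx ↦ hx.form_horLift) hU.exterior_form_horLift hz (hV η)
    refine h1.congr_of_eventuallyEq ?_
    filter_upwards [hev] with t ht
    rw [tangentBundle_pairing F (ht.2 η) (ht.2 η)]
    exact inner_vec_dBase_dParam P ht.1 _
  have h2 := is_const_of_deriv_eq_zero (fun t ↦ (key t).differentiableAt) (fun t ↦ (key t).deriv) t 0
  exact h2.trans (tangentBundle_pairing F (dTime_zero hh p η) (dTime_zero hh p η))

/-- The geodesic flow preserves the exterior derivative of the tautological form. -/
theorem symplectic_dTime (t : ℝ) (p : UnitTangent h) (η η' : TangentSpace unitModel p) :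
    symplectic _ (dTime hh t p η) (dTime hh t p η') = symplectic p η η' := by
  have key : ∀ t₀, HasDerivAt (fun t ↦ symplectic _ (dTime hh t p η) (dTime hh t p η')) 0 t₀ := by
    intro t₀
    obtain ⟨P, z, V, hz₀, hz, hV, hev⟩ := exists_local_variation hh p t₀
    have hU := localUnitBundle P hz₀
    have h1 := hasDerivAt_exterior (X := localGeodesicField P) hU.contDiffAt_form
        ((contDiffAt_localGeodesicField P hz₀).differentiableAt (by simp))
        (hU.eventually.mono fun x hx ↦ hx.exterior_form_horLift) hz (hV η) (hV η')
    refine h1.congr_of_eventuallyEq ?_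
    filter_upwards [hev] with t ht
    rw [tangentBundle_pairing symplectic (ht.2 η) (ht.2 η'),
      (localUnitBundle P ht.1).exterior_form, symplectic, covariantBase_dParam P ht.1,
      covariantBase_dParam P ht.1]
  have h2 := is_const_of_deriv_eq_zero (fun t ↦ (key t).differentiableAt) (fun t ↦ (key t).deriv) t 0
  exact h2.trans (tangentBundle_pairing symplectic (dTime_zero hh p η) (dTime_zero hh p η'))

/-- For a variation by geodesics with base field `J`, the covariant derivative of `J` along the
geodesic equals the covariant derivative of the velocity along `J`, since the torsion vanishes. The
product rule for the metric gives the two terms. -/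
theorem hasDerivAt_baseInner (t₀ : ℝ) (p : UnitTangent h) (η η' : TangentSpace unitModel p) :
    HasDerivAt (fun t ↦ baseInner _ (dTime hh t p η) (dTime hh t p η'))
      (covariantBase _ (dTime hh t₀ p η) (dTime hh t₀ p η') +
        covariantBase _ (dTime hh t₀ p η') (dTime hh t₀ p η)) t₀ := by
  obtain ⟨P, z, V, hz₀, hz, hV, hev⟩ := exists_local_variation hh p t₀
  have h1 := (localUnitBundle P hz₀).hasDerivAt_inner hz (hV η) (hV η')
  have ht₀ := hev.self_of_nhds
  rw [tangentBundle_pairing covariantBase (ht₀.2 η) (ht₀.2 η'),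
    tangentBundle_pairing covariantBase (ht₀.2 η') (ht₀.2 η), covariantBase_dParam P ht₀.1,
    covariantBase_dParam P ht₀.1]
  refine h1.congr_of_eventuallyEq ?_
  filter_upwards [hev] with t ht
  rw [tangentBundle_pairing baseInner (ht.2 η) (ht.2 η'), baseInner_dParam P ht.1]

theorem dTime_mem_liouville (t : ℝ) (p : UnitTangent h) (η : TangentSpace unitModel p) :
    (⟨timeMap hh t p, dTime hh t p η⟩ : TangentBundle unitModel (UnitTangent h)) ∈ liouville h ↔
      (⟨p, η⟩ : TangentBundle unitModel (UnitTangent h)) ∈ liouville h := by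
  rw [mem_liouville, mem_liouville, form_dTime]

/-- The geodesic flow preserves the orientation of the Liouville planes. -/
theorem dTime_orientation (t : ℝ) (p : UnitTangent h) (η : TangentSpace unitModel p)
    (hη : (⟨p, η⟩ : TangentBundle unitModel (UnitTangent h)) ∈ liouville h) (hη0 : η ≠ 0) :
    ∃ a b : ℝ, 0 < b ∧ dTime hh t p (quarterTurn p η) =
      a • dTime hh t p η + b • quarterTurn _ (dTime hh t p η) := by
  have h1 := (dTime_mem_liouville hh t p η).2 hη
  have h2 := (dTime_mem_liouville hh t p _).2 (quarterTurn_mem p η)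
  -- The pairing `dα(η, Jη)` is minus the squared length of `η`. Its invariance makes the pairing of
  -- the images of `η` and `Jη` negative, which is a condition on their orientation.
  have h3 := symplectic_dTime hh t p η (quarterTurn p η)
  rw [symplectic_eq h1 h2, symplectic_eq hη (quarterTurn_mem p η), covariant_quarterTurn,
    inner_normal, quarterTurn_apply p η, inner_normal_ofCoframe, ← quarterTurn_apply] at h3
  have h4 : 0 < h.inner p.base (normal p) (dBase p η) ^ 2 + covariant p η (normal p) ^ 2 := by
    by_contra hneg
    have e1 : h.inner p.base (normal p) (dBase p η) = 0 := by nlinarith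
    have e2 : covariant p η (normal p) = 0 := by nlinarith
    refine hη0 (coframe_injective p ?_)
    rw [coframe_apply, (mem_liouville p η).1 hη, e1, e2, map_zero]
    rfl
  set q := timeMap hh t p with hq
  set f := h.inner q.base (normal q) (dBase q (dTime hh t p η)) with hf
  set g := covariant q (dTime hh t p η) (normal q) with hg
  set f' := h.inner q.base (normal q) (dBase q (dTime hh t p (quarterTurn p η))) with hf'
  set g' := covariant q (dTime hh t p (quarterTurn p η)) (normal q) with hg'
  have h5 : 0 < f ^ 2 + g ^ 2 := by
    by_contra hneg
    have e1 : f = 0 := by nlinarith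
    have e2 : g = 0 := by nlinarith
    rw [e1, e2] at h3
    linarith
  -- These are the coefficients of the image of `Jη` in the orthogonal basis `(w, Jw)`, where `w` is
  -- the image of `η` with components `(f, g)` and `Jw` has the components `(-g, f)`. By `h3` the
  -- numerator of `b` is the squared length of `η`.
  refine ⟨(f * f' + g * g') / (f ^ 2 + g ^ 2), (f * g' - g * f') / (f ^ 2 + g ^ 2),
    div_pos (by linarith) h5, ?_⟩
  refine coframe_injective q ?_
  rw [map_add, map_smul, map_smul, quarterTurn_apply q, coframe_ofCoframe, coframe_apply, coframe_apply,
    (mem_liouville q _).1 h1, (mem_liouville q _).1 h2, ← hf, ← hg, ← hf', ← hg']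
  refine Prod.ext (by simp) (Prod.ext ?_ ?_)
  · simp only [Prod.smul_mk, Prod.mk_add_mk, smul_eq_mul]
    field_simp
    ring
  · simp only [Prod.smul_mk, Prod.mk_add_mk, smul_eq_mul]
    field_simp
    ring

end Invariance

-- Integrals with parameters.

universe u

/-- Primitives depend smoothly on parameters. -/
theorem contDiff_parametric_integral {F : Type u} [NormedAddCommGroup F] [NormedSpace ℝ F]
    [FiniteDimensional ℝ F] {r : ℝ × F → ℝ} (hr : ContDiff ℝ ∞ r) :
    ContDiff ℝ ∞ (fun q : ℝ × F ↦ ∫ s in (0 : ℝ)..q.1, r (s, q.2)) := by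
  have hcont : ∀ y, Continuous fun s ↦ r (s, y) := fun y ↦
    hr.continuous.comp (Continuous.prodMk_left y)
  -- The integral is the last component of the explicit flow `φ` of the field `(1, 0, r)`, so its
  -- smoothness follows from that of flows.
  set v : ℝ × F × ℝ → ℝ × F × ℝ := fun x ↦ (1, 0, r (x.1, x.2.1)) with hv
  set φ : ℝ × (ℝ × F × ℝ) → ℝ × F × ℝ := fun q ↦ (q.2.1 + q.1, q.2.2.1,
    q.2.2.2 + ∫ s in q.2.1..q.2.1 + q.1, r (s, q.2.2.1)) with hφ
  have hvs : ContDiff ℝ ∞ v := by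
    refine contDiff_const.prodMk (contDiff_const.prodMk (hr.comp ?_))
    fun_prop
  have hvs' : ContMDiff 𝓘(ℝ, ℝ × F × ℝ) 𝓘(ℝ, ℝ × F × ℝ).tangent ∞
      (fun x ↦ (⟨x, v x⟩ : TangentBundle 𝓘(ℝ, ℝ × F × ℝ) (ℝ × F × ℝ))) :=
    contMDiff_vectorSpace_iff_contDiff.2 hvs
  have hcurve : ∀ x, IsMIntegralCurve (I := 𝓘(ℝ, ℝ × F × ℝ)) (fun t ↦ φ (t, x)) v := by
    intro x t
    have h1 : HasDerivAt (fun t ↦ x.1 + t) 1 t := (hasDerivAt_id t).const_add _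
    have h2 : HasDerivAt (fun t ↦ ∫ s in x.1..x.1 + t, r (s, x.2.1)) (r (x.1 + t, x.2.1)) t := by
      have := (((hcont x.2.1).integral_hasStrictDerivAt x.1 (x.1 + t)).hasDerivAt).comp t h1
      rwa [mul_one] at this
    have h3 := h1.prodMk ((hasDerivAt_const t x.2.1).prodMk (h2.const_add x.2.2))
    exact h3.hasFDerivAt.hasMFDerivAt
  have h4 := contMDiff_flow hvs' hcurve (fun x ↦ by simp [hφ])
  have h5 : ContMDiff 𝓘(ℝ, ℝ × F) (𝓘(ℝ, ℝ).prod 𝓘(ℝ, ℝ × F × ℝ)) ∞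
      (fun q : ℝ × F ↦ (q.1, ((0 : ℝ), q.2, (0 : ℝ)))) := by
    refine ContMDiff.prodMk (f := fun q : ℝ × F ↦ q.1) (g := fun q : ℝ × F ↦ ((0 : ℝ), q.2, (0 : ℝ)))
      contDiff_fst.contMDiff (ContDiff.contMDiff ?_)
    fun_prop
  have h6 : ContDiff ℝ ∞ (fun q : ℝ × F ↦ φ (q.1, ((0 : ℝ), q.2, (0 : ℝ)))) := (h4.comp h5).contDiff
  have h7 := h6.snd.snd
  simpa [hφ] using h7

/-! ### Jacobi fields and the twisting angle. -/

section Twist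

variable {S : Type*} [TopologicalSpace S] [T2Space S] [ChartedSpace Plane S]
  [IsManifold (𝓡 2) ∞ S] {h : SurfaceMetric S} (hh : IsGeodesicallyComplete h)

/-- The sum of the squares of the two Jacobi fields along a geodesic that come from the orthonormal
basis `Y`, `Z` of the Liouville plane. -/
noncomputable def jacobiNorm (q : ℝ × UnitTangent h) : ℝ :=
  baseInner _ (dTime hh q.1 q.2 (ofCoframe q.2 0 1 0)) (dTime hh q.1 q.2 (ofCoframe q.2 0 1 0)) +
  baseInner _ (dTime hh q.1 q.2 (ofCoframe q.2 0 0 1)) (dTime hh q.1 q.2 (ofCoframe q.2 0 0 1))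

/-- The normal component of the Jacobi field of `η`. -/
noncomputable def jacobi (t : ℝ) (p : UnitTangent h) (η : TangentSpace unitModel p) : ℝ :=
  h.inner (timeMap hh t p).base (normal (timeMap hh t p)) (dBase _ (dTime hh t p η))

/-- The normal component of the covariant derivative of the Jacobi field of `η`. -/
noncomputable def jacobiDeriv (t : ℝ) (p : UnitTangent h) (η : TangentSpace unitModel p) : ℝ :=
  covariant (timeMap hh t p) (dTime hh t p η) (normal (timeMap hh t p))

theorem jacobi_add (t : ℝ) (p : UnitTangent h) (η η' : TangentSpace unitModel p) :
    jacobi hh t p (η + η') = jacobi hh t p η + jacobi hh t p η' := by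
  simp only [jacobi, map_add]

theorem jacobi_smul (t : ℝ) (p : UnitTangent h) (a : ℝ) (η : TangentSpace unitModel p) :
    jacobi hh t p (a • η) = a * jacobi hh t p η := by
  simp only [jacobi, map_smul, smul_eq_mul]

variable {p : UnitTangent h} {η η' : TangentSpace unitModel p}

theorem dBase_dTime (t : ℝ) (hη : (⟨p, η⟩ : TangentBundle unitModel (UnitTangent h)) ∈ liouville h) :
    dBase _ (dTime hh t p η) = jacobi hh t p η • normal (timeMap hh t p) :=
  dBase_of_mem_liouville ((dTime_mem_liouville hh t p η).2 hη)

theorem baseInner_dTime (t : ℝ)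
    (hη : (⟨p, η⟩ : TangentBundle unitModel (UnitTangent h)) ∈ liouville h)
    (hη' : (⟨p, η'⟩ : TangentBundle unitModel (UnitTangent h)) ∈ liouville h) :
    baseInner _ (dTime hh t p η) (dTime hh t p η') = jacobi hh t p η * jacobi hh t p η' := by
  rw [baseInner, dBase_dTime hh t hη, dBase_dTime hh t hη']
  simp only [map_smul, smul_apply, smul_eq_mul, inner_normal]
  ring

theorem covariantBase_dTime (t : ℝ)
    (hη' : (⟨p, η'⟩ : TangentBundle unitModel (UnitTangent h)) ∈ liouville h) :
    covariantBase _ (dTime hh t p η) (dTime hh t p η') =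
      jacobiDeriv hh t p η * jacobi hh t p η' := by
  rw [covariantBase, dBase_dTime hh t hη', covariant_smul_right, jacobiDeriv, mul_comm]

/-- Only products of two Jacobi components are differentiated. The normal along the geodesic is
chosen pointwise, so a single component may jump in sign, whereas a product is an inner product of
base components. -/
theorem hasDerivAt_jacobi (t : ℝ)
    (hη : (⟨p, η⟩ : TangentBundle unitModel (UnitTangent h)) ∈ liouville h)
    (hη' : (⟨p, η'⟩ : TangentBundle unitModel (UnitTangent h)) ∈ liouville h) :
    HasDerivAt (fun t ↦ jacobi hh t p η * jacobi hh t p η')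
      (jacobiDeriv hh t p η * jacobi hh t p η' + jacobiDeriv hh t p η' * jacobi hh t p η) t := by
  have h1 := hasDerivAt_baseInner hh t p η η'
  rw [covariantBase_dTime hh t hη, covariantBase_dTime hh t hη'] at h1
  simpa only [baseInner_dTime hh _ hη hη'] using h1

/-- The flow preserves `dα`, and `dα(Z, Y) = 1`. The pointwise sign of the normal cancels, since
each term contains it twice. -/
theorem jacobi_wronskian (t : ℝ) (p : UnitTangent h) :
    jacobi hh t p (ofCoframe p 0 1 0) * jacobiDeriv hh t p (ofCoframe p 0 0 1) -
      jacobi hh t p (ofCoframe p 0 0 1) * jacobiDeriv hh t p (ofCoframe p 0 1 0) = 1 := by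
  have h1 := symplectic_dTime hh t p (ofCoframe p 0 0 1) (ofCoframe p 0 1 0)
  rw [symplectic_eq (ofCoframe_mem_liouville p _ _) (ofCoframe_mem_liouville p _ _)] at h1
  simp only [covariant_ofCoframe, inner_normal_ofCoframe] at h1
  rw [symplectic, covariantBase_dTime hh t (ofCoframe_mem_liouville p _ _),
    covariantBase_dTime hh t (ofCoframe_mem_liouville p _ _)] at h1
  linarith

theorem jacobiNorm_eq (t : ℝ) (p : UnitTangent h) : jacobiNorm hh (t, p) =
    jacobi hh t p (ofCoframe p 0 1 0) ^ 2 + jacobi hh t p (ofCoframe p 0 0 1) ^ 2 := by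
  rw [jacobiNorm, baseInner_dTime hh t (ofCoframe_mem_liouville p _ _) (ofCoframe_mem_liouville p _ _),
    baseInner_dTime hh t (ofCoframe_mem_liouville p _ _) (ofCoframe_mem_liouville p _ _)]
  ring

/-- Two Jacobi fields with nonzero Wronskian have no common zero. -/
theorem jacobiNorm_pos (q : ℝ × UnitTangent h) : 0 < jacobiNorm hh q := by
  obtain ⟨t, p⟩ := q
  rw [jacobiNorm_eq]
  have h1 := jacobi_wronskian hh t p
  by_contra hneg
  have e1 : jacobi hh t p (ofCoframe p 0 1 0) = 0 := by nlinarith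
  have e2 : jacobi hh t p (ofCoframe p 0 0 1) = 0 := by nlinarith
  rw [e1, e2] at h1
  linarith

theorem hasDerivAt_jacobiNorm (t : ℝ) (p : UnitTangent h) :
    HasDerivAt (fun t ↦ jacobiNorm hh (t, p))
      (2 * (jacobiDeriv hh t p (ofCoframe p 0 1 0) * jacobi hh t p (ofCoframe p 0 1 0) +
        jacobiDeriv hh t p (ofCoframe p 0 0 1) * jacobi hh t p (ofCoframe p 0 0 1))) t := by
  have h1 := (hasDerivAt_jacobi hh t (ofCoframe_mem_liouville p 1 0)
    (ofCoframe_mem_liouville p 1 0)).add (hasDerivAt_jacobi hh t (ofCoframe_mem_liouville p 0 1)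
    (ofCoframe_mem_liouville p 0 1))
  refine (h1.congr_of_eventuallyEq (.of_forall fun s ↦ ?_)).congr_deriv (by ring)
  simp only [Pi.add_apply]
  rw [jacobiNorm_eq]
  ring

/-- The angle by which the geodesic flow turns the kernel of the projection. -/
noncomputable def phase (q : ℝ × UnitTangent h) : ℝ :=
  ∫ s in (0 : ℝ)..q.1, (jacobiNorm hh (s, q.2))⁻¹

theorem phase_zero (p : UnitTangent h) : phase hh (0, p) = 0 :=
  intervalIntegral.integral_same

/-- The Wronskian is one, so this is the angular velocity of the plane curve formed by the Jacobi
components of `Y` and `Z`. Its positivity is the positivity of the twisting. -/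
theorem hasDerivAt_phase (t : ℝ) (p : UnitTangent h) :
    HasDerivAt (fun t ↦ phase hh (t, p)) (jacobiNorm hh (t, p))⁻¹ t := by
  have hc : Continuous fun s ↦ (jacobiNorm hh (s, p))⁻¹ :=
    (continuous_iff_continuousAt.2 fun s ↦ (hasDerivAt_jacobiNorm hh s p).continuousAt).inv₀
      fun s ↦ (jacobiNorm_pos hh (s, p)).ne'
  exact (hc.integral_hasStrictDerivAt 0 t).hasDerivAt

/-- The rotated vertical vector is mapped to a vertical vector. -/
theorem jacobi_phase (t : ℝ) (p : UnitTangent h) :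
    Real.cos (phase hh (t, p)) * jacobi hh t p (ofCoframe p 0 0 1) =
      Real.sin (phase hh (t, p)) * jacobi hh t p (ofCoframe p 0 1 0) := by
  have hY := ofCoframe_mem_liouville p 1 0
  have hZ := ofCoframe_mem_liouville p 0 1
  -- This is the square of `cos · jacobi Z - sin · jacobi Y`, divided by `jacobiNorm` and expanded
  -- so that the components occur only in pairs. In terms of the polar angle `ψ` of `(jacobi Y,
  -- jacobi Z)` it equals `sin² (ψ - phase)`, which is constant because both angles have the same
  -- derivative.
  set e : ℝ → ℝ := fun t ↦ (Real.cos (phase hh (t, p)) ^ 2 * (jacobi hh t p (ofCoframe p 0 0 1) *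
      jacobi hh t p (ofCoframe p 0 0 1)) - 2 * (Real.cos (phase hh (t, p)) *
      Real.sin (phase hh (t, p))) * (jacobi hh t p (ofCoframe p 0 1 0) *
      jacobi hh t p (ofCoframe p 0 0 1)) + Real.sin (phase hh (t, p)) ^ 2 *
      (jacobi hh t p (ofCoframe p 0 1 0) * jacobi hh t p (ofCoframe p 0 1 0))) /
      jacobiNorm hh (t, p) with he
  have hd : ∀ t, HasDerivAt e 0 t := by
    intro t
    have hρ := hasDerivAt_phase hh t p
    have hc := hρ.cos
    have hs := hρ.sin
    have h1 := ((((hc.pow 2).mul (hasDerivAt_jacobi hh t hZ hZ)).sub (((hc.mul hs).const_mul 2).mul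
      (hasDerivAt_jacobi hh t hY hZ))).add ((hs.pow 2).mul (hasDerivAt_jacobi hh t hY hY))).div
      (hasDerivAt_jacobiNorm hh t p) (jacobiNorm_pos hh (t, p)).ne'
    refine h1.congr_deriv ?_
    have hw := jacobi_wronskian hh t p
    have hQ := jacobiNorm_eq hh t p
    have hQ0 := (jacobiNorm_pos hh (t, p)).ne'
    have hcs := Real.sin_sq_add_cos_sq (phase hh (t, p))
    simp only [Pi.add_apply, Pi.sub_apply, Pi.mul_apply, Pi.pow_apply]
    generalize jacobi hh t p (ofCoframe p 0 0 1) = a at *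
    generalize jacobi hh t p (ofCoframe p 0 1 0) = b at *
    generalize jacobiDeriv hh t p (ofCoframe p 0 0 1) = a' at *
    generalize jacobiDeriv hh t p (ofCoframe p 0 1 0) = b' at *
    generalize jacobiNorm hh (t, p) = Q at *
    generalize Real.cos (phase hh (t, p)) = c at *
    generalize Real.sin (phase hh (t, p)) = s at *
    have hu : Q⁻¹ * Q = 1 := inv_mul_cancel₀ hQ0
    generalize Q⁻¹ = u at *
    rw [div_eq_zero_iff]
    left
    linear_combination (-2 * (c * a - s * b) * (s * a + c * b)) * hu +
      2 * (c * a - s * b) * (c * a' - s * b') * hQ + 2 * (c * a - s * b) * (s * a + c * b) * hw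
  have h0 : e 0 = 0 := by
    -- The Jacobi field of the vertical vector starts at zero; this fixes the initial value of the
    -- angle.
    have h2 : jacobi hh 0 p (ofCoframe p 0 0 1) = 0 := by
      have h3 := tangentBundle_pairing baseInner (dTime_zero hh p (ofCoframe p 0 0 1))
        (dTime_zero hh p (ofCoframe p 0 0 1))
      rw [baseInner_dTime hh 0 hZ hZ, baseInner, dBase_ofCoframe] at h3
      simpa using h3
    simp only [he, phase_zero, h2, Real.sin_zero]
    simp
  have h1 : e t = 0 :=
    (is_const_of_deriv_eq_zero (fun t ↦ (hd t).differentiableAt) (fun t ↦ (hd t).deriv) t 0).trans h0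
  rw [he, div_eq_zero_iff, or_iff_left (jacobiNorm_pos hh (t, p)).ne'] at h1
  have h2 : (Real.cos (phase hh (t, p)) * jacobi hh t p (ofCoframe p 0 0 1) -
      Real.sin (phase hh (t, p)) * jacobi hh t p (ofCoframe p 0 1 0)) ^ 2 = 0 := by
    refine Eq.trans ?_ h1; ring
  exact sub_eq_zero.1 (pow_eq_zero_iff (two_ne_zero) |>.1 h2)

/-- The vectors that the geodesic flow maps to vertical vectors. -/
theorem dBase_dTime_eq_zero_iff (t : ℝ) (p : UnitTangent h) (η : TangentSpace unitModel p) :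
    dBase _ (dTime hh t p η) = 0 ↔ ∃ a : ℝ, η = ofCoframe p 0 (-(a * Real.sin (phase hh (t, p))))
      (a * Real.cos (phase hh (t, p))) := by
  have hY := ofCoframe_mem_liouville p 1 0
  have hZ := ofCoframe_mem_liouville p 0 1
  have hph := jacobi_phase hh t p
  have hof : ∀ b c : ℝ, ofCoframe p 0 b c = b • ofCoframe p 0 1 0 + c • ofCoframe p 0 0 1 := by
    intro b c
    refine coframe_injective p ?_
    rw [map_add, map_smul, map_smul, coframe_ofCoframe, coframe_ofCoframe, coframe_ofCoframe]
    simp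
  constructor
  · intro h0
    have hη : (⟨p, η⟩ : TangentBundle unitModel (UnitTangent h)) ∈ liouville h := by
      rw [← dTime_mem_liouville hh t, mem_liouville, h0, map_zero]
    rw [eq_ofCoframe hη] at h0 ⊢
    set y := h.inner p.base (normal p) (dBase p η)
    set x := covariant p η (normal p)
    have h1 : jacobi hh t p (ofCoframe p 0 y x) = 0 := by rw [jacobi, h0, map_zero]
    rw [hof, jacobi_add, jacobi_smul, jacobi_smul] at h1
    have hQ := jacobiNorm_pos hh (t, p)
    rw [jacobiNorm_eq] at hQ
    have hcs := Real.sin_sq_add_cos_sq (phase hh (t, p))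
    generalize jacobi hh t p (ofCoframe p 0 0 1) = a at *
    generalize jacobi hh t p (ofCoframe p 0 1 0) = b at *
    generalize Real.cos (phase hh (t, p)) = c at *
    generalize Real.sin (phase hh (t, p)) = s at *
    -- By `hph` the vector `(b, a)` is the multiple of `(c, s)` by `s * a + c * b`, which is not
    -- zero because `(b, a)` is not. Hence orthogonality of `(y, x)` to `(b, a)` is orthogonality to
    -- `(c, s)`.
    have hk : (s * a + c * b) * (y * c + x * s) = 0 := by
      linear_combination h1 + (-x * c + y * s) * hph + (y * b + x * a) * (hcs)
    have hk0 : s * a + c * b ≠ 0 := by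
      intro hk0
      have : b ^ 2 + a ^ 2 = 0 := by
        linear_combination (s * a + c * b) * hk0 + (c * a - s * b) * hph - (a ^ 2 + b ^ 2) * hcs
      linarith
    have hl := (mul_eq_zero.1 hk).resolve_left hk0
    -- The coefficient of `(y, x)` along the unit vector `(-s, c)` orthogonal to `(c, s)`.
    refine ⟨x * c - y * s, ?_⟩
    congr 1
    · linear_combination c * hl - y * hcs
    · linear_combination s * hl - x * hcs
  · rintro ⟨a, rfl⟩
    rw [dBase_dTime hh t (ofCoframe_mem_liouville p _ _), hof, jacobi_add, jacobi_smul, jacobi_smul]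
    have : -(a * Real.sin (phase hh (t, p))) * jacobi hh t p (ofCoframe p 0 1 0) +
      a * Real.cos (phase hh (t, p)) * jacobi hh t p (ofCoframe p 0 0 1) = 0 := by
        linear_combination a * hph
    rw [this, zero_smul]

end Twist

/-! ### Smoothness of the twisting angle. -/

section TwistSmooth

variable {S : Type*} [TopologicalSpace S] [T2Space S] [ChartedSpace Plane S]
  [IsManifold (𝓡 2) ∞ S] {h : SurfaceMetric S} (hh : IsGeodesicallyComplete h)

/-- The expression is the squared length function on `TΣ`, composed with the tangent map of `(t, z)
↦ base of the flow`, applied to the vector `(0, B z)`. Each of these is smooth, and no normal is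
involved. -/
theorem contDiffAt_baseInner_dTime (p : UnitTangent h) {B : Plane × ℝ → Plane × ℝ}
    (q : ℝ × (Plane × ℝ)) (hz : q.2.1 ∈ (chartAt Plane p.base).target)
    (hB : ContDiffAt ℝ ∞ B q.2) :
    ContDiffAt ℝ ∞ (fun q : ℝ × (Plane × ℝ) ↦
      baseInner (timeMap hh q.1 (param p q.2)) (dTime hh q.1 (param p q.2) (dParam p q.2 (B q.2)))
        (dTime hh q.1 (param p q.2) (dParam p q.2 (B q.2)))) q := by
  set Ψ : ℝ × (Plane × ℝ) → S := fun q ↦ (geodesicFlow hh (q.1, param p q.2)).base with hΨ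
  have hev : ∀ᶠ q' in 𝓝 q, q'.2.1 ∈ (chartAt Plane p.base).target :=
    continuousAt_snd.eventually (eventually_fst_mem_target p hz)
  have hΨs : ∀ᶠ q' in 𝓝 q, ContMDiffAt 𝓘(ℝ, ℝ × (Plane × ℝ)) (𝓡 2) ∞ Ψ q' := by
    filter_upwards [hev] with q hq
    have h1 : ContMDiffAt 𝓘(ℝ, ℝ × (Plane × ℝ)) 𝓘(ℝ, ℝ) ∞ (fun q : ℝ × (Plane × ℝ) ↦ q.1) q :=
      contDiffAt_fst.contMDiffAt
    have h2 : ContMDiffAt 𝓘(ℝ, ℝ × (Plane × ℝ)) 𝓘(ℝ, Plane × ℝ) ∞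
        (fun q : ℝ × (Plane × ℝ) ↦ q.2) q := contDiffAt_snd.contMDiffAt
    have h3 := (contMDiff_geodesicFlow hh).contMDiffAt.comp q (h1.prodMk
      (ContMDiffAt.comp q (g := param p) (isLocalDiffeomorphAt_param p hq).contMDiffAt h2))
    exact (contMDiff_base h).contMDiffAt.comp q h3
  have : IsManifold (𝓡 2) 1 S := IsManifold.of_le (n := ∞) (by simp)
  have h1 : ContMDiffAt 𝓘(ℝ, ℝ × (Plane × ℝ)) 𝓘(ℝ, ℝ × (Plane × ℝ)).tangent ∞
      (fun q ↦ (⟨q, ((0 : ℝ), B q.2)⟩ : TangentBundle 𝓘(ℝ, ℝ × (Plane × ℝ)) (ℝ × (Plane × ℝ)))) q :=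
    contMDiffAt_vectorSpace_iff_contDiffAt.2 (contDiffAt_const.prodMk (hB.comp q contDiffAt_snd))
  have h2 := (contMDiffAt_tangentMap (ζ := ⟨q, ((0 : ℝ), B q.2)⟩) hΨs).comp q h1
  have h3 := ((contMDiff_normSq h).contMDiffAt.comp q h2).contDiffAt
  refine h3.congr_of_eventuallyEq ?_
  filter_upwards [hev, hΨs] with q hq hq'
  have h4 : HasMFDerivAt 𝓘(ℝ, Plane × ℝ) (𝓡 2) (fun z ↦ Ψ (q.1, z)) q.2 _ :=
    HasMFDerivAt.comp (g := Ψ) (f := fun z ↦ (q.1, z)) q.2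
      (hq'.mdifferentiableAt (by simp)).hasMFDerivAt (hasFDerivAt_prodMk_right q.1 q.2).hasMFDerivAt
  have h5 := ((contMDiff_base h).mdifferentiable (by simp) (timeMap hh q.1 (param p q.2))).hasMFDerivAt.comp
    q.2 (((timeMap hh q.1).contMDiff.mdifferentiable (by simp) (param p q.2)).hasMFDerivAt.comp q.2
      ((isLocalDiffeomorphAt_param p hq).contMDiffAt.mdifferentiableAt (by simp)).hasMFDerivAt)
  have h6 := hasMFDerivAt_unique h4 h5
  have h7 := congrArg (fun L : Plane × ℝ →L[ℝ] Plane ↦ L (B q.2)) h6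
  exact (congrArg (fun u : Plane ↦ h.inner (Ψ q) (u : TangentSpace (𝓡 2) (Ψ q))
    (u : TangentSpace (𝓡 2) (Ψ q))) h7).symm

/-- The function `jacobiNorm` in terms of a chart. -/
theorem jacobiNorm_param (p : UnitTangent h) (t : ℝ) {z : Plane × ℝ}
    (hz : z.1 ∈ (chartAt Plane p.base).target) :
    jacobiNorm hh (t, param p z) =
      (baseInner (timeMap hh t (param p z)) (dTime hh t (param p z) (dParam p z (0, 1)))
        (dTime hh t (param p z) (dParam p z (0, 1))) +
      baseInner (timeMap hh t (param p z)) (dTime hh t (param p z) (dParam p z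
          (localTurn (chartMetric h p.base) (chartVec p) z (0, 1))))
        (dTime hh t (param p z) (dParam p z
          (localTurn (chartMetric h p.base) (chartVec p) z (0, 1))))) /
      chartMetric h p.base z.1 (paramDeriv (chartVec p) z) (paramDeriv (chartVec p) z) := by
  have hU := localUnitBundle p hz
  set q := param p z with hq
  set ζ := dParam p z (0, 1) with hζ
  have hb : dBase q ζ = 0 := coordAt_injective p.base (base_param_mem p hz)
    ((dBase_dParam p hz _).trans (map_zero _).symm)
  have hl : (⟨q, ζ⟩ : TangentBundle unitModel (UnitTangent h)) ∈ liouville h := by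
    rw [mem_liouville, hb, map_zero]
  set c := covariant q ζ (normal q) with hc
  -- The coordinate field `ζ = ∂/∂s` is `c Z`, and its quarter turn is `-c Y`. Squaring removes the
  -- sign of `c`, and `c²` is the squared length of `∂v/∂s`; hence the sum over the orthonormal
  -- basis can be computed without a choice.
  have h1 : ζ = c • ofCoframe q 0 0 1 := by
    refine coframe_injective q ?_
    rw [map_smul, coframe_ofCoframe, coframe_apply, hb, ← hc]
    simp
  have h2 : quarterTurn q ζ = (-c) • ofCoframe q 0 1 0 := by
    refine coframe_injective q ?_
    rw [map_smul, quarterTurn_apply, coframe_ofCoframe, coframe_ofCoframe, hb, ← hc]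
    simp
  obtain ⟨w, hw⟩ := coordAt_surjective p.base (base_param_mem p hz) (paramDeriv (chartVec p) z)
  have h3 : ∀ x, covariant q ζ x = h.inner q.base w x := fun x ↦ by
    rw [hζ, covariant_dParam p hz, LocalUnitBundle.cov_vertical, one_mul, inner_param p hz, hw]
  have h4 : chartMetric h p.base z.1 (paramDeriv (chartVec p) z) (paramDeriv (chartVec p) z) =
      c * c := by
    have h5 := h3 w
    rw [inner_param p hz, hw] at h5
    rw [← h5, covariant_eq, ← hc, h.symm, ← h3, ← hc]
  have hc0 : c ≠ 0 := left_ne_zero_of_mul (h4 ▸ hU.param_pos.ne' : c * c ≠ 0)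
  rw [← quarterTurn_dParam p hz _ hl, h4, h2, h1, jacobiNorm]
  simp only [baseInner, map_smul, smul_apply, smul_eq_mul]
  field_simp
  ring

theorem contDiffAt_jacobiNorm (p : UnitTangent h) (q : ℝ × (Plane × ℝ))
    (hz : q.2.1 ∈ (chartAt Plane p.base).target) :
    ContDiffAt ℝ ∞ (fun q : ℝ × (Plane × ℝ) ↦ jacobiNorm hh (q.1, param p q.2)) q := by
  have hU := localUnitBundle p hz
  have hs := hU.contDiffAt_paramDeriv
  have hg := hU.contDiffAt_metric hs hs
  have hturn : ContDiffAt ℝ ∞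
      (fun z ↦ localTurn (chartMetric h p.base) (chartVec p) z (0, 1)) q.2 :=
    (((hU.contDiffAt_cov contDiffAt_const hs).div hg hU.param_pos.ne').neg.smul
      (hU.contDiffAt_horLift hs)).add (contDiffAt_const.prodMk
        ((hU.contDiffAt_metric contDiffAt_const hs).div hg hU.param_pos.ne'))
  have h1 := ((contDiffAt_baseInner_dTime hh p (B := fun _ ↦ (0, 1)) q hz contDiffAt_const).add
    (contDiffAt_baseInner_dTime hh p q hz hturn)).div (hg.comp q contDiffAt_snd) hU.param_pos.ne'
  refine h1.congr_of_eventuallyEq ?_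
  filter_upwards [continuousAt_snd.eventually (eventually_fst_mem_target p hz)] with q hq
  exact jacobiNorm_param hh p q.1 hq

/-- In a chart the integrand is smooth, but it is controlled only for initial points in the chart. A
bump function of the initial point makes it globally smooth; it is one near the point considered,
for the whole time interval, so the integral is unchanged there. -/
theorem contMDiff_phase : ContMDiff (𝓘(ℝ, ℝ).prod unitModel) 𝓘(ℝ, ℝ) ∞ (phase hh) := by
  rintro ⟨t, q⟩
  obtain ⟨p, z, hz, rfl⟩ := exists_param q
  have hf := isLocalDiffeomorphAt_param p hz
  set U : Set (Plane × ℝ) := {z | z.1 ∈ (chartAt Plane p.base).target} with hU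
  have hUo : IsOpen U := (chartAt Plane p.base).open_target.preimage continuous_fst
  obtain ⟨R, hR, hRU⟩ := Metric.nhds_basis_closedBall.mem_iff.1 (hUo.mem_nhds hz)
  let χ : ContDiffBump z := ⟨R / 2, R, by linarith, by linarith⟩
  have hr : ContDiff ℝ ∞ (fun q : ℝ × (Plane × ℝ) ↦
      χ q.2 * (jacobiNorm hh (q.1, param p q.2))⁻¹) := by
    refine contDiff_iff_contDiffAt.2 fun q ↦ ?_
    by_cases hq : q.2 ∈ U
    · exact (χ.contDiff.contDiffAt.comp q contDiffAt_snd).mul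
        ((contDiffAt_jacobiNorm hh p q hq).inv (jacobiNorm_pos hh _).ne')
    · have h1 : ∀ᶠ q' in 𝓝 q, q'.2 ∉ tsupport χ := by
        refine continuousAt_snd.eventually ((isClosed_tsupport χ).isOpen_compl.mem_nhds ?_)
        rw [χ.tsupport_eq]
        exact fun h2 ↦ hq (hRU h2)
      refine (contDiffAt_const (c := (0 : ℝ))).congr_of_eventuallyEq ?_
      filter_upwards [h1] with q' hq'
      rw [image_eq_zero_of_notMem_tsupport hq', zero_mul]
  have h1 := contDiff_parametric_integral hr
  have h2 : ContMDiffAt (𝓘(ℝ, ℝ).prod unitModel) 𝓘(ℝ, ℝ × (Plane × ℝ)) ∞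
      (fun q : ℝ × UnitTangent h ↦ (q.1, hf.localInverse q.2)) (t, param p z) := by
    have h3 : ContMDiffAt (𝓘(ℝ, ℝ).prod unitModel) 𝓘(ℝ, Plane × ℝ) ∞
        (fun q : ℝ × UnitTangent h ↦ hf.localInverse q.2) (t, param p z) :=
      ContMDiffAt.comp (g := hf.localInverse) (f := fun q : ℝ × UnitTangent h ↦ q.2) (t, param p z)
        hf.localInverse_contMDiffAt contMDiffAt_snd
    exact contMDiffAt_fst.prodMk_space h3
  refine (h1.contMDiff.contMDiffAt.comp (t, param p z) h2).congr_of_eventuallyEq ?_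
  have h4 : ∀ᶠ y in 𝓝 (param p z), χ (hf.localInverse y) = 1 :=
    hf.tendsto_localInverse.eventually χ.eventuallyEq_one
  filter_upwards [(continuousAt_snd (p := ((t, param p z) : ℝ × UnitTangent h))).eventually h4,
    (continuousAt_snd (p := ((t, param p z) : ℝ × UnitTangent h))).eventually
      hf.localInverse_eventuallyEq_right] with q h5 h6
  have h6 : param p (hf.localInverse q.2) = q.2 := h6
  simp only [Function.comp_apply, phase, h5, h6, one_mul]

end TwistSmooth

/-! ### The vertical and horizontal line fields and the suspension. -/

section Lines

variable {S : Type*} [TopologicalSpace S] [ChartedSpace Plane S]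
  [IsManifold (𝓡 2) ∞ S] {h : SurfaceMetric S}

theorem smul_ofCoframe (q : UnitTangent h) (r a b c : ℝ) :
    r • ofCoframe q a b c = ofCoframe q (r * a) (r * b) (r * c) := by
  refine coframe_injective q ?_
  rw [map_smul, coframe_ofCoframe, coframe_ofCoframe]; rfl

theorem ofCoframe_add (q : UnitTangent h) (a b c a' b' c' : ℝ) :
    ofCoframe q a b c + ofCoframe q a' b' c' = ofCoframe q (a + a') (b + b') (c + c') := by
  refine coframe_injective q ?_
  rw [map_add, coframe_ofCoframe, coframe_ofCoframe, coframe_ofCoframe]; rfl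

theorem quarterTurn_ofCoframe (q : UnitTangent h) (a b c : ℝ) :
    quarterTurn q (ofCoframe q a b c) = ofCoframe q 0 (-c) b := by
  rw [quarterTurn_apply, covariant_ofCoframe, inner_normal_ofCoframe]

theorem mem_verticalLine_iff (q : UnitTangent h) (η : TangentSpace unitModel q) :
    (⟨q, η⟩ : TangentBundle unitModel (UnitTangent h)) ∈ verticalLine h ↔
      ∃ a : ℝ, η = ofCoframe q 0 0 a := by
  constructor
  · intro hη
    have h0 : dBase q η = 0 := hη
    have := eq_ofCoframe (verticalLine_subset h hη)
    rw [h0, map_zero] at this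
    exact ⟨_, this⟩
  · rintro ⟨a, rfl⟩
    change dBase q _ = 0
    rw [dBase_ofCoframe, zero_smul, zero_smul, add_zero]

theorem mem_horizontalLine_iff (q : UnitTangent h) (η : TangentSpace unitModel q) :
    (⟨q, η⟩ : TangentBundle unitModel (UnitTangent h)) ∈ horizontalLine h ↔
      ∃ a : ℝ, η = ofCoframe q 0 a 0 := by
  constructor
  · intro hη
    have h0 : covariant q η (normal q) = 0 := hη.1 _
    have := eq_ofCoframe (horizontalLine_subset h hη)
    rw [h0] at this
    exact ⟨_, this⟩
  · rintro ⟨a, rfl⟩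
    refine ⟨fun w ↦ ?_, inner_vec_ofCoframe q 0 a 0⟩
    change covariant q _ w = 0
    rw [covariant_eq, covariant_ofCoframe, mul_zero]

/-- The vertical line field turned by the angle `ρ`. -/
theorem exists_rotate_vertical_iff (q : UnitTangent h) (ρ : ℝ) (η : TangentSpace unitModel q) :
    (∃ η₀ : TangentSpace unitModel q,
      (⟨q, η₀⟩ : TangentBundle unitModel (UnitTangent h)) ∈ verticalLine h ∧
        η = Real.cos ρ • η₀ + Real.sin ρ • quarterTurn q η₀) ↔
      ∃ a : ℝ, η = ofCoframe q 0 (-(a * Real.sin ρ)) (a * Real.cos ρ) := by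
  have key : ∀ a : ℝ, Real.cos ρ • ofCoframe q 0 0 a + Real.sin ρ • quarterTurn q (ofCoframe q 0 0 a) =
      ofCoframe q 0 (-(a * Real.sin ρ)) (a * Real.cos ρ) := fun a ↦ by
    rw [quarterTurn_ofCoframe, smul_ofCoframe, smul_ofCoframe, ofCoframe_add]
    congr 1 <;> ring
  constructor
  · rintro ⟨η₀, h0, rfl⟩
    obtain ⟨a, rfl⟩ := (mem_verticalLine_iff q η₀).1 h0
    exact ⟨a, key a⟩
  · rintro ⟨a, rfl⟩
    exact ⟨_, (mem_verticalLine_iff q _).2 ⟨a, rfl⟩, (key a).symm⟩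

/-- The horizontal line field turned by the angle `ρ + π / 2`. -/
theorem exists_rotate_horizontal_iff (q : UnitTangent h) (ρ : ℝ) (η : TangentSpace unitModel q) :
    (∃ η₀ : TangentSpace unitModel q,
      (⟨q, η₀⟩ : TangentBundle unitModel (UnitTangent h)) ∈ horizontalLine h ∧
        η = Real.cos (ρ + Real.pi / 2) • η₀ + Real.sin (ρ + Real.pi / 2) • quarterTurn q η₀) ↔
      ∃ a : ℝ, η = ofCoframe q 0 (-(a * Real.sin ρ)) (a * Real.cos ρ) := by
  have key : ∀ a : ℝ, Real.cos (ρ + Real.pi / 2) • ofCoframe q 0 a 0 +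
      Real.sin (ρ + Real.pi / 2) • quarterTurn q (ofCoframe q 0 a 0) =
      ofCoframe q 0 (-(a * Real.sin ρ)) (a * Real.cos ρ) := fun a ↦ by
    rw [quarterTurn_ofCoframe, smul_ofCoframe, smul_ofCoframe, ofCoframe_add,
      Real.cos_add_pi_div_two, Real.sin_add_pi_div_two]
    congr 1 <;> ring
  constructor
  · rintro ⟨η₀, h0, rfl⟩
    obtain ⟨a, rfl⟩ := (mem_horizontalLine_iff q η₀).1 h0
    exact ⟨a, key a⟩
  · rintro ⟨a, rfl⟩
    exact ⟨_, (mem_horizontalLine_iff q _).2 ⟨a, rfl⟩, (key a).symm⟩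

theorem dBase_eq_zero_congr {q q' : UnitTangent h} {ζ : TangentSpace unitModel q}
    {ζ' : TangentSpace unitModel q'}
    (e : (⟨q, ζ⟩ : TangentBundle unitModel (UnitTangent h)) = ⟨q', ζ'⟩) :
    dBase q ζ = 0 ↔ dBase q' ζ' = 0 := by
  obtain ⟨rfl, h2⟩ := TotalSpace.mk.inj e
  rw [eq_of_heq h2]

variable [T2Space S] (hh : IsGeodesicallyComplete h)

/-- The condition on a line field and an initial phase which says that the twisted line field
consists of the vectors that the geodesic flow makes vertical. -/
def IsVerticalTwist (line : Set (TangentBundle unitModel (UnitTangent h))) (c : ℝ) : Prop :=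
  ∀ (t : ℝ) (p : UnitTangent h) (η : TangentSpace unitModel p),
    (∃ η₀ : TangentSpace unitModel p,
      (⟨p, η₀⟩ : TangentBundle unitModel (UnitTangent h)) ∈ line ∧
        η = Real.cos (phase hh (t, p) + c) • η₀ +
          Real.sin (phase hh (t, p) + c) • quarterTurn p η₀) ↔ dBase _ (dTime hh t p η) = 0

theorem isVerticalTwist_verticalLine : IsVerticalTwist hh (verticalLine h) 0 := fun t p η ↦ by
  rw [add_zero, exists_rotate_vertical_iff, dBase_dTime_eq_zero_iff]

/-- A quarter turn takes `Y` to `Z`; the initial phase `π / 2` accounts for it. -/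
theorem isVerticalTwist_horizontalLine : IsVerticalTwist hh (horizontalLine h) (Real.pi / 2) :=
  fun t p η ↦ by rw [exists_rotate_horizontal_iff, dBase_dTime_eq_zero_iff]

/-- Time is rescaled by `2π` so that the unit period of the mapping torus corresponds to the length
of the circle. -/
theorem hasDerivAt_twist (c t : ℝ) (p : UnitTangent h) :
    HasDerivAt (fun s ↦ phase hh (2 * Real.pi * s, p) + c)
      ((jacobiNorm hh (2 * Real.pi * t, p))⁻¹ * (2 * Real.pi)) t := by
  have h1 : HasDerivAt (fun s : ℝ ↦ 2 * Real.pi * s) (2 * Real.pi) t := by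
    simpa using (hasDerivAt_id t).const_mul (2 * Real.pi)
  exact ((hasDerivAt_phase hh (2 * Real.pi * t) p).comp t h1).add_const c

theorem contMDiff_twist (c : ℝ) : ContMDiff (𝓘(ℝ, ℝ).prod unitModel) 𝓘(ℝ, ℝ) ∞
    (fun q : ℝ × UnitTangent h ↦ phase hh (2 * Real.pi * q.1, q.2) + c) := by
  have h1 : ContMDiff (𝓘(ℝ, ℝ).prod unitModel) 𝓘(ℝ, ℝ) ∞
      (fun q : ℝ × UnitTangent h ↦ 2 * Real.pi * q.1) :=
    (contDiff_const.mul contDiff_id : ContDiff ℝ ∞ fun s : ℝ ↦ 2 * Real.pi * s).contMDiff.comp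
      contMDiff_fst
  exact ((contMDiff_phase hh).comp (h1.prodMk contMDiff_snd)).add contMDiff_const

/-- The suspension of the Liouville contact structure by the time `2π` map of the geodesic flow. -/
noncomputable def geodesicSuspension (line : Set (TangentBundle unitModel (UnitTangent h))) (c : ℝ)
    (hs : IsSmoothDistribution line 1) (hsub : line ⊆ liouville h)
    (hc : IsVerticalTwist hh line c) : Suspension unitModel (UnitTangent h) where
  plane := liouville h
  isContact := isContact_liouville h
  rot := quarterTurn
  rot_mem p η _ := quarterTurn_mem p η
  rot_rot _ _ hη := quarterTurn_quarterTurn hη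
  smooth_rot := smoothNear_quarterTurn
  line := line
  smooth_line := hs
  line_subset := hsub
  map := timeMap hh (2 * Real.pi)
  map_plane ζ := dTime_mem_liouville hh (2 * Real.pi) ζ.1 ζ.2
  map_orientation p η hη hη0 := dTime_orientation hh (2 * Real.pi) p η hη hη0
  twist q := phase hh (2 * Real.pi * q.1, q.2) + c
  smooth_twist := contMDiff_twist hh c
  deriv_twist_pos t p := by
    rw [(hasDerivAt_twist hh c t p).deriv]
    exact mul_pos (inv_pos.2 (jacobiNorm_pos hh _)) Real.two_pi_pos
  -- Both sides say that `η` becomes vertical after the time `2π(t + 1)`: on the right the flow runs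
  -- first for the time `2π`, as the suspension map, and then for `2πt`.
  deck_invariant t p η := by
    refine (hc _ p η).trans (Iff.trans ?_ (hc (2 * Real.pi * t) _ _).symm)
    rw [mul_add, mul_one]
    exact dBase_eq_zero_congr (dTime_add hh (2 * Real.pi * t) (2 * Real.pi) p η)

/-- Only the component of `v` along `S¹(TΣ)` is constrained, since the plane contains `∂/∂t`. By the
choice of the twisting, the constraint is that the flow makes this component vertical. -/
theorem mem_coverDistribution_geodesicSuspension
    {line : Set (TangentBundle unitModel (UnitTangent h))} {c : ℝ}
    (hs : IsSmoothDistribution line 1) (hsub : line ⊆ liouville h)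
    (hc : IsVerticalTwist hh line c) (q : ℝ × UnitTangent h)
    (v : TangentSpace (𝓘(ℝ, ℝ).prod unitModel) q) :
    (⟨q, v⟩ : TangentBundle (𝓘(ℝ, ℝ).prod unitModel)
      (TorusCover (timeMap hh (2 * Real.pi)))) ∈
        (geodesicSuspension hh line c hs hsub hc).coverDistribution ↔
      dBase _ (dTime hh (2 * Real.pi * q.1) q.2 (v : ℝ × (Plane × ℝ)).2) = 0 := by
  have e : mfderiv (𝓘(ℝ, ℝ).prod unitModel) unitModel (fun q : ℝ × UnitTangent h ↦ q.2) q v =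
      (v : ℝ × (Plane × ℝ)).2 := by
    have : mfderiv (𝓘(ℝ, ℝ).prod unitModel) unitModel (fun q : ℝ × UnitTangent h ↦ q.2) q =
      ContinuousLinearMap.snd ℝ ℝ (Plane × ℝ) := mfderiv_snd
    rw [this]; rfl
  refine Iff.trans ?_ (hc _ q.2 (v : ℝ × (Plane × ℝ)).2)
  change (∃ η : TangentSpace unitModel q.2, _ ∧
    mfderiv (𝓘(ℝ, ℝ).prod unitModel) unitModel (fun q : ℝ × UnitTangent h ↦ q.2) q v = _) ↔ _
  rw [e]
  rfl

end Lines

/-! ### Smooth families of null lines. -/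

section NullLines

variable {E : Type*} [NormedAddCommGroup E] [NormedSpace ℝ E] {H : Type*} [TopologicalSpace H]
  {I : ModelWithCorners ℝ E H} {V : Type*} [TopologicalSpace V] [ChartedSpace H V]
  [IsManifold I ∞ V] {g : LorentzMetric I V} [Fact (Module.finrank ℝ E = 3)]
  {F : Type*} [NormedAddCommGroup F] [NormedSpace ℝ F] {K : Type*} [TopologicalSpace K]
  {J : ModelWithCorners ℝ F K} {N : Type*} [TopologicalSpace N] [ChartedSpace K N]

/-- A smooth family of null vectors spans a smooth family of null lines. -/
theorem contMDiffAt_toLine {f : N → NullVector g} {x : N}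
    (hf : ContMDiffAt J I.tangent ∞ (fun y ↦ (f y).val) x) :
    ContMDiffAt J (I.prod 𝓘(ℝ, ℝ)) ∞ (fun y ↦ (f y).toLine) x := by
  set m := (f x).toLine with hm
  have hmem : (f x).val ∈ m.frame.dom := by
    have := NullLine.mem_frameChart_source m.frame
    rw [NullLine.toLine_rep] at this
    exact (NullLine.rep_mem_dom m.frame (f x)).1 this
  have h1 : ContMDiffAt I.tangent (I.prod 𝓘(ℝ, ℝ)) ∞ m.frame.coord (f x).val :=
    (m.frame.contMDiffOn_coord subset_rfl).contMDiffAt (m.frame.isOpen_dom.mem_nhds hmem)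
  have h2 : ContMDiffAt J (I.prod 𝓘(ℝ, ℝ)) ∞ (fun y ↦ m.frame.coord (f y).val) x := h1.comp x hf
  have h3 : ContMDiffAt (I.prod 𝓘(ℝ, ℝ)) (I.prod 𝓘(ℝ, ℝ)) ∞ (chartAt (ModelProd H ℝ) m).symm
      (m.frame.coord (f x).val) := by
    refine contMDiffOn_chart_symm.contMDiffAt
      ((chartAt (ModelProd H ℝ) m).open_target.mem_nhds ?_)
    exact (m.frame.lift_coord hmem).1
  refine (h3.comp x h2).congr_of_eventuallyEq ?_
  filter_upwards [hf.continuousAt.preimage_mem_nhds (m.frame.isOpen_dom.mem_nhds hmem)] with y hy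
  have hs : (f y).toLine ∈ (chartAt (ModelProd H ℝ) m).source :=
    (NullLine.rep_mem_dom m.frame (f y)).2 hy
  have := (chartAt (ModelProd H ℝ) m).left_inv hs
  refine this.symm.trans (congrArg _ ?_)
  exact NullLine.coord_rep m.frame (f y)

/-- Null lines are spanned, locally, by a smooth family of null vectors. -/
theorem exists_smooth_lift (m : NullLine g) : ∃ f : NullLine g → NullVector g,
    ContMDiffAt (I.prod 𝓘(ℝ, ℝ)) I.tangent ∞ (fun m' ↦ (f m').val) m ∧
      ∀ᶠ m' in 𝓝 m, (f m').toLine = m' := by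
  classical
  have hm := mem_chart_source (ModelProd H ℝ) m
  have hs := (chartAt (ModelProd H ℝ) m).open_source.mem_nhds hm
  let f : NullLine g → NullVector g := fun m' ↦
    if hy : chartAt (ModelProd H ℝ) m m' ∈ m.frame.target then m.frame.liftNull hy else m.rep
  have hf : ∀ m' ∈ (chartAt (ModelProd H ℝ) m).source,
      (f m').val = m.frame.lift (chartAt (ModelProd H ℝ) m m') ∧ (f m').toLine = m' := by
    intro m' hm'
    have hy : chartAt (ModelProd H ℝ) m m' ∈ m.frame.target :=
      (chartAt (ModelProd H ℝ) m).map_source hm'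
    have e : f m' = m.frame.liftNull hy := dif_pos hy
    refine ⟨by rw [e]; rfl, ?_⟩
    rw [e, ← NullLine.param_of_mem]
    exact (chartAt (ModelProd H ℝ) m).left_inv hm'
  refine ⟨f, ?_, ?_⟩
  · have h1 : ContMDiffAt (I.prod 𝓘(ℝ, ℝ)) (I.prod 𝓘(ℝ, ℝ)) ∞ (chartAt (ModelProd H ℝ) m) m :=
      contMDiffOn_chart.contMDiffAt hs
    have h2 : ContMDiffAt (I.prod 𝓘(ℝ, ℝ)) I.tangent ∞ m.frame.lift
        (chartAt (ModelProd H ℝ) m m) :=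
      m.frame.contMDiffOn_lift.contMDiffAt
        (m.frame.isOpen_target.mem_nhds ((chartAt (ModelProd H ℝ) m).map_source hm))
    refine (h2.comp m h1).congr_of_eventuallyEq ?_
    filter_upwards [hs] with m' hm'
    exact (hf m' hm').1
  · filter_upwards [hs] with m' hm'
    exact (hf m' hm').2

theorem contMDiff_point :
    ContMDiff (I.prod 𝓘(ℝ, ℝ)) I ∞ (NullLine.point (g := g)) := by
  intro m
  obtain ⟨f, hf, hf'⟩ := exists_smooth_lift m
  have h1 : ContMDiffAt (I.prod 𝓘(ℝ, ℝ)) I ∞ (fun m' ↦ (f m').val.1) m :=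
    (contMDiff_proj (fun x : V ↦ TangentSpace I x)).contMDiffAt.comp m hf
  refine h1.congr_of_eventuallyEq ?_
  filter_upwards [hf'] with m' hm'
  conv_lhs => rw [← hm']
  rfl

end NullLines

/-! ### The exponential and the angle on the circle. -/

section Circle

theorem hasDerivAt_circleExp (t : ℝ) :
    HasDerivAt (fun t : ℝ ↦ (Circle.exp t : ℂ)) (Circle.exp t * Complex.I) t := by
  have h1 : HasDerivAt (fun t : ℝ ↦ (t : ℂ) * Complex.I) Complex.I t := by
    simpa using (Complex.ofRealCLM.hasDerivAt (x := t)).mul_const Complex.I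
  simpa [Circle.coe_exp] using h1.cexp

/-- The unit tangent vector of the circle at `e^{iθ}`. -/
noncomputable def circleField (θ : ℝ) : TangentSpace (𝓡 1) (Circle.exp θ) :=
  mfderiv 𝓘(ℝ, ℝ) (𝓡 1) Circle.exp θ (1 : ℝ)

theorem contMDiff_circleExp_real : ContMDiff 𝓘(ℝ, ℝ) (𝓡 1) ∞ Circle.exp := contMDiff_circleExp

theorem dTheta_circleField (θ : ℝ) : dTheta (Circle.exp θ) (circleField θ) = 1 := by
  have h1 : circleDeriv (Circle.exp θ) (circleField θ) = Circle.exp θ * Complex.I := by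
    have hc : HasMFDerivAt 𝓘(ℝ, ℝ) 𝓘(ℝ, ℂ) (fun t : ℝ ↦ (Circle.exp t : ℂ)) θ
        ((circleDeriv (Circle.exp θ)).comp (mfderiv 𝓘(ℝ, ℝ) (𝓡 1) Circle.exp θ)) :=
      HasMFDerivAt.comp (g := fun z : Circle ↦ (z : ℂ)) (f := Circle.exp) θ
        (contMDiff_coe_circle.mdifferentiable (by simp) _).hasMFDerivAt
        (contMDiff_circleExp_real.mdifferentiable (by simp) _).hasMFDerivAt
    let L : ℝ →L[ℝ] ℂ :=
      (circleDeriv (Circle.exp θ)).comp (mfderiv 𝓘(ℝ, ℝ) (𝓡 1) Circle.exp θ)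
    have hL : HasFDerivAt (fun t : ℝ ↦ (Circle.exp t : ℂ)) L θ := hc.hasFDerivAt
    have hL' : HasDerivAt (fun t : ℝ ↦ (Circle.exp t : ℂ)) (L 1) θ := hL.hasDerivAt
    exact hL'.unique (hasDerivAt_circleExp θ)
  change (starRingEnd ℂ (Circle.exp θ : ℂ) * circleDeriv (Circle.exp θ) (circleField θ)).im = 1
  rw [h1, ← mul_assoc, mul_comm (starRingEnd ℂ _), Complex.mul_conj]
  simp only [Circle.normSq_coe, Complex.ofReal_one, one_mul, Complex.I_im]

/-- The branch of the angle on the circle near `e^{iθ₀}` with values near `θ₀`. -/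
noncomputable def angleNear (θ₀ : ℝ) (z : Circle) : ℝ :=
  θ₀ + Complex.arg ((z / Circle.exp θ₀ : Circle) : ℂ)

theorem exp_angleNear (θ₀ : ℝ) (z : Circle) : Circle.exp (angleNear θ₀ z) = z := by
  rw [angleNear, Circle.exp_add, Circle.exp_arg]
  exact mul_div_cancel (Circle.exp θ₀) z

theorem angleNear_exp (θ₀ : ℝ) : ∀ᶠ θ in 𝓝 θ₀, angleNear θ₀ (Circle.exp θ) = θ := by
  have : Ioo (θ₀ - Real.pi) (θ₀ + Real.pi) ∈ 𝓝 θ₀ :=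
    Ioo_mem_nhds (by linarith [Real.pi_pos]) (by linarith [Real.pi_pos])
  filter_upwards [this] with θ hθ
  rw [angleNear, ← Circle.exp_sub, Circle.arg_exp (by linarith [hθ.1]) (by linarith [hθ.2])]
  ring

theorem contMDiffAt_angleNear (θ₀ : ℝ) :
    ∀ᶠ z in 𝓝 (Circle.exp θ₀), ContMDiffAt (𝓡 1) 𝓘(ℝ, ℝ) ∞ (angleNear θ₀) z := by
  have hc : ContMDiff (𝓡 1) 𝓘(ℝ, ℂ) ∞ (fun z : Circle ↦ (z : ℂ) / (Circle.exp θ₀ : ℂ)) := by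
    have : ContDiff ℝ ∞ (fun w : ℂ ↦ w / (Circle.exp θ₀ : ℂ)) := contDiff_id.div_const _
    exact this.contMDiff.comp contMDiff_coe_circle
  have h1 : ∀ᶠ z : Circle in 𝓝 (Circle.exp θ₀), (z : ℂ) / (Circle.exp θ₀ : ℂ) ∈ Complex.slitPlane := by
    refine hc.continuous.continuousAt.preimage_mem_nhds (Complex.isOpen_slitPlane.mem_nhds ?_)
    rw [div_self (Circle.coe_ne_zero _)]; simp
  filter_upwards [h1] with z hz
  have h2 : ContDiffAt ℝ ∞ (fun w : ℂ ↦ θ₀ + (Complex.log w).im)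
      ((z : ℂ) / (Circle.exp θ₀ : ℂ)) :=
    contDiffAt_const.add
      (Complex.imCLM.contDiff.contDiffAt.comp _ ((Complex.contDiffAt_log hz).restrict_scalars ℝ))
  refine (h2.contMDiffAt.comp z hc.contMDiffAt).congr_of_eventuallyEq (Eventually.of_forall ?_)
  intro z'
  simp only [angleNear, Function.comp_apply, Complex.log_im, Circle.coe_div]

end Circle

/-! ### Null lines as unit tangent vectors with an angle. -/

section Prolongation

variable {S : Type*} [TopologicalSpace S] [ChartedSpace Plane S]
  [IsManifold (𝓡 2) ∞ S] {h : SurfaceMetric S}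

/-- A null vector with `dθ = 0` is tangent to the surface and has length zero for a positive
definite metric. Hence every null line can be normalised by `dθ = 1`. -/
theorem productTheta_ne_zero (w : NullVector (productMetric h)) :
    productTheta w.val.1 w.val.2 ≠ 0 := by
  intro h0
  have h1 := w.null
  rw [productMetric_apply, h0, mul_zero, sub_zero] at h1
  have h2 : productFst w.val.1 w.val.2 = 0 := by
    by_contra hne
    exact (h.pos _ _ hne).ne' h1
  rw [productFst_apply] at h2
  rw [productTheta_apply] at h0
  exact w.ne_zero (Prod.ext h2 (dTheta_injective _ (h0.trans (map_zero (dTheta w.val.1.2)).symm)))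

/-- The unit tangent vector of the surface which is the component of the null vector proportional to
`w` with `dθ = 1`. -/
noncomputable def direction (w : NullVector (productMetric h)) : UnitTangent h where
  val := ⟨w.val.1.1, (productTheta w.val.1 w.val.2)⁻¹ • productFst w.val.1 w.val.2⟩
  normSq_eq := by
    have h1 := w.null
    rw [productMetric_apply] at h1
    have h2 := productTheta_ne_zero w
    simp only [map_smul, smul_apply, smul_eq_mul]
    rw [sub_eq_zero.1 h1]
    field_simp

theorem direction_eq {w w' : NullVector (productMetric h)} {c : ℝ} (hc : c ≠ 0)
    (e : w'.val = ⟨w.val.1, c • w.val.2⟩) : direction w' = direction w := by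
  refine UnitTangent.ext ?_
  obtain ⟨v, h0, hn⟩ := w'
  obtain rfl : v = _ := e
  have h2 := productTheta_ne_zero w
  change (⟨w.val.1.1, (productTheta w.val.1 (c • w.val.2))⁻¹ • productFst w.val.1 (c • w.val.2)⟩ :
    TangentBundle (𝓡 2) S) = ⟨w.val.1.1, _⟩
  rw [map_smul, map_smul, smul_smul, smul_eq_mul, mul_inv, mul_right_comm, inv_mul_cancel₀ hc,
    one_mul]

theorem direction_rep (w : NullVector (productMetric h)) :
    direction w.toLine.rep = direction w := by
  obtain ⟨a, ha, e⟩ := NullVector.exists_smul_of_toLine_eq (NullLine.toLine_rep w.toLine).symm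
  exact direction_eq ha e

variable {F : Type*} [NormedAddCommGroup F] [NormedSpace ℝ F] {K : Type*} [TopologicalSpace K]
  {J : ModelWithCorners ℝ F K} {N : Type*} [TopologicalSpace N] [ChartedSpace K N]

/-- The charts of `S¹(TΣ)` record base points and slopes, and slopes do not change under scaling.
The normalising factor therefore drops out, and smoothness reduces to that of the projection of `TV`
to `TΣ`. -/
theorem contMDiffAt_direction {f : N → NullVector (productMetric h)} {x : N}
    (hf : ContMDiffAt J productModel.tangent ∞ (fun y ↦ (f y).val) x) :
    ContMDiffAt J unitModel ∞ (fun y ↦ direction (f y)) x := by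
  set p := direction (f x) with hp
  set u₀ := (tChart p.1 p.1).2 with hu₀
  let k : N → ModelProd Plane Plane := fun y ↦
    tChart p.1 (tangentMap productModel (𝓡 2) (Prod.fst : S × Circle → S) (f y).val)
  have ht : ContMDiffAt J (𝓡 2).tangent ∞
      (fun y ↦ tangentMap productModel (𝓡 2) (Prod.fst : S × Circle → S) (f y).val) x :=
    ((contMDiff_fst (I := 𝓡 2) (J := 𝓡 1) (M := S) (N := Circle)
      (n := ∞)).contMDiff_tangentMap (m := ∞) le_rfl).contMDiffAt.comp x hf
  have hb : (tangentMap productModel (𝓡 2) (Prod.fst : S × Circle → S) (f x).val) ∈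
      (tChart p.1).source := by
    rw [TangentBundle.mem_chart_source_iff]; exact mem_chart_source _ _
  have hk : ContMDiffAt J ((𝓡 2).prod 𝓘(ℝ, Plane)) ∞ k x :=
    (contMDiffOn_chart.contMDiffAt ((tChart p.1).open_source.mem_nhds hb)).comp x ht
  have hθ : ContMDiffAt J 𝓘(ℝ, ℝ) ∞ (fun y ↦ productTheta (f y).val.1 (f y).val.2) x :=
    contMDiff_productTheta.contMDiffAt.comp x hf
  have hscale : ∀ y, tChart p.1 (direction (f y)).1 =
      ((k y).1, (productTheta (f y).val.1 (f y).val.2)⁻¹ • (k y).2) := fun y ↦ chart_smul p.1 _ _ _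
  have hk2 : ContMDiffAt J 𝓘(ℝ, Plane) ∞ (fun y ↦ (k y).2) x :=
    contMDiff_model_snd.contMDiffAt.comp x hk
  have hk1 : ContMDiffAt J (𝓡 2) ∞ (fun y ↦ (k y).1) x :=
    contMDiff_model_fst.contMDiffAt.comp x hk
  have hden : ContMDiffAt J 𝓘(ℝ, ℝ) ∞ (fun y ↦ slopeDen u₀ (k y).2) x :=
    (contDiff_slopeDen u₀).contMDiff.contMDiffAt.comp x hk2
  have hnum : ContMDiffAt J 𝓘(ℝ, ℝ) ∞ (fun y ↦ slopeNum u₀ (k y).2) x :=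
    (contDiff_slopeNum u₀).contMDiff.contMDiffAt.comp x hk2
  -- Either factor may be negative, because a null vector may point backwards in `θ`. Only the
  -- product is positive, and it is the product that places the direction in the domain of the
  -- chart.
  have hpos : 0 < (productTheta (f x).val.1 (f x).val.2)⁻¹ * slopeDen u₀ (k x).2 := by
    rw [← slopeDen_smul]
    have e : u₀ = (productTheta (f x).val.1 (f x).val.2)⁻¹ • (k x).2 :=
      congrArg Prod.snd (hscale x)
    rw [← e]
    exact slopeDen_self p.coord_self_ne_zero
  have hden0 : slopeDen u₀ (k x).2 ≠ 0 := fun h0 ↦ by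
    rw [h0, mul_zero] at hpos; exact lt_irrefl _ hpos
  have hq : ContMDiffAt J 𝓘(ℝ, ℝ) ∞ (fun y ↦ slopeNum u₀ (k y).2 / slopeDen u₀ (k y).2) x :=
    hnum.div₀ hden hden0
  have hpair : ContMDiffAt (M' := ModelProd Plane ℝ) J unitModel ∞
      (fun y ↦ ((k y).1, slopeNum u₀ (k y).2 / slopeDen u₀ (k y).2)) x := by
    have := hk1.prodMk hq
    rw [chartedSpaceSelf_prod] at this
    exact this
  have hsrc : ∀ᶠ y in 𝓝 x, direction (f y) ∈ (unitChart p).source := by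
    have h1 := ht.continuousAt.preimage_mem_nhds ((tChart p.1).open_source.mem_nhds hb)
    have h2 := ((hθ.continuousAt.inv₀ (productTheta_ne_zero (f x))).mul
      hden.continuousAt).preimage_mem_nhds (Ioi_mem_nhds hpos)
    filter_upwards [h1, h2] with y h1 h2
    refine ⟨?_, ?_⟩
    · have h1' := (TangentBundle.mem_chart_source_iff _ _).1 h1
      exact (TangentBundle.mem_chart_source_iff _ _).2 h1'
    · change 0 < slopeDen u₀ (tChart p.1 (direction (f y)).1).2
      rw [hscale y, slopeDen_smul]; exact h2
  have hchart : ∀ᶠ y in 𝓝 x, unitChart p (direction (f y)) =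
      ((k y).1, slopeNum u₀ (k y).2 / slopeDen u₀ (k y).2) := by
    refine Eventually.of_forall fun y ↦ ?_
    change ((tChart p.1 (direction (f y)).1).1, slopeNum u₀ (tChart p.1 (direction (f y)).1).2 /
      slopeDen u₀ (tChart p.1 (direction (f y)).1).2) = _
    rw [hscale y, slopeDen_smul, slopeNum_smul,
      mul_div_mul_left _ _ (inv_ne_zero (productTheta_ne_zero (f y)))]
  have hsymm : ContMDiffAt unitModel unitModel ∞ (unitChart p).symm
      ((k x).1, slopeNum u₀ (k x).2 / slopeDen u₀ (k x).2) := by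
    rw [← hchart.self_of_nhds]
    have : ContMDiffOn unitModel unitModel ∞ (chartAt (ModelProd Plane ℝ) p).symm
      (chartAt (ModelProd Plane ℝ) p).target := contMDiffOn_chart_symm
    exact this.contMDiffAt ((unitChart p).open_target.mem_nhds
      ((unitChart p).map_source hsrc.self_of_nhds))
  refine (hsymm.comp x hpair).congr_of_eventuallyEq ?_
  filter_upwards [hsrc, hchart] with y h1 h2
  rw [Function.comp_apply, ← h2]
  exact ((unitChart p).left_inv h1).symm

/-- The unit tangent vector of the surface determined by a null line. -/
noncomputable def lineDirection (m : NullLine (productMetric h)) : UnitTangent h := direction m.rep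

theorem lineDirection_toLine (w : NullVector (productMetric h)) :
    lineDirection w.toLine = direction w := direction_rep w

theorem contMDiff_lineDirection : ContMDiff (productModel.prod 𝓘(ℝ, ℝ)) unitModel ∞
    (lineDirection (h := h)) := by
  intro m
  obtain ⟨f, hf, hf'⟩ := exists_smooth_lift m
  refine (contMDiffAt_direction hf).congr_of_eventuallyEq ?_
  filter_upwards [hf'] with m' hm'
  rw [← lineDirection_toLine, hm']

/-- The null vector `v + ∂/∂θ` over the point with angle `θ`. -/
noncomputable def nullVector (q : ℝ × UnitTangent h) : NullVector (productMetric h) where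
  val := (equivTangentBundleProd (𝓡 2) S (𝓡 1) Circle).symm
    (q.2.val, ⟨Circle.exp q.1, circleField q.1⟩)
  ne_zero h0 := by
    have h1 : circleField q.1 = 0 := congrArg Prod.snd h0
    have h2 := dTheta_circleField q.1
    rw [h1, map_zero] at h2
    exact zero_ne_one h2
  null := by
    change h.inner _ (productFst _ _) (productFst _ _) - productTheta _ _ * productTheta _ _ = 0
    rw [productFst_apply, productTheta_apply]
    change h.inner q.2.val.1 q.2.val.2 q.2.val.2 -
      dTheta (Circle.exp q.1) (circleField q.1) * dTheta (Circle.exp q.1) (circleField q.1) = 0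
    rw [q.2.normSq_eq, dTheta_circleField]
    norm_num

theorem direction_nullVector (q : ℝ × UnitTangent h) : direction (nullVector q) = q.2 := by
  refine UnitTangent.ext ?_
  change (⟨q.2.val.1, (productTheta _ _)⁻¹ • productFst _ _⟩ : TangentBundle (𝓡 2) S) = q.2.val
  rw [productFst_apply, productTheta_apply]
  change (⟨q.2.val.1, (dTheta (Circle.exp q.1) (circleField q.1))⁻¹ • q.2.val.2⟩ :
    TangentBundle (𝓡 2) S) = q.2.val
  rw [dTheta_circleField, inv_one, one_smul]

theorem contMDiff_nullVector : ContMDiff (𝓘(ℝ, ℝ).prod unitModel) productModel.tangent ∞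
    (fun q : ℝ × UnitTangent h ↦ (nullVector q).val) := by
  have h1 : ContMDiff (𝓘(ℝ, ℝ).prod unitModel) (𝓡 2).tangent ∞
      (fun q : ℝ × UnitTangent h ↦ q.2.val) := (contMDiff_val h).comp contMDiff_snd
  have h2 : ContMDiff 𝓘(ℝ, ℝ) (𝓡 1).tangent ∞
      (fun θ : ℝ ↦ (⟨Circle.exp θ, circleField θ⟩ : TangentBundle (𝓡 1) Circle)) := by
    have hs : ContMDiff 𝓘(ℝ, ℝ) 𝓘(ℝ, ℝ).tangent ∞
        (fun θ : ℝ ↦ (⟨θ, (1 : ℝ)⟩ : TangentBundle 𝓘(ℝ, ℝ) ℝ)) := fun x ↦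
      (contMDiffAt_vectorSpace_iff_contDiffAt (V := fun _ : ℝ ↦ (1 : ℝ))).2 contDiffAt_const
    exact (contMDiff_circleExp_real.contMDiff_tangentMap (m := ∞) le_rfl).comp hs
  exact contMDiff_equivTangentBundleProd_symm.comp (h1.prodMk (h2.comp contMDiff_fst))

/-- The null line spanned by `v + ∂/∂θ`. -/
noncomputable def nullLine (q : ℝ × UnitTangent h) : NullLine (productMetric h) :=
  (nullVector q).toLine

/-- The vector of the line with `dθ = 1` is the sum of its direction and of `∂/∂θ`; the circle
component is determined by `dθ` since `dTheta` is injective. -/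
theorem nullLine_eq {θ : ℝ} {m : NullLine (productMetric h)} (hθ : Circle.exp θ = m.point.2) :
    nullLine (θ, lineDirection m) = m := by
  obtain ⟨w, rfl⟩ := NullVector.toLine_surjective m
  rw [lineDirection_toLine]
  obtain ⟨⟨⟨x, z⟩, v⟩, h0, hn⟩ := w
  obtain rfl : Circle.exp θ = z := hθ
  set w : NullVector (productMetric h) := ⟨⟨⟨x, Circle.exp θ⟩, v⟩, h0, hn⟩ with hw
  have hne := productTheta_ne_zero w
  refine NullVector.toLine_eq_of_smul (c := (productTheta w.val.1 w.val.2)⁻¹) (inv_ne_zero hne) ?_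
  refine congrArg (fun v : TangentSpace productModel (x, Circle.exp θ) ↦
    (⟨(x, Circle.exp θ), v⟩ : TangentBundle productModel (S × Circle))) ?_
  refine Prod.ext ?_ ?_
  · change (productTheta w.val.1 w.val.2)⁻¹ • productFst w.val.1 w.val.2 = _
    rw [productFst_apply]; rfl
  · refine dTheta_injective (Circle.exp θ) ?_
    refine (dTheta_circleField θ).trans ?_
    have : productTheta w.val.1 ((productTheta w.val.1 w.val.2)⁻¹ • w.val.2) = 1 := by
      rw [map_smul, smul_eq_mul, inv_mul_cancel₀ hne]
    rw [productTheta_apply] at this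
    exact this.symm

theorem nullLine_surjective : Function.Surjective (nullLine (h := h)) := fun m ↦
  ⟨_, nullLine_eq (Circle.exp_arg m.point.2)⟩

theorem nullLine_eq_iff {q q' : ℝ × UnitTangent h} :
    nullLine q = nullLine q' ↔ Circle.exp q.1 = Circle.exp q'.1 ∧ q.2 = q'.2 := by
  constructor
  · intro e
    refine ⟨congrArg (fun m : NullLine (productMetric h) ↦ m.point.2) e, ?_⟩
    have := congrArg lineDirection e
    rwa [nullLine, nullLine, lineDirection_toLine, lineDirection_toLine, direction_nullVector,
      direction_nullVector] at this
  · rintro ⟨h1, h2⟩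
    have : lineDirection (nullLine q') = q'.2 := by
      rw [nullLine, lineDirection_toLine, direction_nullVector]
    have h3 := nullLine_eq (θ := q.1) (m := nullLine q') h1
    rw [this, ← h2] at h3
    exact h3

theorem contMDiff_nullLine : ContMDiff (𝓘(ℝ, ℝ).prod unitModel) (productModel.prod 𝓘(ℝ, ℝ)) ∞
    (nullLine (h := h)) := fun q ↦ contMDiffAt_toLine (contMDiff_nullVector q)

/-- The local inverse consists of a branch of the angle and of `lineDirection`, both smooth. -/
theorem isLocalDiffeomorph_nullLine :
    IsLocalDiffeomorph (𝓘(ℝ, ℝ).prod unitModel) (productModel.prod 𝓘(ℝ, ℝ)) ∞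
      (nullLine (h := h)) := by
  intro q
  have hz : ContMDiff (productModel.prod 𝓘(ℝ, ℝ)) (𝓡 1) ∞
      (fun m : NullLine (productMetric h) ↦ m.point.2) := contMDiff_snd.comp contMDiff_point
  refine .of_eventually (g := fun m ↦ (angleNear q.1 m.point.2, lineDirection m))
    (Eventually.of_forall contMDiff_nullLine) ?_ ?_ ?_
  · have hc : ContinuousAt (fun m : NullLine (productMetric h) ↦ m.point.2) (nullLine q) :=
      hz.continuous.continuousAt
    filter_upwards [hc.eventually (contMDiffAt_angleNear q.1)] with m hm
    exact (hm.comp m (hz m)).prodMk (contMDiff_lineDirection m)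
  · have : ContinuousAt (fun q' : ℝ × UnitTangent h ↦ q'.1) q := continuous_fst.continuousAt
    filter_upwards [this.eventually (angleNear_exp q.1)] with q' hq'
    refine Prod.ext hq' ?_
    change lineDirection (nullVector q').toLine = q'.2
    rw [lineDirection_toLine, direction_nullVector]
  · exact Eventually.of_forall fun m ↦ nullLine_eq (exp_angleNear _ _)

/-- The plane field on `ℝ × S¹(TΣ)` of the velocities for which the base point moves in the direction
of the unit vector, at the speed of the first coordinate. -/
def rollingPlane (h : SurfaceMetric S) :
    Set (TangentBundle (𝓘(ℝ, ℝ).prod unitModel) (ℝ × UnitTangent h)) :=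
  {ζ | dBase ζ.1.2 (ζ.2 : ℝ × (Plane × ℝ)).2 = (ζ.2 : ℝ × (Plane × ℝ)).1 • ζ.1.2.vec}

/-- The composition of `nullLine` with the projection to `Σ × S¹` is `(θ, v) ↦ (base of v, e^{iθ})`.
-/
theorem mfderiv_point_nullLine (q : ℝ × UnitTangent h)
    (v : TangentSpace (𝓘(ℝ, ℝ).prod unitModel) q) :
    mfderiv (productModel.prod 𝓘(ℝ, ℝ)) productModel NullLine.point (nullLine q)
      (mfderiv (𝓘(ℝ, ℝ).prod unitModel) (productModel.prod 𝓘(ℝ, ℝ)) nullLine q v) =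
      ((dBase q.2 (v : ℝ × (Plane × ℝ)).2, (v : ℝ × (Plane × ℝ)).1 • circleField q.1) :
        Plane × EuclideanSpace ℝ (Fin 1)) := by
  have h1 : HasMFDerivAt (𝓘(ℝ, ℝ).prod unitModel) productModel
      (fun q : ℝ × UnitTangent h ↦ (q.2.base, Circle.exp q.1)) q _ :=
    HasMFDerivAt.comp (g := NullLine.point) (f := nullLine) q
      (contMDiff_point.mdifferentiable (by simp) _).hasMFDerivAt
      (contMDiff_nullLine.mdifferentiable (by simp) _).hasMFDerivAt
  have h2 : HasMFDerivAt (𝓘(ℝ, ℝ).prod unitModel) (𝓡 2)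
      (fun q : ℝ × UnitTangent h ↦ q.2.base) q
      ((dBase q.2).comp (ContinuousLinearMap.snd ℝ ℝ (Plane × ℝ))) :=
    HasMFDerivAt.comp (g := UnitTangent.base) (f := Prod.snd) q
      ((contMDiff_base h).mdifferentiable (by simp) _).hasMFDerivAt (hasMFDerivAt_snd q)
  have h3 : HasMFDerivAt (𝓘(ℝ, ℝ).prod unitModel) (𝓡 1)
      (fun q : ℝ × UnitTangent h ↦ Circle.exp q.1) q
      ((mfderiv 𝓘(ℝ, ℝ) (𝓡 1) Circle.exp q.1).comp (ContinuousLinearMap.fst ℝ ℝ (Plane × ℝ))) :=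
    HasMFDerivAt.comp (g := Circle.exp) (f := Prod.fst) q
      (contMDiff_circleExp_real.mdifferentiable (by simp) _).hasMFDerivAt (hasMFDerivAt_fst q)
  have h4 := hasMFDerivAt_unique h1 (h2.prodMk h3)
  refine (congrArg (fun L : ℝ × (Plane × ℝ) →L[ℝ] Plane × EuclideanSpace ℝ (Fin 1) ↦
    L v) h4).trans ?_
  refine Prod.ext rfl ?_
  change mfderiv 𝓘(ℝ, ℝ) (𝓡 1) Circle.exp q.1 (v : ℝ × (Plane × ℝ)).1 = _
  have : (v : ℝ × (Plane × ℝ)).1 = (v : ℝ × (Plane × ℝ)).1 • (1 : ℝ) := by simp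
  conv_lhs => rw [this]
  exact ContinuousLinearMap.map_smul (mfderiv 𝓘(ℝ, ℝ) (𝓡 1) Circle.exp q.1) _ _

/-- The line is spanned by `v + ∂/∂θ`. Applying `dθ` shows that the only possible coefficient is the
first component of the velocity, and the surface component then gives the rolling condition. -/
theorem mem_rollingPlane_iff (q : ℝ × UnitTangent h)
    (v : TangentSpace (𝓘(ℝ, ℝ).prod unitModel) q) :
    (⟨q, v⟩ : TangentBundle (𝓘(ℝ, ℝ).prod unitModel) (ℝ × UnitTangent h)) ∈ rollingPlane h ↔
      (⟨nullLine q, mfderiv (𝓘(ℝ, ℝ).prod unitModel) (productModel.prod 𝓘(ℝ, ℝ)) nullLine q v⟩ :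
        TangentBundle (productModel.prod 𝓘(ℝ, ℝ)) (NullLine (productMetric h))) ∈
        lorentzProlongation (productMetric h) := by
  have h1 : mfderiv (productModel.prod 𝓘(ℝ, ℝ)) productModel NullLine.point (nullLine q)
      (mfderiv (𝓘(ℝ, ℝ).prod unitModel) (productModel.prod 𝓘(ℝ, ℝ)) nullLine q v) ∈
      (nullLine q).line ↔ ∃ a : ℝ, a • ((q.2.vec, circleField q.1) :
        Plane × EuclideanSpace ℝ (Fin 1)) =
      ((dBase q.2 (v : ℝ × (Plane × ℝ)).2, (v : ℝ × (Plane × ℝ)).1 • circleField q.1) :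
        Plane × EuclideanSpace ℝ (Fin 1)) := by
    rw [mfderiv_point_nullLine]
    exact Submodule.mem_span_singleton (R := ℝ) (M := Plane × EuclideanSpace ℝ (Fin 1))
  refine Iff.trans ?_ h1.symm
  constructor
  · intro hv
    refine ⟨(v : ℝ × (Plane × ℝ)).1, Prod.ext ?_ rfl⟩
    have hv' : dBase q.2 (v : ℝ × (Plane × ℝ)).2 = (v : ℝ × (Plane × ℝ)).1 • q.2.vec := hv
    exact hv'.symm
  · rintro ⟨a, ha⟩
    have e1 : a • q.2.vec = dBase q.2 (v : ℝ × (Plane × ℝ)).2 := congrArg Prod.fst ha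
    have e2 : a • circleField q.1 = (v : ℝ × (Plane × ℝ)).1 • circleField q.1 :=
      congrArg Prod.snd ha
    have e3 := congrArg (dTheta (Circle.exp q.1)) e2
    rw [map_smul, map_smul, dTheta_circleField, smul_eq_mul, smul_eq_mul, mul_one, mul_one] at e3
    change dBase q.2 (v : ℝ × (Plane × ℝ)).2 = (v : ℝ × (Plane × ℝ)).1 • q.2.vec
    rw [← e1, e3]

end Prolongation

/-! ### Diffeomorphisms between quotients. -/

section Quotients

variable {E : Type*} [NormedAddCommGroup E] [NormedSpace ℝ E] {H : Type*} [TopologicalSpace H]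
  {I : ModelWithCorners ℝ E H} {M : Type*} [TopologicalSpace M] [ChartedSpace H M]
  {E' : Type*} [NormedAddCommGroup E'] [NormedSpace ℝ E'] {H' : Type*} [TopologicalSpace H']
  {I' : ModelWithCorners ℝ E' H'} {M' : Type*} [TopologicalSpace M'] [ChartedSpace H' M']
  {E'' : Type*} [NormedAddCommGroup E''] [NormedSpace ℝ E''] {H'' : Type*} [TopologicalSpace H'']
  {I'' : ModelWithCorners ℝ E'' H''} {M'' : Type*} [TopologicalSpace M''] [ChartedSpace H'' M'']

/-- Two surjective local diffeomorphisms with the same fibres have diffeomorphic targets. -/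
theorem exists_diffeomorph_of_fibres {r : M → M'} {f : M → M''}
    (hr : IsLocalDiffeomorph I I' ∞ r) (hf : IsLocalDiffeomorph I I'' ∞ f)
    (hrs : Function.Surjective r) (hfs : Function.Surjective f)
    (h : ∀ x y, r x = r y ↔ f x = f y) :
    ∃ Φ : M' ≃ₘ⟮I', I''⟯ M'', ∀ x, Φ (r x) = f x := by
  let Φ : M' → M'' := fun y ↦ f (Function.surjInv hrs y)
  have hΦ : ∀ x, Φ (r x) = f x := fun x ↦ (h _ _).1 (Function.surjInv_eq hrs (r x))
  have hb : Function.Bijective Φ := by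
    constructor
    · intro y y' e
      obtain ⟨x, rfl⟩ := hrs y
      obtain ⟨x', rfl⟩ := hrs y'
      rw [hΦ, hΦ] at e
      exact (h _ _).2 e
    · intro z
      obtain ⟨x, rfl⟩ := hfs z
      exact ⟨r x, hΦ x⟩
  have hl : IsLocalDiffeomorph I' I'' ∞ Φ := by
    intro y
    obtain ⟨x, rfl⟩ := hrs y
    have h1 := (hr x).localInverse_isLocalDiffeomorphAt
    have h2 : IsLocalDiffeomorphAt I I'' ∞ f ((hr x).localInverse (r x)) := hf _
    refine (h1.comp I'' M'' h2).congr ?_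
    filter_upwards [(hr x).localInverse_eventuallyEq_right] with y hy
    have hy' : r ((hr x).localInverse y) = y := hy
    conv_lhs => rw [← hy', hΦ]
    rfl
  exact ⟨hl.diffeomorphOfBijective hb, hΦ⟩

theorem image_tangentMap_image {r : M → M'} {f : M → M''} {Φ : M' → M''}
    (hr : ContMDiff I I' ∞ r) (hΦs : ContMDiff I' I'' ∞ Φ) (hΦ : ∀ x, Φ (r x) = f x)
    (D : Set (TangentBundle I M)) :
    tangentMap I' I'' Φ '' (tangentMap I I' r '' D) = tangentMap I I'' f '' D := by
  rw [← image_comp, ← tangentMap_comp (hΦs.mdifferentiable (by simp))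
    (hr.mdifferentiable (by simp))]
  have : Φ ∘ r = f := funext hΦ
  rw [this]

theorem image_tangentMap_eq {f : M → M'} (hf : IsLocalDiffeomorph I I' ∞ f)
    (hs : Function.Surjective f) {D : Set (TangentBundle I M)} {D' : Set (TangentBundle I' M')}
    (h : ∀ (x : M) (v : TangentSpace I x), (⟨x, v⟩ : TangentBundle I M) ∈ D ↔
      (⟨f x, mfderiv I I' f x v⟩ : TangentBundle I' M') ∈ D') :
    tangentMap I I' f '' D = D' := by
  ext ⟨y, w⟩
  constructor
  · rintro ⟨⟨x, v⟩, hv, e⟩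
    rw [← e]; exact (h x v).1 hv
  · intro hw
    obtain ⟨x, rfl⟩ := hs y
    have e : tangentMap I I' f ⟨x, (mfderiv I I' f x).inverse w⟩ = ⟨f x, w⟩ :=
      congrArg (fun w : TangentSpace I' (f x) ↦ (⟨f x, w⟩ : TangentBundle I' M'))
        ((hf x).apply_inverse w)
    refine ⟨_, (h x _).2 ?_, e⟩
    change tangentMap I I' f ⟨x, (mfderiv I I' f x).inverse w⟩ ∈ D'
    rw [e]; exact hw

variable [IsManifold I ∞ M] [IsManifold I' ∞ M']

theorem engelAt_of_isEngel {D : Set (TangentBundle I M)} (h : IsEngel D) (x : M) : EngelAt D x :=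
  ⟨h.2.1 x, h.2.2.1 x, fun v ↦ by rw [h.2.2.2]; exact mem_univ _⟩

variable [CompleteSpace E] [CompleteSpace E']

/-- Injectivity of the diffeomorphism and of its derivatives turns the image of the distribution
into a pullback relation, along which the local conditions are transported. -/
theorem isEngel_of_isIsomorphic {D : Set (TangentBundle I M)} {D' : Set (TangentBundle I' M')}
    (hE : Module.finrank ℝ E = 4) (h : IsIsomorphic D D') (h' : IsEngel D') : IsEngel D := by
  obtain ⟨Φ, rfl⟩ := h
  refine isEngel_of_engelAt hE fun x ↦ ?_
  have hΦ : IsLocalDiffeomorph I I' ∞ Φ := Φ.isLocalDiffeomorph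
  refine EngelAt.of_pullback (hΦ x) (Eventually.of_forall fun x' v ↦ ?_)
    (engelAt_of_isEngel h' (Φ x))
  constructor
  · exact fun hv ↦ ⟨_, hv, rfl⟩
  · rintro ⟨⟨y, w⟩, hw, e⟩
    have e1 : Φ y = Φ x' := congrArg TotalSpace.proj e
    obtain rfl := Φ.injective e1
    have e2 : mfderiv I I' Φ y w = mfderiv I I' Φ y v := eq_of_heq (TotalSpace.mk.inj e).2
    have e3 : w = v := by
      rw [← (hΦ y).inverse_apply w, ← (hΦ y).inverse_apply v, e2]
    rwa [← e3]

end Quotients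

/-! ### The projection to the mapping torus. -/

section Torus

variable {E : Type*} [NormedAddCommGroup E] [NormedSpace ℝ E] {H : Type*} [TopologicalSpace H]
  {I : ModelWithCorners ℝ E H} {V : Type*} [TopologicalSpace V] [ChartedSpace H V]
  [T2Space V] [LocallyCompactSpace V] (φ : V ≃ₘ⟮I, I⟯ V)

theorem torusProj_surjective : Function.Surjective (torusProj φ) := Quotient.mk_surjective

/-- Each chart of the mapping torus is built from one chosen preimage of the point; other preimages
are reached by deck transformations. -/
theorem exists_chartAt_torus (m : MappingTorus φ) : ∃ a, torusProj φ a = m ∧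
    chartAt (ModelProd ℝ H) m = ((isLocalHomeomorph_torusProj φ).localInverseAt a).trans
      (chartAt (ModelProd ℝ H) a) :=
  ⟨(Quotient.mk_surjective.hasRightInverse (f := torusProj φ)).choose m,
    (Quotient.mk_surjective.hasRightInverse (f := torusProj φ)).choose_spec m, rfl⟩

variable [IsManifold I ∞ V]

/-- In the chart `e` of the torus and the chart of the cover at the chosen preimage, the projection
is the identity, so its smoothness is that of the charts on both sides. -/
theorem isLocalDiffeomorphAt_torusProj {a : TorusCover φ}
    {e : OpenPartialHomeomorph (MappingTorus φ) (ModelProd ℝ H)}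
    (he : e = ((isLocalHomeomorph_torusProj φ).localInverseAt a).trans
      (chartAt (ModelProd ℝ H) a))
    (he1 : ContMDiffOn (𝓘(ℝ, ℝ).prod I) (𝓘(ℝ, ℝ).prod I) ∞ e e.source)
    (he2 : ContMDiffOn (𝓘(ℝ, ℝ).prod I) (𝓘(ℝ, ℝ).prod I) ∞ e.symm e.target) :
    IsLocalDiffeomorphAt (𝓘(ℝ, ℝ).prod I) (𝓘(ℝ, ℝ).prod I) ∞ (torusProj φ) a := by
  have hf := isLocalHomeomorph_torusProj φ
  have hsymm : ∀ x : TorusCover φ, (hf.localInverseAt a).symm x = torusProj φ x :=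
    fun x ↦ congrFun (hf.localInverseAt_symm a) x
  have ha := hf.self_mem_localInverseAt_target (x := a)
  have hca := mem_chart_source (ModelProd ℝ H) a
  have hc1 : ContMDiffOn (𝓘(ℝ, ℝ).prod I) (𝓘(ℝ, ℝ).prod I) ∞ (chartAt (ModelProd ℝ H) a)
    (chartAt (ModelProd ℝ H) a).source := contMDiffOn_chart
  have hc2 : ContMDiffOn (𝓘(ℝ, ℝ).prod I) (𝓘(ℝ, ℝ).prod I) ∞ (chartAt (ModelProd ℝ H) a).symm
    (chartAt (ModelProd ℝ H) a).target := contMDiffOn_chart_symm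
  change e = (hf.localInverseAt a).trans _ at he
  generalize hf.localInverseAt a = L at *
  generalize chartAt (ModelProd ℝ H) a = c at *
  have hmem : ∀ x, x ∈ e.source ↔ x ∈ L.source ∧ L x ∈ c.source := fun x ↦ by
    rw [he, OpenPartialHomeomorph.trans_source]; rfl
  have htgt : ∀ x ∈ c.source ∩ L.target, c x ∈ e.target := fun x hx ↦ by
    rw [he, OpenPartialHomeomorph.trans_target]
    exact ⟨c.map_source hx.1, by rw [mem_preimage, c.left_inv hx.1]; exact hx.2⟩
  refine IsLocalDiffeomorphAt.of_open (g := L) (U := c.source ∩ L.target) (W := e.source)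
    (c.open_source.inter L.open_target) e.open_source ?_ ?_ ?_ ?_ ?_ ?_ ⟨hca, ha⟩
  · intro x hx
    rw [hmem, ← hsymm]
    exact ⟨L.map_target hx.2, by rw [L.right_inv hx.2]; exact hx.1⟩
  · intro x hx
    have := (hmem x).1 hx
    exact ⟨this.2, L.map_source this.1⟩
  · intro x hx
    rw [← hsymm, L.right_inv hx.2]
  · intro y hy
    rw [← hsymm, L.left_inv ((hmem y).1 hy).1]
  · refine (he2.comp (hc1.mono inter_subset_left) htgt).congr fun x hx ↦ ?_
    rw [Function.comp_apply, he, ← hsymm]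
    change _ = L.symm (c.symm (c x))
    rw [c.left_inv hx.1]
  · have hm' : MapsTo e e.source c.target := fun x hx ↦ by
      rw [he]; exact c.map_source ((hmem x).1 hx).2
    refine (hc2.comp he1 hm').congr fun x hx ↦ ?_
    rw [Function.comp_apply, he]
    change _ = c.symm (c (L x))
    rw [c.left_inv ((hmem x).1 hx).2]

/-- An arbitrary point differs from the chosen preimage by a deck transformation, which is a
diffeomorphism of the cover compatible with the projection. -/
theorem isLocalDiffeomorph_torusProj :
    IsLocalDiffeomorph (𝓘(ℝ, ℝ).prod I) (𝓘(ℝ, ℝ).prod I) ∞ (torusProj φ) := by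
  intro x
  obtain ⟨a, ha, he⟩ := exists_chartAt_torus φ (torusProj φ x)
  have hl := isLocalDiffeomorphAt_torusProj φ he contMDiffOn_chart contMDiffOn_chart_symm
  obtain ⟨n, rfl⟩ := (torusProj_eq_iff φ).1 ha
  have hd : IsLocalDiffeomorphAt (𝓘(ℝ, ℝ).prod I) (𝓘(ℝ, ℝ).prod I) ∞
      (fun p : TorusCover φ ↦ n +ᵥ p) x :=
    .of_eventually (g := fun p : TorusCover φ ↦ -n +ᵥ p) (Eventually.of_forall (contMDiff_deck φ n))
      (Eventually.of_forall (contMDiff_deck φ (-n)))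
      (Eventually.of_forall fun p ↦ neg_vadd_vadd n p)
      (Eventually.of_forall fun p ↦ vadd_neg_vadd n p)
  exact (hd.comp (𝓘(ℝ, ℝ).prod I) (MappingTorus φ) hl).congr
    (Eventually.of_forall fun p ↦ (torusProj_vadd φ n p).symm)

end Torus

/-! ### The Engel condition for the Lorentz prolongation. -/

section Rolling

variable {S : Type*} [TopologicalSpace S] [ChartedSpace Plane S]
  [IsManifold (𝓡 2) ∞ S] {h : SurfaceMetric S}

/-- The local parametrisation of `ℝ × S¹(TΣ)`. -/
noncomputable def paramProd (p : UnitTangent h) (x : ℝ × (Plane × ℝ)) : ℝ × UnitTangent h :=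
  (x.1, param p x.2)

theorem isLocalDiffeomorphAt_paramProd (p : UnitTangent h) {x : ℝ × (Plane × ℝ)}
    (hx : x.2.1 ∈ (chartAt Plane p.base).target) :
    IsLocalDiffeomorphAt 𝓘(ℝ, ℝ × (Plane × ℝ)) (𝓘(ℝ, ℝ).prod unitModel) ∞ (paramProd p) x := by
  have hf := isLocalDiffeomorphAt_param p hx
  have hs : ContinuousAt (fun y : ℝ × (Plane × ℝ) ↦ y.2) x := continuous_snd.continuousAt
  have hs' : ContinuousAt (fun y : ℝ × UnitTangent h ↦ y.2) (paramProd p x) :=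
    continuous_snd.continuousAt
  refine .of_eventually (g := fun q ↦ (q.1, hf.localInverse q.2)) ?_ ?_ ?_ ?_
  · filter_upwards [hs.eventually hf.eventually_contMDiffAt] with y hy
    exact ContMDiffAt.prodMk contDiff_fst.contMDiff.contMDiffAt
      (ContMDiffAt.comp y (g := param p) hy contDiff_snd.contMDiff.contMDiffAt)
  · filter_upwards [hs'.eventually
      (hf.localInverse_isLocalDiffeomorphAt.eventually_contMDiffAt)] with q hq
    exact ContMDiffAt.prodMk_space contMDiff_fst.contMDiffAt
      (ContMDiffAt.comp q hq contMDiff_snd.contMDiffAt)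
  · filter_upwards [hs.eventually hf.localInverse_eventuallyEq_left] with y hy
    exact Prod.ext rfl hy
  · filter_upwards [hs'.eventually hf.localInverse_eventuallyEq_right] with q hq
    exact Prod.ext rfl hq

theorem mfderiv_paramProd (p : UnitTangent h) {x : ℝ × (Plane × ℝ)}
    (hx : x.2.1 ∈ (chartAt Plane p.base).target) (v : ℝ × (Plane × ℝ)) :
    mfderiv 𝓘(ℝ, ℝ × (Plane × ℝ)) (𝓘(ℝ, ℝ).prod unitModel) (paramProd p) x v =
      ((v.1, dParam p x.2 v.2) : ℝ × (Plane × ℝ)) := by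
  have h1 : HasMFDerivAt 𝓘(ℝ, ℝ × (Plane × ℝ)) 𝓘(ℝ, ℝ) (fun y : ℝ × (Plane × ℝ) ↦ y.1) x
      (ContinuousLinearMap.fst ℝ ℝ (Plane × ℝ)) := hasFDerivAt_fst.hasMFDerivAt
  have h2 : HasMFDerivAt 𝓘(ℝ, ℝ × (Plane × ℝ)) unitModel
      (fun y : ℝ × (Plane × ℝ) ↦ param p y.2) x
      ((dParam p x.2).comp (ContinuousLinearMap.snd ℝ ℝ (Plane × ℝ))) :=
    HasMFDerivAt.comp (g := param p) (f := Prod.snd) x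
      ((isLocalDiffeomorphAt_param p hx).contMDiffAt.mdifferentiableAt (by simp)).hasMFDerivAt
      (hasFDerivAt_snd (𝕜 := ℝ) (p := x)).hasMFDerivAt
  exact congrArg (fun L : ℝ × (Plane × ℝ) →L[ℝ] ℝ × (Plane × ℝ) ↦ L v) (h1.prodMk h2).mfderiv

/-- In the parametrisation by unit vectors the rolling condition reads `v.2.1 = v.1 • chartVec`,
which is the model plane field. The independence conditions of the model are those of the unit
circles in the tangent planes. -/
theorem engelAt_rollingPlane (q : ℝ × UnitTangent h) : EngelAt (rollingPlane h) q := by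
  obtain ⟨t, q⟩ := q
  obtain ⟨p, z, hz, rfl⟩ := exists_param q
  have hU := localUnitBundle p hz
  have hs : ContinuousAt (fun y : ℝ × (Plane × ℝ) ↦ y.2) (t, z) := continuous_snd.continuousAt
  refine EngelAt.map (f := paramProd p) (x := (t, z)) (isLocalDiffeomorphAt_paramProd p hz) ?_
    (engelAt_modelPlane (v := chartVec p) (x := (t, z)) hU.smooth
      (hU.eventually.mono fun z' hz' ↦ hz'.linearIndependent) hU.linearIndependent_param)
  filter_upwards [hs.eventually (eventually_fst_mem_target p hz)] with x hx v
  have e := mfderiv_paramProd p hx v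
  refine Iff.trans ?_ (Iff.of_eq (congrArg (fun w : ℝ × (Plane × ℝ) ↦
    (⟨paramProd p x, w⟩ : TangentBundle (𝓘(ℝ, ℝ).prod unitModel) (ℝ × UnitTangent h)) ∈
      rollingPlane h) e.symm))
  change v.2.1 = v.1 • chartVec p x.2 ↔
    dBase (param p x.2) (dParam p x.2 v.2) = v.1 • (param p x.2).vec
  rw [← (coordAt_injective p.base (base_param_mem p hx)).eq_iff, dBase_dParam p hx, map_smul,
    coordAt_vec_param p hx]

/-- The conditions are local, and every null line is in the image of the local diffeomorphism
`nullLine`. -/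
theorem isEngel_lorentzProlongation : IsEngel (lorentzProlongation (productMetric h)) := by
  refine isEngel_of_engelAt (by simp) fun m ↦ ?_
  obtain ⟨q, rfl⟩ := nullLine_surjective m
  exact (engelAt_rollingPlane q).map (isLocalDiffeomorph_nullLine q)
    (Eventually.of_forall fun q v ↦ mem_rollingPlane_iff q v)

end Rolling

/-! ### Untwisting by the geodesic flow, and the isomorphism. -/

section Untwisting

variable {S : Type*} [TopologicalSpace S] [ChartedSpace Plane S]
  [IsManifold (𝓡 2) ∞ S] {h : SurfaceMetric S}

theorem contMDiff_const_mul_fst (c : ℝ) :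
    ContMDiff (𝓘(ℝ, ℝ).prod unitModel) (𝓘(ℝ, ℝ).prod unitModel) ∞
    (fun q : ℝ × UnitTangent h ↦ (c * q.1, q.2)) :=
  ((contDiff_const.mul contDiff_id : ContDiff ℝ ∞ fun s : ℝ ↦ c * s).contMDiff.comp
    contMDiff_fst).prodMk contMDiff_snd

variable [T2Space S] (hh : IsGeodesicallyComplete h)

theorem geodesicFlow_neg (t : ℝ) (p : UnitTangent h) :
    geodesicFlow hh (-t, geodesicFlow hh (t, p)) = p := by
  rw [← geodesicFlow_add, neg_add_cancel, geodesicFlow_zero]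

theorem geodesicFlow_neg' (t : ℝ) (p : UnitTangent h) :
    geodesicFlow hh (t, geodesicFlow hh (-t, p)) = p := by
  rw [← geodesicFlow_add, add_neg_cancel, geodesicFlow_zero]

/-- The diffeomorphism of `ℝ × S¹(TΣ)` which moves the second component by the geodesic flow for the
time `2πt`. -/
noncomputable def untwist (q : ℝ × UnitTangent h) : ℝ × UnitTangent h :=
  (2 * Real.pi * q.1, geodesicFlow hh (2 * Real.pi * q.1, q.2))

/-- The inverse of `untwist`. -/
noncomputable def twistBack (q : ℝ × UnitTangent h) : ℝ × UnitTangent h :=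
  ((2 * Real.pi)⁻¹ * q.1, geodesicFlow hh (-1 * q.1, q.2))

theorem contMDiff_untwist : ContMDiff (𝓘(ℝ, ℝ).prod unitModel) (𝓘(ℝ, ℝ).prod unitModel) ∞
    (untwist hh) :=
  (contMDiff_fst.comp (contMDiff_const_mul_fst (2 * Real.pi))).prodMk
    ((contMDiff_geodesicFlow hh).comp (contMDiff_const_mul_fst (2 * Real.pi)))

theorem contMDiff_twistBack : ContMDiff (𝓘(ℝ, ℝ).prod unitModel) (𝓘(ℝ, ℝ).prod unitModel) ∞
    (twistBack hh) :=
  (contMDiff_fst.comp (contMDiff_const_mul_fst (2 * Real.pi)⁻¹)).prodMk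
    ((contMDiff_geodesicFlow hh).comp (contMDiff_const_mul_fst (-1)))

theorem twistBack_untwist (q : ℝ × UnitTangent h) : twistBack hh (untwist hh q) = q := by
  refine Prod.ext ?_ ?_
  · simp only [twistBack, untwist]
    exact inv_mul_cancel_left₀ Real.two_pi_pos.ne' _
  · simp only [twistBack, untwist, neg_mul, one_mul]
    exact geodesicFlow_neg hh _ _

theorem untwist_twistBack (q : ℝ × UnitTangent h) : untwist hh (twistBack hh q) = q := by
  have e : 2 * Real.pi * ((2 * Real.pi)⁻¹ * q.1) = q.1 :=
    mul_inv_cancel_left₀ Real.two_pi_pos.ne' _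
  refine Prod.ext ?_ ?_
  · simp only [twistBack, untwist]
    exact e
  · simp only [twistBack, untwist, neg_mul, one_mul, e]
    exact geodesicFlow_neg' hh _ _

theorem isLocalDiffeomorph_untwist :
    IsLocalDiffeomorph (𝓘(ℝ, ℝ).prod unitModel) (𝓘(ℝ, ℝ).prod unitModel) ∞ (untwist hh) :=
  fun _ ↦ .of_eventually (g := twistBack hh) (Eventually.of_forall (contMDiff_untwist hh))
    (Eventually.of_forall (contMDiff_twistBack hh)) (Eventually.of_forall (twistBack_untwist hh))
    (Eventually.of_forall (untwist_twistBack hh))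

/-- The derivative splits into its restrictions to the two factors: the velocity of the orbit and
the derivative of the time map. -/
theorem mfderiv_geodesicFlow (t : ℝ) (p : UnitTangent h) (τ : ℝ) (η : Plane × ℝ) :
    (mfderiv (𝓘(ℝ, ℝ).prod unitModel) unitModel (geodesicFlow hh) (t, p)
      ((τ, η) : ℝ × (Plane × ℝ)) : TangentSpace unitModel (timeMap hh t p)) =
      τ • geodesicField (timeMap hh t p) + dTime hh t p η := by
  let L : ℝ × (Plane × ℝ) →L[ℝ] TangentSpace unitModel (timeMap hh t p) :=
    mfderiv (𝓘(ℝ, ℝ).prod unitModel) unitModel (geodesicFlow hh) (t, p)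
  have hL : HasMFDerivAt (𝓘(ℝ, ℝ).prod unitModel) unitModel (geodesicFlow hh) (t, p) L :=
    ((contMDiff_geodesicFlow hh).mdifferentiable (by simp) _).hasMFDerivAt
  have h1 : HasMFDerivAt 𝓘(ℝ, ℝ) unitModel (fun t ↦ geodesicFlow hh (t, p)) t
      (L.comp (ContinuousLinearMap.inl ℝ ℝ (Plane × ℝ))) :=
    HasMFDerivAt.comp (g := geodesicFlow hh) (f := fun t : ℝ ↦ (t, p)) t hL
      ((hasMFDerivAt_id t).prodMk (hasMFDerivAt_const p t))
  have h2 : HasMFDerivAt unitModel unitModel (fun p ↦ geodesicFlow hh (t, p)) p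
      (L.comp (ContinuousLinearMap.inr ℝ ℝ (Plane × ℝ))) :=
    HasMFDerivAt.comp (g := geodesicFlow hh) (f := fun p : UnitTangent h ↦ (t, p)) p hL
      ((hasMFDerivAt_const t p).prodMk (hasMFDerivAt_id p))
  have h3 := hasMFDerivAt_unique h1 (isMIntegralCurve_geodesicFlow hh p t)
  have e1 : L (τ, 0) = τ • geodesicField (timeMap hh t p) :=
    congrArg (fun A : ℝ →L[ℝ] TangentSpace unitModel (timeMap hh t p) ↦ A τ) h3
  have e2 : L (0, η) = dTime hh t p η :=
    congrArg (fun A : Plane × ℝ →L[ℝ] TangentSpace unitModel (timeMap hh t p) ↦ A η)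
      h2.mfderiv.symm
  have e3 : ((τ, η) : ℝ × (Plane × ℝ)) = (τ, 0) + (0, η) := by simp
  calc L (τ, η) = L (τ, 0) + L (0, η) := by rw [← map_add, ← e3]
    _ = _ := by rw [e1, e2]

theorem mfderiv_untwist (q : ℝ × UnitTangent h) (v : ℝ × (Plane × ℝ)) :
    mfderiv (𝓘(ℝ, ℝ).prod unitModel) (𝓘(ℝ, ℝ).prod unitModel) (untwist hh) q v =
      ((2 * Real.pi * v.1, (2 * Real.pi * v.1) • geodesicField (timeMap hh (2 * Real.pi * q.1) q.2) +
        dTime hh (2 * Real.pi * q.1) q.2 v.2) : ℝ × (Plane × ℝ)) := by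
  have h1 : HasMFDerivAt (𝓘(ℝ, ℝ).prod unitModel) 𝓘(ℝ, ℝ)
      (fun q : ℝ × UnitTangent h ↦ 2 * Real.pi * q.1) q
      (((2 * Real.pi) • ContinuousLinearMap.id ℝ ℝ).comp
        (ContinuousLinearMap.fst ℝ ℝ (Plane × ℝ))) :=
    HasMFDerivAt.comp (g := fun s : ℝ ↦ 2 * Real.pi * s) (f := Prod.fst) q
      ((hasFDerivAt_id q.1).const_mul (2 * Real.pi)).hasMFDerivAt (hasMFDerivAt_fst q)
  have h2 := h1.prodMk (hasMFDerivAt_snd (I := 𝓘(ℝ, ℝ)) (I' := unitModel) q)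
  have h3 := HasMFDerivAt.comp (g := geodesicFlow hh)
    (f := fun q : ℝ × UnitTangent h ↦ (2 * Real.pi * q.1, q.2)) q
    ((contMDiff_geodesicFlow hh).mdifferentiable (by simp) _).hasMFDerivAt h2
  have h4 := (h1.prodMk h3).mfderiv
  refine (congrArg (fun L : ℝ × (Plane × ℝ) →L[ℝ] ℝ × (Plane × ℝ) ↦ L v) h4).trans ?_
  exact Prod.ext rfl (mfderiv_geodesicFlow hh (2 * Real.pi * q.1) q.2 _ _)

/-- The geodesic field projects to the tautological vector, so the contribution of the time
component cancels the right-hand side of the rolling condition. -/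
theorem mfderiv_untwist_mem_rollingPlane_iff (q : ℝ × UnitTangent h) (v : ℝ × (Plane × ℝ)) :
    (⟨untwist hh q, mfderiv (𝓘(ℝ, ℝ).prod unitModel) (𝓘(ℝ, ℝ).prod unitModel) (untwist hh) q v⟩ :
      TangentBundle (𝓘(ℝ, ℝ).prod unitModel) (ℝ × UnitTangent h)) ∈ rollingPlane h ↔
      dBase _ (dTime hh (2 * Real.pi * q.1) q.2 v.2) = 0 := by
  refine (Iff.of_eq (congrArg (fun w : ℝ × (Plane × ℝ) ↦
    (⟨untwist hh q, w⟩ : TangentBundle (𝓘(ℝ, ℝ).prod unitModel) (ℝ × UnitTangent h)) ∈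
      rollingPlane h) (mfderiv_untwist hh q v))).trans ?_
  change dBase (timeMap hh (2 * Real.pi * q.1) q.2) ((2 * Real.pi * v.1) •
    geodesicField (timeMap hh (2 * Real.pi * q.1) q.2) + dTime hh (2 * Real.pi * q.1) q.2 v.2) =
      (2 * Real.pi * v.1) • (timeMap hh (2 * Real.pi * q.1) q.2).vec ↔ _
  rw [map_add, map_smul, dBase_geodesicField, add_eq_left]

theorem timeMap_zpow (T : ℝ) (n : ℤ) (p : UnitTangent h) :
    ((timeMap hh T).toEquiv ^ n : Equiv.Perm (UnitTangent h)) p = geodesicFlow hh (n * T, p) := by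
  induction n using Int.induction_on generalizing p with
  | zero => simp [geodesicFlow_zero]
  | succ n ih =>
    rw [zpow_add_one, Equiv.Perm.mul_apply, ih]
    change geodesicFlow hh (_, geodesicFlow hh (T, p)) = _
    rw [← geodesicFlow_add]
    push_cast
    rw [add_mul, one_mul]
  | pred n ih =>
    rw [zpow_sub_one, Equiv.Perm.mul_apply, ih]
    change geodesicFlow hh (_, geodesicFlow hh (-T, p)) = _
    rw [← geodesicFlow_add]
    push_cast
    rw [sub_mul, one_mul, sub_eq_add_neg]

/-- The covering of the space of null lines by the covering of the mapping torus. -/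
noncomputable def torusLine (q : TorusCover (timeMap hh (2 * Real.pi))) :
    NullLine (productMetric h) := nullLine (untwist hh q)

theorem isLocalDiffeomorph_torusLine :
    IsLocalDiffeomorph (𝓘(ℝ, ℝ).prod unitModel) (productModel.prod 𝓘(ℝ, ℝ)) ∞
      (torusLine hh) := fun q ↦
  (isLocalDiffeomorph_untwist hh q).comp (productModel.prod 𝓘(ℝ, ℝ)) _
    (isLocalDiffeomorph_nullLine (untwist hh q))

theorem torusLine_surjective : Function.Surjective (torusLine hh) := fun m ↦ by
  obtain ⟨q, rfl⟩ := nullLine_surjective m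
  exact ⟨twistBack hh q, congrArg nullLine (untwist_twistBack hh q)⟩

/-- Two points give the same null line when their times differ by an integer `n` and the flow takes
their second components to the same vector. Undoing the flow, the second components are related by
the power `-n` of the time `2π` map, which is the deck transformation. -/
theorem torusProj_eq_iff_torusLine_eq (x y : TorusCover (timeMap hh (2 * Real.pi))) :
    torusProj _ x = torusProj _ y ↔ torusLine hh x = torusLine hh y := by
  rw [torusProj_eq_iff, torusLine, torusLine, nullLine_eq_iff]
  simp only [untwist]
  -- The deck transformation lengthens the time by `n` periods and moves the starting point back by
  -- `n` periods, so the end point of the geodesic is the same.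
  have hflow : ∀ n : ℤ, geodesicFlow hh (2 * Real.pi * (y.1 + n),
      geodesicFlow hh (((-n : ℤ) : ℝ) * (2 * Real.pi), y.2)) =
      geodesicFlow hh (2 * Real.pi * y.1, y.2) := fun n ↦ by
    rw [← geodesicFlow_add]
    congr 2
    push_cast
    ring
  constructor
  · rintro ⟨n, rfl⟩
    rw [torus_vadd_def]
    refine ⟨?_, ?_⟩
    · rw [Circle.exp_eq_exp]
      exact ⟨n, by ring⟩
    · change geodesicFlow hh (_, ((timeMap hh (2 * Real.pi)).toEquiv ^ (-n) :
        Equiv.Perm (UnitTangent h)) y.2) = _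
      rw [timeMap_zpow]
      exact hflow n
  · rintro ⟨h1, h2⟩
    obtain ⟨n, hn⟩ := Circle.exp_eq_exp.1 h1
    have hn' : x.1 = y.1 + n := by
      have : 2 * Real.pi * x.1 = 2 * Real.pi * (y.1 + n) := by rw [hn]; ring
      exact mul_left_cancel₀ Real.two_pi_pos.ne' this
    refine ⟨n, ?_⟩
    rw [torus_vadd_def, timeMap_zpow]
    refine Prod.ext hn'.symm ?_
    rw [← hflow n, hn'] at h2
    -- Applying the flow backwards for the common time isolates the second component of `x`.
    have := congrArg (fun p ↦ geodesicFlow hh (-(2 * Real.pi * (y.1 + n)), p)) h2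
    simp only [geodesicFlow_neg] at this
    exact this.symm

variable {line : Set (TangentBundle unitModel (UnitTangent h))} {c : ℝ}
    (hs : IsSmoothDistribution line 1) (hsub : line ⊆ liouville h)
    (hc : IsVerticalTwist hh line c)

/-- Verticality under the flow is the link: it describes the twisted planes on the cover by the
choice of the twisting, and the pulled back prolongation by the untwisting. -/
theorem mem_coverDistribution_iff_torusLine (q : TorusCover (timeMap hh (2 * Real.pi)))
    (v : TangentSpace (𝓘(ℝ, ℝ).prod unitModel) q) :
    (⟨q, v⟩ : TangentBundle (𝓘(ℝ, ℝ).prod unitModel) (TorusCover (timeMap hh (2 * Real.pi)))) ∈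
        (geodesicSuspension hh line c hs hsub hc).coverDistribution ↔
      (⟨torusLine hh q, mfderiv (𝓘(ℝ, ℝ).prod unitModel) (productModel.prod 𝓘(ℝ, ℝ))
        (torusLine hh) q v⟩ : TangentBundle (productModel.prod 𝓘(ℝ, ℝ))
          (NullLine (productMetric h))) ∈ lorentzProlongation (productMetric h) := by
  rw [mem_coverDistribution_geodesicSuspension hh hs hsub hc q v]
  refine (mfderiv_untwist_mem_rollingPlane_iff hh q v).symm.trans ?_
  rw [mem_rollingPlane_iff]
  have h1 : HasMFDerivAt (𝓘(ℝ, ℝ).prod unitModel) (productModel.prod 𝓘(ℝ, ℝ)) (torusLine hh) q _ :=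
    HasMFDerivAt.comp (g := nullLine) (f := untwist hh) q
      (contMDiff_nullLine.mdifferentiable (by simp) _).hasMFDerivAt
      ((contMDiff_untwist hh).mdifferentiable (by simp) _).hasMFDerivAt
  exact Iff.of_eq (congrArg (fun w ↦ (⟨torusLine hh q, w⟩ : TangentBundle
    (productModel.prod 𝓘(ℝ, ℝ)) (NullLine (productMetric h))) ∈
      lorentzProlongation (productMetric h))
    (congrArg (fun L : ℝ × (Plane × ℝ) →L[ℝ] (Plane × EuclideanSpace ℝ (Fin 1)) × ℝ ↦ L v)
      h1.mfderiv.symm))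

/-- The mapping torus and the space of null lines are quotients of the same cover with the same
fibres, and on that cover the two plane fields coincide. -/
theorem isIsomorphic_geodesicSuspension :
    IsIsomorphic (geodesicSuspension hh line c hs hsub hc).distribution
      (lorentzProlongation (productMetric h)) := by
  obtain ⟨Φ, hΦ⟩ := exists_diffeomorph_of_fibres
    (isLocalDiffeomorph_torusProj (timeMap hh (2 * Real.pi))) (isLocalDiffeomorph_torusLine hh)
    (torusProj_surjective _) (torusLine_surjective hh) (torusProj_eq_iff_torusLine_eq hh)
  refine ⟨Φ, ?_⟩
  refine (image_tangentMap_image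
    (isLocalDiffeomorph_torusProj (timeMap hh (2 * Real.pi))).contMDiff Φ.contMDiff hΦ _).trans ?_
  exact image_tangentMap_eq (isLocalDiffeomorph_torusLine hh) (torusLine_surjective hh)
    (mem_coverDistribution_iff_torusLine hh hs hsub hc)

theorem isEngel_geodesicSuspension :
    IsEngel (geodesicSuspension hh line c hs hsub hc).distribution :=
  isEngel_of_isIsomorphic (by simp) (isIsomorphic_geodesicSuspension hh hs hsub hc)
    isEngel_lorentzProlongation

end Untwisting

theorem proposition4p1 {S : Type*} [TopologicalSpace S] [T2Space S] [ChartedSpace Plane S]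
    [IsManifold (𝓡 2) ∞ S] (h : SurfaceMetric S) (hh : IsGeodesicallyComplete h) :
    IsEngel (lorentzProlongation (productMetric h)) ∧
    (∃ s : Suspension unitModel (UnitTangent h),
      s.plane = liouville h ∧ IsStandardRotation s.rot ∧ s.line = verticalLine h ∧
      IsTimeMap (2 * Real.pi) s.map ∧ (∀ p, s.twist (0, p) = 0) ∧
      IsEngel s.distribution ∧
      IsIsomorphic s.distribution (lorentzProlongation (productMetric h))) ∧
    (∃ s : Suspension unitModel (UnitTangent h),
      s.plane = liouville h ∧ IsStandardRotation s.rot ∧ s.line = horizontalLine h ∧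
      IsTimeMap (2 * Real.pi) s.map ∧ (∀ p, s.twist (0, p) = Real.pi / 2) ∧
      IsEngel s.distribution ∧
      IsIsomorphic s.distribution (lorentzProlongation (productMetric h))) := by
  refine ⟨isEngel_lorentzProlongation, ?_, ?_⟩
  · refine ⟨geodesicSuspension hh (verticalLine h) 0 (isSmoothDistribution_verticalLine h)
      (verticalLine_subset h) (isVerticalTwist_verticalLine hh), rfl, isStandardRotation, rfl,
      isTimeMap_timeMap hh _, fun p ↦ ?_, isEngel_geodesicSuspension hh _ _ _,
      isIsomorphic_geodesicSuspension hh _ _ _⟩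
    change phase hh (2 * Real.pi * 0, p) + 0 = 0
    rw [mul_zero, phase_zero, add_zero]
  · refine ⟨geodesicSuspension hh (horizontalLine h) (Real.pi / 2)
      (isSmoothDistribution_horizontalLine h) (horizontalLine_subset h)
      (isVerticalTwist_horizontalLine hh), rfl, isStandardRotation, rfl,
      isTimeMap_timeMap hh _, fun p ↦ ?_, isEngel_geodesicSuspension hh _ _ _,
      isIsomorphic_geodesicSuspension hh _ _ _⟩
    change phase hh (2 * Real.pi * 0, p) + Real.pi / 2 = Real.pi / 2
    rw [mul_zero, phase_zero, zero_add]
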